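/- Let $M$ be a smooth $4$-manifold and $\mathcal D$ an Engel structure on $M$, i.e. a smooth plane field such that $\mathcal E=[\mathcal D,\mathcal D]$ is a hyperplane field with $[\mathcal E,\mathcal E]=TM$; let $\mathcal W\subset\mathcal D$ be the kernel line field of $\mathcal E$. If $\mathcal W,\mathcal D$ are oriented and $(W,X)$ is a compatible framing of $\mathcal D$ with $W\in\mathcal W$, the Engel framing is $\{W,X,[W,X],[X,[W,X]]\}$. A formal Engel structure is a flag $\mathcal W\subset\mathcal D\subset\mathcal E\subset TM$ of ranks $1,2,3$ with isomorphisms $\det\mathcal D\cong\mathcal E/\mathcal D$ and $\det(\mathcal E/\mathcal W)\cong TM/\mathcal E$; an Engel structure induces one through the Lie bracket. Engel torsion. Let $N\subset M$ be a closed embedded hypersurface transverse to $\mathcal D$, let $T$ be a vector field tangent to $\mathcal D$ and transverse to $N$, each of whose orbits $\{p\}\times(-\varepsilon,\varepsilon)$ in the resulting tubular neighbourhood $\mathcal U(N)\cong N\times(-\varepsilon,\varepsilon)$ (with $T=\partial_t$) is either everywhere or nowhere tangent to $\mathcal W$. Let $X\in\mathcal D\cap TN$, $Y\in\mathcal E\cap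 TN$, $Z$ be a framing of $TN$, extended $T$-invariantly; then $\mathcal D=\langle\partial_t,H_p(t)\rangle$ for curves $H_p:(-\varepsilon,\varepsilon)\to S^2$, where $H_p(0)=(1,0,0)$ and $\dot H_p(0)$ is a multiple of $(0,1,0)$, positive after choosing the sign of $Y$. Let $(\eta_p)_{p\in N}$ be a $C^2$-family of regularly parametrised $C^2$-curves which, up to parametrisation, are $H_p|_{(-\varepsilon,0]}$, followed by one full turn along the circle in $S^2$ tangent to $H_p$ at $H_p(0)$ with the same geodesic curvature, followed by $H_p|_{[0,\varepsilon)}$, the parametrisation being that of $H_p$ near $\pm\varepsilon$. Let $(\lambda_p)_{p\in N}$ be a smooth family of curves in $S^2$ that is $C^2$-close to $(\eta_p)$ (in the variable $t$), agrees with $H_p$ where the reparametrisation is trivial near $\pm\varepsilon$, and has the same convexity: the sign ($+$, $-$ or $0$) of $\det(\lambda_p,\dot\lambda_p,\ddot\lambda_p)$ is at all times that of $\det(H_p,\dot H_p,\ddot H_p)$ at $t=0$. Then $\mathcal L(\mathcal D)$ is the plane field equal to $\langle\partial_t,\lambda_p(t)\rangle$ on $\mathcal U(N)$ and to $\mathcal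 D$ elsewhere. Claim. For all these choices of $N,T,X,Y,Z,\eta$ and all smoothings $\lambda$ sufficiently $C^2$-close to $\eta$ (with a bound not depending on $\lambda$), the following holds. (0) In each of the situations (a), (b) below, $\mathcal L(\mathcal D)$ is an Engel structure if the set of $p\in N$ with $T(p)\in\mathcal W$ is the closure of its interior in $N$. (a) Let $S$ be an embedded $2$-torus transverse to $\mathcal D$ with a thin neighbourhood $S\times\mathbb D^2$ (all $S\times\partial\mathbb D^2_\rho$, $0<\rho\le1$, are transverse to $\mathcal D$), extended to an embedding of $S\times\{|z|<R\}$, $R>1$, and let $N=\partial(S\times\mathbb D^2)$. Let $V=S\times\{|z|<r\}$ be a slightly bigger neighbourhood, $1<r<R$, with $\mathcal U(N)\subset V$. Suppose that $\mathcal L(\mathcal D)$ is Engel. Then the Engel framing of $\mathcal L(\mathcal D)$ is homotopic to that of $\mathcal D$ relative to $M\setminus V$. That is, for every framing $(W,X)$ as above for $\mathcal D$ on $M$ there is such a framing for $\mathcal L(\mathcal D)$ which agrees with $(W,X)$ on $M\setminus V$, and for each of them the two Engel framings are homotopic through framings of $TM$, constantly on $M\setminus V$. Moreover, without any orientability assumption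 on $M$, $\mathcal D$ or $\mathcal W$, the formal Engel structures induced by $\mathcal D$ and $\mathcal L(\mathcal D)$ are homotopic through formal Engel structures, constantly on $M\setminus V$; so an Engel-Lutz twist does not change the formal type. (b) Let $B\subset M$ be a smoothly embedded closed $4$-ball, and let $N$ be a closed hypersurface as above with $\mathcal U(N)\subset V:=\operatorname{int}B$. If $\mathcal L(\mathcal D)$ is Engel, the same conclusions hold with this $V$, i.e. relative to $M\setminus V$. -/

import Mathlib

open Set Topology
open scoped Manifold ContDiff

noncomputable section

namespace Engel

/-- Model space `ℝ⁴` and, for curves on the sphere, `ℝ³`. -/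
abbrev R4 : Type := EuclideanSpace ℝ (Fin 4)

abbrev R3 : Type := EuclideanSpace ℝ (Fin 3)

section Distributions

variable {M : Type*} [TopologicalSpace M] [ChartedSpace R4 M] [IsManifold (𝓡 4) ∞ M]

/-- `V` is a smooth (C^∞) vector field on the set `O`. -/
def SmoothFieldOn (V : Π x : M, TangentSpace (𝓡 4) x) (O : Set M) : Prop :=
  ContMDiffOn (𝓡 4) (𝓡 4).tangent ∞ (fun x => (⟨x, V x⟩ : TangentBundle (𝓡 4) M)) O

/-- `P` is a smooth distribution of rank `k`: it is locally spanned by a smooth frame. -/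
def IsSmoothDistribution (k : ℕ) (P : Π x : M, Submodule ℝ (TangentSpace (𝓡 4) x)) : Prop :=
  ∀ x₀ : M, ∃ O : Set M, IsOpen O ∧ x₀ ∈ O ∧ ∃ V : Fin k → Π x : M, TangentSpace (𝓡 4) x,
    (∀ i, SmoothFieldOn (V i) O) ∧
    ∀ x ∈ O, LinearIndependent ℝ (fun i => V i x) ∧ P x = Submodule.span ℝ (range fun i => V i x)

/-- `V` is a smooth section of `P` on some open neighbourhood of `x`. -/
def IsLocalSection (P : Π x : M, Submodule ℝ (TangentSpace (𝓡 4) x)) (x : M)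
    (V : Π x : M, TangentSpace (𝓡 4) x) : Prop :=
  ∃ O : Set M, IsOpen O ∧ x ∈ O ∧ SmoothFieldOn V O ∧ ∀ y ∈ O, V y ∈ P y

theorem IsLocalSection.mem {P : Π x : M, Submodule ℝ (TangentSpace (𝓡 4) x)} {x : M}
    {V : Π x : M, TangentSpace (𝓡 4) x} (h : IsLocalSection P x V) : V x ∈ P x := by
  obtain ⟨O, _, hx, _, hV⟩ := h
  exact hV x hx

/-- The Lie bracket of vector fields on the `4`-manifold `M`. -/
abbrev bracket (V W : Π x : M, TangentSpace (𝓡 4) x) : Π x : M, TangentSpace (𝓡 4) x :=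
  fun x => VectorField.mlieBracket (𝓡 4) V W x

/-- The derived distribution `[P, P]`: at `x` it is spanned by `P x` and by the values at `x` of
the brackets of local sections of `P`. -/
def derived (P : Π x : M, Submodule ℝ (TangentSpace (𝓡 4) x)) :
    Π x : M, Submodule ℝ (TangentSpace (𝓡 4) x) :=
  fun x => P x ⊔ Submodule.span ℝ
    {v | ∃ V W, IsLocalSection P x V ∧ IsLocalSection P x W ∧ v = bracket V W x}

/-- An even-contact structure: a smooth hyperplane field `E` with `[E, E] = TM`. -/
def IsEvenContact (E : Π x : M, Submodule ℝ (TangentSpace (𝓡 4) x)) : Prop :=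
  IsSmoothDistribution 3 E ∧ ∀ x, derived E x = ⊤

/-- An Engel structure: a smooth plane field `D` such that `[D, D]` is even-contact. -/
def IsEngel (D : Π x : M, Submodule ℝ (TangentSpace (𝓡 4) x)) : Prop :=
  IsSmoothDistribution 2 D ∧ IsEvenContact (derived D)

/-- `v` belongs to the kernel (characteristic) line field of the even-contact structure `E`,
i.e. to the kernel of the form `E × E → TM / E` induced by the bracket. -/
def IsKernelVector (E : Π x : M, Submodule ℝ (TangentSpace (𝓡 4) x)) (x : M)
    (v : TangentSpace (𝓡 4) x) : Prop :=
  v ∈ E x ∧ ∀ V W, IsLocalSection E x V → IsLocalSection E x W → V x = v → bracket V W x ∈ E x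

/-! ### Engel framings -/

/-- `(W, X)` is a global smooth framing of the Engel structure `D` with `W` spanning its kernel
line field. Such a pair orients the kernel line field and `D`. -/
def IsAdaptedPair (D : Π x : M, Submodule ℝ (TangentSpace (𝓡 4) x))
    (W X : Π x : M, TangentSpace (𝓡 4) x) : Prop :=
  SmoothFieldOn W univ ∧ SmoothFieldOn X univ ∧
  ∀ x, IsKernelVector (derived D) x (W x) ∧ LinearIndependent ℝ ![W x, X x] ∧
    D x = Submodule.span ℝ {W x, X x}

/-- The Engel framing `{W, X, [W, X], [X, [W, X]]}`. -/
def engelFraming (W X : Π x : M, TangentSpace (𝓡 4) x) : Fin 4 → Π x : M, TangentSpace (𝓡 4) x :=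
  ![W, X, bracket W X, bracket X (bracket W X)]

/-- The framings `F₀`, `F₁` of `TM` are homotopic through smooth framings which are constant
outside `V`. -/
def FramingsHomotopicRel (V : Set M) (F₀ F₁ : Fin 4 → Π x : M, TangentSpace (𝓡 4) x) : Prop :=
  ∃ G : unitInterval → Fin 4 → Π x : M, TangentSpace (𝓡 4) x,
    (∀ s i, SmoothFieldOn (G s i) univ) ∧
    (∀ i, Continuous fun q : unitInterval × M =>
      (⟨q.2, G q.1 i q.2⟩ : TangentBundle (𝓡 4) M)) ∧
    (∀ s x, LinearIndependent ℝ fun i => G s i x) ∧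
    G 0 = F₀ ∧ G 1 = F₁ ∧
    ∀ s i, ∀ x ∉ V, G s i x = F₀ i x

/-- The Engel framing of `D'` exists and is homotopic to that of `D` relative to the complement of
`V`: for every choice `(W, X)` of oriented framing for `D` (if `D` and its kernel are orientable),
`D'` has an oriented framing which agrees with `(W, X)` outside `V`, and for each of these the two
Engel framings are homotopic relative to the complement of `V`. -/
def SameEngelFramingRel (V : Set M) (D D' : Π x : M, Submodule ℝ (TangentSpace (𝓡 4) x)) : Prop :=
  ∀ W X, IsAdaptedPair D W X →
    (∃ W' X', IsAdaptedPair D' W' X' ∧ ∀ x ∉ V, W' x = W x ∧ X' x = X x) ∧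
    ∀ W' X', IsAdaptedPair D' W' X' → (∀ x ∉ V, W' x = W x ∧ X' x = X x) →
      FramingsHomotopicRel V (engelFraming W X) (engelFraming W' X')

/-! ### Formal Engel structures -/

variable (M) in
/-- The pointwise data of a formal Engel structure: a complete flag `W ⊂ D ⊂ E ⊂ TM`, and
isomorphisms `det D ≅ E / D` and `det (E / W) ≅ TM / E`. The first one is given as a nonzero
alternating form on the plane `D` with values in `E / D ⊂ TM / D`, the second one as a nonzero
alternating form on `E` with values in `TM / E` which is killed by `W`. -/
structure FormalData where
  W : Π x : M, Submodule ℝ (TangentSpace (𝓡 4) x)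
  D : Π x : M, Submodule ℝ (TangentSpace (𝓡 4) x)
  E : Π x : M, Submodule ℝ (TangentSpace (𝓡 4) x)
  φ₁ : Π x : M, (D x) [⋀^Fin 2]→ₗ[ℝ] (TangentSpace (𝓡 4) x ⧸ D x)
  φ₂ : Π x : M, (E x) [⋀^Fin 2]→ₗ[ℝ] (TangentSpace (𝓡 4) x ⧸ E x)
  W_le : ∀ x, W x ≤ D x
  D_le : ∀ x, D x ≤ E x
  finrank_W : ∀ x, Module.finrank ℝ (W x) = 1
  finrank_D : ∀ x, Module.finrank ℝ (D x) = 2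
  finrank_E : ∀ x, Module.finrank ℝ (E x) = 3
  φ₁_mem : ∀ x u, φ₁ x u ∈ (E x).map (D x).mkQ
  φ₁_ne_zero : ∀ x, φ₁ x ≠ 0
  φ₂_kernel : ∀ x (u v : E x), (u : TangentSpace (𝓡 4) x) ∈ W x → φ₂ x ![u, v] = 0
  φ₂_ne_zero : ∀ x, φ₂ x ≠ 0

/-- The frame `e = (w, x, y, z)` of a tangent space is adapted to the formal data: it is adapted
to the flag, and `w ∧ x ↦ y`, `x ∧ y ↦ z` under the two isomorphisms. The set of adapted frames at
a point determines the formal data at that point. -/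
def FormalData.IsAdapted (F : FormalData M) (x : M) (e : Fin 4 → TangentSpace (𝓡 4) x) : Prop :=
  LinearIndependent ℝ e ∧ e 0 ∈ F.W x ∧
  ∃ (h₀ : e 0 ∈ F.D x) (h₁ : e 1 ∈ F.D x) (h₁' : e 1 ∈ F.E x) (h₂ : e 2 ∈ F.E x),
    F.φ₁ x ![⟨e 0, h₀⟩, ⟨e 1, h₁⟩] = (F.D x).mkQ (e 2) ∧
    F.φ₂ x ![⟨e 1, h₁'⟩, ⟨e 2, h₂⟩] = (F.E x).mkQ (e 3)

/-- Smoothness of the flag and of the two isomorphisms, i.e. the existence of smooth adapted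
frames near every point. -/
def FormalData.IsSmooth (F : FormalData M) : Prop :=
  ∀ x₀ : M, ∃ O : Set M, IsOpen O ∧ x₀ ∈ O ∧ ∃ e : Fin 4 → Π x : M, TangentSpace (𝓡 4) x,
    (∀ i, SmoothFieldOn (e i) O) ∧ ∀ x ∈ O, F.IsAdapted x (fun i => e i x)

variable (M) in
/-- Formal Engel structures on `M`. -/
def FormalEngel : Type _ := {F : FormalData M // F.IsSmooth}

/-- `F` is the formal Engel structure induced by the Engel structure `D`: the flag is
`W ⊂ D ⊂ [D, D]` and both isomorphisms are induced by the Lie bracket. (Since the second form is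
the bracket form of `E`, the line field `W` is its kernel.) -/
def FormalData.IsInducedBy (F : FormalData M) (D : Π x : M, Submodule ℝ (TangentSpace (𝓡 4) x)) :
    Prop :=
  F.D = D ∧ F.E = derived D ∧
  (∀ x V V' (h : IsLocalSection F.D x V) (h' : IsLocalSection F.D x V'),
    F.φ₁ x ![⟨V x, h.mem⟩, ⟨V' x, h'.mem⟩] = (F.D x).mkQ (bracket V V' x)) ∧
  (∀ x V V' (h : IsLocalSection F.E x V) (h' : IsLocalSection F.E x V'),
    F.φ₂ x ![⟨V x, h.mem⟩, ⟨V' x, h'.mem⟩] = (F.E x).mkQ (bracket V V' x))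

/-- A path of formal Engel structures which is continuous for the `C⁰` topology: there are
continuous local adapted frames in `[0,1] × M`. -/
def IsFormalHomotopy (G : unitInterval → FormalEngel M) : Prop :=
  ∀ q₀ : unitInterval × M, ∃ O : Set (unitInterval × M), IsOpen O ∧ q₀ ∈ O ∧
    ∃ e : unitInterval → Fin 4 → Π x : M, TangentSpace (𝓡 4) x,
      (∀ i, ContinuousOn (fun q : unitInterval × M =>
        (⟨q.2, e q.1 i q.2⟩ : TangentBundle (𝓡 4) M)) O) ∧
      ∀ q ∈ O, (G q.1).1.IsAdapted q.2 (fun i => e q.1 i q.2)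

/-- The Engel structures `D` and `D'` have the same formal type: they are homotopic as formal Engel
structures, by a homotopy which is constant outside `V`. -/
def SameFormalTypeRel (V : Set M) (D D' : Π x : M, Submodule ℝ (TangentSpace (𝓡 4) x)) : Prop :=
  ∃ G : unitInterval → FormalEngel M, IsFormalHomotopy G ∧
    (G 0).1.IsInducedBy D ∧ (G 1).1.IsInducedBy D' ∧
    ∀ s, ∀ x ∉ V, ∀ e : Fin 4 → TangentSpace (𝓡 4) x,
      (G s).1.IsAdapted x e ↔ (G 0).1.IsAdapted x e

end Distributions

/-! ### Curves on the sphere -/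

/-- The determinant of three vectors in `ℝ³`. -/
def det3 (u v w : R3) : ℝ := !![u 0, u 1, u 2; v 0, v 1, v 2; w 0, w 1, w 2].det

/-- `det (c, c', c'')`; it is positive (negative, zero) at `t` if the spherical curve `c` has
positive (negative, zero) geodesic curvature at `t`. -/
def convexity (c : ℝ → R3) (t : ℝ) : ℝ := det3 (c t) (deriv c t) (deriv (deriv c) t)

/-- The geodesic curvature of an immersed spherical curve. -/
def geodesicCurvature (c : ℝ → R3) (t : ℝ) : ℝ := convexity c t / ‖deriv c t‖ ^ 3

/-- The circle in the unit sphere which passes through `(1,0,0)` (at angle `0`) with tangent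
direction `(0,1,0)` there, and which has constant geodesic curvature `k`. -/
def sphereCircle (k θ : ℝ) : R3 :=
  !₂[(k ^ 2 + Real.cos θ) / (1 + k ^ 2), Real.sin θ / √(1 + k ^ 2),
    k * (1 - Real.cos θ) / (1 + k ^ 2)]

/-! ### Adding Engel torsion -/

section Torsion

variable {M : Type*} [TopologicalSpace M] [ChartedSpace R4 M] [IsManifold (𝓡 4) ∞ M]
  {EN : Type*} [NormedAddCommGroup EN] [NormedSpace ℝ EN] {HN : Type*} [TopologicalSpace HN]

/-- The plane spanned, at `Φ (p, t)`, by `T = Φ_* ∂ₜ` and `Φ_* (h₁ X + h₂ Y + h₃ Z)`. -/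
def planeAt (J : ModelWithCorners ℝ EN HN) {N : Type*} [TopologicalSpace N] [ChartedSpace HN N]
    (Φ : N × ℝ → M) (X Y Z : Π p : N, TangentSpace J p) (p : N) (t : ℝ) (h : R3) :
    Submodule ℝ (TangentSpace (𝓡 4) (Φ (p, t))) :=
  Submodule.span ℝ
    {mfderiv (J.prod 𝓘(ℝ, ℝ)) (𝓡 4) Φ (p, t) ((0, 1) : EN × ℝ),
     mfderiv (J.prod 𝓘(ℝ, ℝ)) (𝓡 4) Φ (p, t)
      ((h 0 • X p + h 1 • Y p + h 2 • Z p, 0) : EN × ℝ)}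

/-- The description of an Engel structure `D` near a transverse hypersurface `N`.
The hypersurface is `N × {0}` inside the tubular neighbourhood `Φ : N × (-ε, ε) → M`, which is
given by the flow of a vector field `T = Φ_* ∂ₜ` tangent to `D` and transverse to `N`.
The `T`-invariant framing `X ∈ D ∩ TN`, `Y ∈ [D, D] ∩ TN`, `Z` turns `D` into a family of curves
`H p : (-ε, ε) → S²`. The sign of `Y` is normalised by `H p` starting in the direction of `Y`. -/
structure Tube (D : Π x : M, Submodule ℝ (TangentSpace (𝓡 4) x))
    (J : ModelWithCorners ℝ EN HN) (N : Type*) [TopologicalSpace N] [ChartedSpace HN N]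
    [IsManifold J ∞ N] where
  ε : ℝ
  ε_pos : 0 < ε
  Φ : N × ℝ → M
  smooth_Φ : ContMDiffOn (J.prod 𝓘(ℝ, ℝ)) (𝓡 4) ∞ Φ (univ ×ˢ Ioo (-ε) ε)
  injOn_Φ : InjOn Φ (univ ×ˢ Ioo (-ε) ε)
  bijective_Φ : ∀ p, ∀ t ∈ Ioo (-ε) ε,
    Function.Bijective (mfderiv (J.prod 𝓘(ℝ, ℝ)) (𝓡 4) Φ (p, t))
  X : Π p : N, TangentSpace J p
  Y : Π p : N, TangentSpace J p
  Z : Π p : N, TangentSpace J p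
  smooth_X : ContMDiff J J.tangent ∞ (fun p => (⟨p, X p⟩ : TangentBundle J N))
  smooth_Y : ContMDiff J J.tangent ∞ (fun p => (⟨p, Y p⟩ : TangentBundle J N))
  smooth_Z : ContMDiff J J.tangent ∞ (fun p => (⟨p, Z p⟩ : TangentBundle J N))
  framing : ∀ p, LinearIndependent ℝ ![X p, Y p, Z p]
  Y_mem : ∀ p, mfderiv (J.prod 𝓘(ℝ, ℝ)) (𝓡 4) Φ (p, 0) ((Y p, 0) : EN × ℝ) ∈ derived D (Φ (p, 0))
  H : N → ℝ → R3
  smooth_H : ContMDiffOn (J.prod 𝓘(ℝ, ℝ)) 𝓘(ℝ, R3) ∞ (fun q : N × ℝ => H q.1 q.2)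
    (univ ×ˢ Ioo (-ε) ε)
  norm_H : ∀ p, ∀ t ∈ Ioo (-ε) ε, ‖H p t‖ = 1
  D_eq : ∀ p, ∀ t ∈ Ioo (-ε) ε, D (Φ (p, t)) = planeAt J Φ X Y Z p t (H p t)
  H_zero : ∀ p, H p 0 = !₂[1, 0, 0]
  deriv_H_zero : ∀ p, 0 < deriv (H p) 0 1
  /-- Each orbit of `T` is either everywhere tangent to the kernel line field or nowhere. -/
  kernel_iff : ∀ p, ∀ t ∈ Ioo (-ε) ε,
    (IsKernelVector (derived D) (Φ (p, t))
        (mfderiv (J.prod 𝓘(ℝ, ℝ)) (𝓡 4) Φ (p, t) ((0, 1) : EN × ℝ)) ↔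
      IsKernelVector (derived D) (Φ (p, 0))
        (mfderiv (J.prod 𝓘(ℝ, ℝ)) (𝓡 4) Φ (p, 0) ((0, 1) : EN × ℝ)))

namespace Tube

variable {D : Π x : M, Submodule ℝ (TangentSpace (𝓡 4) x)} {J : ModelWithCorners ℝ EN HN}
  {N : Type*} [TopologicalSpace N] [ChartedSpace HN N] [IsManifold J ∞ N] (τ : Tube D J N)

/-- The tubular neighbourhood `U(N)` as a subset of `M`. -/
def image : Set M := τ.Φ '' (univ ×ˢ Ioo (-τ.ε) τ.ε)

/-- The points of `N` at which `T` is tangent to the kernel line field. -/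
def tangencySet : Set N :=
  {p | IsKernelVector (derived D) (τ.Φ (p, 0))
    (mfderiv (J.prod 𝓘(ℝ, ℝ)) (𝓡 4) τ.Φ (p, 0) ((0, 1) : EN × ℝ))}

/-- `T` is tangent to the kernel line field exactly on a closed set which is the closure of its
interior, i.e. on the complement of a regular open neighbourhood of the set where the kernel line
field is tangent to `N`. -/
def IsRegular : Prop := τ.tangencySet ⊆ closure (interior τ.tangencySet)

/-- A `C²`-family `η` of immersed `C²`-curves on `S²` obtained from `H` by inserting one circle
at `t = 0`: up to parametrisation, `η p` is `H p` on `(-ε, 0]`, followed by one turn around the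
circle which is tangent to `H p` at `H p 0 = (1,0,0)` and has the same geodesic curvature there,
followed by `H p` on `[0, ε)`. The reparametrisation `ρ` is trivial near the ends. -/
structure Profile where
  a : ℝ
  b : ℝ
  c : ℝ
  a_mem : -c < a
  a_lt_b : a < b
  b_mem : b < c
  c_lt : c < τ.ε
  ρ : N → ℝ → ℝ
  θ : N → ℝ → ℝ
  η : N → ℝ → R3
  ρ_cont : ContinuousOn (fun q : N × ℝ => ρ q.1 q.2) (univ ×ˢ (Ioc (-τ.ε) a ∪ Ico b τ.ε))
  ρ_mono_left : ∀ p, StrictMonoOn (ρ p) (Ioc (-τ.ε) a)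
  ρ_mono_right : ∀ p, StrictMonoOn (ρ p) (Ico b τ.ε)
  ρ_a : ∀ p, ρ p a = 0
  ρ_b : ∀ p, ρ p b = 0
  ρ_ends : ∀ p, ∀ t ∈ Ioo (-τ.ε) τ.ε, c ≤ |t| → ρ p t = t
  θ_cont : ContinuousOn (fun q : N × ℝ => θ q.1 q.2) (univ ×ˢ Icc a b)
  θ_mono : ∀ p, StrictMonoOn (θ p) (Icc a b)
  θ_a : ∀ p, θ p a = 0
  θ_b : ∀ p, θ p b = 2 * Real.pi
  η_outer : ∀ p, ∀ t ∈ Ioc (-τ.ε) a ∪ Ico b τ.ε, η p t = τ.H p (ρ p t)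
  η_middle : ∀ p, ∀ t ∈ Icc a b, η p t = sphereCircle (geodesicCurvature (τ.H p) 0) (θ p t)
  η_C2 : ContMDiffOn (J.prod 𝓘(ℝ, ℝ)) 𝓘(ℝ, R3) 2 (fun q : N × ℝ => η q.1 q.2)
    (univ ×ˢ Ioo (-τ.ε) τ.ε)
  η_immersed : ∀ p, ∀ t ∈ Ioo (-τ.ε) τ.ε, deriv (η p) t ≠ 0

/-- `l` is a smooth family of spherical curves which is `δ`-close to the profile `η` in the
`C²`-sense, agrees with `H` near the ends, and has the same convexity properties as `H`:
`l p` is everywhere convex, concave, or contained in a great circle according to whether `H p`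
is so. -/
structure IsSmoothing (P : τ.Profile) (δ : ℝ) (l : N → ℝ → R3) : Prop where
  smooth : ContMDiffOn (J.prod 𝓘(ℝ, ℝ)) 𝓘(ℝ, R3) ∞ (fun q : N × ℝ => l q.1 q.2)
    (univ ×ˢ Ioo (-τ.ε) τ.ε)
  norm_eq : ∀ p, ∀ t ∈ Ioo (-τ.ε) τ.ε, ‖l p t‖ = 1
  ends : ∀ p, ∀ t ∈ Ioo (-τ.ε) τ.ε, P.c ≤ |t| → l p t = τ.H p t
  close_zero : ∀ p, ∀ t ∈ Ioo (-τ.ε) τ.ε, ‖l p t - P.η p t‖ < δ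
  close_one : ∀ p, ∀ t ∈ Ioo (-τ.ε) τ.ε, ‖deriv (l p) t - deriv (P.η p) t‖ < δ
  close_two : ∀ p, ∀ t ∈ Ioo (-τ.ε) τ.ε,
    ‖deriv (deriv (l p)) t - deriv (deriv (P.η p)) t‖ < δ
  convex : ∀ p, ∀ t ∈ Ioo (-τ.ε) τ.ε,
    SignType.sign (convexity (l p) t) = SignType.sign (convexity (τ.H p) 0)

/-- `D'` is the plane field which agrees with `D` outside the tubular neighbourhood and which is
described by the curves `l p` inside. -/
def IsReplacement (l : N → ℝ → R3) (D' : Π x : M, Submodule ℝ (TangentSpace (𝓡 4) x)) : Prop :=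
  (∀ x ∉ τ.image, D' x = D x) ∧
  ∀ p, ∀ t ∈ Ioo (-τ.ε) τ.ε, D' (τ.Φ (p, t)) = planeAt J τ.Φ τ.X τ.Y τ.Z p t (l p t)

/-- `Q D'` holds for every plane field `D' = L(D)` which is obtained by introducing Engel torsion
along `N × {0}` in the given tube, for all profiles and all sufficiently `C²`-small smoothings. -/
def ForEveryTorsion (Q : (Π x : M, Submodule ℝ (TangentSpace (𝓡 4) x)) → Prop) : Prop :=
  ∀ P : τ.Profile, ∃ δ : ℝ, 0 < δ ∧ ∀ (l : N → ℝ → R3) (D' : _),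
    τ.IsSmoothing P δ l → τ.IsReplacement l D' → Q D'

end Tube

end Torsion

/-! ### Thin neighbourhoods of transverse tori, and balls -/

section Neighbourhoods

variable {M : Type*} [TopologicalSpace M] [ChartedSpace R4 M] [IsManifold (𝓡 4) ∞ M]

abbrev Torus : Type := Circle × Circle

abbrev torusModel := (𝓡 1).prod (𝓡 1)

/-- `ψ : T² × ball(0, R) → M`, with `R > 1`, is a smooth embedding onto an open set which restricts
to a thin tubular neighbourhood `T² × D²` of the transverse torus `ψ (T² × 0)`: the hypersurfaces
`T² × ∂D²_ρ`, `0 < ρ ≤ 1`, are transverse to `D`. -/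
structure IsThinNeighbourhood (D : Π x : M, Submodule ℝ (TangentSpace (𝓡 4) x))
    (ψ : Torus × ℂ → M) (R : ℝ) : Prop where
  one_lt : 1 < R
  smooth : ContMDiffOn (torusModel.prod 𝓘(ℝ, ℂ)) (𝓡 4) ∞ ψ (univ ×ˢ Metric.ball 0 R)
  injOn : InjOn ψ (univ ×ˢ Metric.ball 0 R)
  bijective : ∀ s, ∀ z ∈ Metric.ball (0 : ℂ) R,
    Function.Bijective (mfderiv (torusModel.prod 𝓘(ℝ, ℂ)) (𝓡 4) ψ (s, z))
  torus_transverse : ∀ s,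
    Submodule.span ℝ {v | ∃ u : EuclideanSpace ℝ (Fin 1) × EuclideanSpace ℝ (Fin 1),
      v = mfderiv (torusModel.prod 𝓘(ℝ, ℂ)) (𝓡 4) ψ (s, 0)
        ((u, 0) : (EuclideanSpace ℝ (Fin 1) × EuclideanSpace ℝ (Fin 1)) × ℂ)} ⊔ D (ψ (s, 0)) = ⊤
  hypersurface_transverse : ∀ s, ∀ z : ℂ, 0 < ‖z‖ → ‖z‖ ≤ 1 →
    Submodule.span ℝ {v | ∃ (u : EuclideanSpace ℝ (Fin 1) × EuclideanSpace ℝ (Fin 1)) (ζ : ℂ),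
      inner ℝ z ζ = 0 ∧ v = mfderiv (torusModel.prod 𝓘(ℝ, ℂ)) (𝓡 4) ψ (s, z)
        ((u, ζ) : (EuclideanSpace ℝ (Fin 1) × EuclideanSpace ℝ (Fin 1)) × ℂ)} ⊔ D (ψ (s, z)) = ⊤

/-- `β : ball(0, R) → M`, with `R > 1`, is a smooth embedding onto an open set; its restriction to
the closed unit ball is a smoothly embedded ball in `M`. -/
structure IsEmbeddedBall (β : R4 → M) (R : ℝ) : Prop where
  one_lt : 1 < R
  smooth : ContMDiffOn 𝓘(ℝ, R4) (𝓡 4) ∞ β (Metric.ball 0 R)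
  injOn : InjOn β (Metric.ball 0 R)
  bijective : ∀ y ∈ Metric.ball (0 : R4) R, Function.Bijective (mfderiv 𝓘(ℝ, R4) (𝓡 4) β y)

end Neighbourhoods

end Engel

end

/-!
Let `D` be an Engel structure with derived hyperplane field `E = [D, D]` and kernel line field `W`.
The pointwise data behind both kinds of comparison are the *bracket frames* (`IsBracketFrame`):
frames `e₀, …, e₃` of a tangent space with `W = ⟨e₀⟩`, `D = ⟨e₀, e₁⟩`, `E = ⟨e₀, e₁, e₂⟩`,
`[e₀, e₁] ≡ e₂` modulo `D` and `[e₁, e₂] ≡ e₃` modulo `E`. Two of them differ by an upper triangular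
matrix with diagonal `(a, b, ab, ab²)` (`TriRel`). Engel framings consist of bracket frames, and the
induced formal Engel structure is the `TriRel`-class of the bracket frames. Therefore it suffices to
find a path of automorphisms of `TM`, starting at the identity and constant outside `V`, whose end
takes bracket frames of `D` to bracket frames of `D'` (`sameFormalTypeRel_of_gaugePath`,
`sameEngelFramingRel_of_gaugePath`). For Engel framings one also needs that `V` is connected and has
boundary points: then the signs of `a` and `b` for a compatible framing of `D'` are determined by its
values outside `V`, and hence so is the Engel framing up to homotopy.

In the tube, a plane field `⟨T, h⟩` given by spherical curves `h` has the frame `T, h, h', h × h'`,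
because `[T, h] = h'` for the `T`-invariant framing of the hypersurface. The coefficients `κ₁, κ₂`
of `h × h'` in `[T, h']` and `[h, h']` decide everything (`IsDerivedFrameOn`): the plane field is
Engel exactly where `(κ₁, κ₂) ≠ 0`, its kernel is spanned by `κ₂ T - κ₁ h`, and `κ₁` is a positive
multiple of `det (h, h', h'')`. If `λ` has the same convexity as `H`, then `κ₁` has the same sign
for both. Where `κ₁` vanishes on an open set of orbits, both families of curves run in the great
circle of `⟨X, Y⟩` and `κ₂` is the `Z`-component of `[X, Y]` for both; if the set of tangent orbits
is the closure of its interior, then by continuity `D'` is Engel (`Tube.IsModification.isEngel`).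
Whenever `D'` is Engel, the pairs `(κ₁, κ₂)` of `D` and `D'` are nowhere opposite to each other, and
they may be joined linearly (`Tube.IsModification.kap_pos`).

This reduces the comparison along the tube to the frames `λ, λ', λ × λ'` and `H, H', H × H'`, that
is, to paths in `GL(3)`. If `λ` is `C¹`-close to the profile `η`, then it is joined to `η` linearly
(`Tube.Profile.exists_delta`); the rescaled tangent of `η` is continuous, and the inserted circle may
be opened to a great circle while the remaining part is reparametrised
(`Tube.Profile.matHomotopic_rotation`). What remains is one full turn, by the angle `2πf(t)`, in the
plane of the first two vectors. As a full turn begins and ends at the identity, its plane may be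
moved relative to the ends of the tube, and it becomes a turn in the plane spanned by the kernel
direction and the normal of `E` for an auxiliary Riemannian metric
(`Tube.IsModification.matHomotopic_adaptedMat`). The entries `a` and `ab²` of the matrices above
have the same sign, so that bracket frames induce the same orientation of this plane, and its
rotations are defined on all of `M`, whether or not anything is orientable
(`gramRot`, `gramRot_conj`, `exists_rotationPath`).

A rotation by the constant angle `2π` is the identity; the function `f`, with values `0` and `1` at
the two ends of the tube, thus defines a continuous function on `M` with values in `ℝ/ℤ` which
vanishes outside a compact subset of `V`. As `V` is a product of a compact space and a ball of
dimension at least two, this function lifts to a real function `F` which vanishes outside `V`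
(`HasLifting`, `exists_lift_prod`, `exists_angle`): a lift exists because the ball is contractible,
and as the complement of a smaller ball is connected, the lift vanishes near all of the boundary as
soon as it vanishes at one boundary point of each fibre. This is where it matters that the tube
lies in a thin neighbourhood of a torus or in a ball. At `s = 1`, the rotations by `2πsF` turn
bracket frames of `D` into frames which are homotopic, relative to the ends of the tube, to bracket
frames of `D'`. Following them by that homotopy, made smooth by a partition of unity
(`exists_smooth_matHomotopy`, `exists_gaugePath_of_matHomotopic`), one obtains the required path
(`Tube.IsModification.exists_gaugePath`).
-/

open Set Topology
open scoped Manifold ContDiff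

noncomputable section

set_option linter.unusedSectionVars false

namespace Engel

/-! ### Vector fields in local coordinates -/

section Matrices

/-- Entries of the inverse matrix depend smoothly on the entries of an invertible matrix. -/
theorem contDiffAt_matrix_inv {k : ℕ} (A₀ : Fin k → Fin k → ℝ) (h : (Matrix.of A₀).det ≠ 0)
    (i j : Fin k) :
    ContDiffAt ℝ ∞ (fun A : Fin k → Fin k → ℝ => (Matrix.of A)⁻¹ i j) A₀ := by
  have hdet : ∀ M : (Fin k → Fin k → ℝ) → Matrix (Fin k) (Fin k) ℝ,
      (∀ i j, ContDiff ℝ ∞ fun A => M A i j) → ContDiff ℝ ∞ fun A => (M A).det := by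
    intro M hM
    simp only [Matrix.det_apply]
    refine ContDiff.sum fun σ _ => ?_
    refine ContDiff.const_smul _ ?_
    exact contDiff_prod fun l _ => hM _ _
  have h1 : ContDiff ℝ ∞ fun A : Fin k → Fin k → ℝ => (Matrix.of A).det :=
    hdet _ fun i j => by simp only [Matrix.of_apply]; fun_prop
  have h2 : ContDiff ℝ ∞ fun A : Fin k → Fin k → ℝ => (Matrix.of A).adjugate i j := by
    simp only [Matrix.adjugate_apply]
    refine hdet _ fun a b => ?_
    by_cases hab : a = j
    · subst hab; simp only [Matrix.updateRow_self]; exact contDiff_const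
    · simp only [Matrix.updateRow_ne hab, Matrix.of_apply]; fun_prop
  have : (fun A : Fin k → Fin k → ℝ => (Matrix.of A)⁻¹ i j) =
      fun A => ((Matrix.of A).det)⁻¹ * (Matrix.of A).adjugate i j := by
    funext A; simp [Matrix.inv_def]
  rw [this]
  exact (h1.contDiffAt.inv h).mul h2.contDiffAt

end Matrices

section Fields

universe u

variable {M : Type u} [TopologicalSpace M] [ChartedSpace R4 M] [IsManifold (𝓡 4) ∞ M]

instance tangentSpace_finiteDimensional (x : M) : FiniteDimensional ℝ (TangentSpace (𝓡 4) x) :=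
  inferInstanceAs (FiniteDimensional ℝ R4)

theorem finrank_tangentSpace (x : M) : Module.finrank ℝ (TangentSpace (𝓡 4) x) = 4 :=
  finrank_euclideanSpace_fin (𝕜 := ℝ) (n := 4)

theorem span_eq_top_of_linearIndependent {x : M} {e : Fin 4 → TangentSpace (𝓡 4) x}
    (h : LinearIndependent ℝ e) : Submodule.span ℝ (range e) = ⊤ :=
  h.span_eq_top_of_card_eq_finrank' (by rw [finrank_tangentSpace]; rfl)

/-- Coordinates of tangent vectors in the trivialization of `TM` around `x₀`. -/
def coord (x₀ x : M) : TangentSpace (𝓡 4) x →ₗ[ℝ] R4 :=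
  (trivializationAt R4 (TangentSpace (𝓡 4) : M → Type _) x₀).linearMapAt ℝ x

/-- The domain of the trivialization of `TM` around `x₀`. -/
def coordDom (x₀ : M) : Set M := (trivializationAt R4 (TangentSpace (𝓡 4) : M → Type _) x₀).baseSet

theorem isOpen_coordDom (x₀ : M) : IsOpen (coordDom x₀) :=
  (trivializationAt R4 (TangentSpace (𝓡 4) : M → Type _) x₀).open_baseSet

theorem mem_coordDom (x₀ : M) : x₀ ∈ coordDom x₀ :=
  FiberBundle.mem_baseSet_trivializationAt' x₀

theorem coord_apply {x₀ x : M} (hx : x ∈ coordDom x₀) (v : TangentSpace (𝓡 4) x) :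
    coord x₀ x v = (trivializationAt R4 (TangentSpace (𝓡 4) : M → Type _) x₀ ⟨x, v⟩).2 := by
  rw [coord, Bundle.Trivialization.linearMapAt_apply]
  exact if_pos hx

theorem coord_injective {x₀ x : M} (hx : x ∈ coordDom x₀) :
    Function.Injective (coord x₀ x) := by
  rw [coord, Bundle.Trivialization.linearMapAt_def_of_mem _ hx]
  exact LinearEquiv.injective _

theorem smoothFieldOn_iff_coord {x₀ : M} {O : Set M} (hO : IsOpen O) (h : O ⊆ coordDom x₀)
    (V : Π x : M, TangentSpace (𝓡 4) x) :
    SmoothFieldOn V O ↔ ContMDiffOn (𝓡 4) 𝓘(ℝ, R4) ∞ (fun x => coord x₀ x (V x)) O := by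
  rw [SmoothFieldOn]
  have := (trivializationAt R4 (TangentSpace (𝓡 4) : M → Type _) x₀).contMDiffOn_section_iff
    (IB := 𝓡 4) (n := ∞) (s := V) hO h
  refine this.trans ⟨fun H => H.congr fun x hx => coord_apply (h hx) _,
    fun H => H.congr fun x hx => (coord_apply (h hx) _).symm⟩

theorem continuousWithinAt_iff_coord {Q : Type*} [TopologicalSpace Q] {π : Q → M}
    {x₀ : M} {S : Set Q} {q₀ : Q} (hπ : ContinuousWithinAt π S q₀) (h : π q₀ ∈ coordDom x₀)
    (Z : Π q : Q, TangentSpace (𝓡 4) (π q)) :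
    ContinuousWithinAt (fun q => (⟨π q, Z q⟩ : TangentBundle (𝓡 4) M)) S q₀ ↔
      ContinuousWithinAt (fun q => coord x₀ (π q) (Z q)) S q₀ := by
  have key := (trivializationAt R4 (TangentSpace (𝓡 4) : M → Type _) x₀).tendsto_nhds_iff
    (l := 𝓝[S] q₀) (f := fun q => (⟨π q, Z q⟩ : TangentBundle (𝓡 4) M))
    (z := ⟨π q₀, Z q₀⟩)
    ((Bundle.Trivialization.mem_source _).2 h)
  have hev : ∀ᶠ q in 𝓝[S] q₀, π q ∈ coordDom x₀ := hπ ((isOpen_coordDom x₀).mem_nhds h)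
  unfold ContinuousWithinAt
  have hc := Filter.tendsto_congr' (l₂ := 𝓝 (coord x₀ (π q₀) (Z q₀)))
    (hev.mono fun q hq => (coord_apply hq (Z q)).symm)
  rw [key, ← hc, coord_apply h]
  exact and_iff_right hπ

theorem SmoothFieldOn.mono {V : Π x : M, TangentSpace (𝓡 4) x} {O O' : Set M}
    (h : SmoothFieldOn V O) (hO : O' ⊆ O) : SmoothFieldOn V O' :=
  ContMDiffOn.mono h hO

theorem SmoothFieldOn.contMDiffAt {V : Π x : M, TangentSpace (𝓡 4) x} {O : Set M} {x : M}
    (h : SmoothFieldOn V O) (hO : IsOpen O) (hx : x ∈ O) :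
    ContMDiffAt (𝓡 4) (𝓡 4).tangent ∞ (fun x => (⟨x, V x⟩ : TangentBundle (𝓡 4) M)) x :=
  ContMDiffOn.contMDiffAt h (hO.mem_nhds hx)

theorem SmoothFieldOn.mdifferentiableAt {V : Π x : M, TangentSpace (𝓡 4) x} {O : Set M} {x : M}
    (h : SmoothFieldOn V O) (hO : IsOpen O) (hx : x ∈ O) :
    MDifferentiableAt (𝓡 4) (𝓡 4).tangent (fun x => (⟨x, V x⟩ : TangentBundle (𝓡 4) M)) x :=
  (h.contMDiffAt hO hx).mdifferentiableAt (by simp)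

theorem SmoothFieldOn.congr {V W : Π x : M, TangentSpace (𝓡 4) x} {O : Set M}
    (h : SmoothFieldOn V O) (hVW : ∀ x ∈ O, W x = V x) : SmoothFieldOn W O :=
  ContMDiffOn.congr h fun x hx => by rw [hVW x hx]

/-- Smoothness of a vector field on an open set is a local property. -/
theorem smoothFieldOn_of_locally {V : Π x : M, TangentSpace (𝓡 4) x} {O : Set M}
    (h : ∀ x ∈ O, ∃ O', IsOpen O' ∧ x ∈ O' ∧ SmoothFieldOn V O') : SmoothFieldOn V O :=
  fun x hx => by
    obtain ⟨O', hO', hx', h'⟩ := h x hx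
    exact (h'.contMDiffAt hO' hx').contMDiffWithinAt

theorem SmoothFieldOn.add {V W : Π x : M, TangentSpace (𝓡 4) x} {O : Set M}
    (hV : SmoothFieldOn V O) (hW : SmoothFieldOn W O) :
    SmoothFieldOn (fun x => V x + W x) O := ContMDiffOn.add_section hV hW

theorem SmoothFieldOn.sub {V W : Π x : M, TangentSpace (𝓡 4) x} {O : Set M}
    (hV : SmoothFieldOn V O) (hW : SmoothFieldOn W O) :
    SmoothFieldOn (fun x => V x - W x) O := ContMDiffOn.sub_section hV hW

theorem SmoothFieldOn.smul {V : Π x : M, TangentSpace (𝓡 4) x} {f : M → ℝ} {O : Set M}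
    (hf : ContMDiffOn (𝓡 4) 𝓘(ℝ) ∞ f O) (hV : SmoothFieldOn V O) :
    SmoothFieldOn (fun x => f x • V x) O := ContMDiffOn.smul_section hf hV

theorem SmoothFieldOn.const_smul {V : Π x : M, TangentSpace (𝓡 4) x} {O : Set M} (c : ℝ)
    (hV : SmoothFieldOn V O) :
    SmoothFieldOn (fun x => c • V x) O := ContMDiffOn.const_smul_section hV

theorem SmoothFieldOn.sum {ι : Type*} (s : Finset ι) {V : ι → Π x : M, TangentSpace (𝓡 4) x}
    {O : Set M} (hV : ∀ i ∈ s, SmoothFieldOn (V i) O) :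
    SmoothFieldOn (fun x => ∑ i ∈ s, V i x) O := ContMDiffOn.sum_section hV

variable (M) in
theorem isManifold_minSmoothness (n : ℕ) : IsManifold (𝓡 4) (minSmoothness ℝ n) M := by
  rw [minSmoothness_of_isRCLikeNormedField]
  exact IsManifold.of_le (n := ∞) (by exact_mod_cast le_top)

theorem SmoothFieldOn.bracket {V W : Π x : M, TangentSpace (𝓡 4) x} {O : Set M}
    (hO : IsOpen O) (hV : SmoothFieldOn V O) (hW : SmoothFieldOn W O) :
    SmoothFieldOn (bracket V W) O := fun x hx =>
  haveI := isManifold_minSmoothness (M := M) 2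
  haveI : IsManifold (𝓡 4) (((⊤ : ℕ∞) : ℕ∞ω) + 1) M := ‹IsManifold (𝓡 4) ∞ M›
  ((hV.contMDiffAt hO hx).mlieBracket_vectorField (n := ⊤) (m := ⊤) (hW.contMDiffAt hO hx)
    (by simp)).contMDiffWithinAt

/-- Fields which are smooth and linearly independent near a point have smooth dual coefficients:
linear forms `c i` on the nearby tangent spaces with `c i (e j) = δ i j` which send smooth fields to
smooth functions and continuous fields to continuous functions. -/
theorem exists_dual_coeff {k : ℕ} {O : Set M} (hO : IsOpen O) {x₀ : M} (hx₀ : x₀ ∈ O)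
    {e : Fin k → Π x : M, TangentSpace (𝓡 4) x} (he : ∀ i, SmoothFieldOn (e i) O)
    (hli : LinearIndependent ℝ fun i => e i x₀) :
    ∃ O' : Set M, IsOpen O' ∧ x₀ ∈ O' ∧ O' ⊆ O ∧ O' ⊆ coordDom x₀ ∧
      ∃ c : Fin k → Π x : M, TangentSpace (𝓡 4) x →ₗ[ℝ] ℝ,
        (∀ x ∈ O', ∀ i j, c i x (e j x) = if i = j then 1 else 0) ∧
        (∀ i (V : Π x : M, TangentSpace (𝓡 4) x) (U : Set M), IsOpen U → U ⊆ O' →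
          SmoothFieldOn V U → ContMDiffOn (𝓡 4) 𝓘(ℝ) ∞ (fun x => c i x (V x)) U) ∧
        (∀ i (Q : Type u) [TopologicalSpace Q] (π : Q → M) (S : Set Q) (q₀ : Q)
          (Z : Π q : Q, TangentSpace (𝓡 4) (π q)), ContinuousWithinAt π S q₀ → π q₀ ∈ O' →
          ContinuousWithinAt (fun q => coord x₀ (π q) (Z q)) S q₀ →
          ContinuousWithinAt (fun q => c i (π q) (Z q)) S q₀) := by
  have hli' : LinearIndependent ℝ fun i => coord x₀ x₀ (e i x₀) :=
    hli.map' _ (LinearMap.ker_eq_bot.2 (coord_injective (mem_coordDom x₀)))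
  -- `L` is a left inverse at `x₀` of the frame in coordinates; the matrix `A x` of the frame at `x`,
  -- read through `L`, is the identity at `x₀`, and `A⁻¹ ∘ L` gives the dual coefficients where `A`
  -- is invertible.
  obtain ⟨L, hL⟩ := LinearMap.exists_leftInverse_of_injective
    (Fintype.linearCombination ℝ fun i => coord x₀ x₀ (e i x₀))
    (LinearMap.ker_eq_bot.2 hli'.fintypeLinearCombination_injective)
  have hL' : ∀ j, L (coord x₀ x₀ (e j x₀)) = Pi.single j 1 := fun j => by
    have := LinearMap.congr_fun hL (Pi.single j 1)
    simpa [Fintype.linearCombination_apply_single] using this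
  set A : M → Fin k → Fin k → ℝ := fun x i j => L (coord x₀ x (e j x)) i with hA
  have hLc : ∀ i, ContMDiff 𝓘(ℝ, R4) 𝓘(ℝ) ∞ fun v : R4 => L v i := fun i => by
    have : ContDiff ℝ ∞ fun v : R4 => L v i :=
      ((LinearMap.proj i ∘ₗ L).toContinuousLinearMap).contDiff
    exact this.contMDiff
  have hAs : ∀ i j, ContMDiffOn (𝓡 4) 𝓘(ℝ) ∞ (fun x => A x i j) (O ∩ coordDom x₀) := fun i j =>
    (hLc i).comp_contMDiffOn ((smoothFieldOn_iff_coord (hO.inter (isOpen_coordDom x₀))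
      inter_subset_right _).1 ((he j).mono inter_subset_left))
  have hAs' : ContMDiffOn (𝓡 4) 𝓘(ℝ, Fin k → Fin k → ℝ) ∞ A (O ∩ coordDom x₀) :=
    contMDiffOn_pi_space.2 fun i => contMDiffOn_pi_space.2 fun j => hAs i j
  have hdet : Continuous fun B : Fin k → Fin k → ℝ => (Matrix.of B).det :=
    Continuous.matrix_det (by fun_prop)
  set O' := (O ∩ coordDom x₀) ∩ A ⁻¹' {B | (Matrix.of B).det ≠ 0} with hO'
  have hO'o : IsOpen O' := hAs'.continuousOn.isOpen_inter_preimage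
    (hO.inter (isOpen_coordDom x₀)) (isOpen_ne_fun hdet continuous_const)
  have hx₀' : x₀ ∈ O' := by
    refine ⟨⟨hx₀, mem_coordDom x₀⟩, ?_⟩
    have : Matrix.of (A x₀) = 1 := by
      ext i j
      simp only [hA, Matrix.of_apply, hL', Matrix.one_apply, Pi.single_apply]
    simp [this]
  have hinv : ∀ x ∈ O', ∀ i j, ContMDiffAt (𝓡 4) 𝓘(ℝ) ∞
      (fun x => (Matrix.of (A x))⁻¹ i j) x := fun x hx i j =>
    (contDiffAt_matrix_inv (A x) hx.2 i j).contMDiffAt.comp x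
      (hAs'.contMDiffAt ((hO.inter (isOpen_coordDom x₀)).mem_nhds hx.1))
  refine ⟨O', hO'o, hx₀', fun x hx => hx.1.1, fun x hx => hx.1.2,
    fun i x => ∑ j, (Matrix.of (A x))⁻¹ i j • (LinearMap.proj j ∘ₗ L ∘ₗ coord x₀ x), ?_, ?_, ?_⟩
  · intro x hx i j
    have h1 : (Matrix.of (A x))⁻¹ * Matrix.of (A x) = 1 :=
      Matrix.nonsing_inv_mul _ (isUnit_iff_ne_zero.2 hx.2)
    have h2 := congrFun (congrFun h1 i) j
    rw [Matrix.mul_apply, Matrix.one_apply] at h2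
    simpa [hA] using h2
  · intro i V U hU hUO' hV x hx
    have h1 := (smoothFieldOn_iff_coord hU (fun y hy => (hUO' hy).1.2) V).1 hV
    have h2 : ∀ j, ContMDiffWithinAt (𝓡 4) 𝓘(ℝ) ∞ (fun x =>
        (Matrix.of (A x))⁻¹ i j * L (coord x₀ x (V x)) j) U x := fun j =>
      ((hinv x (hUO' hx) i j).contMDiffWithinAt).mul ((hLc j).comp_contMDiffOn h1 x hx)
    have := contMDiffWithinAt_finsetSum (t := Finset.univ) fun j _ => h2 j
    simpa using this
  · intro i Q _ π S q₀ Z hπ hq hZ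
    have h2 : ∀ j, ContinuousWithinAt (fun q =>
        (Matrix.of (A (π q)))⁻¹ i j * L (coord x₀ (π q) (Z q)) j) S q₀ := fun j =>
      ((hinv (π q₀) hq i j).continuousAt.comp_continuousWithinAt hπ).mul
        ((hLc j).continuous.continuousAt.comp_continuousWithinAt hZ)
    have := tendsto_finsetSum Finset.univ fun j _ => h2 j
    simpa [ContinuousWithinAt] using this

/-- Coefficients of a smooth field with respect to pointwise independent smooth fields which span
it are smooth. -/
theorem exists_coeff_of_mem_span {k : ℕ} {O : Set M} (hO : IsOpen O) {x₀ : M} (hx₀ : x₀ ∈ O)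
    {e : Fin k → Π x : M, TangentSpace (𝓡 4) x} (he : ∀ i, SmoothFieldOn (e i) O)
    (hli : LinearIndependent ℝ fun i => e i x₀) {V : Π x : M, TangentSpace (𝓡 4) x}
    (hV : SmoothFieldOn V O) (hmem : ∀ x ∈ O, V x ∈ Submodule.span ℝ (range fun i => e i x)) :
    ∃ O' : Set M, IsOpen O' ∧ x₀ ∈ O' ∧ O' ⊆ O ∧ ∃ f : Fin k → M → ℝ,
      (∀ i, ContMDiffOn (𝓡 4) 𝓘(ℝ) ∞ (f i) O') ∧ ∀ x ∈ O', V x = ∑ i, f i x • e i x := by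
  obtain ⟨O', hO', hx', hsub, -, c, hc, hcs, -⟩ := exists_dual_coeff hO hx₀ he hli
  refine ⟨O', hO', hx', hsub, fun i x => c i x (V x),
    fun i => hcs i V O' hO' Subset.rfl (hV.mono hsub), fun x hx => ?_⟩
  obtain ⟨a, ha⟩ := (Submodule.mem_span_range_iff_exists_fun ℝ).1 (hmem x (hsub hx))
  have : ∀ i, c i x (V x) = a i := fun i => by
    rw [← ha, map_sum]
    simp [hc x hx]
  simp only [this, ha]

/-! ### Homotopies of bundle automorphisms -/

/-- A path `L s` of automorphisms of the vector bundle `TM`, covering the identity of `M`: each `L s`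
maps smooth fields to smooth fields, and `L` maps continuous families of tangent vectors to
continuous ones. Nothing is required of `L 0`. -/
structure IsGaugePath (L : unitInterval → Π x : M, TangentSpace (𝓡 4) x →ₗ[ℝ] TangentSpace (𝓡 4) x) :
    Prop where
  injective : ∀ s x, Function.Injective (L s x)
  smooth : ∀ (s : unitInterval) (V : Π x : M, TangentSpace (𝓡 4) x) (O : Set M), IsOpen O →
    SmoothFieldOn V O → SmoothFieldOn (fun x => L s x (V x)) O
  continuous : ∀ (Z : unitInterval → Π x : M, TangentSpace (𝓡 4) x) (S : Set (unitInterval × M)),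
    ContinuousOn (fun q => (⟨q.2, Z q.1 q.2⟩ : TangentBundle (𝓡 4) M)) S →
    ContinuousOn (fun q => (⟨q.2, L q.1 q.2 (Z q.1 q.2)⟩ : TangentBundle (𝓡 4) M)) S

theorem IsGaugePath.comp
    {L L' : unitInterval → Π x : M, TangentSpace (𝓡 4) x →ₗ[ℝ] TangentSpace (𝓡 4) x}
    (hL : IsGaugePath L) (hL' : IsGaugePath L') : IsGaugePath fun s x => L s x ∘ₗ L' s x where
  injective s x := (hL.injective s x).comp (hL'.injective s x)
  smooth s V O hO hV := hL.smooth s _ O hO (hL'.smooth s V O hO hV)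
  continuous Z S hZ := hL.continuous (fun s x => L' s x (Z s x)) S (hL'.continuous Z S hZ)

/-- It suffices to find smooth local frames with respect to which the matrices of `L` are
smooth on `M` and continuous in both variables. -/
theorem isGaugePath_of_local
    {L : unitInterval → Π x : M, TangentSpace (𝓡 4) x →ₗ[ℝ] TangentSpace (𝓡 4) x}
    (h : ∀ x₀ : M, ∃ O : Set M, IsOpen O ∧ x₀ ∈ O ∧ ∃ (e : Fin 4 → Π x : M, TangentSpace (𝓡 4) x)
      (A : unitInterval → M → Matrix (Fin 4) (Fin 4) ℝ), (∀ i, SmoothFieldOn (e i) O) ∧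
      LinearIndependent ℝ (fun i => e i x₀) ∧
      (∀ s i j, ContMDiffOn (𝓡 4) 𝓘(ℝ) ∞ (fun x => A s x i j) O) ∧
      (∀ i j, ContinuousOn (fun q : unitInterval × M => A q.1 q.2 i j) (univ ×ˢ O)) ∧
      (∀ s, ∀ x ∈ O, (A s x).det ≠ 0) ∧
      ∀ s, ∀ x ∈ O, ∀ j, L s x (e j x) = ∑ i, A s x i j • e i x) : IsGaugePath L := by
  -- with the dual coefficients `c` of the frame `e`, the map `L s` is `v ↦ ∑ᵢⱼ Aᵢⱼ cⱼ(v) eᵢ`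
  have key : ∀ x₀ : M, ∃ O : Set M, IsOpen O ∧ x₀ ∈ O ∧ O ⊆ coordDom x₀ ∧
      ∃ (e : Fin 4 → Π x : M, TangentSpace (𝓡 4) x)
      (A : unitInterval → M → Matrix (Fin 4) (Fin 4) ℝ)
      (c : Fin 4 → Π x : M, TangentSpace (𝓡 4) x →ₗ[ℝ] ℝ), (∀ i, SmoothFieldOn (e i) O) ∧
      (∀ s i j, ContMDiffOn (𝓡 4) 𝓘(ℝ) ∞ (fun x => A s x i j) O) ∧
      (∀ i j, ContinuousOn (fun q : unitInterval × M => A q.1 q.2 i j) (univ ×ˢ O)) ∧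
      (∀ s, ∀ x ∈ O, (A s x).det ≠ 0) ∧
      (∀ x ∈ O, ∀ i j, c i x (e j x) = if i = j then 1 else 0) ∧
      (∀ i (V : Π x : M, TangentSpace (𝓡 4) x) (U : Set M), IsOpen U → U ⊆ O →
          SmoothFieldOn V U → ContMDiffOn (𝓡 4) 𝓘(ℝ) ∞ (fun x => c i x (V x)) U) ∧
      (∀ i (Q : Type u) [TopologicalSpace Q] (π : Q → M) (S : Set Q) (q₀ : Q)
          (Z : Π q : Q, TangentSpace (𝓡 4) (π q)), ContinuousWithinAt π S q₀ → π q₀ ∈ O →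
          ContinuousWithinAt (fun q => coord x₀ (π q) (Z q)) S q₀ →
          ContinuousWithinAt (fun q => c i (π q) (Z q)) S q₀) ∧
      (∀ x ∈ O, ∀ v, v = ∑ i, c i x v • e i x) ∧
      (∀ s, ∀ x ∈ O, ∀ v, L s x v = ∑ i, (∑ j, A s x i j * c j x v) • e i x) := by
    intro x₀
    obtain ⟨O, hO, hx, e, A, he, hli, hA, hAc, hAd, hL⟩ := h x₀
    obtain ⟨O', hO', hx', hsub, hdom, c, hc, hcs, hcc⟩ := exists_dual_coeff hO hx he hli
    have hexp : ∀ x ∈ O', ∀ v : TangentSpace (𝓡 4) x, v = ∑ i, c i x v • e i x := by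
      intro x hx v
      have hlix : LinearIndependent ℝ fun i => e i x := by
        rw [Fintype.linearIndependent_iff]
        intro g hg i
        have := congrArg (c i x) hg
        simpa [map_sum, hc x hx] using this
      have hspan := span_eq_top_of_linearIndependent hlix
      obtain ⟨a, ha⟩ := (Submodule.mem_span_range_iff_exists_fun ℝ).1
        (hspan ▸ Submodule.mem_top : v ∈ Submodule.span ℝ (range fun i => e i x))
      have : ∀ i, c i x v = a i := fun i => by
        rw [← ha, map_sum]; simp [hc x hx]
      simp only [this, ha]
    refine ⟨O', hO', hx', hdom, e, A, c, fun i => (he i).mono hsub, fun s i j => (hA s i j).mono hsub,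
      fun i j => (hAc i j).mono (prod_mono Subset.rfl hsub), fun s x hx => hAd s x (hsub hx),
      hc, hcs, hcc, hexp, fun s x hx v => ?_⟩
    conv_lhs => rw [hexp x hx v]
    simp only [map_sum, map_smul, hL s x (hsub hx), Finset.smul_sum, Finset.sum_smul, smul_smul]
    rw [Finset.sum_comm]
    simp only [mul_comm]
  refine ⟨fun s x₀ => ?_, fun s V O hO hV => ?_, fun Z S hZ => ?_⟩
  · obtain ⟨O, hO, hx, hdom, e, A, c, he, hA, hAc, hAd, hc, hcs, hcc, hexp, hL⟩ := key x₀
    refine (injective_iff_map_eq_zero (L s x₀)).2 fun v hv => ?_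
    rw [hL s x₀ hx] at hv
    have h1 : (A s x₀).mulVec (fun j => c j x₀ v) = 0 := by
      funext i
      have := congrArg (c i x₀) hv
      simpa [map_sum, hc x₀ hx, Matrix.mulVec, dotProduct] using this
    have h2 := Matrix.eq_zero_of_mulVec_eq_zero (hAd s x₀ hx) h1
    rw [hexp x₀ hx v]
    simp [fun j => congrFun h2 j]
  · refine smoothFieldOn_of_locally fun x₀ hx₀ => ?_
    obtain ⟨O₁, hO₁, hx, hdom, e, A, c, he, hA, hAc, hAd, hc, hcs, hcc, hexp, hL⟩ := key x₀
    refine ⟨O ∩ O₁, hO.inter hO₁, ⟨hx₀, hx⟩, ?_⟩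
    refine SmoothFieldOn.congr (V := fun x => ∑ i, (∑ j, A s x i j * c j x (V x)) • e i x) ?_
      fun x hx => hL s x hx.2 (V x)
    refine SmoothFieldOn.sum _ fun i _ => SmoothFieldOn.smul ?_ ((he i).mono inter_subset_right)
    refine contMDiffOn_finsetSum fun j _ => ((hA s i j).mono inter_subset_right).mul ?_
    exact hcs j V _ (hO.inter hO₁) inter_subset_right (hV.mono inter_subset_left)
  · intro q₀ hq₀
    obtain ⟨O₁, hO₁, hx, hdom, e, A, c, he, hA, hAc, hAd, hc, hcs, hcc, hexp, hL⟩ := key q₀.2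
    have h1 := (continuousWithinAt_iff_coord continuous_snd.continuousWithinAt (hdom hx)
      (fun q : unitInterval × M => Z q.1 q.2)).1 (hZ q₀ hq₀)
    refine (continuousWithinAt_iff_coord continuous_snd.continuousWithinAt (hdom hx)
      (fun q : unitInterval × M => L q.1 q.2 (Z q.1 q.2))).2 ?_
    have hev : ∀ᶠ q : unitInterval × M in 𝓝[S] q₀, q.2 ∈ O₁ :=
      continuous_snd.continuousWithinAt (hO₁.mem_nhds hx)
    have hc2 : ∀ j, ContinuousWithinAt (fun q : unitInterval × M => c j q.2 (Z q.1 q.2)) S q₀ :=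
      fun j => hcc j (unitInterval × M) Prod.snd S q₀ (fun q => Z q.1 q.2)
        continuous_snd.continuousWithinAt hx h1
    have hA2 : ∀ i j, ContinuousWithinAt (fun q : unitInterval × M => A q.1 q.2 i j) S q₀ :=
      fun i j => ((hAc i j).continuousAt
        ((isOpen_univ.prod hO₁).mem_nhds ⟨mem_univ _, hx⟩)).continuousWithinAt
    have he2 : ∀ i, ContinuousWithinAt (fun q : unitInterval × M => coord q₀.2 q.2 (e i q.2)) S q₀ :=
      fun i => by
        have := ((smoothFieldOn_iff_coord hO₁ hdom (e i)).1 (he i)).continuousOn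
        exact ((this.continuousAt (hO₁.mem_nhds hx)).comp
          continuous_snd.continuousAt).continuousWithinAt
    have h3 : ContinuousWithinAt (fun q : unitInterval × M =>
        ∑ i, (∑ j, A q.1 q.2 i j * c j q.2 (Z q.1 q.2)) • coord q₀.2 q.2 (e i q.2)) S q₀ :=
      tendsto_finsetSum _ fun i _ => Filter.Tendsto.smul
        (tendsto_finsetSum _ fun j _ => (hA2 i j).mul (hc2 j)) (he2 i)
    refine h3.congr_of_eventuallyEq (hev.mono fun q hq => ?_) ?_
    · dsimp only
      rw [hL _ _ hq, map_sum]; simp only [map_smul]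
    · rw [hL _ _ hx, map_sum]; simp only [map_smul]

end Fields

/-! ### Brackets of local sections -/

section Brackets

universe u

variable {M : Type u} [TopologicalSpace M] [ChartedSpace R4 M] [IsManifold (𝓡 4) ∞ M]

theorem bracket_congr {V V' W W' : Π x : M, TangentSpace (𝓡 4) x} {O : Set M} (hO : IsOpen O)
    {x : M} (hx : x ∈ O) (hV : ∀ y ∈ O, V y = V' y) (hW : ∀ y ∈ O, W y = W' y) :
    bracket V W x = bracket V' W' x :=
  Filter.EventuallyEq.mlieBracket_vectorField_eq (Filter.eventually_of_mem (hO.mem_nhds hx) hV)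
    (Filter.eventually_of_mem (hO.mem_nhds hx) hW)

theorem bracket_swap (V W : Π x : M, TangentSpace (𝓡 4) x) (x : M) :
    bracket V W x = -bracket W V x := VectorField.mlieBracket_swap_apply

theorem bracket_self (V : Π x : M, TangentSpace (𝓡 4) x) (x : M) : bracket V V x = 0 := by
  have h : bracket V V x + bracket V V x = 0 := by
    nth_rewrite 1 [bracket_swap V V x]
    exact neg_add_cancel _
  have h2 : (2 : ℝ) • bracket V V x = 0 := by rw [two_smul]; exact h
  exact (smul_eq_zero.1 h2).resolve_left two_ne_zero

theorem bracket_sum_left_sub_mem {ι : Type*} (s : Finset ι) {O : Set M} (hO : IsOpen O) {x : M}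
    (hx : x ∈ O) {e : ι → Π x : M, TangentSpace (𝓡 4) x} (he : ∀ i, SmoothFieldOn (e i) O)
    {f : ι → M → ℝ} (hf : ∀ i, ContMDiffOn (𝓡 4) 𝓘(ℝ) ∞ (f i) O)
    (W : Π x : M, TangentSpace (𝓡 4) x) :
    bracket (fun y => ∑ i ∈ s, f i y • e i y) W x - ∑ i ∈ s, f i x • bracket (e i) W x ∈
      Submodule.span ℝ (range fun i => e i x) := by
  have := isManifold_minSmoothness (M := M) 2
  classical
  induction s using Finset.induction_on with
  | empty =>
    have : bracket (fun y : M => (0 : TangentSpace (𝓡 4) y)) W x = 0 := by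
      have h := VectorField.mlieBracket_zero_left (I := 𝓡 4) (W := W)
      exact congrFun h x
    simp [this]
  | insert a s ha ih =>
    have hfa : MDifferentiableAt (𝓡 4) 𝓘(ℝ) (f a) x :=
      ((hf a).contMDiffAt (hO.mem_nhds hx)).mdifferentiableAt (by simp)
    have h1 := VectorField.mlieBracket_smul_left (I := 𝓡 4) (W := W) hfa
      ((he a).mdifferentiableAt hO hx)
    have hsum : SmoothFieldOn (fun y => ∑ i ∈ s, f i y • e i y) O :=
      SmoothFieldOn.sum s fun i _ => SmoothFieldOn.smul (hf i) (he i)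
    have h2 := VectorField.mlieBracket_add_left (I := 𝓡 4) (W := W)
      ((SmoothFieldOn.smul (hf a) (he a)).mdifferentiableAt hO hx) (hsum.mdifferentiableAt hO hx)
    have h3 : bracket (fun y => ∑ i ∈ insert a s, f i y • e i y) W x =
        bracket (f a • e a) W x + bracket (fun y => ∑ i ∈ s, f i y • e i y) W x := by
      refine Eq.trans ?_ h2
      simp only [Finset.sum_insert ha]
      rfl
    have h4 : e a x ∈ Submodule.span ℝ (range fun i => e i x) :=
      Submodule.subset_span ⟨a, rfl⟩
    rw [h3, Finset.sum_insert ha]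
    obtain ⟨r, hr⟩ : ∃ r : ℝ, bracket (f a • e a) W x = r • e a x + f a x • bracket (e a) W x :=
      ⟨_, h1⟩
    have h5 := Submodule.add_mem _ ih (Submodule.smul_mem _ r h4)
    convert h5 using 1
    rw [hr]
    abel

/-- The bracket of two linear combinations of `e i` with function coefficients, modulo the span of
the `e i`, depends on the values of the coefficients only. -/
theorem bracket_sum_sub_mem {k : ℕ} {O : Set M} (hO : IsOpen O) {x : M} (hx : x ∈ O)
    {e : Fin k → Π x : M, TangentSpace (𝓡 4) x} (he : ∀ i, SmoothFieldOn (e i) O)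
    {f g : Fin k → M → ℝ} (hf : ∀ i, ContMDiffOn (𝓡 4) 𝓘(ℝ) ∞ (f i) O)
    (hg : ∀ i, ContMDiffOn (𝓡 4) 𝓘(ℝ) ∞ (g i) O) {V W : Π x : M, TangentSpace (𝓡 4) x}
    (hV : ∀ y ∈ O, V y = ∑ i, f i y • e i y) (hW : ∀ y ∈ O, W y = ∑ i, g i y • e i y) :
    bracket V W x - ∑ i, ∑ j, (f i x * g j x) • bracket (e i) (e j) x ∈
      Submodule.span ℝ (range fun i => e i x) := by
  rw [bracket_congr hO hx hV hW]
  have h1 := bracket_sum_left_sub_mem Finset.univ hO hx he hf (fun y => ∑ i, g i y • e i y)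
  have h2 : ∀ i, bracket (e i) (fun y => ∑ j, g j y • e j y) x -
      ∑ j, g j x • bracket (e i) (e j) x ∈ Submodule.span ℝ (range fun i => e i x) := by
    intro i
    have := Submodule.neg_mem _ (bracket_sum_left_sub_mem Finset.univ hO hx he hg (e i))
    convert this using 1
    rw [bracket_swap, neg_sub, sub_eq_add_neg, add_comm, ← Finset.sum_neg_distrib,
      sub_eq_add_neg]
    congr 1
    refine Finset.sum_congr rfl fun j _ => ?_
    rw [bracket_swap (e i), smul_neg, neg_neg]
  have h3 := Submodule.add_mem _ h1 (Submodule.sum_mem _ fun i (_ : i ∈ Finset.univ) =>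
    Submodule.smul_mem _ (f i x) (h2 i))
  convert h3 using 1
  simp only [smul_sub, Finset.sum_sub_distrib, Finset.smul_sum, smul_smul]
  abel

theorem IsLocalSection.congr {P P' : Π x : M, Submodule ℝ (TangentSpace (𝓡 4) x)} {O : Set M}
    (hO : IsOpen O) (h : ∀ y ∈ O, P y = P' y) {x : M} (hx : x ∈ O)
    {V : Π x : M, TangentSpace (𝓡 4) x} (hV : IsLocalSection P x V) : IsLocalSection P' x V := by
  obtain ⟨O', hO', hx', hs, hm⟩ := hV
  exact ⟨O ∩ O', hO.inter hO', ⟨hx, hx'⟩, hs.mono inter_subset_right,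
    fun y hy => h y hy.1 ▸ hm y hy.2⟩

theorem isLocalSection_congr {P P' : Π x : M, Submodule ℝ (TangentSpace (𝓡 4) x)} {O : Set M}
    (hO : IsOpen O) (h : ∀ y ∈ O, P y = P' y) {x : M} (hx : x ∈ O)
    {V : Π x : M, TangentSpace (𝓡 4) x} : IsLocalSection P x V ↔ IsLocalSection P' x V :=
  ⟨fun H => H.congr hO h hx, fun H => H.congr hO (fun y hy => (h y hy).symm) hx⟩

theorem derived_congr {P P' : Π x : M, Submodule ℝ (TangentSpace (𝓡 4) x)} {O : Set M}
    (hO : IsOpen O) (h : ∀ y ∈ O, P y = P' y) : ∀ x ∈ O, derived P x = derived P' x := by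
  intro x hx
  simp only [derived, h x hx, isLocalSection_congr hO h hx]

/-- Near a point where `P` is spanned by smooth independent fields, every local section is a
combination of them with smooth coefficients. -/
theorem IsLocalSection.exists_coeff {k : ℕ} {P : Π x : M, Submodule ℝ (TangentSpace (𝓡 4) x)}
    {O : Set M} (hO : IsOpen O) {x : M} (hx : x ∈ O)
    {e : Fin k → Π x : M, TangentSpace (𝓡 4) x} (he : ∀ i, SmoothFieldOn (e i) O)
    (hli : LinearIndependent ℝ fun i => e i x)
    (hP : ∀ y ∈ O, P y = Submodule.span ℝ (range fun i => e i y))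
    {V : Π x : M, TangentSpace (𝓡 4) x} (hV : IsLocalSection P x V) :
    ∃ O' : Set M, IsOpen O' ∧ x ∈ O' ∧ O' ⊆ O ∧ ∃ f : Fin k → M → ℝ,
      (∀ i, ContMDiffOn (𝓡 4) 𝓘(ℝ) ∞ (f i) O') ∧ ∀ y ∈ O', V y = ∑ i, f i y • e i y := by
  obtain ⟨O₁, hO₁, hx₁, hs, hm⟩ := hV
  obtain ⟨O', hO', hx', hsub, f, hf, hVf⟩ := exists_coeff_of_mem_span (hO.inter hO₁) ⟨hx, hx₁⟩
    (fun i => (he i).mono inter_subset_left) hli (hs.mono inter_subset_right)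
    (fun y hy => hP y hy.1 ▸ hm y hy.2)
  exact ⟨O', hO', hx', hsub.trans inter_subset_left, f, hf, hVf⟩

/-- The bracket of two local sections of `P = ⟨e i⟩` at `x`, modulo `P`, in terms of the values of
the sections at `x`. -/
theorem IsLocalSection.bracket_sub_mem {k : ℕ}
    {P : Π x : M, Submodule ℝ (TangentSpace (𝓡 4) x)}
    {O : Set M} (hO : IsOpen O) {x : M} (hx : x ∈ O)
    {e : Fin k → Π x : M, TangentSpace (𝓡 4) x} (he : ∀ i, SmoothFieldOn (e i) O)
    (hli : LinearIndependent ℝ fun i => e i x)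
    (hP : ∀ y ∈ O, P y = Submodule.span ℝ (range fun i => e i y))
    {V W : Π x : M, TangentSpace (𝓡 4) x} (hV : IsLocalSection P x V) (hW : IsLocalSection P x W)
    {a b : Fin k → ℝ} (ha : V x = ∑ i, a i • e i x) (hb : W x = ∑ i, b i • e i x) :
    bracket V W x - ∑ i, ∑ j, (a i * b j) • bracket (e i) (e j) x ∈ P x := by
  obtain ⟨O₁, hO₁, hx₁, hsub₁, f, hf, hVf⟩ := hV.exists_coeff hO hx he hli hP
  obtain ⟨O₂, hO₂, hx₂, hsub₂, g, hg, hWg⟩ := hW.exists_coeff hO hx he hli hP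
  have hfa : ∀ i, f i x = a i := by
    have h1 := (hVf x hx₁).symm.trans ha
    exact fun i => hli.eq_coords_of_eq h1 i
  have hgb : ∀ i, g i x = b i := by
    have h1 := (hWg x hx₂).symm.trans hb
    exact fun i => hli.eq_coords_of_eq h1 i
  have := bracket_sum_sub_mem (hO₁.inter hO₂) ⟨hx₁, hx₂⟩
    (fun i => (he i).mono (inter_subset_left.trans hsub₁))
    (fun i => (hf i).mono inter_subset_left) (fun i => (hg i).mono inter_subset_right)
    (fun y hy => hVf y hy.1) (fun y hy => hWg y hy.2)
  simp only [hfa, hgb] at this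
  rwa [hP x hx]

theorem isLocalSection_of_frame {k : ℕ} {P : Π x : M, Submodule ℝ (TangentSpace (𝓡 4) x)}
    {O : Set M} (hO : IsOpen O) {x : M} (hx : x ∈ O)
    {e : Fin k → Π x : M, TangentSpace (𝓡 4) x} (he : ∀ i, SmoothFieldOn (e i) O)
    (hP : ∀ y ∈ O, P y = Submodule.span ℝ (range fun i => e i y)) (a : Fin k → ℝ) :
    IsLocalSection P x (fun y => ∑ i, a i • e i y) :=
  ⟨O, hO, hx, SmoothFieldOn.sum _ fun i _ => SmoothFieldOn.const_smul _ (he i), fun y hy => by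
    rw [hP y hy]
    exact Submodule.sum_mem _ fun i _ => Submodule.smul_mem _ _ (Submodule.subset_span ⟨i, rfl⟩)⟩

/-- Every vector of a smooth distribution extends to a local section. -/
theorem IsSmoothDistribution.exists_section {k : ℕ}
    {P : Π x : M, Submodule ℝ (TangentSpace (𝓡 4) x)} (hP : IsSmoothDistribution k P) {x : M}
    {v : TangentSpace (𝓡 4) x} (hv : v ∈ P x) : ∃ V, IsLocalSection P x V ∧ V x = v := by
  obtain ⟨O, hO, hx, e, he, h⟩ := hP x
  rw [(h x hx).2] at hv
  obtain ⟨a, ha⟩ := (Submodule.mem_span_range_iff_exists_fun ℝ).1 hv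
  exact ⟨_, isLocalSection_of_frame hO hx he (fun y hy => (h y hy).2) a, ha⟩

theorem range_three {α : Type*} (a b c : α) : range ![a, b, c] = {a, b, c} := by
  rw [Matrix.range_cons, Matrix.range_cons, Matrix.range_cons, Matrix.range_empty,
    Set.union_empty]
  rfl

theorem range_two {α : Type*} (a b : α) : range ![a, b] = {a, b} := by
  rw [Matrix.range_cons, Matrix.range_cons, Matrix.range_empty, Set.union_empty]
  rfl

theorem fields_two (V W : Π x : M, TangentSpace (𝓡 4) x) (x : M) :
    (fun i => (![V, W] : Fin 2 → Π x : M, TangentSpace (𝓡 4) x) i x) = ![V x, W x] := by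
  funext i; fin_cases i <;> rfl

theorem fields_three (U V W : Π x : M, TangentSpace (𝓡 4) x) (x : M) :
    (fun i => (![U, V, W] : Fin 3 → Π x : M, TangentSpace (𝓡 4) x) i x) = ![U x, V x, W x] := by
  funext i; fin_cases i <;> rfl

theorem fields_four (U V W Y : Π x : M, TangentSpace (𝓡 4) x) (x : M) :
    (fun i => (![U, V, W, Y] : Fin 4 → Π x : M, TangentSpace (𝓡 4) x) i x) =
      ![U x, V x, W x, Y x] := by
  funext i; fin_cases i <;> rfl

/-- The bracket of two local sections of a plane field. -/
theorem bracket_sub_mem_two {P : Π x : M, Submodule ℝ (TangentSpace (𝓡 4) x)}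
    {O : Set M} (hO : IsOpen O) {x : M} (hx : x ∈ O)
    {d₁ d₂ : Π x : M, TangentSpace (𝓡 4) x} (h₁ : SmoothFieldOn d₁ O) (h₂ : SmoothFieldOn d₂ O)
    (hli : LinearIndependent ℝ ![d₁ x, d₂ x])
    (hP : ∀ y ∈ O, P y = Submodule.span ℝ {d₁ y, d₂ y})
    {V W : Π x : M, TangentSpace (𝓡 4) x} (hV : IsLocalSection P x V) (hW : IsLocalSection P x W)
    {a b a' b' : ℝ} (ha : V x = a • d₁ x + b • d₂ x) (hb : W x = a' • d₁ x + b' • d₂ x) :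
    bracket V W x - (a * b' - b * a') • bracket d₁ d₂ x ∈ P x := by
  have := IsLocalSection.bracket_sub_mem (e := ![d₁, d₂]) hO hx
    (by intro i; fin_cases i; exacts [h₁, h₂]) (by rwa [fields_two])
    (fun y hy => by rw [fields_two, range_two]; exact hP y hy) hV hW (a := ![a, b])
    (b := ![a', b']) (by rw [Fin.sum_univ_two]; exact ha) (by rw [Fin.sum_univ_two]; exact hb)
  convert this using 2
  rw [Fin.sum_univ_two, Fin.sum_univ_two, Fin.sum_univ_two]
  change _ = (a * a') • bracket d₁ d₁ x + (a * b') • bracket d₁ d₂ x +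
    ((b * a') • bracket d₂ d₁ x + (b * b') • bracket d₂ d₂ x)
  rw [bracket_self, bracket_self, bracket_swap d₂ d₁]
  module

/-- The bracket of two local sections of a hyperplane field. -/
theorem bracket_sub_mem_three {P : Π x : M, Submodule ℝ (TangentSpace (𝓡 4) x)}
    {O : Set M} (hO : IsOpen O) {x : M} (hx : x ∈ O)
    {d₁ d₂ y : Π x : M, TangentSpace (𝓡 4) x} (h₁ : SmoothFieldOn d₁ O) (h₂ : SmoothFieldOn d₂ O)
    (h₃ : SmoothFieldOn y O) (hli : LinearIndependent ℝ ![d₁ x, d₂ x, y x])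
    (hP : ∀ z ∈ O, P z = Submodule.span ℝ {d₁ z, d₂ z, y z})
    {V W : Π x : M, TangentSpace (𝓡 4) x} (hV : IsLocalSection P x V) (hW : IsLocalSection P x W)
    {a b c a' b' c' : ℝ} (ha : V x = a • d₁ x + b • d₂ x + c • y x)
    (hb : W x = a' • d₁ x + b' • d₂ x + c' • y x) :
    bracket V W x - ((a * b' - b * a') • bracket d₁ d₂ x + (a * c' - c * a') • bracket d₁ y x
      + (b * c' - c * b') • bracket d₂ y x) ∈ P x := by
  have := IsLocalSection.bracket_sub_mem (e := ![d₁, d₂, y]) hO hx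
    (by intro i; fin_cases i; exacts [h₁, h₂, h₃]) (by rwa [fields_three])
    (fun y hy => by rw [fields_three, range_three]; exact hP y hy) hV hW (a := ![a, b, c])
    (b := ![a', b', c']) (by rw [Fin.sum_univ_three]; exact ha)
    (by rw [Fin.sum_univ_three]; exact hb)
  convert this using 2
  rw [Fin.sum_univ_three, Fin.sum_univ_three, Fin.sum_univ_three, Fin.sum_univ_three]
  change _ = (a * a') • bracket d₁ d₁ x + (a * b') • bracket d₁ d₂ x + (a * c') • bracket d₁ y x +
    ((b * a') • bracket d₂ d₁ x + (b * b') • bracket d₂ d₂ x + (b * c') • bracket d₂ y x) +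
    ((c * a') • bracket y d₁ x + (c * b') • bracket y d₂ x + (c * c') • bracket y y x)
  rw [bracket_self, bracket_self, bracket_self, bracket_swap d₂ d₁, bracket_swap y d₁,
    bracket_swap y d₂]
  module

/-- The derived distribution of the plane field `⟨d₁, d₂⟩`. -/
theorem derived_eq_of_two {P : Π x : M, Submodule ℝ (TangentSpace (𝓡 4) x)}
    {O : Set M} (hO : IsOpen O) {x : M} (hx : x ∈ O)
    {d₁ d₂ : Π x : M, TangentSpace (𝓡 4) x} (h₁ : SmoothFieldOn d₁ O) (h₂ : SmoothFieldOn d₂ O)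
    (hli : LinearIndependent ℝ ![d₁ x, d₂ x])
    (hP : ∀ y ∈ O, P y = Submodule.span ℝ {d₁ y, d₂ y}) :
    derived P x = Submodule.span ℝ {d₁ x, d₂ x, bracket d₁ d₂ x} := by
  have hPle : P x ≤ Submodule.span ℝ {d₁ x, d₂ x, bracket d₁ d₂ x} := by
    rw [hP x hx]
    exact Submodule.span_mono (by intro z hz; simp at hz ⊢; tauto)
  apply le_antisymm
  · refine sup_le hPle (Submodule.span_le.2 ?_)
    rintro v ⟨V, W, hV, hW, rfl⟩
    -- modulo the plane field, brackets of sections are multiples of `[d₁, d₂]`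
    have hV' := hV.mem
    have hW' := hW.mem
    rw [hP x hx, Submodule.mem_span_pair] at hV' hW'
    obtain ⟨a, b, hab⟩ := hV'
    obtain ⟨a', b', hab'⟩ := hW'
    have h := hPle (bracket_sub_mem_two hO hx h₁ h₂ hli hP hV hW hab.symm hab'.symm)
    have h' : bracket d₁ d₂ x ∈ Submodule.span ℝ {d₁ x, d₂ x, bracket d₁ d₂ x} :=
      Submodule.subset_span (by simp)
    have := Submodule.add_mem _ h (Submodule.smul_mem _ (a * b' - b * a') h')
    simpa using this
  · have hd : ∀ y ∈ O, d₁ y ∈ P y ∧ d₂ y ∈ P y := fun y hy => by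
      rw [hP y hy]; exact ⟨Submodule.subset_span (by simp), Submodule.subset_span (by simp)⟩
    refine Submodule.span_le.2 ?_
    rintro v (rfl | rfl | rfl)
    · exact Submodule.mem_sup_left (hd x hx).1
    · exact Submodule.mem_sup_left (hd x hx).2
    · exact Submodule.mem_sup_right (Submodule.subset_span
        ⟨d₁, d₂, ⟨O, hO, hx, h₁, fun y hy => (hd y hy).1⟩, ⟨O, hO, hx, h₂, fun y hy => (hd y hy).2⟩,
          rfl⟩)

/-- The derived distribution of the hyperplane field `⟨d₁, d₂, y⟩`. -/
theorem derived_eq_of_three {P : Π x : M, Submodule ℝ (TangentSpace (𝓡 4) x)}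
    {O : Set M} (hO : IsOpen O) {x : M} (hx : x ∈ O)
    {d₁ d₂ y : Π x : M, TangentSpace (𝓡 4) x} (h₁ : SmoothFieldOn d₁ O) (h₂ : SmoothFieldOn d₂ O)
    (h₃ : SmoothFieldOn y O) (hli : LinearIndependent ℝ ![d₁ x, d₂ x, y x])
    (hP : ∀ z ∈ O, P z = Submodule.span ℝ {d₁ z, d₂ z, y z})
    (h₁₂ : bracket d₁ d₂ x ∈ P x) :
    derived P x = P x ⊔ Submodule.span ℝ {bracket d₁ y x, bracket d₂ y x} := by
  apply le_antisymm
  · refine sup_le le_sup_left (Submodule.span_le.2 ?_)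
    rintro v ⟨V, W, hV, hW, rfl⟩
    have hV' := hV.mem
    have hW' := hW.mem
    rw [hP x hx, Submodule.mem_span_triple] at hV' hW'
    obtain ⟨a, b, c, hab⟩ := hV'
    obtain ⟨a', b', c', hab'⟩ := hW'
    have h := bracket_sub_mem_three hO hx h₁ h₂ h₃ hli hP hV hW hab.symm hab'.symm
    have h0 := Submodule.add_mem _ h (Submodule.smul_mem _ (a * b' - b * a') h₁₂)
    have ha : bracket d₁ y x ∈ Submodule.span ℝ {bracket d₁ y x, bracket d₂ y x} :=
      Submodule.subset_span (by simp)
    have hb : bracket d₂ y x ∈ Submodule.span ℝ {bracket d₁ y x, bracket d₂ y x} :=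
      Submodule.subset_span (by simp)
    have := Submodule.add_mem_sup h0 (Submodule.add_mem _
      (Submodule.smul_mem _ (a * c' - c * a') ha) (Submodule.smul_mem _ (b * c' - c * b') hb))
    refine (congrArg (· ∈ _) ?_).mp this
    module
  · have hd : ∀ z ∈ O, d₁ z ∈ P z ∧ d₂ z ∈ P z ∧ y z ∈ P z := fun z hz => by
      rw [hP z hz]
      exact ⟨Submodule.subset_span (by simp), Submodule.subset_span (by simp),
        Submodule.subset_span (by simp)⟩
    have s₁ : IsLocalSection P x d₁ := ⟨O, hO, hx, h₁, fun z hz => (hd z hz).1⟩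
    have s₂ : IsLocalSection P x d₂ := ⟨O, hO, hx, h₂, fun z hz => (hd z hz).2.1⟩
    have s₃ : IsLocalSection P x y := ⟨O, hO, hx, h₃, fun z hz => (hd z hz).2.2⟩
    refine sup_le le_sup_left (Submodule.span_le.2 ?_)
    rintro v (rfl | rfl)
    · exact Submodule.mem_sup_right (Submodule.subset_span ⟨_, _, s₁, s₃, rfl⟩)
    · exact Submodule.mem_sup_right (Submodule.subset_span ⟨_, _, s₂, s₃, rfl⟩)

end Brackets

/-! ### Local frames of Engel structures -/

section EngelFrames

universe u

variable {M : Type u} [TopologicalSpace M] [ChartedSpace R4 M] [IsManifold (𝓡 4) ∞ M]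

/-- A smooth frame `(d₁, d₂, y, m)` of `TM` on an open set `O` with `D = ⟨d₁, d₂⟩`,
`[d₁, d₂] ≡ y` modulo `D`, and `[dᵢ, y] ≡ κᵢ m` modulo `⟨d₁, d₂, y⟩ = [D, D]`. The plane field `D`
is an Engel structure on `O` if and only if `(κ₁, κ₂)` has no zero there. -/
structure IsDerivedFrameOn (D : Π x : M, Submodule ℝ (TangentSpace (𝓡 4) x)) (O : Set M)
    (d₁ d₂ y m : Π x : M, TangentSpace (𝓡 4) x) (κ₁ κ₂ : M → ℝ) : Prop where
  isOpen : IsOpen O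
  smooth_d₁ : SmoothFieldOn d₁ O
  smooth_d₂ : SmoothFieldOn d₂ O
  smooth_y : SmoothFieldOn y O
  smooth_m : SmoothFieldOn m O
  smooth_κ₁ : ContMDiffOn (𝓡 4) 𝓘(ℝ) ∞ κ₁ O
  smooth_κ₂ : ContMDiffOn (𝓡 4) 𝓘(ℝ) ∞ κ₂ O
  indep : ∀ x ∈ O, LinearIndependent ℝ ![d₁ x, d₂ x, y x, m x]
  D_eq : ∀ x ∈ O, D x = Submodule.span ℝ {d₁ x, d₂ x}
  bracket_d : ∀ x ∈ O, bracket d₁ d₂ x - y x ∈ Submodule.span ℝ {d₁ x, d₂ x}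
  bracket_d₁ : ∀ x ∈ O, bracket d₁ y x - κ₁ x • m x ∈ Submodule.span ℝ {d₁ x, d₂ x, y x}
  bracket_d₂ : ∀ x ∈ O, bracket d₂ y x - κ₂ x • m x ∈ Submodule.span ℝ {d₁ x, d₂ x, y x}

/-- The frame `e` of `T_x M` is adapted to the flag of the Engel structure `D` and to the two
isomorphisms given by the Lie bracket: `[e 0, e 1] ≡ e 2` modulo `D`, `[e 1, e 2] ≡ e 3` modulo
`[D, D]`, and `e 0` spans the kernel line. -/
structure IsBracketFrame (D : Π x : M, Submodule ℝ (TangentSpace (𝓡 4) x)) (x : M)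
    (e : Fin 4 → TangentSpace (𝓡 4) x) : Prop where
  indep : LinearIndependent ℝ e
  D_eq : D x = Submodule.span ℝ {e 0, e 1}
  E_eq : derived D x = Submodule.span ℝ {e 0, e 1, e 2}
  bracket_D : ∀ V V', IsLocalSection D x V → IsLocalSection D x V' → ∀ a b a' b' : ℝ,
    V x = a • e 0 + b • e 1 → V' x = a' • e 0 + b' • e 1 →
    bracket V V' x - (a * b' - b * a') • e 2 ∈ D x
  bracket_E : ∀ V V', IsLocalSection (derived D) x V → IsLocalSection (derived D) x V' →
    ∀ a b c a' b' c' : ℝ, V x = a • e 0 + b • e 1 + c • e 2 →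
    V' x = a' • e 0 + b' • e 1 + c' • e 2 →
    bracket V V' x - (b * c' - c * b') • e 3 ∈ derived D x

/-- Two frames of a `4`-dimensional space differ by an upper triangular matrix with diagonal
`(a, b, ab, ab²)`. -/
def TriRel {T : Type*} [AddCommGroup T] [Module ℝ T] (e e' : Fin 4 → T) : Prop :=
  ∃ a b : ℝ, a ≠ 0 ∧ b ≠ 0 ∧ ∃ u₀ v₀ v₁ w₀ w₁ w₂ : ℝ, e' 0 = a • e 0 ∧
    e' 1 = b • e 1 + u₀ • e 0 ∧ e' 2 = (a * b) • e 2 + v₁ • e 1 + v₀ • e 0 ∧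
    e' 3 = (a * b ^ 2) • e 3 + w₂ • e 2 + w₁ • e 1 + w₀ • e 0

theorem TriRel.symm {T : Type*} [AddCommGroup T] [Module ℝ T] {e e' : Fin 4 → T}
    (h : TriRel e e') : TriRel e' e := by
  obtain ⟨a, b, ha, hb, u₀, v₀, v₁, w₀, w₁, w₂, h0, h1, h2, h3⟩ := h
  have e0 : e 0 = a⁻¹ • e' 0 := by rw [h0, smul_smul, inv_mul_cancel₀ ha, one_smul]
  have e1 : e 1 = b⁻¹ • e' 1 + (-(b⁻¹ * u₀ * a⁻¹)) • e' 0 := by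
    rw [h1, h0]
    match_scalars <;> field_simp <;> ring
  have e2 : e 2 = (a⁻¹ * b⁻¹) • e' 2 + (-(a⁻¹ * b⁻¹ * v₁ * b⁻¹)) • e' 1 +
      (a⁻¹ * b⁻¹ * (v₁ * b⁻¹ * u₀ - v₀) * a⁻¹) • e' 0 := by
    rw [h2, h1, h0]
    match_scalars <;> field_simp <;> ring
  have e3 : e 3 = (a⁻¹ * b⁻¹ ^ 2) • (e' 3 - w₂ • e 2 - w₁ • e 1 - w₀ • e 0) := by
    rw [h3]
    match_scalars <;> field_simp <;> ring
  refine ⟨a⁻¹, b⁻¹, inv_ne_zero ha, inv_ne_zero hb, _, _, _,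
    (a⁻¹ * b⁻¹ ^ 2) * (-w₂ * (a⁻¹ * b⁻¹ * (v₁ * b⁻¹ * u₀ - v₀) * a⁻¹) + w₁ * (b⁻¹ * u₀ * a⁻¹)
      - w₀ * a⁻¹),
    (a⁻¹ * b⁻¹ ^ 2) * (w₂ * (a⁻¹ * b⁻¹ * v₁ * b⁻¹) - w₁ * b⁻¹),
    (a⁻¹ * b⁻¹ ^ 2) * (-w₂ * (a⁻¹ * b⁻¹)), e0, e1, e2, ?_⟩
  rw [e3, e2, e1, e0]
  match_scalars <;> ring

theorem TriRel.map {T T' : Type*} [AddCommGroup T] [Module ℝ T] [AddCommGroup T'] [Module ℝ T']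
    {e e' : Fin 4 → T} (h : TriRel e e') (L : T →ₗ[ℝ] T') :
    TriRel (fun i => L (e i)) (fun i => L (e' i)) := by
  obtain ⟨a, b, ha, hb, u₀, v₀, v₁, w₀, w₁, w₂, h0, h1, h2, h3⟩ := h
  exact ⟨a, b, ha, hb, u₀, v₀, v₁, w₀, w₁, w₂, by simp [h0], by simp [h1], by simp [h2],
    by simp [h3]⟩

theorem linearIndependent_four_iff {T : Type*} [AddCommGroup T] [Module ℝ T] {e : Fin 4 → T} :
    LinearIndependent ℝ e ↔ ∀ a b c d : ℝ, a • e 0 + b • e 1 + c • e 2 + d • e 3 = 0 →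
      a = 0 ∧ b = 0 ∧ c = 0 ∧ d = 0 := by
  rw [Fintype.linearIndependent_iff]
  constructor
  · intro h a b c d habcd
    have := h ![a, b, c, d] (by rw [Fin.sum_univ_four]; exact habcd)
    exact ⟨this 0, this 1, this 2, this 3⟩
  · intro h g hg
    rw [Fin.sum_univ_four] at hg
    obtain ⟨h0, h1, h2, h3⟩ := h _ _ _ _ hg
    intro i; fin_cases i <;> assumption

theorem TriRel.linearIndependent {T : Type*} [AddCommGroup T] [Module ℝ T] {e e' : Fin 4 → T}
    (h : TriRel e e') (he : LinearIndependent ℝ e) : LinearIndependent ℝ e' := by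
  obtain ⟨a, b, ha, hb, u₀, v₀, v₁, w₀, w₁, w₂, h0, h1, h2, h3⟩ := h
  rw [linearIndependent_four_iff] at he ⊢
  intro x y z t hx
  rw [h0, h1, h2, h3] at hx
  obtain ⟨k0, k1, k2, k3⟩ := he (x * a + y * u₀ + z * v₀ + t * w₀) (y * b + z * v₁ + t * w₁)
    (z * (a * b) + t * w₂) (t * (a * b ^ 2)) (by rw [← hx]; module)
  have ht : t = 0 := by simpa [ha, hb] using k3
  subst ht
  have hz : z = 0 := by simpa [ha, hb] using k2
  subst hz
  have hy : y = 0 := by simpa [hb] using k1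
  subst hy
  have hx : x = 0 := by simpa [ha] using k0
  exact ⟨hx, rfl, rfl, rfl⟩

/-- Bracket frames are determined by `D` up to triangular matrices; conversely the triangular
matrices act on them. -/
theorem IsBracketFrame.of_triRel {D : Π x : M, Submodule ℝ (TangentSpace (𝓡 4) x)} {x : M}
    {e e' : Fin 4 → TangentSpace (𝓡 4) x} (h : IsBracketFrame D x e) (ht : TriRel e e') :
    IsBracketFrame D x e' := by
  have hli := ht.linearIndependent h.indep
  have ht' := ht.symm
  obtain ⟨a, b, ha, hb, u₀, v₀, v₁, w₀, w₁, w₂, h0, h1, h2, h3⟩ := ht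
  obtain ⟨a', b', -, -, u₀', v₀', v₁', w₀', w₁', w₂', h0', h1', h2', h3'⟩ := ht'
  have m0 : e 0 ∈ Submodule.span ℝ {e 0, e 1} := Submodule.subset_span (by simp)
  have m1 : e 1 ∈ Submodule.span ℝ {e 0, e 1} := Submodule.subset_span (by simp)
  have n0 : e 0 ∈ Submodule.span ℝ {e 0, e 1, e 2} := Submodule.subset_span (by simp)
  have n1 : e 1 ∈ Submodule.span ℝ {e 0, e 1, e 2} := Submodule.subset_span (by simp)
  have n2 : e 2 ∈ Submodule.span ℝ {e 0, e 1, e 2} := Submodule.subset_span (by simp)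
  refine ⟨hli, ?_, ?_, ?_, ?_⟩
  · rw [h.D_eq]
    apply le_antisymm <;> rw [Submodule.span_le] <;> rintro v (rfl | rfl) <;>
      rw [SetLike.mem_coe, Submodule.mem_span_pair]
    · exact ⟨a', 0, by rw [h0']; module⟩
    · exact ⟨u₀', b', by rw [h1']; module⟩
    · exact ⟨a, 0, by rw [h0]; module⟩
    · exact ⟨u₀, b, by rw [h1]; module⟩
  · rw [h.E_eq]
    apply le_antisymm <;> rw [Submodule.span_le] <;> rintro v (rfl | rfl | rfl) <;>
      rw [SetLike.mem_coe, Submodule.mem_span_triple]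
    · exact ⟨a', 0, 0, by rw [h0']; module⟩
    · exact ⟨u₀', b', 0, by rw [h1']; module⟩
    · exact ⟨v₀', v₁', a' * b', by rw [h2']; module⟩
    · exact ⟨a, 0, 0, by rw [h0]; module⟩
    · exact ⟨u₀, b, 0, by rw [h1]; module⟩
    · exact ⟨v₀, v₁, a * b, by rw [h2]; module⟩
  · intro V V' hV hV' s t s' t' hs hs'
    have := h.bracket_D V V' hV hV' (s * a + t * u₀) (t * b) (s' * a + t' * u₀) (t' * b)
      (by rw [hs, h0, h1]; module) (by rw [hs', h0, h1]; module)
    have hm : v₁ • e 1 + v₀ • e 0 ∈ D x := by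
      rw [h.D_eq]
      exact Submodule.add_mem _ (Submodule.smul_mem _ _ m1) (Submodule.smul_mem _ _ m0)
    have := Submodule.sub_mem _ this (Submodule.smul_mem _ (s * t' - t * s') hm)
    refine (congrArg (· ∈ _) ?_).mp this
    rw [h2]
    module
  · intro V V' hV hV' s t r s' t' r' hs hs'
    have := h.bracket_E V V' hV hV' (s * a + t * u₀ + r * v₀) (t * b + r * v₁) (r * (a * b))
      (s' * a + t' * u₀ + r' * v₀) (t' * b + r' * v₁) (r' * (a * b))
      (by rw [hs, h0, h1, h2]; module) (by rw [hs', h0, h1, h2]; module)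
    have hm : w₂ • e 2 + w₁ • e 1 + w₀ • e 0 ∈ derived D x := by
      rw [h.E_eq]
      exact Submodule.add_mem _ (Submodule.add_mem _ (Submodule.smul_mem _ _ n2)
        (Submodule.smul_mem _ _ n1)) (Submodule.smul_mem _ _ n0)
    have := Submodule.sub_mem _ this (Submodule.smul_mem _ (t * r' - r * t') hm)
    refine (congrArg (· ∈ _) ?_).mp this
    rw [h3]
    module

theorem mem_of_sub_mem_sub_mem {T : Type*} [AddCommGroup T] [Module ℝ T] {P : Submodule ℝ T}
    {u v w : T} (h : u - v ∈ P) (h' : u - w ∈ P) : w - v ∈ P := by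
  have := P.sub_mem h h'
  rwa [sub_sub_sub_cancel_left] at this

theorem IsBracketFrame.triRel {D : Π x : M, Submodule ℝ (TangentSpace (𝓡 4) x)} {x : M}
    {e e' : Fin 4 → TangentSpace (𝓡 4) x} (hD : IsSmoothDistribution 2 D)
    (hE : IsSmoothDistribution 3 (derived D)) (h : IsBracketFrame D x e)
    (h' : IsBracketFrame D x e') : TriRel e e' := by
  have hli := linearIndependent_four_iff.1 h.indep
  have hli' := linearIndependent_four_iff.1 h'.indep
  have d0 : e' 0 ∈ D x := by rw [h'.D_eq]; exact Submodule.subset_span (by simp)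
  have d1 : e' 1 ∈ D x := by rw [h'.D_eq]; exact Submodule.subset_span (by simp)
  have E0 : e' 0 ∈ derived D x := by rw [h'.E_eq]; exact Submodule.subset_span (by simp)
  have E1 : e' 1 ∈ derived D x := by rw [h'.E_eq]; exact Submodule.subset_span (by simp)
  have E2 : e' 2 ∈ derived D x := by rw [h'.E_eq]; exact Submodule.subset_span (by simp)
  have E2' : e 2 ∈ derived D x := by rw [h.E_eq]; exact Submodule.subset_span (by simp)
  obtain ⟨a, b₀, h0⟩ := Submodule.mem_span_pair.1 (h.D_eq ▸ d0)
  obtain ⟨u₀, b, h1⟩ := Submodule.mem_span_pair.1 (h.D_eq ▸ d1)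
  have e3 : ∀ r : ℝ, r • e 3 ∈ derived D x → r = 0 := by
    intro r hr
    rw [h.E_eq, Submodule.mem_span_triple] at hr
    obtain ⟨p, q, s, hs⟩ := hr
    have := (hli p q s (-r) (by rw [hs]; module)).2.2.2
    simpa using this
  -- the first vector spans the kernel line
  have hb₀ : b₀ = 0 := by
    obtain ⟨V, hV, hVx⟩ := hE.exists_section E0
    obtain ⟨V', hV', hVx'⟩ := hE.exists_section E2'
    obtain ⟨p, q, r, hpq⟩ := Submodule.mem_span_triple.1 (h'.E_eq ▸ E2')
    have k1 := h'.bracket_E V V' hV hV' 1 0 0 p q r (by rw [hVx]; module) (by rw [hVx', hpq])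
    have k2 := h.bracket_E V V' hV hV' a b₀ 0 0 0 1 (by rw [hVx, ← h0]; module)
      (by rw [hVx']; module)
    have := e3 _ (by
      have := mem_of_sub_mem_sub_mem k1 k2
      simpa using this)
    simpa using this
  subst hb₀
  have h0' : e' 0 = a • e 0 := by rw [← h0]; module
  have h1' : e' 1 = b • e 1 + u₀ • e 0 := by rw [← h1]; module
  have hda : a ≠ 0 := by
    rintro rfl
    have := (hli' 1 0 0 0 (by rw [h0']; module)).1
    norm_num at this
  have hdb : b ≠ 0 := by
    rintro rfl
    have := (hli' u₀ (-a) 0 0 (by rw [h0', h1']; module)).2.1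
    exact hda (by simpa using this)
  have h2 : e' 2 - (a * b) • e 2 ∈ D x := by
    obtain ⟨V, hV, hVx⟩ := hD.exists_section d0
    obtain ⟨V', hV', hVx'⟩ := hD.exists_section d1
    have k1 := h'.bracket_D V V' hV hV' 1 0 0 1 (by rw [hVx]; module) (by rw [hVx']; module)
    have k2 := h.bracket_D V V' hV hV' a 0 u₀ b (by rw [hVx, h0']; module)
      (by rw [hVx', h1']; module)
    have := mem_of_sub_mem_sub_mem k2 k1
    simpa using this
  rw [h.D_eq] at h2
  obtain ⟨v₀, v₁, h2⟩ := Submodule.mem_span_pair.1 h2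
  have h2' : e' 2 = (a * b) • e 2 + v₁ • e 1 + v₀ • e 0 := by
    rw [eq_sub_iff_add_eq] at h2
    rw [← h2]; module
  have h3 : e' 3 - (a * b ^ 2) • e 3 ∈ derived D x := by
    obtain ⟨V, hV, hVx⟩ := hE.exists_section E1
    obtain ⟨V', hV', hVx'⟩ := hE.exists_section E2
    have k1 := h'.bracket_E V V' hV hV' 0 1 0 0 0 1 (by rw [hVx]; module) (by rw [hVx']; module)
    have k2 := h.bracket_E V V' hV hV' u₀ b 0 v₀ v₁ (a * b) (by rw [hVx, h1']; module)
      (by rw [hVx', h2']; module)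
    have := mem_of_sub_mem_sub_mem k2 k1
    refine (congrArg (· ∈ _) ?_).mp this
    module
  rw [h.E_eq] at h3
  obtain ⟨w₀, w₁, w₂, h3⟩ := Submodule.mem_span_triple.1 h3
  refine ⟨a, b, hda, hdb, u₀, v₀, v₁, w₀, w₁, w₂, h0', h1', h2', ?_⟩
  rw [eq_sub_iff_add_eq] at h3
  rw [← h3]; module

theorem IsBracketFrame.congr {D D' : Π x : M, Submodule ℝ (TangentSpace (𝓡 4) x)} {O : Set M}
    (hO : IsOpen O) (hDD' : ∀ y ∈ O, D y = D' y) {x : M} (hx : x ∈ O)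
    {e : Fin 4 → TangentSpace (𝓡 4) x} (h : IsBracketFrame D x e) : IsBracketFrame D' x e := by
  have hE := derived_congr hO hDD'
  refine ⟨h.indep, hDD' x hx ▸ h.D_eq, hE x hx ▸ h.E_eq, fun V V' hV hV' => ?_,
    fun V V' hV hV' => ?_⟩
  · rw [← hDD' x hx]
    exact h.bracket_D V V' ((isLocalSection_congr hO hDD' hx).2 hV)
      ((isLocalSection_congr hO hDD' hx).2 hV')
  · rw [← hE x hx]
    exact h.bracket_E V V' ((isLocalSection_congr hO hE hx).2 hV)
      ((isLocalSection_congr hO hE hx).2 hV')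

/-- The first vector of a bracket frame spans the kernel line. -/
theorem IsBracketFrame.isKernelVector {D : Π x : M, Submodule ℝ (TangentSpace (𝓡 4) x)} {x : M}
    {e : Fin 4 → TangentSpace (𝓡 4) x} (h : IsBracketFrame D x e) :
    IsKernelVector (derived D) x (e 0) := by
  refine ⟨by rw [h.E_eq]; exact Submodule.subset_span (by simp), fun V V' hV hV' hVx => ?_⟩
  obtain ⟨p, q, r, hpq⟩ := Submodule.mem_span_triple.1 (h.E_eq ▸ hV'.mem)
  have := h.bracket_E V V' hV hV' 1 0 0 p q r (by rw [hVx]; module) hpq.symm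
  simpa using this

namespace IsDerivedFrameOn

variable {D : Π x : M, Submodule ℝ (TangentSpace (𝓡 4) x)} {O : Set M}
  {d₁ d₂ y m : Π x : M, TangentSpace (𝓡 4) x} {κ₁ κ₂ : M → ℝ}

theorem indep_two (h : IsDerivedFrameOn D O d₁ d₂ y m κ₁ κ₂) {x : M} (hx : x ∈ O) :
    LinearIndependent ℝ ![d₁ x, d₂ x] := by
  have := linearIndependent_four_iff.1 (h.indep x hx)
  rw [LinearIndependent.pair_iff]
  intro s t hst
  have := this s t 0 0 (by
    change s • d₁ x + t • d₂ x + (0 : ℝ) • y x + (0 : ℝ) • m x = 0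
    rw [hst]; module)
  exact ⟨this.1, this.2.1⟩

theorem indep_three (h : IsDerivedFrameOn D O d₁ d₂ y m κ₁ κ₂) {x : M} (hx : x ∈ O) :
    LinearIndependent ℝ ![d₁ x, d₂ x, y x] := by
  have := linearIndependent_four_iff.1 (h.indep x hx)
  rw [Fintype.linearIndependent_iff]
  intro g hg
  rw [Fin.sum_univ_three] at hg
  have := this (g 0) (g 1) (g 2) 0 (by
    change g 0 • d₁ x + g 1 • d₂ x + g 2 • y x + (0 : ℝ) • m x = 0
    rw [zero_smul, add_zero]; exact hg)
  intro i
  fin_cases i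
  exacts [this.1, this.2.1, this.2.2.1]

theorem derived_eq (h : IsDerivedFrameOn D O d₁ d₂ y m κ₁ κ₂) {x : M} (hx : x ∈ O) :
    derived D x = Submodule.span ℝ {d₁ x, d₂ x, y x} := by
  rw [derived_eq_of_two h.isOpen hx h.smooth_d₁ h.smooth_d₂ (h.indep_two hx) h.D_eq]
  obtain ⟨p, q, hpq⟩ := Submodule.mem_span_pair.1 (h.bracket_d x hx)
  rw [eq_sub_iff_add_eq] at hpq
  apply le_antisymm <;> rw [Submodule.span_le] <;> rintro v (rfl | rfl | rfl)
  · exact Submodule.subset_span (by simp)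
  · exact Submodule.subset_span (by simp)
  · rw [← hpq, SetLike.mem_coe, Submodule.mem_span_triple]
    exact ⟨p, q, 1, by module⟩
  · exact Submodule.subset_span (by simp)
  · exact Submodule.subset_span (by simp)
  · rw [SetLike.mem_coe, Submodule.mem_span_triple]
    exact ⟨-p, -q, 1, by rw [← hpq]; module⟩

theorem bracket_D_sub_mem (h : IsDerivedFrameOn D O d₁ d₂ y m κ₁ κ₂) {x : M} (hx : x ∈ O)
    {V W : Π x : M, TangentSpace (𝓡 4) x} (hV : IsLocalSection D x V) (hW : IsLocalSection D x W)
    {a b a' b' : ℝ} (ha : V x = a • d₁ x + b • d₂ x) (hb : W x = a' • d₁ x + b' • d₂ x) :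
    bracket V W x - (a * b' - b * a') • y x ∈ D x := by
  have h1 := bracket_sub_mem_two h.isOpen hx h.smooth_d₁ h.smooth_d₂ (h.indep_two hx) h.D_eq hV hW
    ha hb
  have h2 := Submodule.smul_mem _ (a * b' - b * a') (h.D_eq x hx ▸ h.bracket_d x hx :
    bracket d₁ d₂ x - y x ∈ D x)
  have := Submodule.add_mem _ h1 h2
  refine (congrArg (· ∈ _) ?_).mp this
  module

theorem bracket_E_sub_mem (h : IsDerivedFrameOn D O d₁ d₂ y m κ₁ κ₂) {x : M} (hx : x ∈ O)
    {V W : Π x : M, TangentSpace (𝓡 4) x} (hV : IsLocalSection (derived D) x V)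
    (hW : IsLocalSection (derived D) x W)
    {a b c a' b' c' : ℝ} (ha : V x = a • d₁ x + b • d₂ x + c • y x)
    (hb : W x = a' • d₁ x + b' • d₂ x + c' • y x) :
    bracket V W x - ((a * c' - c * a') * κ₁ x + (b * c' - c * b') * κ₂ x) • m x ∈
      derived D x := by
  have h1 := bracket_sub_mem_three h.isOpen hx h.smooth_d₁ h.smooth_d₂ h.smooth_y (h.indep_three hx)
    (fun z hz => h.derived_eq hz) hV hW ha hb
  have hy : y x ∈ Submodule.span ℝ {d₁ x, d₂ x, y x} := Submodule.subset_span (by simp)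
  have h12 : bracket d₁ d₂ x - y x ∈ Submodule.span ℝ {d₁ x, d₂ x, y x} :=
    Submodule.span_mono (by intro z hz; simp at hz ⊢; tauto) (h.bracket_d x hx)
  rw [h.derived_eq hx] at h1 ⊢
  have := Submodule.add_mem _ h1 (Submodule.add_mem _ (Submodule.add_mem _
    (Submodule.smul_mem _ (a * b' - b * a') (Submodule.add_mem _ h12 hy))
    (Submodule.smul_mem _ (a * c' - c * a') (h.bracket_d₁ x hx)))
    (Submodule.smul_mem _ (b * c' - c * b') (h.bracket_d₂ x hx)))
  refine (congrArg (· ∈ _) ?_).mp this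
  module

theorem derived_derived_eq (h : IsDerivedFrameOn D O d₁ d₂ y m κ₁ κ₂) {x : M} (hx : x ∈ O) :
    derived (derived D) x = Submodule.span ℝ {d₁ x, d₂ x, y x} ⊔
      Submodule.span ℝ {κ₁ x • m x, κ₂ x • m x} := by
  have h12 : bracket d₁ d₂ x ∈ derived D x := by
    rw [derived_eq_of_two h.isOpen hx h.smooth_d₁ h.smooth_d₂ (h.indep_two hx) h.D_eq]
    exact Submodule.subset_span (by simp)
  rw [derived_eq_of_three h.isOpen hx h.smooth_d₁ h.smooth_d₂ h.smooth_y (h.indep_three hx)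
    (fun z hz => h.derived_eq hz) h12, h.derived_eq hx]
  have k1 := h.bracket_d₁ x hx
  have k2 := h.bracket_d₂ x hx
  apply le_antisymm <;> refine sup_le le_sup_left (Submodule.span_le.2 ?_) <;> rintro v (rfl | rfl)
  · have := Submodule.add_mem_sup k1 (Submodule.subset_span (s := {κ₁ x • m x, κ₂ x • m x})
      (by simp : κ₁ x • m x ∈ _))
    simpa using this
  · have := Submodule.add_mem_sup k2 (Submodule.subset_span (s := {κ₁ x • m x, κ₂ x • m x})
      (by simp : κ₂ x • m x ∈ _))
    simpa using this
  · have := Submodule.add_mem_sup (Submodule.neg_mem _ k1)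
      (Submodule.subset_span (s := {bracket d₁ y x, bracket d₂ y x})
      (by simp : bracket d₁ y x ∈ _))
    simpa using this
  · have := Submodule.add_mem_sup (Submodule.neg_mem _ k2)
      (Submodule.subset_span (s := {bracket d₁ y x, bracket d₂ y x})
      (by simp : bracket d₂ y x ∈ _))
    simpa using this

theorem m_notMem (h : IsDerivedFrameOn D O d₁ d₂ y m κ₁ κ₂) {x : M} (hx : x ∈ O) {r : ℝ}
    (hr : r • m x ∈ Submodule.span ℝ {d₁ x, d₂ x, y x}) : r = 0 := by
  obtain ⟨p, q, s, hs⟩ := Submodule.mem_span_triple.1 hr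
  have := (linearIndependent_four_iff.1 (h.indep x hx) p q s (-r) (by
    change p • d₁ x + q • d₂ x + s • y x + (-r) • m x = 0
    rw [hs]; module)).2.2.2
  simpa using this

theorem derived_derived_eq_top_iff (h : IsDerivedFrameOn D O d₁ d₂ y m κ₁ κ₂) {x : M}
    (hx : x ∈ O) : derived (derived D) x = ⊤ ↔ κ₁ x ≠ 0 ∨ κ₂ x ≠ 0 := by
  rw [h.derived_derived_eq hx]
  constructor
  · intro ht
    by_contra! hk
    rw [hk.1, hk.2] at ht
    simp only [zero_smul, Set.pair_eq_singleton, Submodule.span_zero_singleton, sup_bot_eq] at ht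
    have := h.m_notMem hx (r := 1) (ht ▸ Submodule.mem_top)
    norm_num at this
  · intro hk
    rw [eq_top_iff, ← span_eq_top_of_linearIndependent (h.indep x hx), Submodule.span_le]
    rintro v ⟨i, rfl⟩
    have hm : m x ∈ Submodule.span ℝ {κ₁ x • m x, κ₂ x • m x} := by
      rw [Submodule.mem_span_pair]
      rcases hk with hk | hk
      · exact ⟨(κ₁ x)⁻¹, 0, by rw [smul_smul, inv_mul_cancel₀ hk]; module⟩
      · exact ⟨0, (κ₂ x)⁻¹, by rw [smul_smul (κ₂ x)⁻¹, inv_mul_cancel₀ hk]; module⟩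
    fin_cases i
    · exact Submodule.mem_sup_left (Submodule.subset_span (by simp))
    · exact Submodule.mem_sup_left (Submodule.subset_span (by simp))
    · exact Submodule.mem_sup_left (Submodule.subset_span (by simp))
    · exact Submodule.mem_sup_right hm

theorem isKernelVector_iff (h : IsDerivedFrameOn D O d₁ d₂ y m κ₁ κ₂) {x : M} (hx : x ∈ O) :
    IsKernelVector (derived D) x (d₁ x) ↔ κ₁ x = 0 := by
  have hmem : ∀ z ∈ O, d₁ z ∈ derived D z ∧ y z ∈ derived D z := fun z hz => by
    rw [h.derived_eq hz]
    exact ⟨Submodule.subset_span (by simp), Submodule.subset_span (by simp)⟩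
  have s₁ : IsLocalSection (derived D) x d₁ := ⟨O, h.isOpen, hx, h.smooth_d₁, fun z hz => (hmem z hz).1⟩
  have s₃ : IsLocalSection (derived D) x y := ⟨O, h.isOpen, hx, h.smooth_y, fun z hz => (hmem z hz).2⟩
  constructor
  · intro hk
    have h1 := hk.2 d₁ y s₁ s₃ rfl
    rw [h.derived_eq hx] at h1
    have := Submodule.sub_mem _ h1 (h.bracket_d₁ x hx)
    rw [sub_sub_cancel] at this
    exact h.m_notMem hx this
  · intro hk
    refine ⟨(hmem x hx).1, fun V V' hV hV' hVx => ?_⟩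
    obtain ⟨p, q, r, hpq⟩ := Submodule.mem_span_triple.1 (h.derived_eq hx ▸ hV'.mem)
    have := h.bracket_E_sub_mem hx hV hV' (a := 1) (b := 0) (c := 0) (by rw [hVx]; module) hpq.symm
    simpa [hk] using this

/-- The frame adapted to the flag `W ⊂ D ⊂ [D, D]` which is obtained from `(d₁, d₂, y, m)` by a
rotation and rescaling in the plane `D`. -/
theorem isBracketFrame (h : IsDerivedFrameOn D O d₁ d₂ y m κ₁ κ₂) {x : M} (hx : x ∈ O)
    (hκ : κ₁ x ^ 2 + κ₂ x ^ 2 ≠ 0) :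
    IsBracketFrame D x ![κ₂ x • d₁ x - κ₁ x • d₂ x,
      (κ₁ x ^ 2 + κ₂ x ^ 2)⁻¹ • (κ₁ x • d₁ x + κ₂ x • d₂ x), y x, m x] := by
  set k := κ₁ x with hk
  set l := κ₂ x with hl
  set n := k ^ 2 + l ^ 2 with hn
  set e : Fin 4 → TangentSpace (𝓡 4) x := ![l • d₁ x - k • d₂ x,
      n⁻¹ • (k • d₁ x + l • d₂ x), y x, m x] with he
  have e0 : e 0 = l • d₁ x - k • d₂ x := rfl
  have e1 : e 1 = n⁻¹ • (k • d₁ x + l • d₂ x) := rfl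
  have e2 : e 2 = y x := rfl
  have e3 : e 3 = m x := rfl
  have f0 : d₁ x = (n⁻¹ * l) • e 0 + k • e 1 := by
    rw [e0, e1]; match_scalars <;> field_simp <;> rw [hn] <;> ring
  have f1 : d₂ x = (-(n⁻¹ * k)) • e 0 + l • e 1 := by
    rw [e0, e1]; match_scalars <;> field_simp <;> rw [hn] <;> ring
  refine ⟨?_, ?_, ?_, ?_, ?_⟩
  · have hli := linearIndependent_four_iff.1 (h.indep x hx)
    rw [linearIndependent_four_iff]
    intro a b c d habcd
    rw [e0, e1, e2, e3] at habcd
    obtain ⟨h0, h1, h2, h3⟩ := hli (a * l + b * n⁻¹ * k) (-a * k + b * n⁻¹ * l) c d (by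
      rw [← habcd]
      change (a * l + b * n⁻¹ * k) • d₁ x + (-a * k + b * n⁻¹ * l) • d₂ x + c • y x + d • m x = _
      module)
    refine ⟨?_, ?_, h2, h3⟩
    · have : a * n = 0 := by rw [hn]; linear_combination l * h0 - k * h1
      exact (mul_eq_zero.1 this).resolve_right hκ
    · have : b * n⁻¹ * n = 0 := by rw [hn]; linear_combination k * h0 + l * h1
      rwa [inv_mul_cancel_right₀ hκ] at this
  · rw [h.D_eq x hx]
    apply le_antisymm <;> rw [Submodule.span_le] <;> rintro v (rfl | rfl) <;>
      rw [SetLike.mem_coe, Submodule.mem_span_pair]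
    · exact ⟨_, _, f0.symm⟩
    · exact ⟨_, _, f1.symm⟩
    · exact ⟨l, -k, by rw [e0]; module⟩
    · exact ⟨n⁻¹ * k, n⁻¹ * l, by rw [e1]; module⟩
  · rw [h.derived_eq hx]
    apply le_antisymm <;> rw [Submodule.span_le] <;> rintro v (rfl | rfl | rfl) <;>
      rw [SetLike.mem_coe, Submodule.mem_span_triple]
    · exact ⟨n⁻¹ * l, k, 0, by rw [zero_smul, add_zero]; exact f0.symm⟩
    · exact ⟨-(n⁻¹ * k), l, 0, by rw [zero_smul, add_zero]; exact f1.symm⟩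
    · exact ⟨0, 0, 1, by rw [e2]; module⟩
    · exact ⟨l, -k, 0, by rw [e0]; module⟩
    · exact ⟨n⁻¹ * k, n⁻¹ * l, 0, by rw [e1]; module⟩
    · exact ⟨0, 0, 1, by rw [e2]; module⟩
  · intro V V' hV hV' a b a' b' ha ha'
    have := h.bracket_D_sub_mem hx hV hV' (a := a * l + b * n⁻¹ * k) (b := -a * k + b * n⁻¹ * l)
      (a' := a' * l + b' * n⁻¹ * k) (b' := -a' * k + b' * n⁻¹ * l)
      (by rw [ha, e0, e1]; module) (by rw [ha', e0, e1]; module)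
    have hc : (a * l + b * n⁻¹ * k) * (-a' * k + b' * n⁻¹ * l) -
        (-a * k + b * n⁻¹ * l) * (a' * l + b' * n⁻¹ * k) = a * b' - b * a' := by
      have : n⁻¹ * n = 1 := inv_mul_cancel₀ hκ
      rw [hn] at this
      linear_combination (a * b' - b * a') * this
    rwa [hc] at this
  · intro V V' hV hV' a b c a' b' c' ha ha'
    have := h.bracket_E_sub_mem hx hV hV' (a := a * l + b * n⁻¹ * k) (b := -a * k + b * n⁻¹ * l)
      (a' := a' * l + b' * n⁻¹ * k) (b' := -a' * k + b' * n⁻¹ * l) (c := c) (c' := c')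
      (by rw [ha, e0, e1, e2]; module) (by rw [ha', e0, e1, e2]; module)
    have hc : ((a * l + b * n⁻¹ * k) * c' - c * (a' * l + b' * n⁻¹ * k)) * κ₁ x +
        ((-a * k + b * n⁻¹ * l) * c' - c * (-a' * k + b' * n⁻¹ * l)) * κ₂ x = b * c' - c * b' := by
      have : n⁻¹ * n = 1 := inv_mul_cancel₀ hκ
      rw [hn] at this
      rw [← hk, ← hl]
      linear_combination (b * c' - c * b') * this
    rwa [hc] at this

theorem mono (h : IsDerivedFrameOn D O d₁ d₂ y m κ₁ κ₂) {O' : Set M} (hO' : IsOpen O')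
    (hsub : O' ⊆ O) : IsDerivedFrameOn D O' d₁ d₂ y m κ₁ κ₂ where
  isOpen := hO'
  smooth_d₁ := h.smooth_d₁.mono hsub
  smooth_d₂ := h.smooth_d₂.mono hsub
  smooth_y := h.smooth_y.mono hsub
  smooth_m := h.smooth_m.mono hsub
  smooth_κ₁ := h.smooth_κ₁.mono hsub
  smooth_κ₂ := h.smooth_κ₂.mono hsub
  indep x hx := h.indep x (hsub hx)
  D_eq x hx := h.D_eq x (hsub hx)
  bracket_d x hx := h.bracket_d x (hsub hx)
  bracket_d₁ x hx := h.bracket_d₁ x (hsub hx)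
  bracket_d₂ x hx := h.bracket_d₂ x (hsub hx)

end IsDerivedFrameOn

end EngelFrames

/-! ### Existence of adapted local frames -/

section Existence

universe u

variable {M : Type u} [TopologicalSpace M] [ChartedSpace R4 M] [IsManifold (𝓡 4) ∞ M]
  {D : Π x : M, Submodule ℝ (TangentSpace (𝓡 4) x)}

theorem IsSmoothDistribution.finrank_eq {k : ℕ} (hD : IsSmoothDistribution k D) (x : M) :
    Module.finrank ℝ (D x) = k := by
  obtain ⟨O, -, hx, V, -, h⟩ := hD x
  obtain ⟨hli, hspan⟩ := h x hx
  rw [hspan, finrank_span_eq_card hli, Fintype.card_fin]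

theorem linearIndependent_three_of_finrank {x : M} {a b c : TangentSpace (𝓡 4) x}
    (h : Module.finrank ℝ (Submodule.span ℝ {a, b, c}) = 3) : LinearIndependent ℝ ![a, b, c] := by
  rw [linearIndependent_iff_card_eq_finrank_span, range_three, Fintype.card_fin]
  exact h.symm

theorem linearIndependent_snoc_of_notMem {x : M} {a b c d : TangentSpace (𝓡 4) x}
    (h : LinearIndependent ℝ ![a, b, c]) (hd : d ∉ Submodule.span ℝ {a, b, c}) :
    LinearIndependent ℝ ![a, b, c, d] := by
  rw [linearIndependent_four_iff]
  intro p q r s hs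
  change p • a + q • b + r • c + s • d = 0 at hs
  have hs0 : s = 0 := by
    by_contra hne
    refine hd (Submodule.mem_span_triple.2 ⟨-(s⁻¹ * p), -(s⁻¹ * q), -(s⁻¹ * r), ?_⟩)
    have : d = s⁻¹ • (s • d) := by rw [smul_smul, inv_mul_cancel₀ hne, one_smul]
    rw [this, eq_neg_of_add_eq_zero_right hs]
    module
  subst hs0
  have := (Fintype.linearIndependent_iff.1 h) ![p, q, r] (by
    rw [Fin.sum_univ_three]
    change p • a + q • b + r • c = 0
    rw [← hs]; module)
  exact ⟨this 0, this 1, this 2, rfl⟩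

/-- If a plane field with smooth local sections `d₁, d₂` is an Engel structure, then `d₁, d₂` and
their bracket are independent. -/
theorem IsEngel.indep_bracket (hD : IsEngel D) {O : Set M} (hO : IsOpen O)
    {d₁ d₂ : Π x : M, TangentSpace (𝓡 4) x} (h₁ : SmoothFieldOn d₁ O) (h₂ : SmoothFieldOn d₂ O)
    (hli : ∀ x ∈ O, LinearIndependent ℝ ![d₁ x, d₂ x])
    (hP : ∀ y ∈ O, D y = Submodule.span ℝ {d₁ y, d₂ y}) {x : M} (hx : x ∈ O) :
    LinearIndependent ℝ ![d₁ x, d₂ x, bracket d₁ d₂ x] := by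
  apply linearIndependent_three_of_finrank
  rw [← derived_eq_of_two hO hx h₁ h₂ (hli x hx) hP]
  exact hD.2.1.finrank_eq x

/-- One of the brackets `[dᵢ, [d₁, d₂]]` is transverse to `[D, D]`. -/
theorem IsEngel.exists_notMem (hD : IsEngel D) {O : Set M} (hO : IsOpen O)
    {d₁ d₂ : Π x : M, TangentSpace (𝓡 4) x} (h₁ : SmoothFieldOn d₁ O) (h₂ : SmoothFieldOn d₂ O)
    (hli : ∀ x ∈ O, LinearIndependent ℝ ![d₁ x, d₂ x])
    (hP : ∀ y ∈ O, D y = Submodule.span ℝ {d₁ y, d₂ y}) {x : M} (hx : x ∈ O) :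
    bracket d₁ (bracket d₁ d₂) x ∉ Submodule.span ℝ {d₁ x, d₂ x, bracket d₁ d₂ x} ∨
    bracket d₂ (bracket d₁ d₂) x ∉ Submodule.span ℝ {d₁ x, d₂ x, bracket d₁ d₂ x} := by
  by_contra! hcon
  have hE : ∀ z ∈ O, derived D z = Submodule.span ℝ {d₁ z, d₂ z, bracket d₁ d₂ z} :=
    fun z hz => derived_eq_of_two hO hz h₁ h₂ (hli z hz) hP
  have htop := hD.2.2 x
  rw [derived_eq_of_three hO hx h₁ h₂ (h₁.bracket hO h₂) (hD.indep_bracket hO h₁ h₂ hli hP hx)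
    hE (by rw [hE x hx]; exact Submodule.subset_span (by simp)), hE x hx] at htop
  have hle : Submodule.span ℝ {bracket d₁ (bracket d₁ d₂) x, bracket d₂ (bracket d₁ d₂) x} ≤
      Submodule.span ℝ {d₁ x, d₂ x, bracket d₁ d₂ x} := by
    rw [Submodule.span_le]
    rintro v (rfl | rfl)
    exacts [hcon.1, hcon.2]
  rw [sup_eq_left.2 hle, ← hE x hx] at htop
  have := hD.2.1.finrank_eq x
  rw [htop, finrank_top, finrank_tangentSpace] at this
  norm_num at this

theorem span_triple_mem_of_coeff {x : M} {a b c d : TangentSpace (𝓡 4) x}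
    (h : LinearIndependent ℝ ![a, b, c, d]) {f : TangentSpace (𝓡 4) x →ₗ[ℝ] ℝ} (ha : f a = 0)
    (hb : f b = 0) (hc : f c = 0) (hd : f d = 1) (v : TangentSpace (𝓡 4) x) :
    v - f v • d ∈ Submodule.span ℝ {a, b, c} := by
  have hv : v ∈ Submodule.span ℝ (range ![a, b, c, d]) := by
    rw [span_eq_top_of_linearIndependent h]; exact Submodule.mem_top
  obtain ⟨g, hg⟩ := (Submodule.mem_span_range_iff_exists_fun ℝ).1 hv
  rw [Fin.sum_univ_four] at hg
  change g 0 • a + g 1 • b + g 2 • c + g 3 • d = v at hg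
  have : f v = g 3 := by rw [← hg]; simp [ha, hb, hc, hd]
  rw [this, ← hg]
  exact Submodule.mem_span_triple.2 ⟨g 0, g 1, g 2, by module⟩

/-- Near every point an Engel structure has a frame as in `IsDerivedFrameOn`. -/
theorem IsEngel.exists_derivedFrame (hD : IsEngel D) (x₀ : M) :
    ∃ (O : Set M) (d₁ d₂ y m : Π x : M, TangentSpace (𝓡 4) x) (κ₁ κ₂ : M → ℝ), x₀ ∈ O ∧
      IsDerivedFrameOn D O d₁ d₂ y m κ₁ κ₂ ∧ ∀ x ∈ O, κ₁ x ^ 2 + κ₂ x ^ 2 ≠ 0 := by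
  obtain ⟨O₀, hO₀, hx₀, V, hV, h⟩ := hD.1 x₀
  set d₁ := V 0
  set d₂ := V 1
  have h₁ : SmoothFieldOn d₁ O₀ := hV 0
  have h₂ : SmoothFieldOn d₂ O₀ := hV 1
  have hVe : ∀ x, (fun i => V i x) = ![d₁ x, d₂ x] := fun x => by
    funext i; fin_cases i <;> rfl
  have hli : ∀ x ∈ O₀, LinearIndependent ℝ ![d₁ x, d₂ x] := fun x hx => hVe x ▸ (h x hx).1
  have hP : ∀ x ∈ O₀, D x = Submodule.span ℝ {d₁ x, d₂ x} := fun x hx => by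
    rw [(h x hx).2, hVe x, range_two]
  set y := bracket d₁ d₂
  have hy : SmoothFieldOn y O₀ := h₁.bracket hO₀ h₂
  have hind := fun x hx => hD.indep_bracket hO₀ h₁ h₂ hli hP (x := x) hx
  -- one of the two second brackets may serve as the fourth field; its coefficient is then `1`
  obtain ⟨m, hm, hmn, hmd⟩ : ∃ m : Π x : M, TangentSpace (𝓡 4) x, SmoothFieldOn m O₀ ∧
      m x₀ ∉ Submodule.span ℝ {d₁ x₀, d₂ x₀, y x₀} ∧
      ((∀ x, bracket d₁ y x = m x) ∨ (∀ x, bracket d₂ y x = m x)) := by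
    rcases hD.exists_notMem hO₀ h₁ h₂ hli hP hx₀ with hn | hn
    · exact ⟨_, h₁.bracket hO₀ hy, hn, Or.inl fun _ => rfl⟩
    · exact ⟨_, h₂.bracket hO₀ hy, hn, Or.inr fun _ => rfl⟩
  have hfs : ∀ i, SmoothFieldOn ((![d₁, d₂, y, m] : Fin 4 → Π x : M, TangentSpace (𝓡 4) x) i) O₀ := by
    intro i; fin_cases i; exacts [h₁, h₂, hy, hm]
  have hf0 := linearIndependent_snoc_of_notMem (hind x₀ hx₀) hmn
  obtain ⟨O, hO, hx, hsub, -, c, hc, hcs, -⟩ :=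
    exists_dual_coeff hO₀ hx₀ hfs (by rw [fields_four]; exact hf0)
  have hlio : ∀ x ∈ O, LinearIndependent ℝ ![d₁ x, d₂ x, y x, m x] := fun x hx => by
    rw [← fields_four, Fintype.linearIndependent_iff]
    intro g hg i
    have := congrArg (c i x) hg
    rw [map_sum, map_zero, Finset.sum_eq_single i] at this
    · rwa [map_smul, hc x hx, if_pos rfl, smul_eq_mul, mul_one] at this
    · intro j _ hj
      rw [map_smul, hc x hx, if_neg hj.symm, smul_zero]
    · intro hi; exact absurd (Finset.mem_univ i) hi
  have hc0 : ∀ x ∈ O, c 3 x (d₁ x) = 0 := fun x hx => hc x hx 3 0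
  have hc1 : ∀ x ∈ O, c 3 x (d₂ x) = 0 := fun x hx => hc x hx 3 1
  have hc2 : ∀ x ∈ O, c 3 x (y x) = 0 := fun x hx => hc x hx 3 2
  have hc3 : ∀ x ∈ O, c 3 x (m x) = 1 := fun x hx => hc x hx 3 3
  refine ⟨O, d₁, d₂, y, m, fun x => c 3 x (bracket d₁ y x), fun x => c 3 x (bracket d₂ y x), hx,
    ⟨hO, h₁.mono hsub, h₂.mono hsub, hy.mono hsub, hm.mono hsub,
      hcs 3 _ O hO Subset.rfl ((h₁.bracket hO₀ hy).mono hsub),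
      hcs 3 _ O hO Subset.rfl ((h₂.bracket hO₀ hy).mono hsub), hlio,
      fun x hx => hP x (hsub hx), fun x hx => ?_, fun x hx => ?_, fun x hx => ?_⟩,
    fun x hx => ?_⟩
  · have : bracket d₁ d₂ x - y x = 0 := sub_self _
    rw [this]; exact Submodule.zero_mem _
  · exact span_triple_mem_of_coeff (hlio x hx) (hc0 x hx) (hc1 x hx) (hc2 x hx) (hc3 x hx) _
  · exact span_triple_mem_of_coeff (hlio x hx) (hc0 x hx) (hc1 x hx) (hc2 x hx) (hc3 x hx) _
  · rcases hmd with hmd | hmd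
    · have := (congrArg (c 3 x) (hmd x)).trans (hc3 x hx)
      dsimp only
      rw [this]
      positivity
    · have := (congrArg (c 3 x) (hmd x)).trans (hc3 x hx)
      dsimp only
      rw [this]
      positivity

/-- A plane field which has local frames as in `IsDerivedFrameOn` with `(κ₁, κ₂) ≠ 0` is an Engel
structure. -/
theorem isEngel_of_derivedFrame (h : ∀ x₀ : M,
    ∃ (O : Set M) (d₁ d₂ y m : Π x : M, TangentSpace (𝓡 4) x) (κ₁ κ₂ : M → ℝ), x₀ ∈ O ∧
      IsDerivedFrameOn D O d₁ d₂ y m κ₁ κ₂ ∧ ∀ x ∈ O, κ₁ x ≠ 0 ∨ κ₂ x ≠ 0) : IsEngel D := by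
  refine ⟨fun x₀ => ?_, fun x₀ => ?_, fun x₀ => ?_⟩
  · obtain ⟨O, d₁, d₂, y, m, κ₁, κ₂, hx, hf, -⟩ := h x₀
    refine ⟨O, hf.isOpen, hx, ![d₁, d₂], ?_, fun x hx => ?_⟩
    · intro i; fin_cases i; exacts [hf.smooth_d₁, hf.smooth_d₂]
    · rw [fields_two, range_two]
      exact ⟨hf.indep_two hx, hf.D_eq x hx⟩
  · obtain ⟨O, d₁, d₂, y, m, κ₁, κ₂, hx, hf, -⟩ := h x₀
    refine ⟨O, hf.isOpen, hx, ![d₁, d₂, y], ?_, fun x hx => ?_⟩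
    · intro i; fin_cases i; exacts [hf.smooth_d₁, hf.smooth_d₂, hf.smooth_y]
    · rw [fields_three, range_three]
      exact ⟨hf.indep_three hx, hf.derived_eq hx⟩
  · obtain ⟨O, d₁, d₂, y, m, κ₁, κ₂, hx, hf, hκ⟩ := h x₀
    exact (hf.derived_derived_eq_top_iff hx).2 (hκ x₀ hx)

theorem IsEngel.exists_bracketFrame (hD : IsEngel D) (x₀ : M) :
    ∃ (O : Set M) (e : Fin 4 → Π x : M, TangentSpace (𝓡 4) x), IsOpen O ∧ x₀ ∈ O ∧
      (∀ i, SmoothFieldOn (e i) O) ∧ ∀ x ∈ O, IsBracketFrame D x fun i => e i x := by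
  obtain ⟨O, d₁, d₂, y, m, κ₁, κ₂, hx, hf, hκ⟩ := hD.exists_derivedFrame x₀
  refine ⟨O, ![fun x => κ₂ x • d₁ x - κ₁ x • d₂ x,
    fun x => (κ₁ x ^ 2 + κ₂ x ^ 2)⁻¹ • (κ₁ x • d₁ x + κ₂ x • d₂ x), y, m], hf.isOpen, hx, ?_, ?_⟩
  · intro i; fin_cases i
    · exact (SmoothFieldOn.smul hf.smooth_κ₂ hf.smooth_d₁).sub
        (SmoothFieldOn.smul hf.smooth_κ₁ hf.smooth_d₂)
    · refine SmoothFieldOn.smul (f := fun x => (κ₁ x ^ 2 + κ₂ x ^ 2)⁻¹) ?_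
        ((SmoothFieldOn.smul hf.smooth_κ₁ hf.smooth_d₁).add
        (SmoothFieldOn.smul hf.smooth_κ₂ hf.smooth_d₂))
      exact ((hf.smooth_κ₁.pow 2).add (hf.smooth_κ₂.pow 2)).inv₀ hκ
    · exact hf.smooth_y
    · exact hf.smooth_m
  · intro x hx
    rw [fields_four]
    exact hf.isBracketFrame hx (hκ x hx)

/-- The Engel framing given by an adapted pair consists of bracket frames. -/
theorem IsAdaptedPair.isBracketFrame (hD : IsEngel D) {W X : Π x : M, TangentSpace (𝓡 4) x}
    (h : IsAdaptedPair D W X) (x : M) : IsBracketFrame D x fun i => engelFraming W X i x := by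
  obtain ⟨hW, hX, hWX⟩ := h
  have hP : ∀ x ∈ (univ : Set M), D x = Submodule.span ℝ {W x, X x} := fun x _ => (hWX x).2.2
  have hli : ∀ x ∈ (univ : Set M), LinearIndependent ℝ ![W x, X x] := fun x _ => (hWX x).2.1
  have hy : SmoothFieldOn (bracket W X) univ := hW.bracket isOpen_univ hX
  have hE : ∀ x, derived D x = Submodule.span ℝ {W x, X x, bracket W X x} :=
    fun x => derived_eq_of_two isOpen_univ (mem_univ x) hW hX (hli x (mem_univ x)) hP
  -- as `W` lies in the kernel of `[D, D]`, the structure functions of `(W, X)` are `0` and `1`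
  have hker : ∀ x, bracket W (bracket W X) x ∈ Submodule.span ℝ {W x, X x, bracket W X x} := by
    intro x
    rw [← hE x]
    refine (hWX x).1.2 W (bracket W X) ⟨univ, isOpen_univ, mem_univ x, hW, fun z _ => ?_⟩
      ⟨univ, isOpen_univ, mem_univ x, hy, fun z _ => ?_⟩ rfl
    · rw [hE z]; exact Submodule.subset_span (by simp)
    · rw [hE z]; exact Submodule.subset_span (by simp)
  have hf : IsDerivedFrameOn D univ W X (bracket W X) (bracket X (bracket W X)) (fun _ => 0)
      fun _ => 1 :=
    { isOpen := isOpen_univ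
      smooth_d₁ := hW
      smooth_d₂ := hX
      smooth_y := hy
      smooth_m := hX.bracket isOpen_univ hy
      smooth_κ₁ := contMDiffOn_const
      smooth_κ₂ := contMDiffOn_const
      indep := fun x hx => linearIndependent_snoc_of_notMem
        (hD.indep_bracket isOpen_univ hW hX hli hP hx)
        ((hD.exists_notMem isOpen_univ hW hX hli hP hx).resolve_left fun hn => hn (hker x))
      D_eq := hP
      bracket_d := fun x _ => by
        have : bracket W X x - bracket W X x = 0 := sub_self _
        rw [this]; exact Submodule.zero_mem _
      bracket_d₁ := fun x _ => by rw [zero_smul, sub_zero]; exact hker x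
      bracket_d₂ := fun x _ => by rw [one_smul, sub_self]; exact Submodule.zero_mem _ }
  have := hf.isBracketFrame (mem_univ x) (by norm_num)
  refine (congrArg (IsBracketFrame D x) ?_).mp this
  rw [engelFraming, fields_four]
  congr 1
  · module
  · congr 1
    norm_num

end Existence

/-! ### Formal Engel structures given by frames -/

section OfFrame

universe u

variable {M : Type u} [TopologicalSpace M] [ChartedSpace R4 M] [IsManifold (𝓡 4) ∞ M]

/-- The basis of a tangent space given by a frame. -/
def frameBasis {x : M} {e : Fin 4 → TangentSpace (𝓡 4) x} (he : LinearIndependent ℝ e) :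
    Module.Basis (Fin 4) ℝ (TangentSpace (𝓡 4) x) :=
  Module.Basis.mk he (span_eq_top_of_linearIndependent he).ge

theorem frameBasis_coord {x : M} {e : Fin 4 → TangentSpace (𝓡 4) x} (he : LinearIndependent ℝ e)
    (i j : Fin 4) : (frameBasis he).coord i (e j) = if i = j then 1 else 0 := by
  have : e j = frameBasis he j := (Module.Basis.mk_apply _ _ j).symm
  rw [Module.Basis.coord_apply, this, Module.Basis.repr_self, Finsupp.single_apply]
  simp only [eq_comm]

theorem frameBasis_sum {x : M} {e : Fin 4 → TangentSpace (𝓡 4) x} (he : LinearIndependent ℝ e)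
    (v : TangentSpace (𝓡 4) x) : v = (frameBasis he).coord 0 v • e 0 + (frameBasis he).coord 1 v • e 1
      + (frameBasis he).coord 2 v • e 2 + (frameBasis he).coord 3 v • e 3 := by
  have := (frameBasis he).sum_repr v
  rw [Fin.sum_univ_four] at this
  simp only [frameBasis, Module.Basis.mk_apply] at this
  exact this.symm

/-- The alternating form `(u, v) ↦ (f u g v - g u f v) q`. -/
def wedgeForm {P Q : Type*} [AddCommGroup P] [Module ℝ P] [AddCommGroup Q] [Module ℝ Q]
    (f g : P →ₗ[ℝ] ℝ) (q : Q) : P [⋀^Fin 2]→ₗ[ℝ] Q :=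
  (LinearMap.toSpanSingleton ℝ Q q).compAlternatingMap
    (Matrix.detRowAlternating.compLinearMap (LinearMap.pi ![f, g]))

theorem wedgeForm_apply {P Q : Type*} [AddCommGroup P] [Module ℝ P] [AddCommGroup Q] [Module ℝ Q]
    (f g : P →ₗ[ℝ] ℝ) (q : Q) (u : Fin 2 → P) :
    wedgeForm f g q u = (f (u 0) * g (u 1) - g (u 0) * f (u 1)) • q := by
  have : (Matrix.detRowAlternating (R := ℝ) fun i => LinearMap.pi ![f, g] (u i)) =
      f (u 0) * g (u 1) - g (u 0) * f (u 1) :=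
    Matrix.det_fin_two _
  change (Matrix.detRowAlternating (R := ℝ) fun i => LinearMap.pi ![f, g] (u i)) • q = _
  rw [this]

theorem finrank_span_frame {T : Type*} [AddCommGroup T] [Module ℝ T] {e : Fin 4 → T}
    (he : LinearIndependent ℝ e) : Module.finrank ℝ (Submodule.span ℝ {e 0}) = 1 ∧
      Module.finrank ℝ (Submodule.span ℝ {e 0, e 1}) = 2 ∧
      Module.finrank ℝ (Submodule.span ℝ {e 0, e 1, e 2}) = 3 := by
  have h2 : LinearIndependent ℝ ![e 0, e 1] := by
    have := he.comp ![0, 1] (by decide)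
    convert this using 1
    funext i; fin_cases i <;> rfl
  have h3 : LinearIndependent ℝ ![e 0, e 1, e 2] := by
    have := he.comp ![0, 1, 2] (by decide)
    convert this using 1
    funext i; fin_cases i <;> rfl
  refine ⟨finrank_span_singleton (he.ne_zero 0), ?_, ?_⟩
  · rw [← range_two, finrank_span_eq_card h2, Fintype.card_fin]
  · rw [← range_three, finrank_span_eq_card h3, Fintype.card_fin]

/-- The formal data for which the given frames `(w, x, y, z)` are adapted: the flag is
`⟨w⟩ ⊂ ⟨w, x⟩ ⊂ ⟨w, x, y⟩`, and `w ∧ x ↦ y`, `x ∧ y ↦ z`. The frames need not depend on the point in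
any regular way. -/
def FormalData.ofFrame (e : Π x : M, Fin 4 → TangentSpace (𝓡 4) x)
    (he : ∀ x, LinearIndependent ℝ (e x)) : FormalData M where
  W x := Submodule.span ℝ {e x 0}
  D x := Submodule.span ℝ {e x 0, e x 1}
  E x := Submodule.span ℝ {e x 0, e x 1, e x 2}
  φ₁ x := wedgeForm ((frameBasis (he x)).coord 0 ∘ₗ Submodule.subtype _)
    ((frameBasis (he x)).coord 1 ∘ₗ Submodule.subtype _) (Submodule.mkQ _ (e x 2))
  φ₂ x := wedgeForm ((frameBasis (he x)).coord 1 ∘ₗ Submodule.subtype _)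
    ((frameBasis (he x)).coord 2 ∘ₗ Submodule.subtype _) (Submodule.mkQ _ (e x 3))
  W_le x := Submodule.span_mono (by simp)
  D_le x := Submodule.span_mono (by intro z hz; simp at hz ⊢; tauto)
  finrank_W x := (finrank_span_frame (he x)).1
  finrank_D x := (finrank_span_frame (he x)).2.1
  finrank_E x := (finrank_span_frame (he x)).2.2
  φ₁_mem x u := by
    rw [wedgeForm_apply]
    exact Submodule.smul_mem _ _ (Submodule.mem_map_of_mem (Submodule.subset_span (by simp)))
  φ₁_ne_zero x h := by
    have := DFunLike.congr_fun h ![⟨e x 0, Submodule.subset_span (by simp)⟩,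
      ⟨e x 1, Submodule.subset_span (by simp)⟩]
    rw [wedgeForm_apply] at this
    change ((frameBasis (he x)).coord 0 (e x 0) * (frameBasis (he x)).coord 1 (e x 1) -
      (frameBasis (he x)).coord 1 (e x 0) * (frameBasis (he x)).coord 0 (e x 1)) • _ = 0 at this
    simp only [frameBasis_coord] at this
    norm_num at this
    obtain ⟨p, q, hpq⟩ := Submodule.mem_span_pair.1 this
    have := linearIndependent_four_iff.1 (he x) p q (-1) 0 (by rw [hpq]; module)
    norm_num at this
  φ₂_kernel x u v hu := by
    rw [wedgeForm_apply]
    change ((frameBasis (he x)).coord 1 (u : TangentSpace (𝓡 4) x) *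
      (frameBasis (he x)).coord 2 (v : TangentSpace (𝓡 4) x) -
      (frameBasis (he x)).coord 2 (u : TangentSpace (𝓡 4) x) *
      (frameBasis (he x)).coord 1 (v : TangentSpace (𝓡 4) x)) • _ = 0
    obtain ⟨p, hp⟩ := Submodule.mem_span_singleton.1 hu
    rw [← hp]
    simp [-Module.Basis.coord_apply, frameBasis_coord]
  φ₂_ne_zero x h := by
    have := DFunLike.congr_fun h ![⟨e x 1, Submodule.subset_span (by simp)⟩,
      ⟨e x 2, Submodule.subset_span (by simp)⟩]
    rw [wedgeForm_apply] at this
    change ((frameBasis (he x)).coord 1 (e x 1) * (frameBasis (he x)).coord 2 (e x 2) -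
      (frameBasis (he x)).coord 2 (e x 1) * (frameBasis (he x)).coord 1 (e x 2)) • _ = 0 at this
    simp +decide only [frameBasis_coord, if_true, if_false] at this
    norm_num at this
    obtain ⟨p, q, r, hpq⟩ := Submodule.mem_span_triple.1 this
    have := linearIndependent_four_iff.1 (he x) p q r (-1) (by rw [hpq]; module)
    norm_num at this

theorem FormalData.ofFrame_φ₁ {e : Π x : M, Fin 4 → TangentSpace (𝓡 4) x}
    (he : ∀ x, LinearIndependent ℝ (e x)) (x : M) (u v : (FormalData.ofFrame e he).D x)
    {a b a' b' : ℝ} (hu : (u : TangentSpace (𝓡 4) x) = a • e x 0 + b • e x 1)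
    (hv : (v : TangentSpace (𝓡 4) x) = a' • e x 0 + b' • e x 1) :
    (FormalData.ofFrame e he).φ₁ x ![u, v] =
      ((FormalData.ofFrame e he).D x).mkQ ((a * b' - b * a') • e x 2) := by
  rw [map_smul]
  refine (wedgeForm_apply _ _ _ _).trans ?_
  change ((frameBasis (he x)).coord 0 (u : TangentSpace (𝓡 4) x) *
      (frameBasis (he x)).coord 1 (v : TangentSpace (𝓡 4) x) -
      (frameBasis (he x)).coord 1 (u : TangentSpace (𝓡 4) x) *
      (frameBasis (he x)).coord 0 (v : TangentSpace (𝓡 4) x)) • _ = _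
  rw [hu, hv]
  simp +decide only [map_add, map_smul, frameBasis_coord, if_true, if_false, smul_eq_mul, mul_one,
    mul_zero, add_zero, zero_add]
  rfl

theorem FormalData.ofFrame_φ₂ {e : Π x : M, Fin 4 → TangentSpace (𝓡 4) x}
    (he : ∀ x, LinearIndependent ℝ (e x)) (x : M) (u v : (FormalData.ofFrame e he).E x)
    {a b c a' b' c' : ℝ}
    (hu : (u : TangentSpace (𝓡 4) x) = a • e x 0 + b • e x 1 + c • e x 2)
    (hv : (v : TangentSpace (𝓡 4) x) = a' • e x 0 + b' • e x 1 + c' • e x 2) :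
    (FormalData.ofFrame e he).φ₂ x ![u, v] =
      ((FormalData.ofFrame e he).E x).mkQ ((b * c' - c * b') • e x 3) := by
  rw [map_smul]
  refine (wedgeForm_apply _ _ _ _).trans ?_
  change ((frameBasis (he x)).coord 1 (u : TangentSpace (𝓡 4) x) *
      (frameBasis (he x)).coord 2 (v : TangentSpace (𝓡 4) x) -
      (frameBasis (he x)).coord 2 (u : TangentSpace (𝓡 4) x) *
      (frameBasis (he x)).coord 1 (v : TangentSpace (𝓡 4) x)) • _ = _
  rw [hu, hv]
  simp +decide only [map_add, map_smul, frameBasis_coord, if_true, if_false, smul_eq_mul, mul_one,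
    mul_zero, add_zero, zero_add]
  rfl

theorem FormalData.ofFrame_isAdapted_iff {e : Π x : M, Fin 4 → TangentSpace (𝓡 4) x}
    (he : ∀ x, LinearIndependent ℝ (e x)) (x : M) (e' : Fin 4 → TangentSpace (𝓡 4) x) :
    (FormalData.ofFrame e he).IsAdapted x e' ↔ TriRel (e x) e' := by
  constructor
  · rintro ⟨hli, hW, h₀, h₁, h₁', h₂, hφ₁, hφ₂⟩
    obtain ⟨a, ha⟩ := Submodule.mem_span_singleton.1 hW
    obtain ⟨u₀, b, hb⟩ := Submodule.mem_span_pair.1 h₁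
    -- reading `φ₁` and `φ₂` on the frame vectors yields the third and the fourth vector in terms of
    -- the diagonal entries `a`, `b`
    have ha' : e' 0 = a • e x 0 + (0 : ℝ) • e x 1 := by rw [← ha]; module
    rw [FormalData.ofFrame_φ₁ he x _ _ ha' hb.symm, Submodule.mkQ_apply, Submodule.mkQ_apply, eq_comm,
      Submodule.Quotient.eq] at hφ₁
    obtain ⟨v₀, v₁, hv⟩ := Submodule.mem_span_pair.1 hφ₁
    rw [eq_sub_iff_add_eq] at hv
    have hb' : e' 1 = u₀ • e x 0 + b • e x 1 + (0 : ℝ) • e x 2 := by rw [← hb]; module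
    have hv' : e' 2 = v₀ • e x 0 + v₁ • e x 1 + (a * b) • e x 2 := by rw [← hv]; module
    rw [FormalData.ofFrame_φ₂ he x _ _ hb' hv', Submodule.mkQ_apply, Submodule.mkQ_apply, eq_comm,
      Submodule.Quotient.eq] at hφ₂
    obtain ⟨w₀, w₁, w₂, hw⟩ := Submodule.mem_span_triple.1 hφ₂
    rw [eq_sub_iff_add_eq] at hw
    have hli' := linearIndependent_four_iff.1 hli
    have hda : a ≠ 0 := by
      rintro rfl
      have := (hli' 1 0 0 0 (by rw [ha']; module)).1
      norm_num at this
    have hdb : b ≠ 0 := by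
      rintro rfl
      have := (hli' u₀ (-a) 0 0 (by rw [ha', hb']; module)).2.1
      exact hda (by simpa using this)
    exact ⟨a, b, hda, hdb, u₀, v₀, v₁, w₀, w₁, w₂, ha.symm, by rw [hb']; module,
      by rw [hv']; module, by rw [← hw]; module⟩
  · intro h
    have hli := h.linearIndependent (he x)
    obtain ⟨a, b, ha, hb, u₀, v₀, v₁, w₀, w₁, w₂, h0, h1, h2, h3⟩ := h
    have k0 : e' 0 = a • e x 0 + (0 : ℝ) • e x 1 := by rw [h0]; module
    have k1 : e' 1 = u₀ • e x 0 + b • e x 1 := by rw [h1]; module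
    have k1' : e' 1 = u₀ • e x 0 + b • e x 1 + (0 : ℝ) • e x 2 := by rw [h1]; module
    have k2 : e' 2 = v₀ • e x 0 + v₁ • e x 1 + (a * b) • e x 2 := by rw [h2]; module
    refine ⟨hli, Submodule.mem_span_singleton.2 ⟨a, h0.symm⟩,
      Submodule.mem_span_pair.2 ⟨_, _, k0.symm⟩, Submodule.mem_span_pair.2 ⟨_, _, k1.symm⟩,
      Submodule.mem_span_triple.2 ⟨_, _, _, k1'.symm⟩,
      Submodule.mem_span_triple.2 ⟨_, _, _, k2.symm⟩, ?_, ?_⟩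
    · rw [FormalData.ofFrame_φ₁ he x _ _ k0 k1, Submodule.mkQ_apply, Submodule.mkQ_apply, eq_comm,
        Submodule.Quotient.eq]
      exact Submodule.mem_span_pair.2 ⟨v₀, v₁, by rw [k2]; module⟩
    · rw [FormalData.ofFrame_φ₂ he x _ _ k1' k2, Submodule.mkQ_apply, Submodule.mkQ_apply, eq_comm,
        Submodule.Quotient.eq]
      exact Submodule.mem_span_triple.2 ⟨w₀, w₁, w₂, by rw [h3]; module⟩

theorem FormalData.ofFrame_isInducedBy {D : Π x : M, Submodule ℝ (TangentSpace (𝓡 4) x)}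
    {e : Π x : M, Fin 4 → TangentSpace (𝓡 4) x} (he : ∀ x, LinearIndependent ℝ (e x))
    (h : ∀ x, IsBracketFrame D x (e x)) : (FormalData.ofFrame e he).IsInducedBy D := by
  have hD : (FormalData.ofFrame e he).D = D := funext fun x => (h x).D_eq.symm
  have hE : (FormalData.ofFrame e he).E = derived D := funext fun x => (h x).E_eq.symm
  refine ⟨hD, hE, fun x V V' hV hV' => ?_, fun x V V' hV hV' => ?_⟩
  · obtain ⟨a, b, hab⟩ := Submodule.mem_span_pair.1 hV.mem
    obtain ⟨a', b', hab'⟩ := Submodule.mem_span_pair.1 hV'.mem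
    rw [FormalData.ofFrame_φ₁ he x _ _ hab.symm hab'.symm, Submodule.mkQ_apply,
      Submodule.mkQ_apply, eq_comm, Submodule.Quotient.eq]
    have hVD : IsLocalSection D x V := hD ▸ hV
    have hVD' : IsLocalSection D x V' := hD ▸ hV'
    rw [congrFun hD x]
    exact (h x).bracket_D V V' hVD hVD' a b a' b' hab.symm hab'.symm
  · obtain ⟨a, b, c, hab⟩ := Submodule.mem_span_triple.1 hV.mem
    obtain ⟨a', b', c', hab'⟩ := Submodule.mem_span_triple.1 hV'.mem
    rw [FormalData.ofFrame_φ₂ he x _ _ hab.symm hab'.symm, Submodule.mkQ_apply,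
      Submodule.mkQ_apply, eq_comm, Submodule.Quotient.eq]
    have hVD : IsLocalSection (derived D) x V := hE ▸ hV
    have hVD' : IsLocalSection (derived D) x V' := hE ▸ hV'
    rw [congrFun hE x]
    exact (h x).bracket_E V V' hVD hVD' a b c a' b' c' hab.symm hab'.symm

/-- A path of automorphisms of `TM` which starts at the identity and takes bracket frames of `D`
to bracket frames of `D'` deforms the formal Engel structure of `D` to that of `D'`. -/
theorem sameFormalTypeRel_of_gaugePath {V : Set M}
    {D D' : Π x : M, Submodule ℝ (TangentSpace (𝓡 4) x)} (hD : IsEngel D)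
    {L : unitInterval → Π x : M, TangentSpace (𝓡 4) x →ₗ[ℝ] TangentSpace (𝓡 4) x}
    (hL : IsGaugePath L) (h0 : ∀ x, L 0 x = LinearMap.id)
    (hV : ∀ s, ∀ x ∉ V, L s x = LinearMap.id)
    (h1 : ∀ x e, IsBracketFrame D x e → IsBracketFrame D' x fun i => L 1 x (e i)) :
    SameFormalTypeRel V D D' := by
  have hex : ∀ x, ∃ e, IsBracketFrame D x e := fun x => by
    obtain ⟨O, e, -, hx, -, h⟩ := hD.exists_bracketFrame x
    exact ⟨_, h x hx⟩
  -- the frames `e x` depend on `x` in an arbitrary way; only their classes up to `TriRel` matter, and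
  -- these are represented by smooth local frames
  choose e he using hex
  have hli : ∀ s x, LinearIndependent ℝ fun i => L s x (e x i) := fun s x =>
    (he x).indep.map' (L s x) (LinearMap.ker_eq_bot.2 (hL.injective s x))
  have hloc : ∀ x₀ : M, ∃ (O : Set M) (f : Fin 4 → Π x : M, TangentSpace (𝓡 4) x), IsOpen O ∧ x₀ ∈ O ∧
      (∀ i, SmoothFieldOn (f i) O) ∧
      ∀ s, ∀ x ∈ O, TriRel (fun i => L s x (e x i)) fun i => L s x (f i x) := fun x₀ => by
    obtain ⟨O, f, hO, hx, hf, h⟩ := hD.exists_bracketFrame x₀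
    exact ⟨O, f, hO, hx, hf, fun s x hx => ((he x).triRel hD.1 hD.2.1 (h x hx)).map (L s x)⟩
  refine ⟨fun s => ⟨FormalData.ofFrame (fun x i => L s x (e x i)) (hli s), fun x₀ => ?_⟩,
    fun q₀ => ?_, ?_, ?_, fun s x hx e' => ?_⟩
  · obtain ⟨O, f, hO, hx, hf, h⟩ := hloc x₀
    exact ⟨O, hO, hx, fun i x => L s x (f i x), fun i => hL.smooth s _ O hO (hf i),
      fun x hx => (FormalData.ofFrame_isAdapted_iff (hli s) x _).2 (h s x hx)⟩
  · obtain ⟨O, f, hO, hx, hf, h⟩ := hloc q₀.2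
    refine ⟨univ ×ˢ O, isOpen_univ.prod hO, ⟨mem_univ _, hx⟩, fun s i x => L s x (f i x),
      fun i => hL.continuous (fun _ x => f i x) _ ?_,
      fun q hq => (FormalData.ofFrame_isAdapted_iff (hli q.1) q.2 _).2 (h q.1 q.2 hq.2)⟩
    exact (hf i).continuousOn.comp continuous_snd.continuousOn fun q hq => hq.2
  · refine FormalData.ofFrame_isInducedBy (hli 0) fun x => ?_
    simp only [h0]
    exact he x
  · exact FormalData.ofFrame_isInducedBy (hli 1) fun x => h1 x _ (he x)
  · rw [FormalData.ofFrame_isAdapted_iff (hli s), FormalData.ofFrame_isAdapted_iff (hli 0),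
      hV s x hx, hV 0 x hx]

end OfFrame

/-! ### Homotopies of Engel framings -/

section Framings

universe u

variable {M : Type u} [TopologicalSpace M] [ChartedSpace R4 M] [IsManifold (𝓡 4) ∞ M]

theorem smooth_frameCoeff {e : Fin 4 → Π x : M, TangentSpace (𝓡 4) x}
    (he : ∀ i, SmoothFieldOn (e i) univ) (hli : ∀ x, LinearIndependent ℝ fun i => e i x)
    {V : Π x : M, TangentSpace (𝓡 4) x} (hV : SmoothFieldOn V univ) (i : Fin 4) :
    ContMDiff (𝓡 4) 𝓘(ℝ) ∞ fun x => (frameBasis (hli x)).coord i (V x) := by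
  intro x₀
  obtain ⟨O, hO, hx, -, -, c, hc, hcs, -⟩ := exists_dual_coeff isOpen_univ (mem_univ x₀) he (hli x₀)
  refine ((hcs i V O hO Subset.rfl (hV.mono (subset_univ _))).congr fun x hx => ?_).contMDiffAt
    (hO.mem_nhds hx)
  have : c i x = (frameBasis (hli x)).coord i := by
    refine (frameBasis (hli x)).ext fun j => ?_
    have hj : frameBasis (hli x) j = e j x := Module.Basis.mk_apply _ _ j
    rw [hj, hc x hx, frameBasis_coord (hli x) i j]
  rw [this]

theorem isClosed_fields_eq {V W : Π x : M, TangentSpace (𝓡 4) x} (hV : SmoothFieldOn V univ)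
    (hW : SmoothFieldOn W univ) : IsClosed {x | V x = W x} := by
  rw [← isOpen_compl_iff, isOpen_iff_mem_nhds]
  intro x₀ hx₀
  have h1 := ((smoothFieldOn_iff_coord (isOpen_coordDom x₀) Subset.rfl V).1
    (hV.mono (subset_univ _))).continuousOn
  have h2 := ((smoothFieldOn_iff_coord (isOpen_coordDom x₀) Subset.rfl W).1
    (hW.mono (subset_univ _))).continuousOn
  have hnhds := (isOpen_coordDom x₀).mem_nhds (mem_coordDom x₀)
  have hne : coord x₀ x₀ (V x₀) ≠ coord x₀ x₀ (W x₀) := fun h =>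
    hx₀ (coord_injective (mem_coordDom x₀) h)
  have h3 : ∀ᶠ x in 𝓝 x₀, coord x₀ x (V x) - coord x₀ x (W x) ≠ 0 :=
    ((h1.continuousAt hnhds).sub (h2.continuousAt hnhds)).eventually_ne (sub_ne_zero.2 hne)
  refine h3.mono fun x hx hVW => hx ?_
  rw [show V x = W x from hVW, sub_self]

theorem pos_of_ne_zero_of_isPreconnected {X : Type*} [TopologicalSpace X] {V : Set X} {f : X → ℝ}
    (hf : Continuous f) (h0 : ∀ x, f x ≠ 0) (hV : IsPreconnected V) {p : X} (hp : p ∈ closure V)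
    (hfp : 0 < f p) {x : X} (hx : x ∈ V) : 0 < f x := by
  by_contra hneg
  obtain ⟨y, -, hy⟩ := hV.closure.intermediate_value (subset_closure hx) hp hf.continuousOn
    ⟨not_lt.1 hneg, hfp.le⟩
  exact h0 y hy

theorem smooth_engelFraming {W X : Π x : M, TangentSpace (𝓡 4) x} (hW : SmoothFieldOn W univ)
    (hX : SmoothFieldOn X univ) (i : Fin 4) : SmoothFieldOn (engelFraming W X i) univ := by
  have hy := hW.bracket isOpen_univ hX
  fin_cases i
  exacts [hW, hX, hy, hX.bracket isOpen_univ hy]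

/-- A path of automorphisms of `TM` which starts at the identity and takes bracket frames of `D`
to bracket frames of `D'` deforms the Engel framings. Compatible framings of `D'` differ from the
image framing by triangular matrices, which have positive diagonal since they are the identity
outside the connected set `V`. -/
theorem sameEngelFramingRel_of_gaugePath {V : Set M}
    {D D' : Π x : M, Submodule ℝ (TangentSpace (𝓡 4) x)} (hD : IsEngel D) (hD' : IsEngel D')
    (hVc : IsPreconnected V) (hVb : (closure V ∩ Vᶜ).Nonempty) (hVi : Vᶜ ⊆ closure (interior Vᶜ))
    {L : unitInterval → Π x : M, TangentSpace (𝓡 4) x →ₗ[ℝ] TangentSpace (𝓡 4) x}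
    (hL : IsGaugePath L) (h0 : ∀ x, L 0 x = LinearMap.id)
    (hV : ∀ s, ∀ x ∉ V, L s x = LinearMap.id)
    (h1 : ∀ x e, IsBracketFrame D x e → IsBracketFrame D' x fun i => L 1 x (e i)) :
    SameEngelFramingRel V D D' := by
  intro W X hWX
  have hF := hWX.isBracketFrame hD
  have hFs := smooth_engelFraming hWX.1 hWX.2.1
  have hLF : ∀ x, IsBracketFrame D' x fun i => L 1 x (engelFraming W X i x) :=
    fun x => h1 x _ (hF x)
  refine ⟨⟨fun x => L 1 x (W x), fun x => L 1 x (X x), ⟨hL.smooth 1 _ _ isOpen_univ hWX.1,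
    hL.smooth 1 _ _ isOpen_univ hWX.2.1, fun x => ⟨(hLF x).isKernelVector, ?_, (hLF x).D_eq⟩⟩,
    fun x hx => ?_⟩, ?_⟩
  · have := (hLF x).indep.comp ![0, 1] (by decide)
    convert this using 1
    funext i; fin_cases i <;> rfl
  · dsimp only
    rw [hV 1 x hx]; exact ⟨rfl, rfl⟩
  intro W' X' hWX' hoff
  have hF' := hWX'.isBracketFrame hD'
  have hFs' := smooth_engelFraming hWX'.1 hWX'.2.1
  -- the framings agree outside `V`, where the brackets are determined by continuity
  have hFoff : ∀ i, ∀ x ∉ V, engelFraming W' X' i x = engelFraming W X i x := by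
    intro i x hx
    have hint : interior Vᶜ ⊆ {x | engelFraming W' X' i x = engelFraming W X i x} := by
      intro z hz
      have hy : ∀ y ∈ interior Vᶜ, bracket W' X' y = bracket W X y := fun y hy =>
        bracket_congr isOpen_interior hy (fun w hw => (hoff w (interior_subset hw)).1)
          fun w hw => (hoff w (interior_subset hw)).2
      have hz' := hoff z (interior_subset hz)
      fin_cases i
      exacts [hz'.1, hz'.2, hy z hz, bracket_congr isOpen_interior hz
        (fun w hw => (hoff w (interior_subset hw)).2) hy]
    exact closure_minimal hint (isClosed_fields_eq (hFs' i) (hFs i)) (hVi hx)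
  have hes : ∀ i, SmoothFieldOn (fun x => L 1 x (engelFraming W X i x)) univ := fun i =>
    hL.smooth 1 _ _ isOpen_univ (hFs i)
  have hli : ∀ x, LinearIndependent ℝ fun i => L 1 x (engelFraming W X i x) := fun x => (hLF x).indep
  set c : Fin 4 → Fin 4 → M → ℝ := fun i j x => (frameBasis (hli x)).coord i (engelFraming W' X' j x)
    with hc
  have hcs : ∀ i j, ContMDiff (𝓡 4) 𝓘(ℝ) ∞ (c i j) := fun i j => smooth_frameCoeff hes hli (hFs' j) i
  have hcsum : ∀ x j, engelFraming W' X' j x = ∑ i, c i j x • L 1 x (engelFraming W X i x) := by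
    intro x j
    rw [Fin.sum_univ_four]
    exact frameBasis_sum (hli x) _
  have hcoff : ∀ x ∉ V, ∀ i j, c i j x = if i = j then 1 else 0 := by
    intro x hx i j
    have : engelFraming W' X' j x = L 1 x (engelFraming W X j x) := by
      rw [hFoff j x hx, hV 1 x hx]; rfl
    change (frameBasis (hli x)).coord i (engelFraming W' X' j x) = _
    rw [this]
    exact frameBasis_coord (hli x) i j
  have htri : ∀ x, c 0 0 x ≠ 0 ∧ c 1 1 x ≠ 0 ∧ c 2 2 x = c 0 0 x * c 1 1 x ∧
      c 3 3 x = c 0 0 x * c 1 1 x ^ 2 ∧ ∀ i j : Fin 4, j < i → c i j x = 0 := by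
    intro x
    obtain ⟨a, b, ha, hb, u₀, v₀, v₁, w₀, w₁, w₂, k0, k1, k2, k3⟩ :=
      (hLF x).triRel hD'.1 hD'.2.1 (hF' x)
    beta_reduce at k0 k1 k2 k3
    have hcc : ∀ i j, c i j x = (frameBasis (hli x)).coord i (engelFraming W' X' j x) :=
      fun i j => rfl
    have hco := frameBasis_coord (hli x)
    have e00 : c 0 0 x = a := by
      rw [hcc, k0, map_smul, hco]; simp
    have e11 : c 1 1 x = b := by
      rw [hcc, k1]
      simp +decide only [map_add, map_smul, hco, if_true, if_false, smul_eq_mul, mul_one,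
        mul_zero, add_zero]
    have e22 : c 2 2 x = a * b := by
      rw [hcc, k2]
      simp +decide only [map_add, map_smul, hco, if_true, if_false, smul_eq_mul, mul_one,
        mul_zero, add_zero]
    have e33 : c 3 3 x = a * b ^ 2 := by
      rw [hcc, k3]
      simp +decide only [map_add, map_smul, hco, if_true, if_false, smul_eq_mul, mul_one,
        mul_zero, add_zero]
    have h10 : ∀ i : Fin 4, 0 < i → c i 0 x = 0 := fun i hi => by
      rw [hcc, k0, map_smul, hco, if_neg hi.ne', smul_zero]
    have h21 : ∀ i : Fin 4, 1 < i → c i 1 x = 0 := fun i hi => by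
      rw [hcc, k1, map_add, map_smul, map_smul, hco, hco, if_neg hi.ne',
        if_neg (lt_trans (by decide) hi).ne', smul_zero, smul_zero, add_zero]
    have h32 : c 3 2 x = 0 := by
      rw [hcc, k2]
      simp +decide only [map_add, map_smul, hco, if_false, smul_eq_mul,
        mul_zero, add_zero]
    refine ⟨e00 ▸ ha, e11 ▸ hb, by rw [e22, e00, e11], by rw [e33, e00, e11], ?_⟩
    intro i j hij
    fin_cases j
    · exact h10 i hij
    · exact h21 i hij
    · have : i = 3 := by revert hij; revert i; decide
      rw [this]; exact h32
    · exact absurd hij (by revert i; decide)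
  obtain ⟨p, hpV, hpV'⟩ := hVb
  have hpos : ∀ i, (∀ x, c i i x ≠ 0) → ∀ x, 0 < c i i x := by
    intro i hne x
    by_cases hx : x ∈ V
    · exact pos_of_ne_zero_of_isPreconnected (hcs i i).continuous hne hVc hpV
        (by rw [hcoff p hpV' i i, if_pos rfl]; exact one_pos) hx
    · rw [hcoff x hx i i, if_pos rfl]; exact one_pos
  have hpos0 := hpos 0 fun x => (htri x).1
  have hpos1 := hpos 1 fun x => (htri x).2.1
  -- linear interpolation in the image framing
  set P : unitInterval → Π x : M, TangentSpace (𝓡 4) x →ₗ[ℝ] TangentSpace (𝓡 4) x := fun s x =>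
    (frameBasis (hli x)).constr ℝ fun j => (1 - (s : ℝ)) • L 1 x (engelFraming W X j x) +
      (s : ℝ) • engelFraming W' X' j x with hPdef
  have hPe : ∀ s x j, P s x (L 1 x (engelFraming W X j x)) =
      (1 - (s : ℝ)) • L 1 x (engelFraming W X j x) + (s : ℝ) • engelFraming W' X' j x := by
    intro s x j
    have : frameBasis (hli x) j = L 1 x (engelFraming W X j x) := Module.Basis.mk_apply _ _ j
    rw [hPdef]
    dsimp only
    rw [← this, Module.Basis.constr_basis, this]
  have hP : IsGaugePath P := by
    refine isGaugePath_of_local fun x₀ => ⟨univ, isOpen_univ, mem_univ _, _,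
      fun s x => (1 - (s : ℝ)) • (1 : Matrix (Fin 4) (Fin 4) ℝ) + (s : ℝ) • Matrix.of fun i j => c i j x,
      hes, hli x₀, fun s i j => ?_, fun i j => ?_, fun s x _ => ?_, fun s x _ j => ?_⟩
    · have : ContMDiff (𝓡 4) 𝓘(ℝ) ∞ fun x => (1 - (s : ℝ)) * (1 : Matrix (Fin 4) (Fin 4) ℝ) i j +
          (s : ℝ) * c i j x := contMDiff_const.add (contMDiff_const.mul (hcs i j))
      exact this.contMDiffOn
    · have : Continuous fun q : unitInterval × M => (1 - (q.1 : ℝ)) *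
          (1 : Matrix (Fin 4) (Fin 4) ℝ) i j + (q.1 : ℝ) * c i j q.2 := by
        have := (hcs i j).continuous
        fun_prop
      exact this.continuousOn
    · have hs0 := s.2.1
      have hs1 := s.2.2
      have hdiag : ∀ r : ℝ, 0 < r → 0 < (1 - (s : ℝ)) + (s : ℝ) * r := fun r hr => by
        rcases eq_or_lt_of_le hs0 with h | h
        · rw [← h]; norm_num
        · have := mul_pos h hr
          linarith
      rw [Matrix.det_of_isUpperTriangular]
      · refine (Finset.prod_pos fun i _ => ?_).ne'
        have : 0 < c i i x := by
          fin_cases i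
          · exact hpos0 x
          · exact hpos1 x
          · exact (htri x).2.2.1 ▸ mul_pos (hpos0 x) (hpos1 x)
          · exact (htri x).2.2.2.1 ▸ mul_pos (hpos0 x) (pow_pos (hpos1 x) 2)
        have := hdiag _ this
        change 0 < (1 - (s : ℝ)) * (1 : Matrix (Fin 4) (Fin 4) ℝ) i i + s * c i i x
        rw [Matrix.one_apply_eq, mul_one]
        exact this
      · intro i j hij
        have hij' : j < i := hij
        change (1 - (s : ℝ)) * (1 : Matrix (Fin 4) (Fin 4) ℝ) i j + s * c i j x = 0
        rw [Matrix.one_apply_ne hij'.ne', (htri x).2.2.2.2 i j hij', mul_zero, mul_zero, add_zero]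
    · rw [hPe, hcsum x j]
      simp only [Matrix.add_apply, Matrix.smul_apply, Matrix.of_apply, smul_eq_mul, add_smul,
        Finset.sum_add_distrib, Finset.smul_sum, smul_smul]
      congr 1
      rw [Finset.sum_eq_single j]
      · rw [Matrix.one_apply_eq, mul_one]
      · intro i _ hi; rw [Matrix.one_apply_ne hi, mul_zero, zero_smul]
      · intro hj; exact absurd (Finset.mem_univ j) hj
  have hPid : ∀ s x, (s = 0 ∨ x ∉ V) → P s x = LinearMap.id := by
    intro s x hsx
    refine (frameBasis (hli x)).ext fun j => ?_
    have : frameBasis (hli x) j = L 1 x (engelFraming W X j x) := Module.Basis.mk_apply _ _ j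
    rw [this, hPe, LinearMap.id_apply]
    rcases hsx with rfl | hx
    · simp
    · rw [hFoff j x hx, hV 1 x hx, LinearMap.id_apply, ← add_smul, sub_add_cancel, one_smul]
  have hG := hP.comp hL
  refine ⟨fun s i x => P s x (L s x (engelFraming W X i x)),
    fun s i => hG.smooth s _ _ isOpen_univ (hFs i), fun i => ?_, fun s x => ?_, ?_, ?_, ?_⟩
  · rw [← continuousOn_univ]
    refine hG.continuous (fun _ x => engelFraming W X i x) _ ?_
    exact (hFs i).continuousOn.comp continuous_snd.continuousOn fun q hq => mem_univ _
  · exact (hF x).indep.map' (P s x ∘ₗ L s x) (LinearMap.ker_eq_bot.2 (hG.injective s x))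
  · funext i x
    beta_reduce
    rw [h0, hPid 0 x (Or.inl rfl)]; rfl
  · funext i x
    beta_reduce
    rw [hPe]; simp
  · intro s i x hx
    beta_reduce
    rw [hV s x hx, hPid s x (Or.inr hx)]; rfl

end Framings

/-! ### Inverses of smooth injective local diffeomorphisms -/

section InverseFunction

variable {M : Type*} [TopologicalSpace M] [ChartedSpace R4 M] [IsManifold (𝓡 4) ∞ M]
  {EX : Type*} [NormedAddCommGroup EX] [NormedSpace ℝ EX] [FiniteDimensional ℝ EX]
  {HX : Type*} [TopologicalSpace HX] {I : ModelWithCorners ℝ EX HX} [I.Boundaryless]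
  {X : Type*} [TopologicalSpace X] [ChartedSpace HX X] [IsManifold I ∞ X]

/-- The inverse function theorem on manifolds: a local inverse. -/
theorem exists_local_inverse {f : X → M} {x : X} (hf : ContMDiffAt I (𝓡 4) ∞ f x)
    (hbij : Function.Bijective (mfderiv I (𝓡 4) f x)) :
    ∃ g : M → X, ContMDiffAt (𝓡 4) I ∞ g (f x) ∧ g (f x) = x ∧ ∀ᶠ y in 𝓝 (f x), f (g y) = y := by
  have hfd : MDifferentiableAt I (𝓡 4) f x := hf.mdifferentiableAt (by simp)
  -- invert the expression `F` of `f` in charts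
  set F := writtenInExtChartAt I (𝓡 4) x f with hF
  have hFc : ContDiffAt ℝ ∞ F (extChartAt I x x) := by
    have := (contMDiffAt_iff.1 hf).2
    rw [I.range_eq_univ, contDiffWithinAt_univ] at this
    exact this
  have hder : mfderiv I (𝓡 4) f x = fderiv ℝ F (extChartAt I x x) := by
    rw [hfd.mfderiv, I.range_eq_univ, fderivWithin_univ]
  have hb : Function.Bijective (fderiv ℝ F (extChartAt I x x)) := by
    rw [hder] at hbij; exact hbij
  let F' : EX ≃L[ℝ] R4 := (LinearEquiv.ofBijective (fderiv ℝ F (extChartAt I x x)).toLinearMap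
    hb).toContinuousLinearEquiv
  have hF' : HasFDerivAt F (F' : EX →L[ℝ] R4) (extChartAt I x x) := by
    have h1 : (F' : EX →L[ℝ] R4) = fderiv ℝ F (extChartAt I x x) := by
      ext v; rfl
    rw [h1]
    exact (hFc.differentiableAt (by simp)).hasFDerivAt
  have hstr : HasStrictFDerivAt F (F' : EX →L[ℝ] R4) (extChartAt I x x) :=
    hFc.hasStrictFDerivAt' hF' (by simp)
  have hFx : F (extChartAt I x x) = extChartAt (𝓡 4) (f x) (f x) := by
    rw [hF, writtenInExtChartAt]
    simp
  set G := hFc.localInverse hF' (by simp) with hG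
  have hGx : G (extChartAt (𝓡 4) (f x) (f x)) = extChartAt I x x := by
    rw [← hFx]; exact hFc.localInverse_apply_image hF' (by simp)
  have hGs : ContDiffAt ℝ ∞ G (extChartAt (𝓡 4) (f x) (f x)) := by
    rw [← hFx]; exact hFc.to_localInverse hF' (by simp)
  have hGr : ∀ᶠ y in 𝓝 (extChartAt (𝓡 4) (f x) (f x)), F (G y) = y := by
    rw [← hFx]; exact hstr.eventually_right_inverse
  have hχ : ContMDiffAt (𝓡 4) 𝓘(ℝ, R4) ∞ (extChartAt (𝓡 4) (f x)) (f x) := contMDiffAt_extChartAt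
  have hGχ : ContMDiffAt (𝓡 4) 𝓘(ℝ, EX) ∞ (fun y => G (extChartAt (𝓡 4) (f x) y)) (f x) :=
    ContMDiffAt.comp (f x) hGs.contMDiffAt hχ
  have hsymm : ContMDiffAt 𝓘(ℝ, EX) I ∞ (extChartAt I x).symm
      (G (extChartAt (𝓡 4) (f x) (f x))) := by
    rw [hGx]
    exact (contMDiffOn_extChartAt_symm (n := ∞) x).contMDiffAt
      (extChartAt_target_mem_nhds x)
  have hgs : ContMDiffAt (𝓡 4) I ∞
      (fun y => (extChartAt I x).symm (G (extChartAt (𝓡 4) (f x) y))) (f x) :=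
    ContMDiffAt.comp (f x) hsymm hGχ
  have hgx : (extChartAt I x).symm (G (extChartAt (𝓡 4) (f x) (f x))) = x := by
    rw [hGx, extChartAt_to_inv]
  refine ⟨_, hgs, hgx, ?_⟩
  have hc1 : ∀ᶠ y in 𝓝 (f x), y ∈ (extChartAt (𝓡 4) (f x)).source := extChartAt_source_mem_nhds (f x)
  have hc2 : ∀ᶠ y in 𝓝 (f x), f ((extChartAt I x).symm (G (extChartAt (𝓡 4) (f x) y))) ∈
      (extChartAt (𝓡 4) (f x)).source := by
    have hcont : ContinuousAt (fun y => f ((extChartAt I x).symm (G (extChartAt (𝓡 4) (f x) y))))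
        (f x) := ContinuousAt.comp (g := f) (by rw [hgx]; exact hf.continuousAt) hgs.continuousAt
    refine hcont.eventually_mem ?_
    rw [hgx]
    exact extChartAt_source_mem_nhds (f x)
  have hc3 := hχ.continuousAt.eventually hGr
  filter_upwards [hc1, hc2, hc3] with y h1 h2 h3
  refine (extChartAt (𝓡 4) (f x)).injOn h2 h1 ?_
  exact h3

/-- An injective local diffeomorphism on an open set has open images and a smooth inverse. -/
theorem exists_smooth_inverse [Nonempty X] {f : X → M} {S : Set X} (hS : IsOpen S)
    (hf : ContMDiffOn I (𝓡 4) ∞ f S)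
    (hinj : InjOn f S) (hbij : ∀ x ∈ S, Function.Bijective (mfderiv I (𝓡 4) f x)) :
    ∃ g : M → X, (∀ x ∈ S, g (f x) = x) ∧ ContMDiffOn (𝓡 4) I ∞ g (f '' S) ∧
      ∀ U ⊆ S, IsOpen U → IsOpen (f '' U) := by
  have hloc := fun x (hx : x ∈ S) =>
    exists_local_inverse (hf.contMDiffAt (hS.mem_nhds hx)) (hbij x hx)
  refine ⟨Function.invFunOn f S, fun x hx => hinj.leftInvOn_invFunOn hx, ?_, ?_⟩
  · rintro _ ⟨x, hx, rfl⟩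
    obtain ⟨g, hg, hgx, hgf⟩ := hloc x hx
    have hmem : ∀ᶠ y in 𝓝 (f x), g y ∈ S :=
      hg.continuousAt.eventually_mem (by rw [hgx]; exact hS.mem_nhds hx)
    refine ContMDiffAt.contMDiffWithinAt (hg.congr_of_eventuallyEq ?_)
    filter_upwards [hgf, hmem] with y h1 h2
    rw [← h1, hinj.leftInvOn_invFunOn h2, h1]
  · intro U hU hUo
    rw [isOpen_iff_mem_nhds]
    rintro _ ⟨x, hx, rfl⟩
    obtain ⟨g, hg, hgx, hgf⟩ := hloc x (hU hx)
    have hmem : ∀ᶠ y in 𝓝 (f x), g y ∈ U :=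
      hg.continuousAt.eventually_mem (by rw [hgx]; exact hUo.mem_nhds hx)
    filter_upwards [hgf, hmem] with y h1 h2
    exact ⟨g y, h2, h1⟩

end InverseFunction

/-! ### Vector fields in a tube -/

section PartialDerivative

variable {EN : Type*} [NormedAddCommGroup EN] [NormedSpace ℝ EN] {HN : Type*} [TopologicalSpace HN]
  {J : ModelWithCorners ℝ EN HN} {N : Type*} [TopologicalSpace N] [ChartedSpace HN N]
  [IsManifold J ∞ N] {F : Type*} [NormedAddCommGroup F] [NormedSpace ℝ F]

/-- Partial derivatives in the second variable of functions on an open subset of `N × ℝ`. -/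
theorem contMDiffOn_deriv_snd {m n : ℕ∞ω} (hmn : m + 1 ≤ n) {u : N → ℝ → F} {S : Set (N × ℝ)}
    (hS : IsOpen S)
    (hu : ContMDiffOn (J.prod 𝓘(ℝ, ℝ)) 𝓘(ℝ, F) n (fun q : N × ℝ => u q.1 q.2) S) :
    ContMDiffOn (J.prod 𝓘(ℝ, ℝ)) 𝓘(ℝ, F) m (fun q : N × ℝ => deriv (u q.1) q.2) S := by
  intro q hq
  have h1 : ContMDiffAt ((J.prod 𝓘(ℝ, ℝ)).prod 𝓘(ℝ, ℝ)) 𝓘(ℝ, F) n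
      (Function.uncurry fun (q : N × ℝ) (t : ℝ) => u q.1 t) (q, q.2) :=
    ContMDiffAt.comp (f := fun r : (N × ℝ) × ℝ => (r.1.1, r.2)) (q, q.2)
      (hu.contMDiffAt (hS.mem_nhds hq)) (contMDiffAt_fst.fst.prodMk contMDiffAt_snd)
  have h2 := ContMDiffAt.mfderiv (fun (q : N × ℝ) (t : ℝ) => u q.1 t) Prod.snd h1
    (contMDiffAt_snd (n := m)) hmn
  have h3 : ContMDiffAt (J.prod 𝓘(ℝ, ℝ)) 𝓘(ℝ, ℝ →L[ℝ] F) m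
      (fun q : N × ℝ => fderiv ℝ (u q.1) q.2) q := by
    simpa only [inTangentCoordinates_model_space, mfderiv_eq_fderiv] using h2
  have h4 : ContMDiffAt (J.prod 𝓘(ℝ, ℝ)) 𝓘(ℝ, F) m
      (fun q : N × ℝ => fderiv ℝ (u q.1) q.2 1) q :=
    ContMDiffAt.comp q ((ContinuousLinearMap.apply ℝ F (1 : ℝ)).contDiff.contMDiff.contMDiffAt) h3
  exact h4.contMDiffWithinAt

theorem mfderiv_snd_eq_deriv {u : N × ℝ → F} {q : N × ℝ}
    (hu : MDifferentiableAt (J.prod 𝓘(ℝ, ℝ)) 𝓘(ℝ, F) u q) :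
    mfderiv (J.prod 𝓘(ℝ, ℝ)) 𝓘(ℝ, F) u q ((0, 1) : EN × ℝ) =
      deriv (fun t => u (q.1, t)) q.2 := by
  have h1 : HasMFDerivAt 𝓘(ℝ, ℝ) (J.prod 𝓘(ℝ, ℝ)) (fun t : ℝ => (q.1, t)) q.2
      (ContinuousLinearMap.inr ℝ EN ℝ) :=
    (hasMFDerivAt_const q.1 q.2).prodMk (hasMFDerivAt_id q.2)
  have h2 : HasMFDerivAt 𝓘(ℝ, ℝ) 𝓘(ℝ, F) (fun t => u (q.1, t)) q.2 _ :=
    HasMFDerivAt.comp (f := fun t : ℝ => (q.1, t)) q.2 hu.hasMFDerivAt h1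
  have h3 := h2.mfderiv
  rw [mfderiv_eq_fderiv] at h3
  rw [← fderiv_apply_one_eq_deriv, h3]
  rfl

end PartialDerivative

namespace Tube

universe u

variable {M : Type u} [TopologicalSpace M] [ChartedSpace R4 M] [IsManifold (𝓡 4) ∞ M]
  {EN : Type*} [NormedAddCommGroup EN] [NormedSpace ℝ EN] [FiniteDimensional ℝ EN]
  {HN : Type*} [TopologicalSpace HN]
  {D : Π x : M, Submodule ℝ (TangentSpace (𝓡 4) x)} {J : ModelWithCorners ℝ EN HN} [J.Boundaryless]
  {N : Type*} [TopologicalSpace N] [ChartedSpace HN N] [IsManifold J ∞ N] [Nonempty N]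
  (τ : Tube D J N)

/-- The domain of the tubular neighbourhood map. -/
def dom : Set (N × ℝ) := univ ×ˢ Ioo (-τ.ε) τ.ε

theorem isOpen_dom : IsOpen τ.dom := isOpen_univ.prod isOpen_Ioo

theorem mk_mem_dom {p : N} {t : ℝ} : (p, t) ∈ τ.dom ↔ t ∈ Ioo (-τ.ε) τ.ε := by
  simp [dom]

theorem exists_inv : ∃ g : M → N × ℝ, (∀ q ∈ τ.dom, g (τ.Φ q) = q) ∧
    ContMDiffOn (𝓡 4) (J.prod 𝓘(ℝ, ℝ)) ∞ g (τ.Φ '' τ.dom) ∧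
      ∀ U ⊆ τ.dom, IsOpen U → IsOpen (τ.Φ '' U) :=
  exists_smooth_inverse τ.isOpen_dom τ.smooth_Φ τ.injOn_Φ
    fun q hq => τ.bijective_Φ q.1 q.2 (τ.mk_mem_dom.1 hq)

/-- The inverse of the tubular neighbourhood map. -/
def inv : M → N × ℝ := τ.exists_inv.choose

theorem inv_Φ {q : N × ℝ} (hq : q ∈ τ.dom) : τ.inv (τ.Φ q) = q := τ.exists_inv.choose_spec.1 q hq

theorem contMDiffOn_inv : ContMDiffOn (𝓡 4) (J.prod 𝓘(ℝ, ℝ)) ∞ τ.inv τ.image :=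
  τ.exists_inv.choose_spec.2.1

theorem isOpen_image_Φ {U : Set (N × ℝ)} (hU : U ⊆ τ.dom) (hUo : IsOpen U) : IsOpen (τ.Φ '' U) :=
  τ.exists_inv.choose_spec.2.2 U hU hUo

theorem isOpen_image : IsOpen τ.image := τ.isOpen_image_Φ Subset.rfl τ.isOpen_dom

theorem Φ_mem {q : N × ℝ} (hq : q ∈ τ.dom) : τ.Φ q ∈ τ.image := mem_image_of_mem _ hq

theorem inv_mem {x : M} (hx : x ∈ τ.image) : τ.inv x ∈ τ.dom := by
  obtain ⟨q, hq, rfl⟩ := hx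
  rwa [τ.inv_Φ hq]

theorem Φ_inv {x : M} (hx : x ∈ τ.image) : τ.Φ (τ.inv x) = x := by
  obtain ⟨q, hq, rfl⟩ := hx
  rw [τ.inv_Φ hq]

theorem mdifferentiableAt_Φ {q : N × ℝ} (hq : q ∈ τ.dom) :
    MDifferentiableAt (J.prod 𝓘(ℝ, ℝ)) (𝓡 4) τ.Φ q :=
  (τ.smooth_Φ.contMDiffAt (τ.isOpen_dom.mem_nhds hq)).mdifferentiableAt (by simp)

/-- The image under the tubular neighbourhood map of a vector field on `N × (-ε, ε)`. -/
def pushField (v : N × ℝ → EN × ℝ) : Π x : M, TangentSpace (𝓡 4) x :=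
  fun x => mfderiv (J.prod 𝓘(ℝ, ℝ)) (𝓡 4) τ.Φ (τ.inv x) (v (τ.inv x))

theorem pushField_Φ (v : N × ℝ → EN × ℝ) {q : N × ℝ} (hq : q ∈ τ.dom) :
    τ.pushField v (τ.Φ q) = mfderiv (J.prod 𝓘(ℝ, ℝ)) (𝓡 4) τ.Φ q (v q) :=
  congrArg (fun q' => (mfderiv (J.prod 𝓘(ℝ, ℝ)) (𝓡 4) τ.Φ q' (v q') : R4)) (τ.inv_Φ hq)

theorem smooth_pushField {v : N × ℝ → EN × ℝ} (hv : ContMDiff (J.prod 𝓘(ℝ, ℝ))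
      (J.prod 𝓘(ℝ, ℝ)).tangent ∞ fun q => (⟨q, v q⟩ : TangentBundle (J.prod 𝓘(ℝ, ℝ)) (N × ℝ))) :
    SmoothFieldOn (τ.pushField v) τ.image := by
  have : IsManifold (𝓡 4) (((⊤ : ℕ∞) : ℕ∞ω) + 1) M := ‹IsManifold (𝓡 4) ∞ M›
  have : IsManifold (J.prod 𝓘(ℝ, ℝ)) (((⊤ : ℕ∞) : ℕ∞ω) + 1) (N × ℝ) :=
    inferInstanceAs (IsManifold (J.prod 𝓘(ℝ, ℝ)) ∞ (N × ℝ))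
  have h1 : ContMDiffOn (J.prod 𝓘(ℝ, ℝ)).tangent (𝓡 4).tangent ∞
      (tangentMapWithin (J.prod 𝓘(ℝ, ℝ)) (𝓡 4) τ.Φ τ.dom) _ :=
    ContMDiffOn.contMDiffOn_tangentMapWithin (m := ∞) (n := ∞) τ.smooth_Φ le_rfl
      τ.isOpen_dom.uniqueMDiffOn
  have h2 : ContMDiffOn (𝓡 4) (J.prod 𝓘(ℝ, ℝ)).tangent ∞
      (fun x => (⟨τ.inv x, v (τ.inv x)⟩ : TangentBundle (J.prod 𝓘(ℝ, ℝ)) (N × ℝ))) τ.image :=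
    hv.comp_contMDiffOn τ.contMDiffOn_inv
  have h3 := h1.comp h2 fun x hx => τ.inv_mem hx
  refine h3.congr ?_
  rintro _ ⟨q, hq, rfl⟩
  have hq' : q ∈ τ.dom := hq
  simp only [Function.comp_apply, tangentMapWithin]
  rw [mfderivWithin_of_isOpen τ.isOpen_dom (τ.inv_mem (τ.Φ_mem hq'))]
  have := τ.Φ_inv (τ.Φ_mem hq')
  have h5 := τ.pushField_Φ v hq'
  rw [h5]
  have h6 := τ.inv_Φ hq'
  rw [h6]

theorem smooth_lift {w : Π p : N, TangentSpace J p}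
    (hw : ContMDiff J J.tangent ∞ fun p => (⟨p, w p⟩ : TangentBundle J N)) :
    ContMDiff (J.prod 𝓘(ℝ, ℝ)) (J.prod 𝓘(ℝ, ℝ)).tangent ∞
      fun q : N × ℝ => (⟨q, ((w q.1 : EN), (0 : ℝ))⟩ : TangentBundle (J.prod 𝓘(ℝ, ℝ)) (N × ℝ)) := by
  have : IsManifold J (((⊤ : ℕ∞) : ℕ∞ω) + 1) N := ‹IsManifold J ∞ N›
  have h0 : ContMDiff 𝓘(ℝ, ℝ) 𝓘(ℝ, ℝ).tangent ∞ fun t : ℝ => (⟨t, 0⟩ : TangentBundle 𝓘(ℝ, ℝ) ℝ) :=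
    Bundle.contMDiff_zeroSection ℝ (TangentSpace 𝓘(ℝ, ℝ) : ℝ → Type _)
  exact contMDiff_equivTangentBundleProd_symm.comp
    ((hw.comp contMDiff_fst).prodMk (h0.comp contMDiff_snd))

theorem smooth_dt : ContMDiff (J.prod 𝓘(ℝ, ℝ)) (J.prod 𝓘(ℝ, ℝ)).tangent ∞
      fun q : N × ℝ => (⟨q, ((0 : EN), (1 : ℝ))⟩ : TangentBundle (J.prod 𝓘(ℝ, ℝ)) (N × ℝ)) := by
  have : IsManifold J (((⊤ : ℕ∞) : ℕ∞ω) + 1) N := ‹IsManifold J ∞ N›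
  have h0 : ContMDiff 𝓘(ℝ, ℝ) 𝓘(ℝ, ℝ).tangent ∞ fun t : ℝ => (⟨t, (1 : ℝ)⟩ : TangentBundle 𝓘(ℝ, ℝ) ℝ) :=
    fun t => Bundle.contMDiffAt_section t |>.2 (by
      simpa using! contMDiffAt_const)
  have h1 : ContMDiff J J.tangent ∞ fun p : N => (⟨p, 0⟩ : TangentBundle J N) :=
    Bundle.contMDiff_zeroSection ℝ (TangentSpace J : N → Type _)
  exact contMDiff_equivTangentBundleProd_symm.comp
    ((h1.comp contMDiff_fst).prodMk (h0.comp contMDiff_snd))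

/-- The vector field `T` and the `T`-invariant extensions of the framing `X, Y, Z` of `N`, as vectors
in `N × ℝ`. -/
def vec (q : N × ℝ) : Fin 4 → EN × ℝ := ![(0, 1), (τ.X q.1, 0), (τ.Y q.1, 0), (τ.Z q.1, 0)]

/-- The frame `T, X, Y, Z` on the tube. -/
def field (i : Fin 4) : Π x : M, TangentSpace (𝓡 4) x := τ.pushField fun q => τ.vec q i

theorem smooth_field (i : Fin 4) : SmoothFieldOn (τ.field i) τ.image := by
  fin_cases i
  exacts [τ.smooth_pushField smooth_dt, τ.smooth_pushField (smooth_lift τ.smooth_X),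
    τ.smooth_pushField (smooth_lift τ.smooth_Y), τ.smooth_pushField (smooth_lift τ.smooth_Z)]

theorem field_Φ (i : Fin 4) {q : N × ℝ} (hq : q ∈ τ.dom) :
    τ.field i (τ.Φ q) = mfderiv (J.prod 𝓘(ℝ, ℝ)) (𝓡 4) τ.Φ q (τ.vec q i) := τ.pushField_Φ _ hq

theorem indep_vec (q : N × ℝ) : LinearIndependent ℝ (τ.vec q) := by
  rw [linearIndependent_four_iff]
  intro a b c d h
  let x : EN := τ.X q.1
  let y : EN := τ.Y q.1
  let z : EN := τ.Z q.1
  have h1 : (a • (0 : EN) + b • x + c • y + d • z, a * 1 + b * 0 + c * 0 + d * 0) =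
    ((0, 0) : EN × ℝ) := h
  rw [Prod.mk.injEq] at h1
  obtain ⟨h2, h3⟩ := h1
  have h4 := Fintype.linearIndependent_iff.1 (τ.framing q.1) ![b, c, d] (by
    rw [Fin.sum_univ_three]
    change b • x + c • y + d • z = 0
    rw [smul_zero, zero_add] at h2
    exact h2)
  exact ⟨by simpa using h3, h4 0, h4 1, h4 2⟩

theorem indep_field {x : M} (hx : x ∈ τ.image) : LinearIndependent ℝ fun i => τ.field i x := by
  obtain ⟨q, hq, rfl⟩ := hx
  have hq' : q ∈ τ.dom := hq
  have := (τ.indep_vec q).map' (mfderiv (J.prod 𝓘(ℝ, ℝ)) (𝓡 4) τ.Φ q).toLinearMap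
    (LinearMap.ker_eq_bot.2 (τ.bijective_Φ q.1 q.2 (τ.mk_mem_dom.1 hq')).1)
  have hfun : (fun i => τ.field i (τ.Φ q)) =
      (mfderiv (J.prod 𝓘(ℝ, ℝ)) (𝓡 4) τ.Φ q).toLinearMap ∘ τ.vec q :=
    funext fun i => τ.field_Φ i hq'
  rw [hfun]
  exact this

end Tube

/-! ### Brackets in a tube -/

namespace Tube

universe u

variable {M : Type u} [TopologicalSpace M] [ChartedSpace R4 M] [IsManifold (𝓡 4) ∞ M]
  {EN : Type*} [NormedAddCommGroup EN] [NormedSpace ℝ EN] [FiniteDimensional ℝ EN]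
  {HN : Type*} [TopologicalSpace HN]
  {D : Π x : M, Submodule ℝ (TangentSpace (𝓡 4) x)} {J : ModelWithCorners ℝ EN HN} [J.Boundaryless]
  {N : Type*} [TopologicalSpace N] [ChartedSpace HN N] [IsManifold J ∞ N] [Nonempty N]
  (τ : Tube D J N)

/-- A chart of `N` around `p₀` turns the tube into an open subset of a vector space. -/
def flatten (p₀ : N) (x : M) : EN × ℝ := (extChartAt J p₀ (τ.inv x).1, (τ.inv x).2)

theorem contMDiffAt_flatten {p₀ : N} {q : N × ℝ} (hq : q ∈ τ.dom)
    (hp : q.1 ∈ (chartAt HN p₀).source) :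
    ContMDiffAt (𝓡 4) 𝓘(ℝ, EN × ℝ) ∞ (τ.flatten p₀) (τ.Φ q) := by
  have h1 : ContMDiffAt (𝓡 4) (J.prod 𝓘(ℝ, ℝ)) ∞ τ.inv (τ.Φ q) :=
    τ.contMDiffOn_inv.contMDiffAt (τ.isOpen_image.mem_nhds (τ.Φ_mem hq))
  have h2 : ContMDiffAt J 𝓘(ℝ, EN) ∞ (extChartAt J p₀) (τ.inv (τ.Φ q)).1 := by
    rw [τ.inv_Φ hq]
    exact contMDiffAt_extChartAt' hp
  exact (ContMDiffAt.comp (τ.Φ q) h2 h1.fst).prodMk_space h1.snd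

theorem mfderiv_flatten {p₀ : N} {q : N × ℝ} (hq : q ∈ τ.dom)
    (hp : q.1 ∈ (chartAt HN p₀).source) (v : EN × ℝ) :
    mfderiv (𝓡 4) 𝓘(ℝ, EN × ℝ) (τ.flatten p₀) (τ.Φ q)
      (mfderiv (J.prod 𝓘(ℝ, ℝ)) (𝓡 4) τ.Φ q v) =
      ((mfderiv J 𝓘(ℝ, EN) (extChartAt J p₀) q.1 v.1, v.2) : EN × ℝ) := by
  have h1 : MDifferentiableAt (𝓡 4) 𝓘(ℝ, EN × ℝ) (τ.flatten p₀) (τ.Φ q) :=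
    (τ.contMDiffAt_flatten hq hp).mdifferentiableAt (by simp)
  have h2 := mfderiv_comp q h1 (τ.mdifferentiableAt_Φ hq)
  have h3 : HasMFDerivAt (J.prod 𝓘(ℝ, ℝ)) 𝓘(ℝ, EN × ℝ)
      (fun q : N × ℝ => (extChartAt J p₀ q.1, q.2)) q
      (((mfderiv J 𝓘(ℝ, EN) (extChartAt J p₀) q.1).comp (ContinuousLinearMap.fst ℝ EN ℝ)).prod
        (ContinuousLinearMap.snd ℝ EN ℝ)) := by
    have k1 : HasMFDerivAt J 𝓘(ℝ, EN) (extChartAt J p₀) q.1 _ :=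
      (mdifferentiableAt_extChartAt hp).hasMFDerivAt
    have k2 := HasMFDerivAt.comp q k1 (hasMFDerivAt_fst (I := J) (I' := 𝓘(ℝ, ℝ)) q)
    rw [modelWithCornersSelf_prod, ← chartedSpaceSelf_prod]
    exact HasMFDerivAt.prodMk k2 (hasMFDerivAt_snd (I := J) (I' := 𝓘(ℝ, ℝ)) q)
  have h4 : HasMFDerivAt (J.prod 𝓘(ℝ, ℝ)) 𝓘(ℝ, EN × ℝ) (τ.flatten p₀ ∘ τ.Φ) q _ :=
    h3.congr_of_eventuallyEq (Filter.eventually_of_mem (τ.isOpen_dom.mem_nhds hq) fun r hr => by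
      simp only [Function.comp_apply, flatten, τ.inv_Φ hr])
  have h5 := h2.symm.trans h4.mfderiv
  exact DFunLike.congr_fun h5 v

theorem isInvertible_mfderiv_flatten {p₀ : N} {q : N × ℝ} (hq : q ∈ τ.dom)
    (hp : q.1 ∈ (chartAt HN p₀).source) :
    (mfderiv (𝓡 4) 𝓘(ℝ, EN × ℝ) (τ.flatten p₀) (τ.Φ q)).IsInvertible := by
  have hc : Function.Bijective (mfderiv J 𝓘(ℝ, EN) (extChartAt J p₀) q.1) := by
    obtain ⟨e, he⟩ := isInvertible_mfderiv_extChartAt (I := J) (x := p₀) (y := q.1) (by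
      rw [extChartAt_source]; exact hp)
    rw [← he]
    exact e.bijective
  have hΦ := τ.bijective_Φ q.1 q.2 (τ.mk_mem_dom.1 hq)
  have hb : Function.Bijective (mfderiv (𝓡 4) 𝓘(ℝ, EN × ℝ) (τ.flatten p₀) (τ.Φ q)) := by
    constructor
    · intro a b hab
      obtain ⟨a', rfl⟩ := hΦ.2 a
      obtain ⟨b', rfl⟩ := hΦ.2 b
      have h1 := (τ.mfderiv_flatten hq hp a').symm.trans (hab.trans (τ.mfderiv_flatten hq hp b'))
      obtain ⟨h2, h3⟩ := Prod.mk.injEq _ _ _ _ ▸ h1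
      have h4 : a' = b' := Prod.ext (hc.1 h2) h3
      rw [h4]
    · intro c
      obtain ⟨d, hd⟩ := hc.2 (c : EN × ℝ).1
      exact ⟨_, (τ.mfderiv_flatten hq hp (d, (c : EN × ℝ).2)).trans (Prod.ext hd rfl)⟩
  let f : R4 →L[ℝ] EN × ℝ := mfderiv (𝓡 4) 𝓘(ℝ, EN × ℝ) (τ.flatten p₀) (τ.Φ q)
  have hf : Function.Bijective f.toLinearMap := hb
  exact ⟨(LinearEquiv.ofBijective f.toLinearMap hf).toContinuousLinearEquiv, rfl⟩

/-- `[T, w] = 0` for the `T`-invariant extension of a vector field `w` on `N`. -/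
theorem bracket_pushField_eq_zero {w : Π p : N, TangentSpace J p}
    (hw : ContMDiff J J.tangent ∞ fun p => (⟨p, w p⟩ : TangentBundle J N)) {x : M}
    (hx : x ∈ τ.image) :
    bracket (τ.pushField fun _ => (0, 1)) (τ.pushField fun q => (w q.1, 0)) x = 0 := by
  obtain ⟨q₀, hq₀, rfl⟩ := hx
  have hq₀ : q₀ ∈ τ.dom := hq₀
  set p₀ := q₀.1
  have := isManifold_minSmoothness (M := M) 2
  -- in the flattened tube, `T` is the constant field `(0, 1)` and `w` becomes a field `(w', 0)` which
  -- does not depend on the last coordinate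
  set w' : EN → EN := fun y => (trivializationAt EN (TangentSpace J : N → Type _) p₀
    ⟨(extChartAt J p₀).symm y, w ((extChartAt J p₀).symm y)⟩).2 with hw'
  have hw's : ContDiffAt ℝ ∞ w' (extChartAt J p₀ p₀) := by
    have h1 := (Bundle.contMDiffAt_section (n := ∞) (IB := J) p₀).1 (hw p₀)
    have h2 : ContMDiffAt 𝓘(ℝ, EN) J ∞ (extChartAt J p₀).symm (extChartAt J p₀ p₀) :=
      (contMDiffOn_extChartAt_symm (n := ∞) p₀).contMDiffAt (extChartAt_target_mem_nhds p₀)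
    exact (ContMDiffAt.comp (g := fun p => (trivializationAt EN (TangentSpace J : N → Type _) p₀
      ⟨p, w p⟩).2) (extChartAt J p₀ p₀) (by rwa [extChartAt_to_inv]) h2).contDiffAt
  set V : Π z : EN × ℝ, TangentSpace 𝓘(ℝ, EN × ℝ) z := fun _ => ((0, 1) : EN × ℝ)
  set W : Π z : EN × ℝ, TangentSpace 𝓘(ℝ, EN × ℝ) z := fun z => ((w' z.1, 0) : EN × ℝ)
  have hflat : τ.flatten p₀ (τ.Φ q₀) = (extChartAt J p₀ p₀, q₀.2) := by
    rw [flatten, τ.inv_Φ hq₀]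
  have hWd : ContDiffAt ℝ ∞ (fun z : EN × ℝ => ((w' z.1, 0) : EN × ℝ))
      (extChartAt J p₀ p₀, q₀.2) :=
    (ContDiffAt.comp (extChartAt J p₀ p₀, q₀.2) hw's contDiffAt_fst).prodMk contDiffAt_const
  have hopen : IsOpen (τ.dom ∩ Prod.fst ⁻¹' (chartAt HN p₀).source) :=
    τ.isOpen_dom.inter ((chartAt HN p₀).open_source.preimage continuous_fst)
  have hnhds : τ.Φ '' (τ.dom ∩ Prod.fst ⁻¹' (chartAt HN p₀).source) ∈ 𝓝 (τ.Φ q₀) :=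
    (τ.isOpen_image_Φ inter_subset_left hopen).mem_nhds
      ⟨q₀, ⟨hq₀, mem_chart_source HN p₀⟩, rfl⟩
  have hV : ∀ᶠ x in 𝓝 (τ.Φ q₀), τ.pushField (fun _ => (0, 1)) x =
      VectorField.mpullback (𝓡 4) 𝓘(ℝ, EN × ℝ) (τ.flatten p₀) V x := by
    filter_upwards [hnhds] with x hx
    obtain ⟨q, ⟨hq, hp⟩, rfl⟩ := hx
    rw [VectorField.mpullback_apply, eq_comm,
      (τ.isInvertible_mfderiv_flatten hq hp).inverse_apply_eq, τ.pushField_Φ _ hq]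
    refine Eq.trans ?_ (τ.mfderiv_flatten hq hp (0, 1)).symm
    change ((0, 1) : EN × ℝ) = _
    exact Prod.ext (map_zero (mfderiv J 𝓘(ℝ, EN) (extChartAt J p₀) q.1)).symm rfl
  have hW : ∀ᶠ x in 𝓝 (τ.Φ q₀), τ.pushField (fun q => (w q.1, 0)) x =
      VectorField.mpullback (𝓡 4) 𝓘(ℝ, EN × ℝ) (τ.flatten p₀) W x := by
    filter_upwards [hnhds] with x hx
    obtain ⟨q, ⟨hq, hp⟩, rfl⟩ := hx
    rw [VectorField.mpullback_apply, eq_comm,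
      (τ.isInvertible_mfderiv_flatten hq hp).inverse_apply_eq, τ.pushField_Φ _ hq]
    refine Eq.trans ?_ (τ.mfderiv_flatten hq hp (w q.1, 0)).symm
    change ((w' (τ.flatten p₀ (τ.Φ q)).1, 0) : EN × ℝ) = _
    refine Prod.ext ?_ rfl
    change w' (τ.flatten p₀ (τ.Φ q)).1 = mfderiv J 𝓘(ℝ, EN) (extChartAt J p₀) q.1 (w q.1)
    rw [flatten, τ.inv_Φ hq, hw']
    dsimp only
    have hps : q.1 ∈ (extChartAt J p₀).source := by rw [extChartAt_source]; exact hp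
    rw [(extChartAt J p₀).left_inv hps, ← TangentBundle.continuousLinearMapAt_trivializationAt hp]
    change _ = (trivializationAt EN (TangentSpace J : N → Type _) p₀).linearMapAt ℝ q.1 (w q.1)
    rw [Bundle.Trivialization.linearMapAt_apply, if_pos]
    exact hp
  have hbr : bracket (τ.pushField fun _ => (0, 1)) (τ.pushField fun q => (w q.1, 0)) (τ.Φ q₀) =
      VectorField.mpullback (𝓡 4) 𝓘(ℝ, EN × ℝ) (τ.flatten p₀)
        (VectorField.mlieBracket 𝓘(ℝ, EN × ℝ) V W) (τ.Φ q₀) := by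
    refine (Filter.EventuallyEq.mlieBracket_vectorField_eq hV hW).trans ?_
    refine (VectorField.mpullback_mlieBracket (n := ∞) ?_ ?_
      (τ.contMDiffAt_flatten hq₀ (mem_chart_source HN p₀)) ?_).symm
    · rw [hflat]
      exact (contMDiffAt_vectorSpace_iff_contDiffAt.2
        (contDiffAt_const : ContDiffAt ℝ 1 (fun _ : EN × ℝ => ((0, 1) : EN × ℝ)) _)).mdifferentiableAt
        one_ne_zero
    · rw [hflat]
      exact (contMDiffAt_vectorSpace_iff_contDiffAt.2 hWd).mdifferentiableAt (by simp)
    · rw [minSmoothness_of_isRCLikeNormedField]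
      exact WithTop.coe_le_coe.2 (le_top : (2 : ℕ∞) ≤ ⊤)
  have hzero : VectorField.mlieBracket 𝓘(ℝ, EN × ℝ) V W (τ.flatten p₀ (τ.Φ q₀)) = 0 := by
    rw [← VectorField.mlieBracketWithin_univ, VectorField.mlieBracketWithin_eq_lieBracketWithin,
      VectorField.lieBracketWithin_univ, hflat]
    change fderiv ℝ (fun z : EN × ℝ => ((w' z.1, 0) : EN × ℝ)) _ ((0, 1) : EN × ℝ) -
      fderiv ℝ (fun _ : EN × ℝ => ((0, 1) : EN × ℝ)) _ _ = 0
    have h1 : HasFDerivAt (fun z : EN × ℝ => ((w' z.1, 0) : EN × ℝ)) _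
        (extChartAt J p₀ p₀, q₀.2) :=
      (HasFDerivAt.comp (g := w') (extChartAt J p₀ p₀, q₀.2)
        (hw's.differentiableAt (by simp)).hasFDerivAt hasFDerivAt_fst).prodMk
        (hasFDerivAt_const (0 : ℝ) _)
    rw [h1.fderiv, fderiv_fun_const]
    simp
  rw [hbr, VectorField.mpullback_apply, hzero, map_zero]

end Tube

/-! ### Plane fields given by curves in a tube -/

/-- The cross product in `ℝ³`. -/
def cross (u v : R3) : R3 := !₂[u 1 * v 2 - u 2 * v 1, u 2 * v 0 - u 0 * v 2, u 0 * v 1 - u 1 * v 0]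

theorem cross_zero (u v : R3) : cross u v 0 = u 1 * v 2 - u 2 * v 1 := rfl
theorem cross_one (u v : R3) : cross u v 1 = u 2 * v 0 - u 0 * v 2 := rfl
theorem cross_two (u v : R3) : cross u v 2 = u 0 * v 1 - u 1 * v 0 := rfl

theorem inner_eq_three (u v : R3) : inner ℝ u v = u 0 * v 0 + u 1 * v 1 + u 2 * v 2 := by
  rw [PiLp.inner_apply, Fin.sum_univ_three]
  simp only [RCLike.inner_apply, conj_trivial]
  ring

theorem det3_eq_inner_cross (u v w : R3) : det3 u v w = inner ℝ w (cross u v) := by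
  rw [inner_eq_three, cross_zero, cross_one, cross_two, det3, Matrix.det_fin_three]
  simp
  ring

theorem inner_cross_self (u v : R3) :
    inner ℝ (cross u v) (cross u v) = inner ℝ u u * inner ℝ v v - inner ℝ u v ^ 2 := by
  simp only [inner_eq_three, cross_zero, cross_one, cross_two]
  ring

theorem inner_cross_left (u v : R3) : inner ℝ u (cross u v) = 0 := by
  simp only [inner_eq_three, cross_zero, cross_one, cross_two]
  ring

theorem inner_cross_right (u v : R3) : inner ℝ v (cross u v) = 0 := by
  simp only [inner_eq_three, cross_zero, cross_one, cross_two]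
  ring

/-- Decomposition of a vector in the orthogonal basis `u, v, u × v`, where `u` is a unit vector. -/
theorem eq_smul_add_smul_add_cross {u v : R3} (hu : ‖u‖ = 1) (hv : v ≠ 0) (huv : inner ℝ u v = 0)
    (w : R3) (i : Fin 3) : w i = inner ℝ u w * u i + inner ℝ v w / ‖v‖ ^ 2 * v i +
      inner ℝ w (cross u v) / ‖v‖ ^ 2 * cross u v i := by
  have hu' : u 0 * u 0 + u 1 * u 1 + u 2 * u 2 = 1 := by
    rw [← inner_eq_three, real_inner_self_eq_norm_sq, hu, one_pow]
  have huv' := huv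
  rw [inner_eq_three] at huv'
  have hm : ‖v‖ ^ 2 ≠ 0 := pow_ne_zero _ (norm_ne_zero_iff.2 hv)
  have key : ‖v‖ ^ 2 * w i = ‖v‖ ^ 2 * (inner ℝ u w * u i) + inner ℝ v w * v i +
      inner ℝ w (cross u v) * cross u v i := by
    rw [← real_inner_self_eq_norm_sq]
    simp only [inner_eq_three, cross_zero, cross_one, cross_two]
    fin_cases i
    all_goals simp only [Fin.zero_eta, Fin.mk_one, Fin.reduceFinMk, cross_zero, cross_one, cross_two]
    · linear_combination (-(w 0 * (v 0 * v 0 + v 1 * v 1 + v 2 * v 2)) + v 0 * (v 0 * w 0 + v 1 * w 1 + v 2 * w 2)) * hu' +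
        (w 0 * (u 0 * v 0 + u 1 * v 1 + u 2 * v 2) - u 0 * (v 0 * w 0 + v 1 * w 1 + v 2 * w 2) - v 0 * (u 0 * w 0 + u 1 * w 1 + u 2 * w 2)) * huv'
    · linear_combination (-(w 1 * (v 0 * v 0 + v 1 * v 1 + v 2 * v 2)) + v 1 * (v 0 * w 0 + v 1 * w 1 + v 2 * w 2)) * hu' +
        (w 1 * (u 0 * v 0 + u 1 * v 1 + u 2 * v 2) - u 1 * (v 0 * w 0 + v 1 * w 1 + v 2 * w 2) - v 1 * (u 0 * w 0 + u 1 * w 1 + u 2 * w 2)) * huv'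
    · linear_combination (-(w 2 * (v 0 * v 0 + v 1 * v 1 + v 2 * v 2)) + v 2 * (v 0 * w 0 + v 1 * w 1 + v 2 * w 2)) * hu' +
        (w 2 * (u 0 * v 0 + u 1 * v 1 + u 2 * v 2) - u 2 * (v 0 * w 0 + v 1 * w 1 + v 2 * w 2) - v 2 * (u 0 * w 0 + u 1 * w 1 + u 2 * w 2)) * huv'
  field_simp
  linear_combination key

namespace Tube

universe u

variable {M : Type u} [TopologicalSpace M] [ChartedSpace R4 M] [IsManifold (𝓡 4) ∞ M]
  {EN : Type*} [NormedAddCommGroup EN] [NormedSpace ℝ EN] [FiniteDimensional ℝ EN]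
  {HN : Type*} [TopologicalSpace HN]
  {D : Π x : M, Submodule ℝ (TangentSpace (𝓡 4) x)} {J : ModelWithCorners ℝ EN HN} [J.Boundaryless]
  {N : Type*} [TopologicalSpace N] [ChartedSpace HN N] [IsManifold J ∞ N] [Nonempty N]
  (τ : Tube D J N)

/-- The components of a vector with respect to the frame `T, X, Y, Z` of the tube; zero outside
the tube. -/
def frameCoord (i : Fin 4) (x : M) : TangentSpace (𝓡 4) x →ₗ[ℝ] ℝ :=
  open Classical in if hx : x ∈ τ.image then (frameBasis (τ.indep_field hx)).coord i else 0

theorem frameCoord_field {x : M} (hx : x ∈ τ.image) (i j : Fin 4) :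
    τ.frameCoord i x (τ.field j x) = if i = j then 1 else 0 := by
  rw [frameCoord, dif_pos hx]
  exact frameBasis_coord (τ.indep_field hx) i j

theorem eq_sum_frameCoord {x : M} (hx : x ∈ τ.image) (v : TangentSpace (𝓡 4) x) :
    v = τ.frameCoord 0 x v • τ.field 0 x + τ.frameCoord 1 x v • τ.field 1 x +
      τ.frameCoord 2 x v • τ.field 2 x + τ.frameCoord 3 x v • τ.field 3 x := by
  simp only [frameCoord, dif_pos hx]
  exact frameBasis_sum (τ.indep_field hx) v

theorem smooth_frameCoord {U : Set M} (hU : IsOpen U) (hUi : U ⊆ τ.image)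
    {V : Π x : M, TangentSpace (𝓡 4) x} (hV : SmoothFieldOn V U) (i : Fin 4) :
    ContMDiffOn (𝓡 4) 𝓘(ℝ) ∞ (fun x => τ.frameCoord i x (V x)) U := by
  intro x₀ hx₀
  obtain ⟨O, hO, hx, hOU, -, c, hc, hcs, -⟩ := exists_dual_coeff hU hx₀
    (fun i => (τ.smooth_field i).mono hUi) (τ.indep_field (hUi hx₀))
  refine (ContMDiffAt.contMDiffWithinAt ?_)
  refine ((hcs i V O hO Subset.rfl (hV.mono hOU)).congr fun x hx => ?_).contMDiffAt
    (hO.mem_nhds hx)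
  have : c i x = τ.frameCoord i x := by
    refine (frameBasis (τ.indep_field (hUi (hOU hx)))).ext fun j => ?_
    have hj : frameBasis (τ.indep_field (hUi (hOU hx))) j = τ.field j x :=
      Module.Basis.mk_apply _ _ j
    rw [hj, hc x hx, τ.frameCoord_field (hUi (hOU hx))]
  rw [this]

/-- The components, as functions on the tube, of a family of curves in `ℝ³`. -/
def comp (h : N → ℝ → R3) (i : Fin 3) (x : M) : ℝ := h (τ.inv x).1 (τ.inv x).2 i

/-- The vector field `h₁ X + h₂ Y + h₃ Z` on the tube given by a family of curves in `ℝ³`. -/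
def push (h : N → ℝ → R3) : Π x : M, TangentSpace (𝓡 4) x := fun x =>
  τ.comp h 0 x • τ.field 1 x + τ.comp h 1 x • τ.field 2 x + τ.comp h 2 x • τ.field 3 x

/-- The family of curves `h` is smooth on the domain of the tube. -/
def SmoothCurves (h : N → ℝ → R3) : Prop :=
  ContMDiffOn (J.prod 𝓘(ℝ, ℝ)) 𝓘(ℝ, R3) ∞ (fun q : N × ℝ => h q.1 q.2) τ.dom

variable {τ} in
theorem SmoothCurves.deriv {h : N → ℝ → R3} (hs : τ.SmoothCurves h) :
    τ.SmoothCurves fun p => deriv (h p) :=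
  contMDiffOn_deriv_snd (by simp) τ.isOpen_dom hs

variable {τ} in
theorem SmoothCurves.apply {h : N → ℝ → R3} (hs : τ.SmoothCurves h) (i : Fin 3) :
    ContMDiffOn (J.prod 𝓘(ℝ, ℝ)) 𝓘(ℝ) ∞ (fun q : N × ℝ => h q.1 q.2 i) τ.dom :=
  ((EuclideanSpace.proj i : R3 →L[ℝ] ℝ).contDiff.contMDiff).comp_contMDiffOn hs

variable {τ} in
theorem smoothCurves_of_apply {h : N → ℝ → R3} (hs : ∀ i,
    ContMDiffOn (J.prod 𝓘(ℝ, ℝ)) 𝓘(ℝ) ∞ (fun q : N × ℝ => h q.1 q.2 i) τ.dom) :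
    τ.SmoothCurves h := by
  have h1 : ContMDiffOn (J.prod 𝓘(ℝ, ℝ)) 𝓘(ℝ, Fin 3 → ℝ) ∞
      (fun q : N × ℝ => fun i => h q.1 q.2 i) τ.dom := contMDiffOn_pi_space.2 hs
  exact ((EuclideanSpace.equiv (Fin 3) ℝ).symm : (Fin 3 → ℝ) →L[ℝ] R3).contDiff.contMDiff.comp_contMDiffOn h1

variable {τ} in
theorem SmoothCurves.cross {h k : N → ℝ → R3} (hs : τ.SmoothCurves h) (ks : τ.SmoothCurves k) :
    τ.SmoothCurves fun p t => cross (h p t) (k p t) := by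
  have hm : ∀ i j, ContMDiffOn (J.prod 𝓘(ℝ, ℝ)) 𝓘(ℝ) ∞
      (fun q : N × ℝ => h q.1 q.2 i * k q.1 q.2 j) τ.dom :=
    fun i j => (hs.apply i).mul (ks.apply j)
  refine smoothCurves_of_apply fun i => ?_
  fin_cases i
  exacts [(hm 1 2).sub (hm 2 1), (hm 2 0).sub (hm 0 2), (hm 0 1).sub (hm 1 0)]

variable {τ} in
theorem SmoothCurves.inner {h k : N → ℝ → R3} (hs : τ.SmoothCurves h) (ks : τ.SmoothCurves k) :
    ContMDiffOn (J.prod 𝓘(ℝ, ℝ)) 𝓘(ℝ) ∞ (fun q : N × ℝ => inner ℝ (h q.1 q.2) (k q.1 q.2))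
      τ.dom := by
  simp only [inner_eq_three]
  exact (((hs.apply 0).mul (ks.apply 0)).add ((hs.apply 1).mul (ks.apply 1))).add
    ((hs.apply 2).mul (ks.apply 2))

variable {τ} in
theorem SmoothCurves.differentiableAt {h : N → ℝ → R3} (hs : τ.SmoothCurves h) {p : N} {t : ℝ}
    (ht : t ∈ Ioo (-τ.ε) τ.ε) : DifferentiableAt ℝ (h p) t := by
  have h1 : ContMDiffAt (J.prod 𝓘(ℝ, ℝ)) 𝓘(ℝ, R3) ∞ (fun q : N × ℝ => h q.1 q.2) (p, t) :=
    ContMDiffOn.contMDiffAt hs (τ.isOpen_dom.mem_nhds (τ.mk_mem_dom.2 ht))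
  have h2 : ContMDiffAt 𝓘(ℝ, ℝ) 𝓘(ℝ, R3) ∞ (h p) t :=
    ContMDiffAt.comp (f := fun t : ℝ => (p, t)) t h1 (contMDiffAt_const.prodMk contMDiffAt_id)
  exact h2.contDiffAt.differentiableAt (by simp)

theorem smooth_comp_inv {f : N × ℝ → ℝ} (hf : ContMDiffOn (J.prod 𝓘(ℝ, ℝ)) 𝓘(ℝ) ∞ f τ.dom) :
    ContMDiffOn (𝓡 4) 𝓘(ℝ) ∞ (fun x => f (τ.inv x)) τ.image :=
  hf.comp τ.contMDiffOn_inv fun _ hx => τ.inv_mem hx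

variable {τ} in
theorem SmoothCurves.comp {h : N → ℝ → R3} (hs : τ.SmoothCurves h) (i : Fin 3) :
    ContMDiffOn (𝓡 4) 𝓘(ℝ) ∞ (τ.comp h i) τ.image := τ.smooth_comp_inv (hs.apply i)

variable {τ} in
theorem SmoothCurves.push {h : N → ℝ → R3} (hs : τ.SmoothCurves h) :
    SmoothFieldOn (τ.push h) τ.image :=
  (((τ.smooth_field 1).smul (hs.comp 0)).add ((τ.smooth_field 2).smul (hs.comp 1))).add
    ((τ.smooth_field 3).smul (hs.comp 2))

theorem comp_Φ (h : N → ℝ → R3) (i : Fin 3) {q : N × ℝ} (hq : q ∈ τ.dom) :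
    τ.comp h i (τ.Φ q) = h q.1 q.2 i := by
  rw [comp, τ.inv_Φ hq]

theorem push_Φ (h : N → ℝ → R3) {q : N × ℝ} (hq : q ∈ τ.dom) :
    τ.push h (τ.Φ q) = mfderiv (J.prod 𝓘(ℝ, ℝ)) (𝓡 4) τ.Φ q
      ((h q.1 q.2 0 • τ.X q.1 + h q.1 q.2 1 • τ.Y q.1 + h q.1 q.2 2 • τ.Z q.1, 0) : EN × ℝ) := by
  let x : EN := τ.X q.1
  let y : EN := τ.Y q.1
  let z : EN := τ.Z q.1
  have h1 : ((h q.1 q.2 0 • x + h q.1 q.2 1 • y + h q.1 q.2 2 • z, 0) : EN × ℝ) =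
      h q.1 q.2 0 • (x, (0 : ℝ)) + h q.1 q.2 1 • (y, (0 : ℝ)) + h q.1 q.2 2 • (z, (0 : ℝ)) := by
    simp
  rw [push, τ.comp_Φ h 0 hq, τ.comp_Φ h 1 hq, τ.comp_Φ h 2 hq, τ.field_Φ 1 hq, τ.field_Φ 2 hq,
    τ.field_Φ 3 hq]
  refine Eq.trans ?_ (congrArg (mfderiv (J.prod 𝓘(ℝ, ℝ)) (𝓡 4) τ.Φ q) h1.symm)
  refine Eq.symm ((map_add _ _ _).trans (congrArg₂ (· + ·) ((map_add _ _ _).trans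
    (congrArg₂ (· + ·) (map_smul _ _ _) (map_smul _ _ _))) (map_smul _ _ _)))

theorem planeAt_eq (h : N → ℝ → R3) {p : N} {t : ℝ} (ht : t ∈ Ioo (-τ.ε) τ.ε) :
    planeAt J τ.Φ τ.X τ.Y τ.Z p t (h p t) =
      Submodule.span ℝ {τ.field 0 (τ.Φ (p, t)), τ.push h (τ.Φ (p, t))} := by
  rw [τ.push_Φ h (τ.mk_mem_dom.2 ht), τ.field_Φ 0 (τ.mk_mem_dom.2 ht)]
  rfl

theorem mfderiv_comp_field_zero {h : N → ℝ → R3} (hs : τ.SmoothCurves h) (i : Fin 3) {x : M}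
    (hx : x ∈ τ.image) : mfderiv (𝓡 4) 𝓘(ℝ) (τ.comp h i) x (τ.field 0 x) =
      τ.comp (fun p => deriv (h p)) i x := by
  obtain ⟨q, hq, rfl⟩ := hx
  have hq : q ∈ τ.dom := hq
  have hd : MDifferentiableAt (𝓡 4) 𝓘(ℝ) (τ.comp h i) (τ.Φ q) :=
    ((hs.comp i).contMDiffAt (τ.isOpen_image.mem_nhds (τ.Φ_mem hq))).mdifferentiableAt (by simp)
  have h1 := mfderiv_comp q hd (τ.mdifferentiableAt_Φ hq)
  have h2 : (τ.comp h i ∘ τ.Φ) =ᶠ[𝓝 q] fun q => h q.1 q.2 i := by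
    filter_upwards [τ.isOpen_dom.mem_nhds hq] with q' hq'
    exact τ.comp_Φ h i hq'
  have hmd : MDifferentiableAt (J.prod 𝓘(ℝ, ℝ)) 𝓘(ℝ) (fun q : N × ℝ => h q.1 q.2 i) q :=
    ((hs.apply i).contMDiffAt (τ.isOpen_dom.mem_nhds hq)).mdifferentiableAt (by simp)
  have h3 := mfderiv_snd_eq_deriv hmd
  rw [h2.mfderiv_eq] at h1
  have h4 : deriv (fun t => h q.1 t i) q.2 = deriv (h q.1) q.2 i := by
    have := (EuclideanSpace.proj i : R3 →L[ℝ] ℝ).hasFDerivAt.comp_hasDerivAt q.2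
      (hs.differentiableAt (p := q.1) (τ.mk_mem_dom.1 hq)).hasDerivAt
    exact this.deriv
  have h5 : mfderiv (𝓡 4) 𝓘(ℝ) (τ.comp h i) (τ.Φ q) (τ.field 0 (τ.Φ q)) =
      mfderiv (J.prod 𝓘(ℝ, ℝ)) 𝓘(ℝ) (fun q : N × ℝ => h q.1 q.2 i) q ((0, 1) : EN × ℝ) := by
    rw [τ.field_Φ 0 hq, h1]
    rfl
  exact h5.trans (h3.trans (h4.trans (τ.comp_Φ (fun p => deriv (h p)) i hq).symm))

/-- Since the fields `X, Y, Z` are `T`-invariant, the bracket with `T` differentiates curves. -/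
theorem bracket_field_zero_push {h : N → ℝ → R3} (hs : τ.SmoothCurves h) {x : M}
    (hx : x ∈ τ.image) :
    bracket (τ.field 0) (τ.push h) x = τ.push (fun p => deriv (h p)) x := by
  have := isManifold_minSmoothness (M := M) 2
  have hsm : ∀ (i : Fin 3) (j : Fin 4), SmoothFieldOn (fun x => τ.comp h i x • τ.field j x) τ.image :=
    fun i j => (τ.smooth_field j).smul (hs.comp i)
  have hb : ∀ j : Fin 3, bracket (τ.field 0) (τ.field j.succ) x = 0 := by
    intro j
    fin_cases j
    exacts [τ.bracket_pushField_eq_zero τ.smooth_X hx, τ.bracket_pushField_eq_zero τ.smooth_Y hx,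
      τ.bracket_pushField_eq_zero τ.smooth_Z hx]
  have hsmul : ∀ i j : Fin 3, VectorField.mlieBracket (𝓡 4) (τ.field 0)
      (τ.comp h i • τ.field j.succ) x = τ.comp (fun p => deriv (h p)) i x • τ.field j.succ x := by
    intro i j
    have h1 : MDifferentiableAt (𝓡 4) 𝓘(ℝ) (τ.comp h i) x :=
      ((hs.comp i).contMDiffAt (τ.isOpen_image.mem_nhds hx)).mdifferentiableAt (by simp)
    rw [VectorField.mlieBracket_smul_right h1
      ((τ.smooth_field j.succ).mdifferentiableAt τ.isOpen_image hx)]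
    have h2 : VectorField.mlieBracket (𝓡 4) (τ.field 0) (τ.field j.succ) x = 0 := hb j
    rw [h2, smul_zero, add_zero]
    exact congrArg (· • τ.field j.succ x) (τ.mfderiv_comp_field_zero hs i hx)
  have a1 := VectorField.mlieBracket_add_right (V := τ.field 0)
    (((hsm 0 1).add (hsm 1 2)).mdifferentiableAt τ.isOpen_image hx)
    ((hsm 2 3).mdifferentiableAt τ.isOpen_image hx)
  have a2 := VectorField.mlieBracket_add_right (V := τ.field 0)
    ((hsm 0 1).mdifferentiableAt τ.isOpen_image hx) ((hsm 1 2).mdifferentiableAt τ.isOpen_image hx)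
  exact a1.trans (congrArg₂ (· + ·) (a2.trans (congrArg₂ (· + ·) (hsmul 0 0) (hsmul 1 1)))
    (hsmul 2 2))

end Tube

namespace Tube

universe u

variable {M : Type u} [TopologicalSpace M] [ChartedSpace R4 M] [IsManifold (𝓡 4) ∞ M]
  {EN : Type*} [NormedAddCommGroup EN] [NormedSpace ℝ EN] [FiniteDimensional ℝ EN]
  {HN : Type*} [TopologicalSpace HN]
  {D : Π x : M, Submodule ℝ (TangentSpace (𝓡 4) x)} {J : ModelWithCorners ℝ EN HN} [J.Boundaryless]
  {N : Type*} [TopologicalSpace N] [ChartedSpace HN N] [IsManifold J ∞ N] [Nonempty N]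
  (τ : Tube D J N)

/-- `h` is a smooth family of immersed curves in the unit sphere. -/
structure IsCurveFamily (h : N → ℝ → R3) : Prop where
  smooth : τ.SmoothCurves h
  norm_eq : ∀ p, ∀ t ∈ Ioo (-τ.ε) τ.ε, ‖h p t‖ = 1
  deriv_ne : ∀ p, ∀ t ∈ Ioo (-τ.ε) τ.ε, deriv (h p) t ≠ 0

theorem inv_snd_mem {x : M} (hx : x ∈ τ.image) : (τ.inv x).2 ∈ Ioo (-τ.ε) τ.ε :=
  (τ.inv_mem hx).2

theorem frameCoord_push {x : M} (hx : x ∈ τ.image) (h : N → ℝ → R3) :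
    τ.frameCoord 0 x (τ.push h x) = 0 ∧ ∀ i : Fin 3, τ.frameCoord i.succ x (τ.push h x) = τ.comp h i x := by
  have hf := τ.frameCoord_field hx
  have key : ∀ i, τ.frameCoord i x (τ.push h x) = τ.comp h 0 x * (if i = 1 then 1 else 0) +
      τ.comp h 1 x * (if i = 2 then 1 else 0) + τ.comp h 2 x * (if i = 3 then 1 else 0) := by
    intro i
    rw [← hf i 1, ← hf i 2, ← hf i 3, push, map_add, map_add, map_smul, map_smul, map_smul]
    rfl
  refine ⟨by simp +decide [key], fun i => ?_⟩
  fin_cases i <;> simp +decide [key]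

/-- The normal `h × h'` to the curves `h` in the sphere. -/
def normal (h : N → ℝ → R3) : N → ℝ → R3 := fun p t => cross (h p t) (deriv (h p) t)

/-- The coefficient of `h × h'` in the decomposition of a vector with respect to the frame
`T, h, h', h × h'`. -/
def normalCoord (h : N → ℝ → R3) (x : M) : TangentSpace (𝓡 4) x →ₗ[ℝ] ℝ :=
  (‖deriv (h (τ.inv x).1) (τ.inv x).2‖ ^ 2)⁻¹ • (τ.comp (normal h) 0 x • τ.frameCoord 1 x +
    τ.comp (normal h) 1 x • τ.frameCoord 2 x + τ.comp (normal h) 2 x • τ.frameCoord 3 x)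

theorem normalCoord_apply (h : N → ℝ → R3) (x : M) (v : TangentSpace (𝓡 4) x) :
    τ.normalCoord h x v = (‖deriv (h (τ.inv x).1) (τ.inv x).2‖ ^ 2)⁻¹ *
      (τ.comp (normal h) 0 x * τ.frameCoord 1 x v + τ.comp (normal h) 1 x * τ.frameCoord 2 x v +
        τ.comp (normal h) 2 x * τ.frameCoord 3 x v) := rfl

theorem normalCoord_push (h k : N → ℝ → R3) {x : M} (hx : x ∈ τ.image) :
    τ.normalCoord h x (τ.push k x) = (‖deriv (h (τ.inv x).1) (τ.inv x).2‖ ^ 2)⁻¹ *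
      inner ℝ (k (τ.inv x).1 (τ.inv x).2) (normal h (τ.inv x).1 (τ.inv x).2) := by
  have h1 := (τ.frameCoord_push hx k).2
  have e0 : τ.frameCoord 1 x (τ.push k x) = _ := h1 0
  have e1 : τ.frameCoord 2 x (τ.push k x) = _ := h1 1
  have e2 : τ.frameCoord 3 x (τ.push k x) = _ := h1 2
  rw [normalCoord_apply, e0, e1, e2, inner_eq_three]
  simp only [comp]
  ring

/-- The coefficient of `h × h'` in `[T, h']`: the curvature of the curves `h`, up to a positive
factor. -/
def kap₁ (h : N → ℝ → R3) (x : M) : ℝ := τ.normalCoord h x (τ.push (fun p => deriv (deriv (h p))) x)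

/-- The coefficient of `h × h'` in `[h, h']`. -/
def kap₂ (h : N → ℝ → R3) (x : M) : ℝ :=
  τ.normalCoord h x (bracket (τ.push h) (τ.push fun p => deriv (h p)) x)

theorem kap₁_eq (h : N → ℝ → R3) {x : M} (hx : x ∈ τ.image) : τ.kap₁ h x =
    (‖deriv (h (τ.inv x).1) (τ.inv x).2‖ ^ 2)⁻¹ * convexity (h (τ.inv x).1) (τ.inv x).2 := by
  rw [kap₁, τ.normalCoord_push _ _ hx, convexity, det3_eq_inner_cross]
  rfl

namespace IsCurveFamily

variable {τ} {h : N → ℝ → R3}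

theorem smooth_normal (hh : τ.IsCurveFamily h) : τ.SmoothCurves (normal h) :=
  hh.smooth.cross hh.smooth.deriv

theorem inner_deriv (hh : τ.IsCurveFamily h) (p : N) {t : ℝ} (ht : t ∈ Ioo (-τ.ε) τ.ε) :
    inner ℝ (h p t) (deriv (h p) t) = 0 := by
  have h1 := (hh.smooth.differentiableAt (p := p) ht).hasDerivAt
  have h2 := h1.inner ℝ h1
  have h3 : (fun t => inner ℝ (h p t) (h p t)) =ᶠ[𝓝 t] fun _ => (1 : ℝ) := by
    filter_upwards [isOpen_Ioo.mem_nhds ht] with s hs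
    rw [real_inner_self_eq_norm_sq, hh.norm_eq p s hs, one_pow]
  have h4 := h2.deriv
  rw [h3.deriv_eq, deriv_const, real_inner_comm] at h4
  rw [real_inner_comm]
  linarith

theorem inner_normal_self (hh : τ.IsCurveFamily h) (p : N) {t : ℝ} (ht : t ∈ Ioo (-τ.ε) τ.ε) :
    inner ℝ (normal h p t) (normal h p t) = ‖deriv (h p) t‖ ^ 2 := by
  rw [normal, inner_cross_self, hh.inner_deriv p ht, real_inner_self_eq_norm_sq,
    real_inner_self_eq_norm_sq, hh.norm_eq p t ht]
  ring

theorem norm_ne (hh : τ.IsCurveFamily h) (p : N) {t : ℝ} (ht : t ∈ Ioo (-τ.ε) τ.ε) :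
    ‖deriv (h p) t‖ ^ 2 ≠ 0 := pow_ne_zero _ (norm_ne_zero_iff.2 (hh.deriv_ne p t ht))

theorem normalCoord_field_zero (h : N → ℝ → R3) {x : M} (hx : x ∈ τ.image) :
    τ.normalCoord h x (τ.field 0 x) = 0 := by
  rw [normalCoord_apply, τ.frameCoord_field hx, τ.frameCoord_field hx, τ.frameCoord_field hx]
  simp

theorem normalCoord_self (h : N → ℝ → R3) {x : M} (hx : x ∈ τ.image) :
    τ.normalCoord h x (τ.push h x) = 0 := by
  rw [τ.normalCoord_push _ _ hx, normal, inner_cross_left, mul_zero]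

theorem normalCoord_deriv (h : N → ℝ → R3) {x : M} (hx : x ∈ τ.image) :
    τ.normalCoord h x (τ.push (fun p => deriv (h p)) x) = 0 := by
  rw [τ.normalCoord_push _ _ hx, normal, inner_cross_right, mul_zero]

theorem normalCoord_normal (hh : τ.IsCurveFamily h) {x : M} (hx : x ∈ τ.image) :
    τ.normalCoord h x (τ.push (normal h) x) = 1 := by
  rw [τ.normalCoord_push _ _ hx, hh.inner_normal_self _ (τ.inv_snd_mem hx)]
  exact inv_mul_cancel₀ (hh.norm_ne _ (τ.inv_snd_mem hx))

theorem smooth_normalCoord (hh : τ.IsCurveFamily h) {V : Π x : M, TangentSpace (𝓡 4) x}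
    (hV : SmoothFieldOn V τ.image) :
    ContMDiffOn (𝓡 4) 𝓘(ℝ) ∞ (fun x => τ.normalCoord h x (V x)) τ.image := by
  have h1 : ContMDiffOn (J.prod 𝓘(ℝ, ℝ)) 𝓘(ℝ) ∞
      (fun q : N × ℝ => (inner ℝ (deriv (h q.1) q.2) (deriv (h q.1) q.2))⁻¹) τ.dom :=
    (hh.smooth.deriv.inner hh.smooth.deriv).inv₀ fun q hq => by
      rw [real_inner_self_eq_norm_sq]
      exact hh.norm_ne q.1 (τ.mk_mem_dom.1 hq)
  have h2 := τ.smooth_comp_inv h1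
  have hc := fun i => τ.smooth_frameCoord τ.isOpen_image Subset.rfl hV i
  have hn := fun i => hh.smooth_normal.comp i
  refine (h2.mul ((((hn 0).mul (hc 1)).add ((hn 1).mul (hc 2))).add ((hn 2).mul (hc 3)))).congr ?_
  intro x hx
  rw [normalCoord_apply, ← real_inner_self_eq_norm_sq]
  rfl

theorem indep (hh : τ.IsCurveFamily h) {x : M} (hx : x ∈ τ.image) : LinearIndependent ℝ
    ![τ.field 0 x, τ.push h x, τ.push (fun p => deriv (h p)) x, τ.push (normal h) x] := by
  rw [linearIndependent_four_iff]
  intro a b c d habcd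
  change a • τ.field 0 x + b • τ.push h x + c • τ.push (fun p => deriv (h p)) x +
    d • τ.push (normal h) x = 0 at habcd
  have ht := τ.inv_snd_mem hx
  have hd : d = 0 := by
    have := congrArg (τ.normalCoord h x) habcd
    rw [map_add, map_add, map_add, map_smul, map_smul, map_smul, map_smul,
      normalCoord_field_zero h hx, normalCoord_self h hx, normalCoord_deriv h hx,
      hh.normalCoord_normal hx, map_zero] at this
    simpa using this
  subst hd
  have ha : a = 0 := by
    have := congrArg (τ.frameCoord 0 x) habcd
    rw [map_add, map_add, map_add, map_smul, map_smul, map_smul, map_smul, τ.frameCoord_field hx,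
      (τ.frameCoord_push hx _).1, (τ.frameCoord_push hx _).1, (τ.frameCoord_push hx _).1,
      map_zero] at this
    simpa using this
  subst ha
  set q := τ.inv x
  have hbc : ∀ i, b * h q.1 q.2 i + c * deriv (h q.1) q.2 i = 0 := by
    intro i
    have := congrArg (τ.frameCoord i.succ x) habcd
    rw [map_add, map_add, map_add, map_smul, map_smul, map_smul, map_smul,
      (τ.frameCoord_push hx _).2, (τ.frameCoord_push hx _).2, map_zero] at this
    simpa [comp] using this
  have h1 : b * inner ℝ (h q.1 q.2) (h q.1 q.2) + c * inner ℝ (h q.1 q.2) (deriv (h q.1) q.2) = 0 := by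
    rw [inner_eq_three, inner_eq_three]
    linear_combination h q.1 q.2 0 * hbc 0 + h q.1 q.2 1 * hbc 1 + h q.1 q.2 2 * hbc 2
  rw [real_inner_self_eq_norm_sq, hh.norm_eq _ _ ht, hh.inner_deriv _ ht] at h1
  have hb : b = 0 := by linarith
  subst hb
  have h2 : c * inner ℝ (deriv (h q.1) q.2) (deriv (h q.1) q.2) = 0 := by
    rw [inner_eq_three]
    linear_combination deriv (h q.1) q.2 0 * hbc 0 + deriv (h q.1) q.2 1 * hbc 1 +
      deriv (h q.1) q.2 2 * hbc 2
  rw [real_inner_self_eq_norm_sq] at h2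
  exact ⟨rfl, rfl, (mul_eq_zero.1 h2).resolve_right (hh.norm_ne _ ht), rfl⟩

theorem span_eq {D' : Π x : M, Submodule ℝ (TangentSpace (𝓡 4) x)}
    (hD' : ∀ p, ∀ t ∈ Ioo (-τ.ε) τ.ε, D' (τ.Φ (p, t)) = planeAt J τ.Φ τ.X τ.Y τ.Z p t (h p t))
    {x : M} (hx : x ∈ τ.image) : D' x = Submodule.span ℝ {τ.field 0 x, τ.push h x} := by
  obtain ⟨⟨p, t⟩, hq, rfl⟩ := hx
  rw [hD' p t hq.2, τ.planeAt_eq h hq.2]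

/-- The plane field `⟨T, h⟩` has the frame `T, h, h', h × h'`. -/
theorem isDerivedFrameOn (hh : τ.IsCurveFamily h)
    {D' : Π x : M, Submodule ℝ (TangentSpace (𝓡 4) x)}
    (hD' : ∀ p, ∀ t ∈ Ioo (-τ.ε) τ.ε, D' (τ.Φ (p, t)) = planeAt J τ.Φ τ.X τ.Y τ.Z p t (h p t)) :
    IsDerivedFrameOn D' τ.image (τ.field 0) (τ.push h) (τ.push fun p => deriv (h p))
      (τ.push (normal h)) (τ.kap₁ h) (τ.kap₂ h) where
  isOpen := τ.isOpen_image
  smooth_d₁ := τ.smooth_field 0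
  smooth_d₂ := hh.smooth.push
  smooth_y := hh.smooth.deriv.push
  smooth_m := hh.smooth_normal.push
  smooth_κ₁ := hh.smooth_normalCoord hh.smooth.deriv.deriv.push
  smooth_κ₂ := hh.smooth_normalCoord (hh.smooth.push.bracket τ.isOpen_image hh.smooth.deriv.push)
  indep x hx := hh.indep hx
  D_eq x hx := span_eq hD' hx
  bracket_d x hx := by
    rw [τ.bracket_field_zero_push hh.smooth hx, sub_self]
    exact Submodule.zero_mem _
  bracket_d₁ x hx := by
    rw [τ.bracket_field_zero_push hh.smooth.deriv hx]
    exact span_triple_mem_of_coeff (hh.indep hx) (normalCoord_field_zero h hx)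
      (normalCoord_self h hx) (normalCoord_deriv h hx) (hh.normalCoord_normal hx) _
  bracket_d₂ x hx := span_triple_mem_of_coeff (hh.indep hx) (normalCoord_field_zero h hx)
      (normalCoord_self h hx) (normalCoord_deriv h hx) (hh.normalCoord_normal hx) _

end IsCurveFamily

theorem indep_field_push {h : N → ℝ → R3} {x : M} (hx : x ∈ τ.image)
    (hne : h (τ.inv x).1 (τ.inv x).2 ≠ 0) : LinearIndependent ℝ ![τ.field 0 x, τ.push h x] := by
  rw [LinearIndependent.pair_iff]
  intro a b hab
  have hb : ∀ i, b * h (τ.inv x).1 (τ.inv x).2 i = 0 := by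
    intro i
    have := congrArg (τ.frameCoord i.succ x) hab
    rw [map_add, map_smul, map_smul, (τ.frameCoord_push hx _).2, τ.frameCoord_field hx,
      map_zero] at this
    simpa [comp, Fin.succ_ne_zero] using this
  have hb0 : b = 0 := by
    by_contra hb0
    refine hne (PiLp.ext fun i => ?_)
    exact (mul_eq_zero.1 (hb i)).resolve_left hb0
  subst hb0
  have := congrArg (τ.frameCoord 0 x) hab
  rw [map_add, map_smul, map_smul, τ.frameCoord_field hx, map_zero] at this
  exact ⟨by simpa using this, rfl⟩

/-- As `D` is an Engel structure, the curves `H` are immersed. -/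
theorem isCurveFamily_H (hD : IsEngel D) : τ.IsCurveFamily τ.H := by
  have hs : τ.SmoothCurves τ.H := τ.smooth_H
  refine ⟨hs, τ.norm_H, fun p t ht h0 => ?_⟩
  have hx : τ.Φ (p, t) ∈ τ.image := τ.Φ_mem (τ.mk_mem_dom.2 ht)
  have hli : ∀ x ∈ τ.image, LinearIndependent ℝ ![τ.field 0 x, τ.push τ.H x] := fun x hx =>
    τ.indep_field_push hx fun h => by
      have := τ.norm_H (τ.inv x).1 _ (τ.inv_snd_mem hx)
      rw [h, norm_zero] at this
      exact zero_ne_one this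
  have h1 := hD.indep_bracket τ.isOpen_image (τ.smooth_field 0) hs.push hli
    (fun y hy => IsCurveFamily.span_eq τ.D_eq hy) hx
  -- where `H'` vanishes, so does `[T, H] = H'`, and `D`, `[D, D]` have the same rank
  refine h1.ne_zero 2 ?_
  change bracket (τ.field 0) (τ.push τ.H) (τ.Φ (p, t)) = 0
  rw [τ.bracket_field_zero_push hs hx, push, comp_Φ _ _ _ (τ.mk_mem_dom.2 ht),
    comp_Φ _ _ _ (τ.mk_mem_dom.2 ht), comp_Φ _ _ _ (τ.mk_mem_dom.2 ht)]
  simp [h0]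

end Tube

/-! ### Comparison of the structure functions of `D` and of its modification -/

theorem mul_pos_of_isPreconnected {X : Type*} [TopologicalSpace X] {S : Set X} {f : X → ℝ}
    (hS : IsPreconnected S) (hf : ContinuousOn f S) (h0 : ∀ x ∈ S, f x ≠ 0) {x y : X}
    (hx : x ∈ S) (hy : y ∈ S) : 0 < f x * f y := by
  rcases lt_or_gt_of_ne (h0 x hx) with h1 | h1 <;> rcases lt_or_gt_of_ne (h0 y hy) with h2 | h2
  · exact mul_pos_of_neg_of_neg h1 h2
  · obtain ⟨z, hz, hz'⟩ := hS.intermediate_value hx hy hf ⟨h1.le, h2.le⟩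
    exact absurd hz' (h0 z hz)
  · obtain ⟨z, hz, hz'⟩ := hS.intermediate_value hy hx hf ⟨h2.le, h1.le⟩
    exact absurd hz' (h0 z hz)
  · exact mul_pos h1 h2

namespace Tube

universe u

variable {M : Type u} [TopologicalSpace M] [ChartedSpace R4 M] [IsManifold (𝓡 4) ∞ M]
  {EN : Type*} [NormedAddCommGroup EN] [NormedSpace ℝ EN] [FiniteDimensional ℝ EN]
  {HN : Type*} [TopologicalSpace HN]
  {D : Π x : M, Submodule ℝ (TangentSpace (𝓡 4) x)} {J : ModelWithCorners ℝ EN HN} [J.Boundaryless]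
  {N : Type*} [TopologicalSpace N] [ChartedSpace HN N] [IsManifold J ∞ N] [Nonempty N]
  (τ : Tube D J N)

theorem zero_mem_Ioo : (0 : ℝ) ∈ Ioo (-τ.ε) τ.ε := ⟨neg_lt_zero.2 τ.ε_pos, τ.ε_pos⟩

theorem kap₁_Φ (h : N → ℝ → R3) {p : N} {t : ℝ} (ht : t ∈ Ioo (-τ.ε) τ.ε) :
    τ.kap₁ h (τ.Φ (p, t)) = (‖deriv (h p) t‖ ^ 2)⁻¹ * convexity (h p) t := by
  rw [τ.kap₁_eq h (τ.Φ_mem (τ.mk_mem_dom.2 ht)), τ.inv_Φ (τ.mk_mem_dom.2 ht)]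

/-- The curves `H p` start in the direction of `Y`. -/
theorem deriv_H_zero_eq (hD : IsEngel D) (p : N) :
    deriv (τ.H p) 0 0 = 0 ∧ deriv (τ.H p) 0 2 = 0 := by
  have hh := τ.isCurveFamily_H hD
  have h0 := τ.zero_mem_Ioo
  have hx : τ.Φ (p, 0) ∈ τ.image := τ.Φ_mem (τ.mk_mem_dom.2 h0)
  have h1 : deriv (τ.H p) 0 0 = 0 := by
    have := hh.inner_deriv p h0
    rw [inner_eq_three, τ.H_zero] at this
    simpa using this
  refine ⟨h1, ?_⟩
  -- `Y` lies in `[D, D] = ⟨T, H, H'⟩`, and `H = X` at time zero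
  have hY : τ.field 2 (τ.Φ (p, 0)) ∈ derived D (τ.Φ (p, 0)) := by
    rw [τ.field_Φ 2 (τ.mk_mem_dom.2 h0)]
    exact τ.Y_mem p
  rw [(hh.isDerivedFrameOn τ.D_eq).derived_eq hx, Submodule.mem_span_triple] at hY
  obtain ⟨a, b, c, hY⟩ := hY
  have key : ∀ i : Fin 3, b * τ.H p 0 i + c * deriv (τ.H p) 0 i = if i.succ = 2 then 1 else 0 := by
    intro i
    have := congrArg (τ.frameCoord i.succ (τ.Φ (p, 0))) hY
    rw [map_add, map_add, map_smul, map_smul, map_smul, (τ.frameCoord_push hx _).2,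
      (τ.frameCoord_push hx _).2, τ.frameCoord_field hx, τ.frameCoord_field hx,
      τ.comp_Φ _ _ (τ.mk_mem_dom.2 h0), τ.comp_Φ _ _ (τ.mk_mem_dom.2 h0)] at this
    simpa [Fin.succ_ne_zero] using this
  have k1 := key 1
  have k2 := key 2
  rw [τ.H_zero] at k1 k2
  simp +decide at k1 k2
  rcases k2 with k2 | k2
  · rw [k2, zero_mul] at k1
    exact absurd k1 zero_ne_one
  · exact k2

theorem kap₁_H_eq_zero_iff (hD : IsEngel D) {p : N} {t : ℝ} (ht : t ∈ Ioo (-τ.ε) τ.ε) :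
    τ.kap₁ τ.H (τ.Φ (p, t)) = 0 ↔ p ∈ τ.tangencySet := by
  have hx : τ.Φ (p, t) ∈ τ.image := τ.Φ_mem (τ.mk_mem_dom.2 ht)
  rw [← ((τ.isCurveFamily_H hD).isDerivedFrameOn τ.D_eq).isKernelVector_iff hx,
    τ.field_Φ 0 (τ.mk_mem_dom.2 ht)]
  exact τ.kernel_iff p t ht

theorem convexity_H_eq_zero_iff (hD : IsEngel D) {p : N} {t : ℝ} (ht : t ∈ Ioo (-τ.ε) τ.ε) :
    convexity (τ.H p) t = 0 ↔ p ∈ τ.tangencySet := by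
  rw [← τ.kap₁_H_eq_zero_iff hD ht, τ.kap₁_Φ _ ht, mul_eq_zero, inv_eq_zero,
    or_iff_right ((τ.isCurveFamily_H hD).norm_ne p ht)]

variable {τ} in
theorem SmoothCurves.continuousOn_convexity {h : N → ℝ → R3} (hs : τ.SmoothCurves h) :
    ContinuousOn (fun q : N × ℝ => convexity (h q.1) q.2) τ.dom := by
  simp only [convexity, det3_eq_inner_cross]
  exact (hs.deriv.deriv.inner (hs.cross hs.deriv)).continuousOn

theorem continuousOn_slice {f : N × ℝ → ℝ} (hf : ContinuousOn f τ.dom) (p : N) :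
    ContinuousOn (fun t => f (p, t)) (Ioo (-τ.ε) τ.ε) :=
  hf.comp (Continuous.prodMk_right p).continuousOn fun _ ht => τ.mk_mem_dom.2 ht

theorem continuousOn_slice_Φ {f : M → ℝ} (hf : ContinuousOn f τ.image) (p : N) :
    ContinuousOn (fun t => f (τ.Φ (p, t))) (Ioo (-τ.ε) τ.ε) :=
  τ.continuousOn_slice (hf.comp τ.smooth_Φ.continuousOn fun _ hq => τ.Φ_mem hq) p

theorem sign_convexity_H (hD : IsEngel D) (p : N) {t : ℝ} (ht : t ∈ Ioo (-τ.ε) τ.ε) :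
    SignType.sign (convexity (τ.H p) t) = SignType.sign (convexity (τ.H p) 0) := by
  by_cases hp : p ∈ τ.tangencySet
  · rw [(τ.convexity_H_eq_zero_iff hD ht).2 hp, (τ.convexity_H_eq_zero_iff hD τ.zero_mem_Ioo).2 hp]
  · have h1 := mul_pos_of_isPreconnected isPreconnected_Ioo
      (τ.continuousOn_slice (τ.isCurveFamily_H hD).smooth.continuousOn_convexity p)
      (fun s hs => mt (τ.convexity_H_eq_zero_iff hD hs).1 hp) ht τ.zero_mem_Ioo
    rcases pos_and_pos_or_neg_and_neg_of_mul_pos h1 with ⟨h2, h3⟩ | ⟨h2, h3⟩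
    · rw [sign_pos h2, sign_pos h3]
    · rw [sign_neg h2, sign_neg h3]

/-- The plane field `D'` is obtained from `D` by replacing the curves `H` by curves `l` of the same
convexity, which agree with `H` for `c ≤ |t|`. -/
structure IsModification (c : ℝ) (l : N → ℝ → R3)
    (D' : Π x : M, Submodule ℝ (TangentSpace (𝓡 4) x)) : Prop where
  family : τ.IsCurveFamily l
  c_pos : 0 < c
  c_lt : c < τ.ε
  ends : ∀ p, ∀ t ∈ Ioo (-τ.ε) τ.ε, c ≤ |t| → l p t = τ.H p t
  convex : ∀ p, ∀ t ∈ Ioo (-τ.ε) τ.ε,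
    SignType.sign (convexity (l p) t) = SignType.sign (convexity (τ.H p) 0)
  replacement : τ.IsReplacement l D'

/-- A spherical curve of vanishing curvature lies in a great circle. -/
theorem IsCurveFamily.normal_eq_zero {τ : Tube D J N} {h : N → ℝ → R3} (hh : τ.IsCurveFamily h)
    {p : N} (hc : ∀ t ∈ Ioo (-τ.ε) τ.ε, convexity (h p) t = 0) {i : Fin 3} {t₀ : ℝ}
    (ht₀ : t₀ ∈ Ioo (-τ.ε) τ.ε) (h0 : normal h p t₀ i = 0) {t : ℝ} (ht : t ∈ Ioo (-τ.ε) τ.ε) :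
    normal h p t i = 0 := by
  -- without curvature `h''` is a combination of `h` and `h'`, hence the normal `w` satisfies a linear
  -- equation `w' = β w`; therefore the quotients `wᵢ² / |w|²` are constant
  set β : ℝ → ℝ := fun t => inner ℝ (deriv (h p) t) (deriv (deriv (h p)) t) / ‖deriv (h p) t‖ ^ 2
  have hd : ∀ s ∈ Ioo (-τ.ε) τ.ε, ∀ j, HasDerivAt (fun t => normal h p t j)
      (β s * normal h p s j) s := by
    intro s hs
    have h2 : ∀ j, deriv (deriv (h p)) s j = inner ℝ (h p s) (deriv (deriv (h p)) s) * h p s j +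
        β s * deriv (h p) s j := by
      intro j
      rw [eq_smul_add_smul_add_cross (hh.norm_eq p s hs) (hh.deriv_ne p s hs)
        (hh.inner_deriv p hs) (deriv (deriv (h p)) s) j, ← det3_eq_inner_cross]
      have h3 : det3 (h p s) (deriv (h p) s) (deriv (deriv (h p)) s) = 0 := hc s hs
      rw [h3, zero_div, zero_mul, add_zero]
    have d0 : ∀ j, HasDerivAt (fun t => h p t j) (deriv (h p) s j) s := fun j =>
      (EuclideanSpace.proj j : R3 →L[ℝ] ℝ).hasFDerivAt.comp_hasDerivAt s
        (hh.smooth.differentiableAt (p := p) hs).hasDerivAt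
    have d1 : ∀ j, HasDerivAt (fun t => deriv (h p) t j) (deriv (deriv (h p)) s j) s := fun j =>
      (EuclideanSpace.proj j : R3 →L[ℝ] ℝ).hasFDerivAt.comp_hasDerivAt s
        (hh.smooth.deriv.differentiableAt (p := p) hs).hasDerivAt
    have key : ∀ a b, HasDerivAt (fun t => h p t a * deriv (h p) t b - h p t b * deriv (h p) t a)
        (β s * (h p s a * deriv (h p) s b - h p s b * deriv (h p) s a)) s := by
      intro a b
      refine (((d0 a).mul (d1 b)).sub ((d0 b).mul (d1 a))).congr_deriv ?_
      rw [h2 a, h2 b]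
      ring
    intro j
    fin_cases j
    exacts [key 1 2, key 2 0, key 0 1]
  set w : ℝ → Fin 3 → ℝ := fun t j => normal h p t j
  set g : ℝ → ℝ := fun t => w t 0 ^ 2 + w t 1 ^ 2 + w t 2 ^ 2
  have hg : ∀ s ∈ Ioo (-τ.ε) τ.ε, g s ≠ 0 := by
    intro s hs
    have h1 := hh.inner_normal_self p hs
    rw [inner_eq_three] at h1
    have h2 := hh.norm_ne p hs
    rw [← h1] at h2
    convert h2 using 1
    simp only [g, w]
    ring
  have hw2 : ∀ s ∈ Ioo (-τ.ε) τ.ε, ∀ j, HasDerivAt (fun t => w t j ^ 2) (2 * β s * w s j ^ 2) s := by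
    intro s hs j
    refine ((hd s hs j).pow 2).congr_deriv ?_
    simp only [w]
    ring
  have hgd : ∀ s ∈ Ioo (-τ.ε) τ.ε, HasDerivAt g (2 * β s * g s) s := by
    intro s hs
    refine (((hw2 s hs 0).add (hw2 s hs 1)).add (hw2 s hs 2)).congr_deriv ?_
    simp only [g]
    ring
  have hq : ∀ s ∈ Ioo (-τ.ε) τ.ε, HasDerivAt (fun t => w t i ^ 2 / g t) 0 s := by
    intro s hs
    refine ((hw2 s hs i).div (hgd s hs) (hg s hs)).congr_deriv ?_
    rw [div_eq_zero_iff]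
    left
    ring
  have := isOpen_Ioo.is_const_of_deriv_eq_zero isPreconnected_Ioo
    (fun s hs => (hq s hs).differentiableAt.differentiableWithinAt)
    (fun s hs => (hq s hs).deriv) ht ht₀
  have h1 : w t₀ i = 0 := h0
  rw [h1, zero_pow two_ne_zero, zero_div, div_eq_zero_iff, or_iff_left (hg t ht)] at this
  exact pow_eq_zero_iff two_ne_zero |>.1 this

/-- If the curves lie in the plane `⟨X, Y⟩`, then the second structure function is the
`Z`-component of `[X, Y]`; it does not depend on the curves. -/
theorem IsCurveFamily.kap₂_eq_of_planar {τ : Tube D J N} {h : N → ℝ → R3} (hh : τ.IsCurveFamily h)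
    {P : Set N} (hP : IsOpen P)
    (hc : ∀ p ∈ P, ∀ t ∈ Ioo (-τ.ε) τ.ε, normal h p t 0 = 0 ∧ normal h p t 1 = 0) {p : N}
    (hp : p ∈ P) {t : ℝ} (ht : t ∈ Ioo (-τ.ε) τ.ε) : τ.kap₂ h (τ.Φ (p, t)) =
      τ.frameCoord 3 (τ.Φ (p, t)) (bracket (τ.field 1) (τ.field 2) (τ.Φ (p, t))) := by
  set O : Set M := τ.Φ '' (P ×ˢ Ioo (-τ.ε) τ.ε)
  have hsub : P ×ˢ Ioo (-τ.ε) τ.ε ⊆ τ.dom := prod_mono (subset_univ _) Subset.rfl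
  have hO : IsOpen O := τ.isOpen_image_Φ hsub (hP.prod isOpen_Ioo)
  have hOi : O ⊆ τ.image := image_mono hsub
  have hx : τ.Φ (p, t) ∈ O := mem_image_of_mem _ ⟨hp, ht⟩
  have hx' := hOi hx
  -- the normal is a multiple of `Z`, so that `h` and `h'` have no `Z`-component
  have hz : ∀ p ∈ P, ∀ t ∈ Ioo (-τ.ε) τ.ε, normal h p t 2 ≠ 0 ∧ h p t 2 = 0 ∧
      deriv (h p) t 2 = 0 := by
    intro p hp t ht
    obtain ⟨h0, h1⟩ := hc p hp t ht
    have h2 : normal h p t 2 ≠ 0 := by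
      intro h2
      have := hh.inner_normal_self p ht
      rw [inner_eq_three, h0, h1, h2] at this
      exact hh.norm_ne p ht (by rw [← this]; ring)
    have e1 := inner_cross_left (h p t) (deriv (h p) t)
    have e2 := inner_cross_right (h p t) (deriv (h p) t)
    change inner ℝ _ (normal h p t) = 0 at e1
    change inner ℝ _ (normal h p t) = 0 at e2
    rw [inner_eq_three, h0, h1] at e1 e2
    refine ⟨h2, ?_, ?_⟩
    · simpa [h2] using e1
    · simpa [h2] using e2
  have hV : ∀ k : N → ℝ → R3, (∀ p ∈ P, ∀ t ∈ Ioo (-τ.ε) τ.ε, k p t 2 = 0) → ∀ y ∈ O,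
      τ.push k y = ∑ i : Fin 2, (![τ.comp k 0, τ.comp k 1] : Fin 2 → M → ℝ) i y •
        (![τ.field 1, τ.field 2] : Fin 2 → Π x : M, TangentSpace (𝓡 4) x) i y := by
    rintro k hk _ ⟨⟨p, t⟩, ⟨hp, ht⟩, rfl⟩
    rw [Fin.sum_univ_two]
    have := τ.comp_Φ k 2 (τ.mk_mem_dom.2 ht : (p, t) ∈ τ.dom)
    rw [push, this, show k (p, t).1 (p, t).2 2 = 0 from hk p hp t ht, zero_smul, add_zero]
    rfl
  have hsc : ∀ {k : N → ℝ → R3}, τ.SmoothCurves k → ∀ i : Fin 2,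
      ContMDiffOn (𝓡 4) 𝓘(ℝ) ∞ ((![τ.comp k 0, τ.comp k 1] : Fin 2 → M → ℝ) i) O := by
    intro k hk i
    fin_cases i
    exacts [(hk.comp 0).mono hOi, (hk.comp 1).mono hOi]
  have hb := bracket_sum_sub_mem (e := ![τ.field 1, τ.field 2]) hO hx
    (fun i => by fin_cases i; exacts [(τ.smooth_field 1).mono hOi, (τ.smooth_field 2).mono hOi])
    (hsc hh.smooth) (hsc hh.smooth.deriv) (hV h fun p hp t ht => (hz p hp t ht).2.1)
    (hV (fun p => deriv (h p)) fun p hp t ht => (hz p hp t ht).2.2)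
  set x := τ.Φ (p, t)
  have hker : ∀ v ∈ Submodule.span ℝ (range fun i =>
      (![τ.field 1, τ.field 2] : Fin 2 → Π x : M, TangentSpace (𝓡 4) x) i x),
      τ.frameCoord 3 x v = 0 := by
    intro v hv
    have hle : Submodule.span ℝ (range fun i =>
      (![τ.field 1, τ.field 2] : Fin 2 → Π x : M, TangentSpace (𝓡 4) x) i x) ≤
        LinearMap.ker (τ.frameCoord 3 x) := by
      rw [Submodule.span_le]
      rintro _ ⟨i, rfl⟩
      fin_cases i
      · exact (τ.frameCoord_field hx' 3 1).trans (if_neg (by decide))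
      · exact (τ.frameCoord_field hx' 3 2).trans (if_neg (by decide))
    exact hle hv
  have hq : (p, t) ∈ τ.dom := τ.mk_mem_dom.2 ht
  -- modulo `X, Y`, the bracket of `h` and `h'` is `h × h'` times that of `X` and `Y`
  have h3 : τ.frameCoord 3 x (bracket (τ.push h) (τ.push fun p => deriv (h p)) x) =
      normal h p t 2 * τ.frameCoord 3 x (bracket (τ.field 1) (τ.field 2) x) := by
    have h4 := hker _ hb
    rw [map_sub, sub_eq_zero] at h4
    rw [h4, Fin.sum_univ_two, Fin.sum_univ_two, Fin.sum_univ_two]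
    change τ.frameCoord 3 x (((τ.comp h 0 x * τ.comp (fun p => deriv (h p)) 0 x) •
      bracket (τ.field 1) (τ.field 1) x + (τ.comp h 0 x * τ.comp (fun p => deriv (h p)) 1 x) •
      bracket (τ.field 1) (τ.field 2) x) + ((τ.comp h 1 x * τ.comp (fun p => deriv (h p)) 0 x) •
      bracket (τ.field 2) (τ.field 1) x + (τ.comp h 1 x * τ.comp (fun p => deriv (h p)) 1 x) •
      bracket (τ.field 2) (τ.field 2) x)) = _
    rw [bracket_self, bracket_self, bracket_swap (τ.field 2) (τ.field 1), τ.comp_Φ _ _ hq,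
      τ.comp_Φ _ _ hq, τ.comp_Φ _ _ hq, τ.comp_Φ _ _ hq, normal, cross_two]
    simp only [smul_zero, zero_add, add_zero, smul_neg, map_add, map_neg, map_smul, smul_eq_mul]
    ring
  have hm := hh.inner_normal_self p ht
  rw [inner_eq_three, (hc p hp t ht).1, (hc p hp t ht).2] at hm
  rw [kap₂, normalCoord_apply, h3, τ.comp_Φ _ _ hq, τ.comp_Φ _ _ hq, τ.comp_Φ _ _ hq,
    τ.inv_Φ hq, ← hm]
  change _ * (normal h p t 0 * _ + normal h p t 1 * _ + normal h p t 2 * _) = _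
  rw [(hc p hp t ht).1, (hc p hp t ht).2]
  have := (hz p hp t ht).1
  field_simp
  ring

end Tube

namespace Tube

universe u

variable {M : Type u} [TopologicalSpace M] [T2Space M] [ChartedSpace R4 M] [IsManifold (𝓡 4) ∞ M]
  {EN : Type*} [NormedAddCommGroup EN] [NormedSpace ℝ EN] [FiniteDimensional ℝ EN]
  {HN : Type*} [TopologicalSpace HN]
  {D : Π x : M, Submodule ℝ (TangentSpace (𝓡 4) x)} {J : ModelWithCorners ℝ EN HN} [J.Boundaryless]
  {N : Type*} [TopologicalSpace N] [CompactSpace N] [ChartedSpace HN N] [IsManifold J ∞ N]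
  [Nonempty N] (τ : Tube D J N)

/-- The part `|t| ≤ c` of the tube. -/
def core (c : ℝ) : Set M := τ.Φ '' (univ ×ˢ Icc (-c) c)

theorem prod_Icc_subset_dom {c : ℝ} (hc : c < τ.ε) : (univ : Set N) ×ˢ Icc (-c) c ⊆ τ.dom :=
  prod_mono Subset.rfl fun _ ht => ⟨by linarith [ht.1], by linarith [ht.2]⟩

theorem isCompact_core {c : ℝ} (hc : c < τ.ε) : IsCompact (τ.core c) :=
  (isCompact_univ.prod isCompact_Icc).image_of_continuousOn
    (τ.smooth_Φ.continuousOn.mono (τ.prod_Icc_subset_dom hc))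

theorem core_subset_image {c : ℝ} (hc : c < τ.ε) : τ.core c ⊆ τ.image :=
  image_mono (τ.prod_Icc_subset_dom hc)

theorem Φ_mem_core_iff {c : ℝ} (hc : c < τ.ε) {p : N} {t : ℝ} (ht : t ∈ Ioo (-τ.ε) τ.ε) :
    τ.Φ (p, t) ∈ τ.core c ↔ |t| ≤ c := by
  constructor
  · rintro ⟨q, hq, hqt⟩
    have := τ.injOn_Φ (τ.prod_Icc_subset_dom hc hq) (τ.mk_mem_dom.2 ht) hqt
    subst this
    exact abs_le.2 hq.2
  · exact fun h => mem_image_of_mem _ ⟨mem_univ _, abs_le.1 h⟩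

namespace IsModification

variable {τ} {c : ℝ} {l : N → ℝ → R3} {D' : Π x : M, Submodule ℝ (TangentSpace (𝓡 4) x)}

theorem eq_of_notMem_core (hm : τ.IsModification c l D') {x : M} (hx : x ∉ τ.core c) :
    D' x = D x := by
  by_cases hxi : x ∈ τ.image
  · obtain ⟨⟨p, t⟩, hq, rfl⟩ := hxi
    have ht : t ∈ Ioo (-τ.ε) τ.ε := hq.2
    rw [τ.Φ_mem_core_iff hm.c_lt ht, not_le] at hx
    rw [hm.replacement.2 p t ht, hm.ends p t ht hx.le, τ.D_eq p t ht]
  · exact hm.replacement.1 x hxi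

theorem isDerivedFrameOn (hm : τ.IsModification c l D') :
    IsDerivedFrameOn D' τ.image (τ.field 0) (τ.push l) (τ.push fun p => deriv (l p))
      (τ.push (normal l)) (τ.kap₁ l) (τ.kap₂ l) :=
  hm.family.isDerivedFrameOn hm.replacement.2

theorem convexity_compare (hD : IsEngel D) (hm : τ.IsModification c l D') {p : N} {t : ℝ}
    (ht : t ∈ Ioo (-τ.ε) τ.ε) :
    SignType.sign (convexity (l p) t) = SignType.sign (convexity (τ.H p) t) := by
  rw [hm.convex p t ht, τ.sign_convexity_H hD p ht]

theorem kap₁_pos_or (hD : IsEngel D) (hm : τ.IsModification c l D') {p : N} {t : ℝ}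
    (ht : t ∈ Ioo (-τ.ε) τ.ε) :
    (p ∉ τ.tangencySet ∧ 0 < τ.kap₁ l (τ.Φ (p, t)) * τ.kap₁ τ.H (τ.Φ (p, t))) ∨
      (p ∈ τ.tangencySet ∧ τ.kap₁ l (τ.Φ (p, t)) = 0 ∧ τ.kap₁ τ.H (τ.Φ (p, t)) = 0) := by
  have h1 := hm.convexity_compare hD (p := p) ht
  have hl := sq_nonneg ‖deriv (l p) t‖ |>.lt_of_ne' (hm.family.norm_ne p ht)
  have hH := sq_nonneg ‖deriv (τ.H p) t‖ |>.lt_of_ne' ((τ.isCurveFamily_H hD).norm_ne p ht)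
  rw [← inv_pos] at hl hH
  have hiff := τ.convexity_H_eq_zero_iff hD (p := p) ht
  rw [τ.kap₁_Φ _ ht, τ.kap₁_Φ _ ht]
  rcases lt_trichotomy (convexity (τ.H p) t) 0 with h2 | h2 | h2
  · rw [sign_neg h2, sign_eq_neg_one_iff] at h1
    exact Or.inl ⟨mt hiff.2 h2.ne, mul_pos_of_neg_of_neg (mul_neg_of_pos_of_neg hl h1)
      (mul_neg_of_pos_of_neg hH h2)⟩
  · rw [h2, sign_zero, sign_eq_zero_iff] at h1
    exact Or.inr ⟨hiff.1 h2, by rw [h1, mul_zero], by rw [h2, mul_zero]⟩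
  · rw [sign_pos h2, sign_eq_one_iff] at h1
    exact Or.inl ⟨mt hiff.2 h2.ne', mul_pos (mul_pos hl h1) (mul_pos hH h2)⟩

theorem deriv_eq (hm : τ.IsModification c l D') (p : N) {t : ℝ} (ht : t ∈ Ioo (-τ.ε) τ.ε)
    (hc : c < |t|) : deriv (l p) t = deriv (τ.H p) t := by
  refine Filter.EventuallyEq.deriv_eq ?_
  filter_upwards [isOpen_Ioo.mem_nhds ht, (isOpen_lt continuous_const continuous_abs).mem_nhds hc]
    with s hs hs' using hm.ends p s hs hs'.le

/-- Outside the core, the structure functions agree. -/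
theorem kap_eq (hm : τ.IsModification c l D') {p : N} {t : ℝ} (ht : t ∈ Ioo (-τ.ε) τ.ε)
    (hc : c < |t|) : τ.kap₁ l (τ.Φ (p, t)) = τ.kap₁ τ.H (τ.Φ (p, t)) ∧
      τ.kap₂ l (τ.Φ (p, t)) = τ.kap₂ τ.H (τ.Φ (p, t)) := by
  set O : Set M := τ.Φ '' (univ ×ˢ (Ioo (-τ.ε) τ.ε ∩ {t | c < |t|}))
  have hsub : (univ : Set N) ×ˢ (Ioo (-τ.ε) τ.ε ∩ {t | c < |t|}) ⊆ τ.dom :=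
    prod_mono Subset.rfl inter_subset_left
  have hO : IsOpen O := τ.isOpen_image_Φ hsub
    (isOpen_univ.prod (isOpen_Ioo.inter (isOpen_lt continuous_const continuous_abs)))
  have hx : τ.Φ (p, t) ∈ O := mem_image_of_mem _ ⟨mem_univ _, ht, hc⟩
  have hpush : ∀ {h k : N → ℝ → R3}, (∀ p, ∀ t ∈ Ioo (-τ.ε) τ.ε, c < |t| → h p t = k p t) →
      ∀ y ∈ O, τ.push h y = τ.push k y := by
    rintro h k hhk _ ⟨⟨p, t⟩, ⟨-, ht, hc⟩, rfl⟩
    have hq : (p, t) ∈ τ.dom := τ.mk_mem_dom.2 ht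
    simp only [push, τ.comp_Φ _ _ hq, hhk p t ht hc]
  have h1 := hpush fun p t ht hc => hm.ends p t ht (le_of_lt hc)
  have h2 := hpush fun p t ht hc => hm.deriv_eq p ht hc
  have hd := hm.deriv_eq p ht hc
  have hn : ∀ v, τ.normalCoord l (τ.Φ (p, t)) v = τ.normalCoord τ.H (τ.Φ (p, t)) v := by
    intro v
    have hq : (p, t) ∈ τ.dom := τ.mk_mem_dom.2 ht
    have hn' : normal l p t = normal τ.H p t := by
      rw [normal, normal, hm.ends p t ht hc.le, hd]
    rw [normalCoord_apply, normalCoord_apply, τ.comp_Φ _ _ hq, τ.comp_Φ _ _ hq, τ.comp_Φ _ _ hq,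
      τ.comp_Φ _ _ hq, τ.comp_Φ _ _ hq, τ.comp_Φ _ _ hq, τ.inv_Φ hq]
    simp only [hn', hd]
  constructor
  · have hdd : deriv (l p) =ᶠ[𝓝 t] deriv (τ.H p) := by
      filter_upwards [isOpen_Ioo.mem_nhds ht, (isOpen_lt continuous_const continuous_abs).mem_nhds hc]
        with s hs hs' using hm.deriv_eq p hs hs'
    rw [τ.kap₁_Φ _ ht, τ.kap₁_Φ _ ht, hd, convexity, convexity, hd, hdd.deriv_eq,
      hm.ends p t ht hc.le]
  · rw [kap₂, kap₂, hn, bracket_congr hO hx h1 h2]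

theorem exists_end (hm : τ.IsModification c l D') : ∃ t ∈ Ioo (-τ.ε) τ.ε, c < |t| := by
  have h0 := hm.c_pos
  have h1 := hm.c_lt
  refine ⟨(c + τ.ε) / 2, ⟨by linarith, by linarith⟩, ?_⟩
  rw [abs_of_pos (by linarith)]
  linarith

theorem continuousOn_kap₂ (hm : τ.IsModification c l D') : ContinuousOn (τ.kap₂ l) τ.image :=
  hm.isDerivedFrameOn.smooth_κ₂.continuousOn

/-- On the interior of the tangency set all curves are planar, hence the second structure functions
of `D` and `D'` agree there. -/
theorem kap₂_eq_of_mem_interior (hD : IsEngel D) (hm : τ.IsModification c l D') {p : N}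
    (hp : p ∈ interior τ.tangencySet) {t : ℝ} (ht : t ∈ Ioo (-τ.ε) τ.ε) :
    τ.kap₂ l (τ.Φ (p, t)) = τ.kap₂ τ.H (τ.Φ (p, t)) := by
  have hH := τ.isCurveFamily_H hD
  have h1 : ∀ p ∈ interior τ.tangencySet, ∀ t ∈ Ioo (-τ.ε) τ.ε,
      normal τ.H p t 0 = 0 ∧ normal τ.H p t 1 = 0 := by
    intro p hp t ht
    have hc : ∀ s ∈ Ioo (-τ.ε) τ.ε, convexity (τ.H p) s = 0 := fun s hs =>
      (τ.convexity_H_eq_zero_iff hD hs).2 (interior_subset hp)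
    obtain ⟨e0, e2⟩ := τ.deriv_H_zero_eq hD p
    refine ⟨hH.normal_eq_zero hc τ.zero_mem_Ioo ?_ ht, hH.normal_eq_zero hc τ.zero_mem_Ioo ?_ ht⟩
    · rw [normal, cross_zero, e2, τ.H_zero]
      simp
    · rw [normal, cross_one, e2, e0]
      simp
  -- the great circles of `l` and `H` agree because the curves agree near the ends
  have h2 : ∀ p ∈ interior τ.tangencySet, ∀ t ∈ Ioo (-τ.ε) τ.ε,
      normal l p t 0 = 0 ∧ normal l p t 1 = 0 := by
    intro p hp t ht
    obtain ⟨s, hs, hs'⟩ := hm.exists_end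
    have hc : ∀ s ∈ Ioo (-τ.ε) τ.ε, convexity (l p) s = 0 := by
      intro s hs
      have := hm.convexity_compare hD (p := p) hs
      rwa [(τ.convexity_H_eq_zero_iff hD hs).2 (interior_subset hp), sign_zero,
        sign_eq_zero_iff] at this
    have hn : normal l p s = normal τ.H p s := by
      rw [normal, normal, hm.ends p s hs hs'.le, hm.deriv_eq p hs hs']
    exact ⟨hm.family.normal_eq_zero hc hs (by rw [hn]; exact (h1 p hp s hs).1) ht,
      hm.family.normal_eq_zero hc hs (by rw [hn]; exact (h1 p hp s hs).2) ht⟩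
  rw [hm.family.kap₂_eq_of_planar isOpen_interior h2 hp ht,
    hH.kap₂_eq_of_planar isOpen_interior h1 hp ht]

/-- If the tangency set is the closure of its interior, then the modified plane field is an
Engel structure. -/
theorem isEngel (hD : IsEngel D) (hm : τ.IsModification c l D') (hreg : τ.IsRegular) :
    IsEngel D' := by
  have hHf := (τ.isCurveFamily_H hD).isDerivedFrameOn τ.D_eq
  refine isEngel_of_derivedFrame fun x₀ => ?_
  by_cases hx₀ : x₀ ∈ τ.image
  · refine ⟨τ.image, _, _, _, _, _, _, hx₀, hm.isDerivedFrameOn, ?_⟩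
    rintro _ ⟨⟨p, t⟩, hq, rfl⟩
    have ht : t ∈ Ioo (-τ.ε) τ.ε := hq.2
    have hx := τ.Φ_mem (τ.mk_mem_dom.2 ht : (p, t) ∈ τ.dom)
    rcases hm.kap₁_pos_or hD (p := p) ht with ⟨-, h1⟩ | ⟨hp, -, h2⟩
    · exact Or.inl fun h => by rw [h, zero_mul] at h1; exact lt_irrefl _ h1
    · right
      -- the second structure functions agree on the interior of the tangency set, hence on its closure
      have hcl : p ∈ closure {p' | τ.kap₂ l (τ.Φ (p', t)) = τ.kap₂ τ.H (τ.Φ (p', t))} :=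
        closure_mono (fun p' hp' => hm.kap₂_eq_of_mem_interior hD hp' ht) (hreg hp)
      have hcont : ∀ {f : M → ℝ}, ContinuousOn f τ.image → Continuous fun p' => f (τ.Φ (p', t)) :=
        fun hf => hf.comp_continuous (τ.smooth_Φ.continuousOn.comp_continuous
          (Continuous.prodMk_left t) fun p' => τ.mk_mem_dom.2 ht)
          fun p' => τ.Φ_mem (τ.mk_mem_dom.2 ht)
      rw [(isClosed_eq (hcont hm.continuousOn_kap₂)
        (hcont hHf.smooth_κ₂.continuousOn)).closure_eq] at hcl
      rw [hcl]
      exact ((hHf.derived_derived_eq_top_iff hx).1 (hD.2.2 _)).resolve_left fun h => h h2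
  -- away from the core `D'` is equal to `D`
  · obtain ⟨O, d₁, d₂, y, m, κ₁, κ₂, hxO, hf, hκ⟩ := hD.exists_derivedFrame x₀
    have hcl := (τ.isCompact_core hm.c_lt).isClosed
    have hf' := hf.mono (hf.isOpen.inter hcl.isOpen_compl) inter_subset_left
    refine ⟨O ∩ (τ.core c)ᶜ, d₁, d₂, y, m, κ₁, κ₂,
      ⟨hxO, fun h => hx₀ (τ.core_subset_image hm.c_lt h)⟩,
      { hf' with D_eq := fun x hx => (hm.eq_of_notMem_core hx.2).trans (hf'.D_eq x hx) },
      fun x hx => ?_⟩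
    by_contra! h
    exact hκ x hx.1 (by rw [h.1, h.2]; norm_num)

/-- If `D'` is an Engel structure, then the pairs of structure functions of `D` and `D'` are nowhere
opposite to each other. -/
theorem kap_pos (hD : IsEngel D) (hm : τ.IsModification c l D') (hD' : IsEngel D') {x : M}
    (hx : x ∈ τ.image) : 0 < τ.kap₁ l x * τ.kap₁ τ.H x ∨
      (τ.kap₁ l x = 0 ∧ τ.kap₁ τ.H x = 0 ∧ 0 < τ.kap₂ l x * τ.kap₂ τ.H x) := by
  have hHf := (τ.isCurveFamily_H hD).isDerivedFrameOn τ.D_eq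
  obtain ⟨⟨p, t⟩, hq, rfl⟩ := hx
  have ht : t ∈ Ioo (-τ.ε) τ.ε := hq.2
  rcases hm.kap₁_pos_or hD (p := p) ht with ⟨-, h1⟩ | ⟨hp, h1, h2⟩
  · exact Or.inl h1
  refine Or.inr ⟨h1, h2, ?_⟩
  obtain ⟨s, hs, hs'⟩ := hm.exists_end
  have hz : ∀ r ∈ Ioo (-τ.ε) τ.ε, τ.kap₁ l (τ.Φ (p, r)) = 0 ∧ τ.kap₁ τ.H (τ.Φ (p, r)) = 0 :=
    fun r hr => ((hm.kap₁_pos_or hD hr).resolve_left fun h => h.1 hp).2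
  have hne : ∀ r ∈ Ioo (-τ.ε) τ.ε, τ.kap₂ l (τ.Φ (p, r)) ≠ 0 := fun r hr =>
    ((hm.isDerivedFrameOn.derived_derived_eq_top_iff (τ.Φ_mem (τ.mk_mem_dom.2 hr))).1
      (hD'.2.2 _)).resolve_left fun h => h (hz r hr).1
  have hne' : ∀ r ∈ Ioo (-τ.ε) τ.ε, τ.kap₂ τ.H (τ.Φ (p, r)) ≠ 0 := fun r hr =>
    ((hHf.derived_derived_eq_top_iff (τ.Φ_mem (τ.mk_mem_dom.2 hr))).1
      (hD.2.2 _)).resolve_left fun h => h (hz r hr).2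
  -- the second structure functions have no zeros along the orbit, and agree near its ends
  have k1 := mul_pos_of_isPreconnected isPreconnected_Ioo
    ((τ.continuousOn_slice_Φ hm.continuousOn_kap₂ p).mul
      (τ.continuousOn_slice_Φ hHf.smooth_κ₂.continuousOn p))
    (fun r hr => mul_ne_zero (hne r hr) (hne' r hr)) hs ht
  have k2 : 0 < τ.kap₂ l (τ.Φ (p, s)) * τ.kap₂ τ.H (τ.Φ (p, s)) := by
    rw [(hm.kap_eq hs hs').2]
    exact mul_self_pos.2 (hne' s hs)
  exact (pos_iff_pos_of_mul_pos k1).1 k2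

end IsModification

end Tube

/-! ### The profile curves -/

/-- A one-sided chain rule for unit tangent vectors, for reparametrisations which are only
continuous and increasing. -/
theorem normalize_deriv_eq {γ η : ℝ → R3} {ρ : ℝ → ℝ} {t : ℝ} {v w : R3}
    (hγ : HasDerivAt γ v (ρ t)) (hv : v ≠ 0) (hη : HasDerivAt η w t) (hw : w ≠ 0)
    (hρ : ContinuousWithinAt ρ (Iio t) t) (hmono : ∀ᶠ s in 𝓝[<] t, ρ s < ρ t)
    (heq : ∀ᶠ s in 𝓝[<] t, η s = γ (ρ s)) (ht : η t = γ (ρ t)) : ‖w‖⁻¹ • w = ‖v‖⁻¹ • v := by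
  have h1 : Filter.Tendsto (fun s => slope γ (ρ t) (ρ s)) (𝓝[<] t) (𝓝 v) := by
    refine hγ.tendsto_slope.comp (tendsto_nhdsWithin_iff.2 ⟨hρ, ?_⟩)
    exact hmono.mono fun s hs => hs.ne
  have h2 : Filter.Tendsto (slope η t) (𝓝[<] t) (𝓝 w) :=
    hη.tendsto_slope.mono_left (nhdsWithin_mono _ fun s hs => ne_of_lt hs)
  have hn : ∀ {x : R3}, x ≠ 0 → ContinuousAt (fun x : R3 => ‖x‖⁻¹ • x) x := fun hx =>
    (continuousAt_id.norm.inv₀ (norm_ne_zero_iff.2 hx)).smul continuousAt_id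
  have h3 := (hn hv).tendsto.comp h1
  have h4 := (hn hw).tendsto.comp h2
  refine tendsto_nhds_unique (h4.congr' ?_) h3
  filter_upwards [hmono, heq, self_mem_nhdsWithin] with s hs hs' hst
  -- the difference quotient of `η` is a positive multiple of that of `γ`
  have hst' : s - t < 0 := sub_neg.2 hst
  have hr : 0 < (s - t)⁻¹ * (ρ s - ρ t) :=
    mul_pos_of_neg_of_neg (inv_lt_zero.2 hst') (sub_neg.2 hs)
  have hsl : slope η t s = ((s - t)⁻¹ * (ρ s - ρ t)) • slope γ (ρ t) (ρ s) := by
    rw [slope_def_module, slope_def_module, hs', ht, smul_smul, mul_assoc,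
      mul_inv_cancel₀ (sub_neg.2 hs).ne, mul_one]
  simp only [Function.comp_apply]
  rw [hsl, norm_smul, Real.norm_of_nonneg hr.le, smul_smul]
  rw [mul_inv, mul_right_comm, inv_mul_cancel₀ hr.ne', one_mul]

/-- The unit tangent of the circle `sphereCircle k`. -/
def circleTangent (k θ : ℝ) : R3 :=
  !₂[-Real.sin θ / √(1 + k ^ 2), Real.cos θ, k * Real.sin θ / √(1 + k ^ 2)]

theorem one_add_sq_pos (k : ℝ) : 0 < 1 + k ^ 2 := by positivity

theorem hasDerivAt_R3 {f : ℝ → R3} {f' : R3} {t : ℝ}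
    (h : ∀ i, HasDerivAt (fun s => f s i) (f' i) t) : HasDerivAt f f' t := by
  have h1 : HasDerivAt (fun s i => f s i) (fun i => f' i) t := hasDerivAt_pi.2 h
  exact ((EuclideanSpace.equiv (Fin 3) ℝ).symm : (Fin 3 → ℝ) →L[ℝ] R3).hasFDerivAt.comp_hasDerivAt t h1

theorem hasDerivAt_sphereCircle (k θ : ℝ) :
    HasDerivAt (sphereCircle k) ((√(1 + k ^ 2))⁻¹ • circleTangent k θ) θ := by
  have hp := one_add_sq_pos k
  have hs : √(1 + k ^ 2) * √(1 + k ^ 2) = 1 + k ^ 2 := Real.mul_self_sqrt hp.le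
  have hs0 : √(1 + k ^ 2) ≠ 0 := (Real.sqrt_pos.2 hp).ne'
  have hdiv : ∀ x : ℝ, x / (1 + k ^ 2) = (√(1 + k ^ 2))⁻¹ * (x / √(1 + k ^ 2)) := by
    intro x
    rw [inv_mul_eq_div, div_div, hs]
  refine hasDerivAt_R3 fun i => ?_
  fin_cases i
  · refine (((Real.hasDerivAt_cos θ).const_add (k ^ 2)).div_const (1 + k ^ 2)).congr_deriv ?_
    simp only [circleTangent]
    simp
    exact hdiv _
  · refine ((Real.hasDerivAt_sin θ).div_const √(1 + k ^ 2)).congr_deriv ?_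
    simp only [circleTangent]
    simp
    field_simp
  · refine ((((Real.hasDerivAt_cos θ).const_sub 1).const_mul k).div_const (1 + k ^ 2)).congr_deriv ?_
    simp only [circleTangent]
    simp
    exact hdiv _

theorem inner_sphereCircle_self (k θ : ℝ) :
    inner ℝ (sphereCircle k θ) (sphereCircle k θ) = 1 := by
  have hp := one_add_sq_pos k
  have hs : √(1 + k ^ 2) ^ 2 = 1 + k ^ 2 := Real.sq_sqrt hp.le
  have hs0 : √(1 + k ^ 2) ≠ 0 := (Real.sqrt_pos.2 hp).ne'
  rw [inner_eq_three]
  simp only [sphereCircle]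
  simp
  rw [div_mul_div_comm, div_mul_div_comm, div_mul_div_comm, ← pow_two √(1 + k ^ 2), hs]
  field_simp
  have := Real.sin_sq_add_cos_sq θ
  linear_combination (1 + k ^ 2) * this

theorem inner_circleTangent_self (k θ : ℝ) :
    inner ℝ (circleTangent k θ) (circleTangent k θ) = 1 := by
  have hp := one_add_sq_pos k
  have hs : √(1 + k ^ 2) ^ 2 = 1 + k ^ 2 := Real.sq_sqrt hp.le
  rw [inner_eq_three]
  simp only [circleTangent]
  simp
  rw [div_mul_div_comm, div_mul_div_comm, ← pow_two √(1 + k ^ 2), hs]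
  field_simp
  have := Real.sin_sq_add_cos_sq θ
  linear_combination (1 + k ^ 2) * this

theorem inner_sphereCircle_circleTangent (k θ : ℝ) :
    inner ℝ (sphereCircle k θ) (circleTangent k θ) = 0 := by
  have hp := one_add_sq_pos k
  have hs0 : √(1 + k ^ 2) ≠ 0 := (Real.sqrt_pos.2 hp).ne'
  rw [inner_eq_three]
  simp only [circleTangent, sphereCircle]
  simp
  field_simp
  ring

theorem norm_eq_one_of_inner_self {x : R3} (h : inner ℝ x x = 1) : ‖x‖ = 1 := by
  rw [real_inner_self_eq_norm_sq] at h
  exact (pow_eq_one_iff_of_nonneg (norm_nonneg _) two_ne_zero).1 h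

namespace Tube

universe u

variable {M : Type u} [TopologicalSpace M] [T2Space M] [ChartedSpace R4 M] [IsManifold (𝓡 4) ∞ M]
  {EN : Type*} [NormedAddCommGroup EN] [NormedSpace ℝ EN] [FiniteDimensional ℝ EN]
  {HN : Type*} [TopologicalSpace HN]
  {D : Π x : M, Submodule ℝ (TangentSpace (𝓡 4) x)} {J : ModelWithCorners ℝ EN HN} [J.Boundaryless]
  {N : Type*} [TopologicalSpace N] [CompactSpace N] [ChartedSpace HN N] [IsManifold J ∞ N]
  [Nonempty N] {τ : Tube D J N}

namespace Profile

variable (P : τ.Profile)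

theorem c_pos : 0 < P.c := by
  have := P.a_mem; have := P.a_lt_b; have := P.b_mem
  linarith

theorem neg_ε_lt_a : -τ.ε < P.a := by
  have := P.a_mem; have := P.c_lt
  linarith

theorem b_lt_ε : P.b < τ.ε := P.b_mem.trans P.c_lt

theorem ρ_mem_left (p : N) {t : ℝ} (ht : t ∈ Ioc (-τ.ε) P.a) : P.ρ p t ∈ Ioc (-τ.ε) 0 := by
  have h1 := P.c_lt
  have h2 := P.c_pos
  have h3 := P.a_mem
  refine ⟨?_, ?_⟩
  · rcases le_or_gt t (-P.c) with h | h
    · rw [P.ρ_ends p t ⟨ht.1, by linarith⟩ (by rw [abs_of_neg (by linarith)]; linarith)]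
      exact ht.1
    · have h4 := P.ρ_mono_left p ⟨by linarith, P.a_mem.le⟩ ht h
      rw [P.ρ_ends p (-P.c) ⟨by linarith, by linarith⟩ (by rw [abs_neg, abs_of_pos h2])] at h4
      linarith
  · rw [← P.ρ_a p]
    exact (P.ρ_mono_left p).monotoneOn ht ⟨P.neg_ε_lt_a, le_rfl⟩ ht.2

theorem ρ_mem_right (p : N) {t : ℝ} (ht : t ∈ Ico P.b τ.ε) : P.ρ p t ∈ Ico 0 τ.ε := by
  have h1 := P.c_lt
  have h2 := P.c_pos
  have h3 := P.b_mem
  refine ⟨?_, ?_⟩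
  · rw [← P.ρ_b p]
    exact (P.ρ_mono_right p).monotoneOn ⟨le_rfl, P.b_lt_ε⟩ ht ht.1
  · rcases le_or_gt P.c t with h | h
    · rw [P.ρ_ends p t ⟨by linarith, ht.2⟩ (h.trans (le_abs_self t))]
      exact ht.2
    · have h4 := P.ρ_mono_right p ht ⟨P.b_mem.le, P.c_lt⟩ h
      rw [P.ρ_ends p P.c ⟨by linarith, by linarith⟩ (le_abs_self _)] at h4
      linarith

/-- The extension of the reparametrisation `ρ` by zero along the inserted circle. -/
def ρ' (p : N) (t : ℝ) : ℝ := P.ρ p (min t P.a) + P.ρ p (max t P.b)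

/-- The extension of the angle `θ` by constants. -/
def θ' (p : N) (t : ℝ) : ℝ := P.θ p (max P.a (min t P.b))

theorem ρ'_left (p : N) {t : ℝ} (ht : t ≤ P.a) : P.ρ' p t = P.ρ p t := by
  rw [ρ', min_eq_left ht, max_eq_right (ht.trans P.a_lt_b.le), P.ρ_b, add_zero]

theorem ρ'_right (p : N) {t : ℝ} (ht : P.b ≤ t) : P.ρ' p t = P.ρ p t := by
  rw [ρ', min_eq_right (P.a_lt_b.le.trans ht), max_eq_left ht, P.ρ_a, zero_add]

theorem ρ'_middle (p : N) {t : ℝ} (ht : t ∈ Icc P.a P.b) : P.ρ' p t = 0 := by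
  rw [ρ', min_eq_right ht.1, max_eq_right ht.2, P.ρ_a, P.ρ_b, zero_add]

theorem θ'_left (p : N) {t : ℝ} (ht : t ≤ P.a) : P.θ' p t = 0 := by
  rw [θ', max_eq_left ((min_le_left _ _).trans ht), P.θ_a]

theorem θ'_right (p : N) {t : ℝ} (ht : P.b ≤ t) : P.θ' p t = 2 * Real.pi := by
  rw [θ', min_eq_right ht, max_eq_right P.a_lt_b.le, P.θ_b]

theorem θ'_middle (p : N) {t : ℝ} (ht : t ∈ Icc P.a P.b) : P.θ' p t = P.θ p t := by
  rw [θ', min_eq_left ht.2, max_eq_right ht.1]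

theorem ρ'_mem (p : N) {t : ℝ} (ht : t ∈ Ioo (-τ.ε) τ.ε) : P.ρ' p t ∈ Ioo (-τ.ε) τ.ε := by
  rcases le_or_gt t P.a with h | h
  · rw [P.ρ'_left p h]
    have := P.ρ_mem_left p ⟨ht.1, h⟩
    exact ⟨this.1, this.2.trans_lt τ.ε_pos⟩
  · rcases le_or_gt P.b t with h' | h'
    · rw [P.ρ'_right p h']
      have := P.ρ_mem_right p ⟨h', ht.2⟩
      exact ⟨(neg_lt_zero.2 τ.ε_pos).trans_le this.1, this.2⟩
    · rw [P.ρ'_middle p ⟨h.le, h'.le⟩]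
      exact τ.zero_mem_Ioo

theorem continuousOn_ρ' : ContinuousOn (fun q : N × ℝ => P.ρ' q.1 q.2) τ.dom := by
  have h1 := P.neg_ε_lt_a
  have h2 := P.b_lt_ε
  have h3 := P.a_lt_b
  refine ContinuousOn.add (P.ρ_cont.comp (f := fun q : N × ℝ => (q.1, min q.2 P.a))
    (continuous_fst.prodMk (continuous_snd.min continuous_const)).continuousOn ?_)
    (P.ρ_cont.comp (f := fun q : N × ℝ => (q.1, max q.2 P.b))
      (continuous_fst.prodMk (continuous_snd.max continuous_const)).continuousOn ?_)
  · exact fun q hq => ⟨mem_univ _, Or.inl ⟨lt_min hq.2.1 h1, min_le_right _ _⟩⟩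
  · exact fun q hq => ⟨mem_univ _, Or.inr ⟨le_max_right _ _, max_lt hq.2.2 h2⟩⟩

theorem continuous_θ' : Continuous fun q : N × ℝ => P.θ' q.1 q.2 :=
  P.θ_cont.comp_continuous (f := fun q : N × ℝ => (q.1, max P.a (min q.2 P.b)))
    (by fun_prop) fun q => ⟨mem_univ _, le_max_left _ _, max_le P.a_lt_b.le (min_le_right _ _)⟩

theorem ρ'_ends (p : N) {t : ℝ} (ht : t ∈ Ioo (-τ.ε) τ.ε) (hc : P.c ≤ |t|) : P.ρ' p t = t := by
  have h1 := P.ρ_ends p t ht hc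
  rcases le_abs.1 hc with h | h
  · rw [P.ρ'_right p (P.b_mem.le.trans h), h1]
  · rw [P.ρ'_left p (by linarith [P.a_mem]), h1]

theorem θ'_ends (p : N) {t : ℝ} (hc : P.c ≤ |t|) : P.θ' p t = if 0 ≤ t then 2 * Real.pi else 0 := by
  have := P.c_pos
  rcases le_abs.1 hc with h | h
  · rw [P.θ'_right p (P.b_mem.le.trans h), if_pos (by linarith)]
  · rw [P.θ'_left p (by linarith [P.a_mem]), if_neg (by linarith)]

theorem η_eq_H (p : N) {t : ℝ} (ht : t ∈ Ioo (-τ.ε) τ.ε) (hc : P.c ≤ |t|) :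
    P.η p t = τ.H p t := by
  rw [P.η_outer p t, P.ρ_ends p t ht hc]
  rcases le_abs.1 hc with h | h
  · exact Or.inr ⟨P.b_mem.le.trans h, ht.2⟩
  · exact Or.inl ⟨ht.1, by linarith [P.a_mem]⟩

theorem deriv_η_eq (p : N) {t : ℝ} (ht : t ∈ Ioo (-τ.ε) τ.ε) (hc : P.c < |t|) :
    deriv (P.η p) t = deriv (τ.H p) t := by
  refine Filter.EventuallyEq.deriv_eq ?_
  filter_upwards [isOpen_Ioo.mem_nhds ht, (isOpen_lt continuous_const continuous_abs).mem_nhds hc]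
    with s hs hs' using P.η_eq_H p hs hs'.le

theorem norm_η (p : N) {t : ℝ} (ht : t ∈ Ioo (-τ.ε) τ.ε) : ‖P.η p t‖ = 1 := by
  by_cases h : t ∈ Icc P.a P.b
  · rw [P.η_middle p t h]
    exact norm_eq_one_of_inner_self (inner_sphereCircle_self _ _)
  · have h1 := P.ρ'_mem p ht
    rcases le_or_gt t P.a with h' | h'
    · rw [P.η_outer p t (Or.inl ⟨ht.1, h'⟩), ← P.ρ'_left p h', τ.norm_H p _ h1]
    · have h2 : P.b ≤ t := by
        by_contra h2
        exact h ⟨h'.le, (not_le.1 h2).le⟩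
      rw [P.η_outer p t (Or.inr ⟨h2, ht.2⟩), ← P.ρ'_right p h2, τ.norm_H p _ h1]

theorem contMDiffOn_deriv_η : ContMDiffOn (J.prod 𝓘(ℝ, ℝ)) 𝓘(ℝ, R3) 1
    (fun q : N × ℝ => deriv (P.η q.1) q.2) τ.dom :=
  contMDiffOn_deriv_snd (by norm_num) τ.isOpen_dom P.η_C2

theorem hasDerivAt_η (p : N) {t : ℝ} (ht : t ∈ Ioo (-τ.ε) τ.ε) :
    HasDerivAt (P.η p) (deriv (P.η p) t) t := by
  have h1 : ContMDiffAt (J.prod 𝓘(ℝ, ℝ)) 𝓘(ℝ, R3) 2 (fun q : N × ℝ => P.η q.1 q.2) (p, t) :=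
    P.η_C2.contMDiffAt (τ.isOpen_dom.mem_nhds (τ.mk_mem_dom.2 ht))
  have h2 : ContMDiffAt 𝓘(ℝ, ℝ) 𝓘(ℝ, R3) 2 (P.η p) t :=
    ContMDiffAt.comp (f := fun t : ℝ => (p, t)) t h1 (contMDiffAt_const.prodMk contMDiffAt_id)
  exact (h2.contDiffAt.differentiableAt (by simp)).hasDerivAt

theorem inner_deriv_η (p : N) {t : ℝ} (ht : t ∈ Ioo (-τ.ε) τ.ε) :
    inner ℝ (P.η p t) (deriv (P.η p) t) = 0 := by
  have h2 := (P.hasDerivAt_η p ht).inner ℝ (P.hasDerivAt_η p ht)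
  have h3 : (fun t => inner ℝ (P.η p t) (P.η p t)) =ᶠ[𝓝 t] fun _ => (1 : ℝ) := by
    filter_upwards [isOpen_Ioo.mem_nhds ht] with s hs
    rw [real_inner_self_eq_norm_sq, P.norm_η p hs, one_pow]
  have h4 := h2.deriv
  rw [h3.deriv_eq, deriv_const, real_inner_comm] at h4
  rw [real_inner_comm]
  linarith

/-- Up to positive factors, the tangent of `η` is that of the reparametrised curve `H` away from the
inserted circle. -/
theorem normalize_deriv_η_outer (hD : IsEngel D) (p : N) {t : ℝ} (ht : t ∈ Ioo (-τ.ε) τ.ε)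
    (hab : t ∉ Ioc P.a P.b) : ‖deriv (P.η p) t‖⁻¹ • deriv (P.η p) t =
      ‖deriv (τ.H p) (P.ρ' p t)‖⁻¹ • deriv (τ.H p) (P.ρ' p t) := by
  have hH := τ.isCurveFamily_H hD
  have h1 := P.ρ'_mem p ht
  have hcont : ContinuousAt (P.ρ' p) t :=
    (P.continuousOn_ρ'.continuousAt (τ.isOpen_dom.mem_nhds (τ.mk_mem_dom.2 ht : (p, t) ∈ τ.dom))).comp
      (f := fun t => (p, t)) (Continuous.prodMk_right p).continuousAt
  have hlt : ∀ {x : ℝ}, x < t → ∀ᶠ s in 𝓝[<] t, x < s ∧ s < t := fun hx =>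
    Filter.Eventually.and (nhdsWithin_le_nhds (lt_mem_nhds hx)) self_mem_nhdsWithin
  refine normalize_deriv_eq (hH.smooth.differentiableAt h1).hasDerivAt (hH.deriv_ne p _ h1)
    (P.hasDerivAt_η p ht) (P.η_immersed p t ht) hcont.continuousWithinAt ?_ ?_ ?_
  · rcases le_or_gt t P.a with h | h
    · filter_upwards [hlt ht.1] with s hs
      rw [P.ρ'_left p h, P.ρ'_left p (hs.2.le.trans h)]
      exact P.ρ_mono_left p ⟨hs.1, hs.2.le.trans h⟩ ⟨ht.1, h⟩ hs.2
    · have h2 : P.b < t := not_le.1 fun h2 => hab ⟨h, h2⟩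
      filter_upwards [hlt h2] with s hs
      rw [P.ρ'_right p h2.le, P.ρ'_right p hs.1.le]
      exact P.ρ_mono_right p ⟨hs.1.le, hs.2.trans ht.2⟩ ⟨h2.le, ht.2⟩ hs.2
  · rcases le_or_gt t P.a with h | h
    · filter_upwards [hlt ht.1] with s hs
      rw [P.ρ'_left p (hs.2.le.trans h), P.η_outer p s (Or.inl ⟨hs.1, hs.2.le.trans h⟩)]
    · have h2 : P.b < t := not_le.1 fun h2 => hab ⟨h, h2⟩
      filter_upwards [hlt h2] with s hs
      rw [P.ρ'_right p hs.1.le, P.η_outer p s (Or.inr ⟨hs.1.le, hs.2.trans ht.2⟩)]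
  · rcases le_or_gt t P.a with h | h
    · rw [P.ρ'_left p h, P.η_outer p t (Or.inl ⟨ht.1, h⟩)]
    · have h2 : P.b < t := not_le.1 fun h2 => hab ⟨h, h2⟩
      rw [P.ρ'_right p h2.le, P.η_outer p t (Or.inr ⟨h2.le, ht.2⟩)]

theorem norm_circleTangent (k θ : ℝ) : ‖circleTangent k θ‖ = 1 :=
  norm_eq_one_of_inner_self (inner_circleTangent_self k θ)

theorem normalize_deriv_η_middle (p : N) {t : ℝ} (hab : t ∈ Ioc P.a P.b) :
    ‖deriv (P.η p) t‖⁻¹ • deriv (P.η p) t =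
      circleTangent (geodesicCurvature (τ.H p) 0) (P.θ' p t) := by
  set k := geodesicCurvature (τ.H p) 0
  have ht : t ∈ Ioo (-τ.ε) τ.ε := ⟨P.neg_ε_lt_a.trans hab.1, hab.2.trans_lt P.b_lt_ε⟩
  have hlt : ∀ᶠ s in 𝓝[<] t, P.a < s ∧ s < t :=
    Filter.Eventually.and (nhdsWithin_le_nhds (lt_mem_nhds hab.1)) self_mem_nhdsWithin
  have hr : 0 < (√(1 + k ^ 2))⁻¹ := inv_pos.2 (Real.sqrt_pos.2 (one_add_sq_pos k))
  have hne : circleTangent k (P.θ' p t) ≠ 0 := fun h => by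
    have := norm_circleTangent k (P.θ' p t)
    rw [h, norm_zero] at this
    exact zero_ne_one this
  have h1 := normalize_deriv_eq (hasDerivAt_sphereCircle k (P.θ' p t))
    (smul_ne_zero hr.ne' hne) (P.hasDerivAt_η p ht) (P.η_immersed p t ht)
    ((P.continuous_θ'.comp (Continuous.prodMk_right p)).continuousAt.continuousWithinAt) ?_ ?_ ?_
  · rw [h1, norm_smul, Real.norm_of_nonneg hr.le, norm_circleTangent, mul_one, smul_smul,
      inv_mul_cancel₀ hr.ne', one_smul]
  · filter_upwards [hlt] with s hs
    rw [P.θ'_middle p ⟨hs.1.le, hs.2.le.trans hab.2⟩, P.θ'_middle p ⟨hab.1.le, hab.2⟩]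
    exact P.θ_mono p ⟨hs.1.le, hs.2.le.trans hab.2⟩ ⟨hab.1.le, hab.2⟩ hs.2
  · filter_upwards [hlt] with s hs
    rw [P.θ'_middle p ⟨hs.1.le, hs.2.le.trans hab.2⟩, P.η_middle p s ⟨hs.1.le, hs.2.le.trans hab.2⟩]
  · rw [P.θ'_middle p ⟨hab.1.le, hab.2⟩, P.η_middle p t ⟨hab.1.le, hab.2⟩]

end Profile

end Tube

/-! ### Homotopies of matrix valued functions -/

section MatrixHomotopy

variable {X : Type*} [TopologicalSpace X]

/-- The families `A`, `B` of invertible matrices are homotopic through invertible matrices,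
relative to `S`. -/
def MatHomotopic (S : Set X) (A B : X → Matrix (Fin 4) (Fin 4) ℝ) : Prop :=
  ∃ F : unitInterval × X → Matrix (Fin 4) (Fin 4) ℝ, Continuous F ∧ (∀ z, (F z).det ≠ 0) ∧
    (∀ x, F (0, x) = A x) ∧ (∀ x, F (1, x) = B x) ∧ ∀ s, ∀ x ∈ S, F (s, x) = A x

variable {S : Set X} {A B C : X → Matrix (Fin 4) (Fin 4) ℝ}

theorem MatHomotopic.trans (h₁ : MatHomotopic S A B) (h₂ : MatHomotopic S B C) :
    MatHomotopic S A C := by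
  obtain ⟨F, hF, hFd, hF0, hF1, hFS⟩ := h₁
  obtain ⟨G, hG, hGd, hG0, hG1, hGS⟩ := h₂
  have hB : Continuous B := by
    have h : B = fun x => F (1, x) := funext fun x => (hF1 x).symm
    rw [h]
    exact hF.comp (Continuous.prodMk_right 1)
  have hproj : Continuous (projIcc (0 : ℝ) 1 zero_le_one) := continuous_projIcc
  -- at each time one of the two homotopies is at rest at `B`
  refine ⟨fun z => F (projIcc 0 1 zero_le_one (2 * (z.1 : ℝ)), z.2) +
    G (projIcc 0 1 zero_le_one (2 * (z.1 : ℝ) - 1), z.2) - B z.2, ?_, ?_, ?_, ?_, ?_⟩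
  · exact ((hF.comp ((hproj.comp (by fun_prop)).prodMk continuous_snd)).add
      (hG.comp ((hproj.comp (by fun_prop)).prodMk continuous_snd))).sub (hB.comp continuous_snd)
  · rintro ⟨s, x⟩
    rcases le_total (2 * (s : ℝ)) 1 with h | h
    · have : projIcc (0 : ℝ) 1 zero_le_one (2 * (s : ℝ) - 1) = 0 := projIcc_of_le_left _ (by linarith)
      simp only [this, hG0]
      rw [add_sub_cancel_right]
      exact hFd _
    · have : projIcc (0 : ℝ) 1 zero_le_one (2 * (s : ℝ)) = 1 := projIcc_of_right_le _ h
      simp only [this, hF1]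
      rw [add_sub_cancel_left]
      exact hGd _
  · intro x
    have h1 : projIcc (0 : ℝ) 1 zero_le_one (2 * ((0 : unitInterval) : ℝ)) = 0 :=
      projIcc_of_le_left _ (by simp)
    have h2 : projIcc (0 : ℝ) 1 zero_le_one (2 * ((0 : unitInterval) : ℝ) - 1) = 0 :=
      projIcc_of_le_left _ (by simp)
    simp only [h1, h2, hF0, hG0, add_sub_cancel_right]
  · intro x
    have h1 : projIcc (0 : ℝ) 1 zero_le_one (2 * ((1 : unitInterval) : ℝ)) = 1 :=
      projIcc_of_right_le _ (by norm_num)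
    have h2 : projIcc (0 : ℝ) 1 zero_le_one (2 * ((1 : unitInterval) : ℝ) - 1) = 1 :=
      projIcc_of_right_le _ (by norm_num)
    simp only [h1, h2, hF1, hG1, add_sub_cancel_left]
  · intro s x hx
    have hAB : A x = B x := by rw [← hFS 1 x hx, hF1]
    simp only [hFS _ x hx, hGS _ x hx, add_sub_cancel_right]

theorem MatHomotopic.symm (h : MatHomotopic S A B) : MatHomotopic S B A := by
  obtain ⟨F, hF, hFd, hF0, hF1, hFS⟩ := h
  refine ⟨fun z => F (unitInterval.symm z.1, z.2),
    hF.comp ((unitInterval.continuous_symm.comp continuous_fst).prodMk continuous_snd),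
    fun z => hFd _, fun x => ?_, fun x => ?_, fun s x hx => ?_⟩
  · simp [hF1]
  · simp [hF0]
  · simp only
    rw [hFS _ x hx, ← hFS 1 x hx, hF1]

theorem MatHomotopic.mul (h : MatHomotopic S A B) {U V : X → Matrix (Fin 4) (Fin 4) ℝ}
    (hU : Continuous U) (hV : Continuous V) (hUd : ∀ x, (U x).det ≠ 0) (hVd : ∀ x, (V x).det ≠ 0) :
    MatHomotopic S (fun x => U x * A x * V x) fun x => U x * B x * V x := by
  obtain ⟨F, hF, hFd, hF0, hF1, hFS⟩ := h
  refine ⟨fun z => U z.2 * F z * V z.2, ((hU.comp continuous_snd).matrix_mul hF).matrix_mul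
    (hV.comp continuous_snd), fun z => ?_, fun x => ?_, fun x => ?_, fun s x hx => ?_⟩
  · rw [Matrix.det_mul, Matrix.det_mul]
    exact mul_ne_zero (mul_ne_zero (hUd _) (hFd _)) (hVd _)
  · simp only [hF0]
  · simp only [hF1]
  · simp only [hFS s x hx]

theorem MatHomotopic.mul_right (h : MatHomotopic S A B) {V : X → Matrix (Fin 4) (Fin 4) ℝ}
    (hV : Continuous V) (hVd : ∀ x, (V x).det ≠ 0) :
    MatHomotopic S (fun x => A x * V x) fun x => B x * V x := by
  simpa using h.mul (U := fun _ => 1) continuous_const hV (by simp) hVd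

end MatrixHomotopy

/-! ### Rotations -/

/-- The rotation by the angle `θ` in the plane given by `J`, where `J³ = -J`. -/
def rotMat (J : Matrix (Fin 4) (Fin 4) ℝ) (θ : ℝ) : Matrix (Fin 4) (Fin 4) ℝ :=
  1 + Real.sin θ • J + (1 - Real.cos θ) • (J * J)

theorem rotMat_mul_neg {J : Matrix (Fin 4) (Fin 4) ℝ} (hJ : J * J * J = -J) (θ : ℝ) :
    rotMat J θ * rotMat J (-θ) = 1 := by
  have h4 : J * J * (J * J) = -(J * J) := by
    rw [← mul_assoc, hJ, neg_mul]
  have h3 : J * (J * J) = -J := by rw [← mul_assoc, hJ]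
  have hsc := Real.sin_sq_add_cos_sq θ
  rw [rotMat, rotMat, Real.sin_neg, Real.cos_neg]
  simp only [add_mul, mul_add, mul_one, one_mul, smul_mul_assoc, mul_smul_comm, hJ, h4, h3]
  have hz : (2 * (1 - Real.cos θ) - Real.sin θ ^ 2 - (1 - Real.cos θ) ^ 2) • (J * J) = 0 := by
    rw [show 2 * (1 - Real.cos θ) - Real.sin θ ^ 2 - (1 - Real.cos θ) ^ 2 = 0 by
      linear_combination -hsc, zero_smul]
  calc _ = 1 + (2 * (1 - Real.cos θ) - Real.sin θ ^ 2 - (1 - Real.cos θ) ^ 2) • (J * J) := by module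
    _ = 1 := by rw [hz, add_zero]

theorem det_rotMat_ne_zero {J : Matrix (Fin 4) (Fin 4) ℝ} (hJ : J * J * J = -J) (θ : ℝ) :
    (rotMat J θ).det ≠ 0 := by
  have h := congrArg Matrix.det (rotMat_mul_neg hJ θ)
  rw [Matrix.det_mul, Matrix.det_one] at h
  exact left_ne_zero_of_mul_eq_one h

theorem rotMat_two_pi (J : Matrix (Fin 4) (Fin 4) ℝ) : rotMat J (2 * Real.pi) = 1 := by
  simp [rotMat]

theorem rotMat_zero (J : Matrix (Fin 4) (Fin 4) ℝ) : rotMat J 0 = 1 := by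
  simp [rotMat]

theorem rotMat_conj {J J' P : Matrix (Fin 4) (Fin 4) ℝ} (h : P * J' = J * P) (θ : ℝ) :
    P * rotMat J' θ = rotMat J θ * P := by
  have h2 : P * (J' * J') = J * J * P := by
    rw [← mul_assoc, h, mul_assoc, h, mul_assoc]
  simp only [rotMat, mul_add, add_mul, mul_one, one_mul, mul_smul_comm, smul_mul_assoc, h, h2]

theorem continuous_rotMat {X : Type*} [TopologicalSpace X] {J : X → Matrix (Fin 4) (Fin 4) ℝ}
    {θ : X → ℝ} (hJ : Continuous J) (hθ : Continuous θ) :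
    Continuous fun x => rotMat (J x) (θ x) :=
  (continuous_const.add ((Real.continuous_sin.comp hθ).smul hJ)).add
    ((continuous_const.sub (Real.continuous_cos.comp hθ)).smul (hJ.matrix_mul hJ))

theorem matHomotopic_rotMat {X : Type*} [TopologicalSpace X] {S : Set X}
    {J : unitInterval × X → Matrix (Fin 4) (Fin 4) ℝ} (hJ : Continuous J)
    (hJ3 : ∀ z, J z * J z * J z = -J z) {θ : X → ℝ} (hθ : Continuous θ)
    (hS : ∀ x ∈ S, θ x = 0 ∨ θ x = 2 * Real.pi) :
    MatHomotopic S (fun x => rotMat (J (0, x)) (θ x)) fun x => rotMat (J (1, x)) (θ x) := by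
  refine ⟨fun z => rotMat (J z) (θ z.2), continuous_rotMat hJ (hθ.comp continuous_snd),
    fun z => det_rotMat_ne_zero (hJ3 z) _, fun x => rfl, fun x => rfl, fun s x hx => ?_⟩
  rcases hS x hx with h | h
  · simp only [h, rotMat_zero]
  · simp only [h, rotMat_two_pi]

/-- The infinitesimal rotation `u ↦ w`, `w ↦ -u` in the plane spanned by `u, w`. -/
def planeRot (u w : Fin 4 → ℝ) : Matrix (Fin 4) (Fin 4) ℝ :=
  Matrix.vecMulVec w u - Matrix.vecMulVec u w

/-- A difference of two elementary tensors `w ⊗ φ - u ⊗ ψ`, where `φ, ψ` are positive multiples of a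
dual basis of `u, w`, is a multiple of an infinitesimal rotation. -/
theorem sub_vecMulVec_cube {u w φ ψ : Fin 4 → ℝ} {a b : ℝ} (h1 : φ ⬝ᵥ u = a) (h2 : ψ ⬝ᵥ w = b)
    (h3 : φ ⬝ᵥ w = 0) (h4 : ψ ⬝ᵥ u = 0) (N : Matrix (Fin 4) (Fin 4) ℝ)
    (hN : N = Matrix.vecMulVec w φ - Matrix.vecMulVec u ψ) : N * N * N = (-(a * b)) • N := by
  have hm : ∀ p q r t : Fin 4 → ℝ, Matrix.vecMulVec p q * Matrix.vecMulVec r t =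
      (q ⬝ᵥ r) • Matrix.vecMulVec p t := by
    intro p q r t
    rw [Matrix.vecMulVec_mul_vecMulVec, Matrix.vecMulVec_smul]
  have hN2 : N * N = -(a • Matrix.vecMulVec w ψ) - b • Matrix.vecMulVec u φ := by
    rw [hN, sub_mul, mul_sub, mul_sub, hm, hm, hm, hm, h1, h2, h3, h4]
    module
  rw [hN2, hN, sub_mul, neg_mul, mul_sub, mul_sub, smul_mul_assoc, smul_mul_assoc, smul_mul_assoc,
    smul_mul_assoc, hm, hm, hm, hm, h1, h2, h3, h4]
  module

theorem planeRot_cube {u w : Fin 4 → ℝ} (hu : u ⬝ᵥ u = 1) (hw : w ⬝ᵥ w = 1) (huw : u ⬝ᵥ w = 0) :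
    planeRot u w * planeRot u w * planeRot u w = -planeRot u w := by
  rw [sub_vecMulVec_cube hu hw huw (by rw [dotProduct_comm, huw]) (planeRot u w) rfl]
  simp

/-- The infinitesimal rotation `e₀ ↦ n / ‖n‖`, where `n` is the orthogonal complement of
`⟨e₀, e₁, e₂⟩`, for the scalar product with Gram matrix `γ`: it is the normalised multiple of
`v ↦ ⟨e₀, v⟩ n - ⟨n, v⟩ e₀`. -/
def gramRot (γ : Matrix (Fin 4) (Fin 4) ℝ) : Matrix (Fin 4) (Fin 4) ℝ :=
  (√(γ 0 0 * γ⁻¹ 3 3))⁻¹ • (Matrix.vecMulVec (fun i => γ⁻¹ i 3) (γ 0) -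
    Matrix.vecMulVec (Pi.single 0 1) (Pi.single 3 1))

theorem gramRot_apply (γ : Matrix (Fin 4) (Fin 4) ℝ) (i j : Fin 4) : gramRot γ i j =
    (√(γ 0 0 * γ⁻¹ 3 3))⁻¹ * (γ⁻¹ i 3 * γ 0 j - (Pi.single 0 1 : Fin 4 → ℝ) i *
      (Pi.single 3 1 : Fin 4 → ℝ) j) := rfl

theorem gramRot_pos {γ : Matrix (Fin 4) (Fin 4) ℝ} (hγ : γ.PosDef) : 0 < γ 0 0 * γ⁻¹ 3 3 :=
  mul_pos hγ.diag_pos hγ.inv.diag_pos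

theorem gramRot_cube {γ : Matrix (Fin 4) (Fin 4) ℝ} (hγ : γ.PosDef) :
    gramRot γ * gramRot γ * gramRot γ = -gramRot γ := by
  have hpos := gramRot_pos hγ
  have hdet : IsUnit γ.det := hγ.det_pos.ne'.isUnit
  have h1 := sub_vecMulVec_cube (u := Pi.single 0 1) (w := fun i => γ⁻¹ i 3) (φ := γ 0)
    (ψ := Pi.single 3 1) (a := γ 0 0) (b := γ⁻¹ 3 3) (by simp) (by simp)
    (by
      have := congrFun (congrFun (Matrix.mul_nonsing_inv γ hdet) 0) 3
      simpa [Matrix.mul_apply, dotProduct] using this) (by simp) _ rfl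
  have hs : √(γ 0 0 * γ⁻¹ 3 3) * √(γ 0 0 * γ⁻¹ 3 3) = γ 0 0 * γ⁻¹ 3 3 := Real.mul_self_sqrt hpos.le
  have hs0 : √(γ 0 0 * γ⁻¹ 3 3) ≠ 0 := (Real.sqrt_pos.2 hpos).ne'
  rw [gramRot, smul_mul_smul_comm, smul_mul_smul_comm, h1, smul_smul, ← neg_smul]
  generalize √(γ 0 0 * γ⁻¹ 3 3) = s at hs hs0 ⊢
  rw [← hs]
  congr 1
  field_simp

theorem contDiffAt_gramRot (A₀ : Fin 4 → Fin 4 → ℝ) (h : (Matrix.of A₀).PosDef) (i j : Fin 4) :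
    ContDiffAt ℝ ∞ (fun A : Fin 4 → Fin 4 → ℝ => gramRot (Matrix.of A) i j) A₀ := by
  have hinv := contDiffAt_matrix_inv A₀ h.det_pos.ne'
  have hent : ∀ i j, ContDiffAt ℝ ∞ (fun A : Fin 4 → Fin 4 → ℝ => Matrix.of A i j) A₀ := by
    intro i j
    simp only [Matrix.of_apply]
    fun_prop
  simp only [gramRot_apply]
  have hpos := gramRot_pos h
  exact ((((hent 0 0).mul (hinv 3 3)).sqrt hpos.ne').inv (Real.sqrt_pos.2 hpos).ne').mul
    (((hinv i 3).mul (hent 0 j)).sub contDiffAt_const)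

theorem continuous_gramRot {X : Type*} [TopologicalSpace X] {γ : X → Matrix (Fin 4) (Fin 4) ℝ}
    (hγ : Continuous γ) (hp : ∀ x, (γ x).PosDef) : Continuous fun x => gramRot (γ x) := by
  refine continuous_matrix fun i j => continuous_iff_continuousAt.2 fun x => ?_
  exact (contDiffAt_gramRot (γ x) (hp x) i j).continuousAt.comp (f := γ) hγ.continuousAt

theorem gramRot_one : gramRot 1 = planeRot (Pi.single 0 1) (Pi.single 3 1) := by
  ext i j
  rw [gramRot_apply, planeRot]
  simp [Matrix.vecMulVec_apply, Matrix.one_apply, Pi.single_apply, eq_comm]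

/-- The rotation `gramRot` does not depend on the choice of the frame, as long as frames are related
by matrices preserving the line spanned by `e₀` and the hyperplane `⟨e₀, e₁, e₂⟩`, with diagonal
entries of the same sign. -/
theorem gramRot_conj {γ P : Matrix (Fin 4) (Fin 4) ℝ} (hγ : γ.PosDef) (hP : P.det ≠ 0) {a d : ℝ}
    (had : 0 < a * d) (h0 : ∀ i, P i 0 = if i = 0 then a else 0)
    (h3 : ∀ j, P 3 j = if j = 3 then d else 0) :
    P * gramRot (P.transpose * γ * P) = gramRot γ * P := by
  have hPu : IsUnit P.det := hP.isUnit
  have hPtu : IsUnit P.transpose.det := by rwa [Matrix.det_transpose]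
  have ha : a ≠ 0 := left_ne_zero_of_mul had.ne'
  have hd : d ≠ 0 := right_ne_zero_of_mul had.ne'
  have hγu : IsUnit γ.det := hγ.det_pos.ne'.isUnit
  have hinv : (P.transpose * γ * P)⁻¹ = P⁻¹ * γ⁻¹ * P.transpose⁻¹ := by
    rw [Matrix.mul_inv_rev, Matrix.mul_inv_rev, mul_assoc]
  have hPinv : P * (P⁻¹ * γ⁻¹ * P.transpose⁻¹) = γ⁻¹ * P.transpose⁻¹ := by
    rw [mul_assoc, Matrix.mul_nonsing_inv_cancel_left _ _ hPu]
  -- the last row of `P` determines the last row of its inverse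
  have hPi : ∀ j, P⁻¹ 3 j = if j = 3 then d⁻¹ else 0 := by
    intro j
    have h := congrFun (congrFun (Matrix.mul_nonsing_inv P hPu) 3) j
    rw [Matrix.mul_apply, Fin.sum_univ_four, h3, h3, h3, h3] at h
    simp +decide at h
    rw [Matrix.one_apply] at h
    by_cases hj : j = 3
    · subst hj
      simp at h ⊢
      field_simp
      linear_combination h
    · rw [if_neg (Ne.symm hj)] at h
      rw [if_neg hj]
      exact (mul_eq_zero.1 h).resolve_left hd
  have hPti : ∀ i, P.transpose⁻¹ i 3 = if i = 3 then d⁻¹ else 0 := by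
    intro i
    rw [← Matrix.transpose_nonsing_inv, Matrix.transpose_apply, hPi]
  have hcol : ∀ i, (γ⁻¹ * P.transpose⁻¹) i 3 = d⁻¹ * γ⁻¹ i 3 := by
    intro i
    rw [Matrix.mul_apply, Fin.sum_univ_four, hPti, hPti, hPti, hPti]
    simp +decide
    ring
  have h33 : (P.transpose * γ * P)⁻¹ 3 3 = d⁻¹ * d⁻¹ * γ⁻¹ 3 3 := by
    rw [hinv, mul_assoc, Matrix.mul_apply, Fin.sum_univ_four, hPi, hPi, hPi, hPi]
    simp +decide
    rw [hcol]
    ring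
  have hrow : ∀ j, (P.transpose * γ * P) 0 j = a * (γ * P) 0 j := by
    intro j
    rw [mul_assoc, Matrix.mul_apply, Fin.sum_univ_four]
    simp only [Matrix.transpose_apply]
    rw [h0, h0, h0, h0]
    simp +decide
  have h00 : (P.transpose * γ * P) 0 0 = a * a * γ 0 0 := by
    rw [hrow, Matrix.mul_apply, Fin.sum_univ_four, h0, h0, h0, h0]
    simp +decide
    ring
  have hsqrt : √((P.transpose * γ * P) 0 0 * (P.transpose * γ * P)⁻¹ 3 3) =
      a / d * √(γ 0 0 * γ⁻¹ 3 3) := by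
    have had' : 0 ≤ a / d := by
      rw [← mul_div_mul_right a d hd]
      exact div_nonneg had.le (mul_self_nonneg d)
    rw [h00, h33, show a * a * γ 0 0 * (d⁻¹ * d⁻¹ * γ⁻¹ 3 3) = (a / d) ^ 2 * (γ 0 0 * γ⁻¹ 3 3) by
      field_simp, Real.sqrt_mul (sq_nonneg _), Real.sqrt_sq had']
  have hs0 : √(γ 0 0 * γ⁻¹ 3 3) ≠ 0 := (Real.sqrt_pos.2 (gramRot_pos hγ)).ne'
  ext i j
  have hL : (P * gramRot (P.transpose * γ * P)) i j = (a / d * √(γ 0 0 * γ⁻¹ 3 3))⁻¹ *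
      ((∑ k, P i k * (P.transpose * γ * P)⁻¹ k 3) * (a * (γ * P) 0 j) -
        P i 0 * (Pi.single 3 1 : Fin 4 → ℝ) j) := by
    have hg : ∀ k, gramRot (P.transpose * γ * P) k j = (a / d * √(γ 0 0 * γ⁻¹ 3 3))⁻¹ *
        ((P.transpose * γ * P)⁻¹ k 3 * (a * (γ * P) 0 j) - (if k = 0 then 1 else 0) *
          (Pi.single 3 1 : Fin 4 → ℝ) j) := by
      intro k
      rw [gramRot_apply, hsqrt, hrow, Pi.single_apply]
    rw [Matrix.mul_apply]
    simp only [Fin.sum_univ_four, hg]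
    simp +decide only [if_true, if_false]
    ring
  have hR : (gramRot γ * P) i j = (√(γ 0 0 * γ⁻¹ 3 3))⁻¹ *
      (γ⁻¹ i 3 * (γ * P) 0 j - (Pi.single 0 1 : Fin 4 → ℝ) i * P 3 j) := by
    rw [Matrix.mul_apply, Matrix.mul_apply]
    generalize hσ : (Pi.single 0 1 : Fin 4 → ℝ) i = σ
    simp only [gramRot_apply, hσ, Fin.sum_univ_four, Pi.single_apply]
    simp +decide only [if_true, if_false]
    ring
  rw [hL, hR, ← Matrix.mul_apply, hinv, hPinv, hcol, h0, h3]
  simp only [Pi.single_apply]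
  by_cases hi : i = 0 <;> by_cases hj : j = 3 <;> simp [hi, hj] <;> field_simp

/-! ### Frames along curves as matrices -/

/-- The matrix with columns `T, u, v, u × v`. -/
def frameMat (u v : R3) : Matrix (Fin 4) (Fin 4) ℝ :=
  !![1, 0, 0, 0; 0, u 0, v 0, cross u v 0; 0, u 1, v 1, cross u v 1; 0, u 2, v 2, cross u v 2]

theorem det_frameMat (u v : R3) : (frameMat u v).det = inner ℝ (cross u v) (cross u v) := by
  rw [inner_eq_three, cross_zero, cross_one, cross_two, frameMat, Matrix.det_succ_column_zero]
  simp [Fin.sum_univ_succ, Matrix.det_fin_three, Fin.succAbove, cross_zero, cross_one, cross_two]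
  ring

theorem det_frameMat_ne_zero {u v : R3} (h : cross u v ≠ 0) : (frameMat u v).det ≠ 0 := by
  rw [det_frameMat]
  exact inner_self_ne_zero.2 h

/-- The passage from `(T, h)` to the frame `(κ₂ T - κ₁ h, (κ₁ T + κ₂ h) / (κ₁² + κ₂²))`. -/
def kapMat (k₁ k₂ : ℝ) : Matrix (Fin 4) (Fin 4) ℝ :=
  !![k₂, k₁ / (k₁ ^ 2 + k₂ ^ 2), 0, 0; -k₁, k₂ / (k₁ ^ 2 + k₂ ^ 2), 0, 0; 0, 0, 1, 0; 0, 0, 0, 1]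

theorem det_kapMat {k₁ k₂ : ℝ} (h : k₁ ^ 2 + k₂ ^ 2 ≠ 0) : (kapMat k₁ k₂).det = 1 := by
  rw [kapMat, Matrix.det_succ_column_zero]
  simp [Fin.sum_univ_succ, Matrix.det_fin_three, Fin.succAbove]
  field_simp
  ring

/-- The rescaling of the last two columns. -/
def scaleMat (m : ℝ) : Matrix (Fin 4) (Fin 4) ℝ := Matrix.diagonal ![1, 1, m, m]

theorem det_scaleMat (m : ℝ) : (scaleMat m).det = m * m := by
  simp [scaleMat, Fin.prod_univ_succ]

theorem frameMat_smul (u v : R3) (m : ℝ) : frameMat u (m • v) = frameMat u v * scaleMat m := by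
  ext i j
  rw [scaleMat, Matrix.mul_diagonal]
  fin_cases i <;> fin_cases j <;> simp [frameMat, cross] <;> ring

theorem scaleMat_mul_kapMat_comm (m k₁ k₂ : ℝ) :
    scaleMat m * kapMat k₁ k₂ * planeRot (Pi.single 2 1) (Pi.single 3 1) =
      planeRot (Pi.single 2 1) (Pi.single 3 1) * (scaleMat m * kapMat k₁ k₂) := by
  ext i j
  simp only [Matrix.mul_apply, Fin.sum_univ_four, scaleMat, planeRot]
  fin_cases i <;> fin_cases j <;> simp [kapMat, Matrix.vecMulVec_apply]

theorem frameMat_standard : frameMat !₂[1, 0, 0] !₂[0, 1, 0] = 1 := by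
  ext i j
  fin_cases i <;> fin_cases j <;> simp [frameMat, cross]

theorem frameMat_sphereCircle_zero (θ : ℝ) : frameMat (sphereCircle 0 θ) (circleTangent 0 θ) =
    rotMat (planeRot (Pi.single 1 1) (Pi.single 2 1)) θ := by
  ext i j
  have h := Real.sin_sq_add_cos_sq θ
  simp only [rotMat, Matrix.add_apply, Matrix.smul_apply, Matrix.mul_apply, Fin.sum_univ_four]
  fin_cases i <;> fin_cases j <;>
    simp [frameMat, cross, planeRot, sphereCircle, circleTangent, Matrix.vecMulVec_apply] <;>
      linear_combination h

theorem sphereCircle_angle_zero (k : ℝ) : sphereCircle k 0 = !₂[1, 0, 0] := by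
  have := (one_add_sq_pos k).ne'
  ext i
  fin_cases i <;> simp [sphereCircle] <;> field_simp <;> ring

theorem sphereCircle_angle_two_pi (k : ℝ) : sphereCircle k (2 * Real.pi) = !₂[1, 0, 0] := by
  rw [← sphereCircle_angle_zero k]
  simp [sphereCircle]

theorem circleTangent_angle_zero (k : ℝ) : circleTangent k 0 = !₂[0, 1, 0] := by
  ext i
  fin_cases i <;> simp [circleTangent]

theorem circleTangent_angle_two_pi (k : ℝ) : circleTangent k (2 * Real.pi) = !₂[0, 1, 0] := by
  rw [← circleTangent_angle_zero k]
  simp [circleTangent]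

section Homotopies

variable {X : Type*} [TopologicalSpace X]

theorem continuous_frameMat {u v : X → R3} (hu : Continuous u) (hv : Continuous v) :
    Continuous fun x => frameMat (u x) (v x) := by
  have hu' : ∀ i, Continuous fun x => u x i := fun i => by fun_prop
  have hv' : ∀ i, Continuous fun x => v x i := fun i => by fun_prop
  refine continuous_matrix fun i j => ?_
  fin_cases i <;> fin_cases j <;> simp [frameMat, cross] <;> fun_prop

theorem continuous_kapMat {k₁ k₂ : X → ℝ} (h₁ : Continuous k₁) (h₂ : Continuous k₂)
    (h : ∀ x, k₁ x ^ 2 + k₂ x ^ 2 ≠ 0) : Continuous fun x => kapMat (k₁ x) (k₂ x) := by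
  have a1 := h₁.div ((h₁.pow 2).add (h₂.pow 2)) h
  have a2 := h₂.div ((h₁.pow 2).add (h₂.pow 2)) h
  refine continuous_matrix fun i j => ?_
  fin_cases i <;> fin_cases j <;> simp [kapMat] <;> first | assumption | fun_prop

theorem continuous_scaleMat {m : X → ℝ} (hm : Continuous m) : Continuous fun x => scaleMat (m x) := by
  refine continuous_matrix fun i j => ?_
  fin_cases i <;> fin_cases j <;> simp [scaleMat] <;> fun_prop

theorem sq_add_sq_ne_zero_of {a b a' b' : ℝ} (h : 0 < a * a' ∨ (a = 0 ∧ a' = 0 ∧ 0 < b * b'))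
    (s : unitInterval) :
    ((1 - (s : ℝ)) * a + s * a') ^ 2 + ((1 - (s : ℝ)) * b + s * b') ^ 2 ≠ 0 := by
  have key : ∀ {x y : ℝ}, 0 < x * y → (1 - (s : ℝ)) * x + s * y ≠ 0 := by
    intro x y hxy h0
    have h1 : (1 - (s : ℝ)) * x ^ 2 + s * (x * y) = 0 := by linear_combination x * h0
    have h2 : 0 ≤ (1 - (s : ℝ)) * x ^ 2 := mul_nonneg (sub_nonneg.2 s.2.2) (sq_nonneg x)
    have h3 : 0 ≤ (s : ℝ) * (x * y) := mul_nonneg s.2.1 hxy.le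
    have hs : (s : ℝ) = 0 := (mul_eq_zero.1 (by linarith : (s : ℝ) * (x * y) = 0)).resolve_right hxy.ne'
    rw [hs] at h0
    have hx : x = 0 := by linarith
    rw [hx, zero_mul] at hxy
    exact lt_irrefl _ hxy
  intro h0
  have h1 := (add_eq_zero_iff_of_nonneg (sq_nonneg _) (sq_nonneg _)).1 h0
  rcases h with h | ⟨-, -, h⟩
  · exact key h (pow_eq_zero_iff two_ne_zero |>.1 h1.1)
  · exact key h (pow_eq_zero_iff two_ne_zero |>.1 h1.2)

theorem matHomotopic_kapMat {S : Set X} {a b a' b' : X → ℝ} (ha : Continuous a) (hb : Continuous b)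
    (ha' : Continuous a') (hb' : Continuous b')
    (h : ∀ x, 0 < a x * a' x ∨ (a x = 0 ∧ a' x = 0 ∧ 0 < b x * b' x))
    (hS : ∀ x ∈ S, a x = a' x ∧ b x = b' x) :
    MatHomotopic S (fun x => kapMat (a x) (b x)) fun x => kapMat (a' x) (b' x) := by
  refine ⟨fun z => kapMat ((1 - (z.1 : ℝ)) * a z.2 + z.1 * a' z.2)
    ((1 - (z.1 : ℝ)) * b z.2 + z.1 * b' z.2), continuous_kapMat (by fun_prop) (by fun_prop)
      fun z => sq_add_sq_ne_zero_of (h z.2) z.1, fun z => ?_, fun x => ?_, fun x => ?_,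
      fun s x hx => ?_⟩
  · rw [det_kapMat (sq_add_sq_ne_zero_of (h z.2) z.1)]
    exact one_ne_zero
  · simp
  · simp
  · obtain ⟨h1, h2⟩ := hS x hx
    simp only [← h1, ← h2]
    congr 1 <;> ring

theorem matHomotopic_frameMat {S : Set X} {u v u' v' : X → R3} (hu : Continuous u)
    (hv : Continuous v) (hu' : Continuous u') (hv' : Continuous v')
    (h : ∀ x, ∀ s ∈ Icc (0 : ℝ) 1,
      cross ((1 - s) • u x + s • u' x) ((1 - s) • v x + s • v' x) ≠ 0)
    (hS : ∀ x ∈ S, u x = u' x ∧ v x = v' x) :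
    MatHomotopic S (fun x => frameMat (u x) (v x)) fun x => frameMat (u' x) (v' x) := by
  refine ⟨fun z => frameMat ((1 - (z.1 : ℝ)) • u z.2 + (z.1 : ℝ) • u' z.2)
    ((1 - (z.1 : ℝ)) • v z.2 + (z.1 : ℝ) • v' z.2), continuous_frameMat (by fun_prop) (by fun_prop),
      fun z => det_frameMat_ne_zero (h z.2 z.1 z.1.2), fun x => ?_, fun x => ?_, fun s x hx => ?_⟩
  · simp
  · simp
  · obtain ⟨h1, h2⟩ := hS x hx
    simp only [← h1, ← h2, ← add_smul, sub_add_cancel, one_smul]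

theorem matHomotopic_planeRot {S : Set X} {u : ℝ → Fin 4 → ℝ} {w : Fin 4 → ℝ} (hu : Continuous u)
    (huu : ∀ s, u s ⬝ᵥ u s = 1) (hw : w ⬝ᵥ w = 1) (huw : ∀ s, u s ⬝ᵥ w = 0) {θ : X → ℝ}
    (hθ : Continuous θ) (hS : ∀ x ∈ S, θ x = 0 ∨ θ x = 2 * Real.pi) :
    MatHomotopic S (fun x => rotMat (planeRot (u 0) w) (θ x))
      fun x => rotMat (planeRot (u 1) w) (θ x) := by
  have h := matHomotopic_rotMat (S := S) (J := fun z : unitInterval × X => planeRot (u z.1) w)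
    ?_ (fun z => planeRot_cube (huu _) hw (huw _)) hθ hS
  · simpa using h
  · have hc : Continuous fun z : unitInterval × X => u z.1 := by fun_prop
    refine continuous_matrix fun i j => ?_
    simp only [planeRot, Matrix.sub_apply, Matrix.vecMulVec_apply]
    have hi : ∀ i, Continuous fun z : unitInterval × X => u z.1 i := fun i =>
      (continuous_apply i).comp hc
    have := hi i
    have := hi j
    fun_prop

theorem matHomotopic_gramRot {S : Set X} {γ : X → Matrix (Fin 4) (Fin 4) ℝ} (hγ : Continuous γ)
    (hp : ∀ x, (γ x).PosDef) {θ : X → ℝ}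
    (hθ : Continuous θ) (hS : ∀ x ∈ S, θ x = 0 ∨ θ x = 2 * Real.pi) :
    MatHomotopic S (fun x => rotMat (gramRot 1) (θ x)) fun x => rotMat (gramRot (γ x)) (θ x) := by
  have hpos : ∀ z : unitInterval × X, ((1 - (z.1 : ℝ)) • (1 : Matrix (Fin 4) (Fin 4) ℝ) +
      (z.1 : ℝ) • γ z.2).PosDef := by
    rintro ⟨s, x⟩
    rcases eq_or_lt_of_le s.2.1 with h | h
    · simp only [← h]
      simpa using Matrix.PosDef.one
    · exact Matrix.PosDef.posSemidef_add (Matrix.PosDef.one.posSemidef.smul (sub_nonneg.2 s.2.2))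
        ((hp x).smul h)
  have h := matHomotopic_rotMat (S := S) (J := fun z : unitInterval × X =>
    gramRot ((1 - (z.1 : ℝ)) • (1 : Matrix (Fin 4) (Fin 4) ℝ) + (z.1 : ℝ) • γ z.2))
    (continuous_gramRot (by fun_prop) hpos) (fun z => gramRot_cube (hpos z)) hθ hS
  simpa using h

end Homotopies

/-! ### Homotopy of the adapted frames along the tube -/

theorem cross_ne_zero_of_inner {u v : R3} (h : inner ℝ u v ^ 2 < ‖u‖ ^ 2 * ‖v‖ ^ 2) :
    cross u v ≠ 0 := by
  intro h0
  have h1 := inner_cross_self u v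
  rw [h0, inner_zero_left, real_inner_self_eq_norm_sq, real_inner_self_eq_norm_sq] at h1
  linarith

/-- Linear independence is stable under small perturbations of an orthogonal pair. -/
theorem cross_ne_zero_of_close {e f u v : R3} {δ : ℝ} (hδ : δ ≤ 1 / 8) (hδ0 : 0 ≤ δ) (he : ‖e‖ = 1)
    (hδf : δ ≤ ‖f‖ / 8) (hf : f ≠ 0) (hef : inner ℝ e f = 0) (hu : ‖u - e‖ ≤ δ) (hv : ‖v - f‖ ≤ δ) :
    cross u v ≠ 0 := by
  have hf0 : 0 < ‖f‖ := norm_pos_iff.2 hf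
  have h1 : 7 / 8 ≤ ‖u‖ := by
    have := norm_sub_norm_le e u
    rw [norm_sub_rev] at this
    linarith
  have h2 : 7 / 8 * ‖f‖ ≤ ‖v‖ := by
    have := norm_sub_norm_le f v
    rw [norm_sub_rev] at this
    linarith
  have h3 : ‖v‖ ≤ 9 / 8 * ‖f‖ := by
    have := norm_sub_norm_le v f
    linarith
  have h4 : |inner ℝ u v| ≤ 1 / 2 * ‖f‖ := by
    have h5 : inner ℝ u v = inner ℝ (u - e) v + inner ℝ e (v - f) := by
      rw [inner_sub_left, inner_sub_right, hef]
      ring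
    have h6 := abs_real_inner_le_norm (u - e) v
    have h7 := abs_real_inner_le_norm e (v - f)
    rw [he, one_mul] at h7
    have h8 : ‖u - e‖ * ‖v‖ ≤ 1 / 8 * (9 / 8 * ‖f‖) :=
      mul_le_mul (hu.trans hδ) h3 (norm_nonneg _) (by norm_num)
    rw [h5]
    refine (abs_add_le _ _).trans ?_
    linarith
  refine cross_ne_zero_of_inner ?_
  have h9 : 49 / 64 * ‖f‖ ≤ ‖u‖ * ‖v‖ := by
    calc 49 / 64 * ‖f‖ = 7 / 8 * (7 / 8 * ‖f‖) := by ring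
      _ ≤ ‖u‖ * ‖v‖ := mul_le_mul h1 h2 (by positivity) (norm_nonneg _)
  rw [← mul_pow, ← sq_abs (inner ℝ u v)]
  exact pow_lt_pow_left₀ (by linarith) (abs_nonneg _) two_ne_zero

theorem continuous_vec_three {Z : Type*} [TopologicalSpace Z] {x y z : Z → ℝ} (hx : Continuous x)
    (hy : Continuous y) (hz : Continuous z) : Continuous fun w => (!₂[x w, y w, z w] : R3) := by
  refine (PiLp.continuous_toLp 2 _).comp (continuous_pi fun i => ?_)
  fin_cases i
  exacts [hx, hy, hz]

theorem continuous_sphereCircle {Z : Type*} [TopologicalSpace Z] {a b : Z → ℝ} (ha : Continuous a)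
    (hb : Continuous b) : Continuous fun z => sphereCircle (a z) (b z) := by
  have hs : ∀ z, (1 + a z ^ 2) ≠ 0 := fun z => (one_add_sq_pos _).ne'
  have hs' : ∀ z, √(1 + a z ^ 2) ≠ 0 := fun z => (Real.sqrt_pos.2 (one_add_sq_pos _)).ne'
  have h1 : Continuous fun z => 1 + a z ^ 2 := by fun_prop
  exact continuous_vec_three (((ha.pow 2).add (Real.continuous_cos.comp hb)).div h1 hs)
    ((Real.continuous_sin.comp hb).div h1.sqrt hs')
    ((ha.mul (continuous_const.sub (Real.continuous_cos.comp hb))).div h1 hs)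

theorem continuous_circleTangent {Z : Type*} [TopologicalSpace Z] {a b : Z → ℝ} (ha : Continuous a)
    (hb : Continuous b) : Continuous fun z => circleTangent (a z) (b z) := by
  have hs' : ∀ z, √(1 + a z ^ 2) ≠ 0 := fun z => (Real.sqrt_pos.2 (one_add_sq_pos _)).ne'
  have h1 : Continuous fun z => 1 + a z ^ 2 := by fun_prop
  exact continuous_vec_three ((Real.continuous_sin.comp hb).neg.div h1.sqrt hs')
    (Real.continuous_cos.comp hb) ((ha.mul (Real.continuous_sin.comp hb)).div h1.sqrt hs')

theorem planeRot_neg (u w : Fin 4 → ℝ) : planeRot (-w) u = planeRot u w := by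
  rw [planeRot, planeRot, Matrix.vecMulVec_neg, Matrix.neg_vecMulVec]
  abel

namespace Tube

universe u

variable {M : Type u} [TopologicalSpace M] [T2Space M] [ChartedSpace R4 M] [IsManifold (𝓡 4) ∞ M]
  {EN : Type*} [NormedAddCommGroup EN] [NormedSpace ℝ EN] [FiniteDimensional ℝ EN]
  {HN : Type*} [TopologicalSpace HN]
  {D : Π x : M, Submodule ℝ (TangentSpace (𝓡 4) x)} {J : ModelWithCorners ℝ EN HN} [J.Boundaryless]
  {N : Type*} [TopologicalSpace N] [CompactSpace N] [ChartedSpace HN N] [IsManifold J ∞ N]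
  [Nonempty N] {τ : Tube D J N}

theorem IsCurveFamily.cross_ne_zero {h : N → ℝ → R3} (hh : τ.IsCurveFamily h) (p : N) {t : ℝ}
    (ht : t ∈ Ioo (-τ.ε) τ.ε) : cross (h p t) (deriv (h p) t) ≠ 0 := by
  refine cross_ne_zero_of_inner ?_
  rw [hh.inner_deriv p ht, hh.norm_eq p t ht, zero_pow two_ne_zero, one_pow, one_mul]
  exact (sq_nonneg _).lt_of_ne' (hh.norm_ne p ht)

theorem SmoothCurves.continuous {h : N → ℝ → R3} (hs : τ.SmoothCurves h) :
    Continuous fun q : τ.dom => h q.1.1 q.1.2 :=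
  ContMDiffOn.continuousOn hs |>.comp_continuous continuous_subtype_val fun q => q.2

theorem dom_mem (q : τ.dom) : q.1.2 ∈ Ioo (-τ.ε) τ.ε := q.2.2

/-- Smoothings which are sufficiently close to the profile are connected with it by a linear
homotopy of pairs of linearly independent vectors. -/
theorem Profile.exists_delta (hD : IsEngel D) (P : τ.Profile) : ∃ δ : ℝ, 0 < δ ∧
    ∀ l, τ.IsSmoothing P δ l → ∀ p, ∀ t ∈ Ioo (-τ.ε) τ.ε, ∀ s ∈ Icc (0 : ℝ) 1,
      cross ((1 - s) • l p t + s • P.η p t)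
        ((1 - s) • deriv (l p) t + s • deriv (P.η p) t) ≠ 0 := by
  have hc := P.c_lt
  have hc0 := P.c_pos
  set c' := (P.c + τ.ε) / 2 with hc'
  have hsub := τ.prod_Icc_subset_dom (show c' < τ.ε by linarith)
  have hne : ((univ : Set N) ×ˢ Icc (-c') c').Nonempty :=
    ⟨(Classical.arbitrary N, 0), mem_univ _, by constructor <;> linarith⟩
  -- on the compact part `|t| ≤ c'` of the tube the velocity of `η` is bounded below, and `η ⊥ η'`;
  -- for `c < |t|` the curves `l` and `η` agree
  obtain ⟨q₀, hq₀, hmin⟩ := (isCompact_univ.prod isCompact_Icc).exists_isMinOn hne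
    (P.contMDiffOn_deriv_η.continuousOn.norm.mono hsub)
  have hm : 0 < ‖deriv (P.η q₀.1) q₀.2‖ := norm_pos_iff.2 (P.η_immersed _ _ (hsub hq₀).2)
  refine ⟨min (1 / 8) (‖deriv (P.η q₀.1) q₀.2‖ / 8), by positivity, fun l hl p t ht s hs => ?_⟩
  rcases le_or_gt |t| c' with h | h
  · have hle : ‖deriv (P.η q₀.1) q₀.2‖ ≤ ‖deriv (P.η p) t‖ :=
      hmin (a := (p, t)) ⟨mem_univ _, abs_le.1 h⟩
    have hclose : ∀ {x y : R3} {d : ℝ}, ‖x - y‖ < d → ‖(1 - s) • x + s • y - y‖ ≤ d := by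
      intro x y d hxy
      have h1 : (1 - s) • x + s • y - y = (1 - s) • (x - y) := by module
      rw [h1, norm_smul, Real.norm_of_nonneg (by linarith [hs.2])]
      calc (1 - s) * ‖x - y‖ ≤ 1 * ‖x - y‖ :=
            mul_le_mul_of_nonneg_right (by linarith [hs.1]) (norm_nonneg _)
        _ ≤ d := by rw [one_mul]; exact hxy.le
    exact cross_ne_zero_of_close (min_le_left _ _) (by positivity) (P.norm_η p ht)
      ((min_le_right _ _).trans (by linarith)) (P.η_immersed p t ht) (P.inner_deriv_η p ht)
      (hclose (hl.close_zero p t ht)) (hclose (hl.close_one p t ht))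
  · have h1 : P.c < |t| := lt_of_le_of_lt (by linarith) h
    have hd : deriv (l p) t = deriv (τ.H p) t := by
      refine Filter.EventuallyEq.deriv_eq ?_
      filter_upwards [isOpen_Ioo.mem_nhds ht,
        (isOpen_lt continuous_const continuous_abs).mem_nhds h1] with r hr hr'
        using hl.ends p r hr (le_of_lt hr')
    rw [hl.ends p t ht h1.le, hd, P.η_eq_H p ht h1.le, P.deriv_η_eq p ht h1, ← add_smul, ← add_smul,
      sub_add_cancel, one_smul, one_smul]
    exact (τ.isCurveFamily_H hD).cross_ne_zero p ht

theorem IsSmoothing.isModification {P : τ.Profile} {δ : ℝ} {l : N → ℝ → R3}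
    (hl : τ.IsSmoothing P δ l) {D' : Π x : M, Submodule ℝ (TangentSpace (𝓡 4) x)}
    (hD' : τ.IsReplacement l D') (h : ∀ p, ∀ t ∈ Ioo (-τ.ε) τ.ε, ∀ s ∈ Icc (0 : ℝ) 1,
      cross ((1 - s) • l p t + s • P.η p t)
        ((1 - s) • deriv (l p) t + s • deriv (P.η p) t) ≠ 0) : τ.IsModification P.c l D' where
  family := ⟨hl.smooth, hl.norm_eq, fun p t ht h0 => by
    refine h p t ht 0 (by simp) ?_
    rw [h0]
    ext i
    fin_cases i <;> simp [cross]⟩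
  c_pos := P.c_pos
  c_lt := P.c_lt
  ends := hl.ends
  convex := hl.convex
  replacement := hD'

/-- The matrix, in the frame `T, X, Y, Z`, of the frame of the tube which is adapted to the plane
field `⟨T, h⟩`. -/
def adaptedMat (τ : Tube D J N) (h : N → ℝ → R3) (q : τ.dom) : Matrix (Fin 4) (Fin 4) ℝ :=
  frameMat (h q.1.1 q.1.2) (deriv (h q.1.1) q.1.2) *
    kapMat (τ.kap₁ h (τ.Φ q.1)) (τ.kap₂ h (τ.Φ q.1))

theorem continuous_comp_Φ {f : M → ℝ} (hf : ContinuousOn f τ.image) :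
    Continuous fun q : τ.dom => f (τ.Φ q.1) :=
  hf.comp_continuous (τ.smooth_Φ.continuousOn.comp_continuous continuous_subtype_val fun q => q.2)
    fun q => τ.Φ_mem q.2

section Chain

variable {l : N → ℝ → R3} {D' : Π x : M, Submodule ℝ (TangentSpace (𝓡 4) x)} {P : τ.Profile}
  {c' : ℝ}

/-- The ends of the tube. -/
def endSet (τ : Tube D J N) (c' : ℝ) : Set τ.dom := {q | c' ≤ |q.1.2|}

theorem IsModification.kap_ne_zero {c : ℝ} (hD : IsEngel D) (hm : τ.IsModification c l D')
    (hD' : IsEngel D') (q : τ.dom) :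
    τ.kap₁ l (τ.Φ q.1) ^ 2 + τ.kap₂ l (τ.Φ q.1) ^ 2 ≠ 0 ∧
      τ.kap₁ τ.H (τ.Φ q.1) ^ 2 + τ.kap₂ τ.H (τ.Φ q.1) ^ 2 ≠ 0 := by
  have h := hm.kap_pos hD hD' (τ.Φ_mem q.2)
  constructor
  · simpa using sq_add_sq_ne_zero_of h 0
  · simpa using sq_add_sq_ne_zero_of h 1

/-- Deformation of the structure functions of the modified plane field. -/
theorem IsModification.matHomotopic_kap {c : ℝ} (hD : IsEngel D) (hm : τ.IsModification c l D')
    (hD' : IsEngel D') (hc' : c < c') : MatHomotopic (τ.endSet c') (τ.adaptedMat l) fun q =>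
      frameMat (l q.1.1 q.1.2) (deriv (l q.1.1) q.1.2) *
        kapMat (τ.kap₁ τ.H (τ.Φ q.1)) (τ.kap₂ τ.H (τ.Φ q.1)) := by
  have hHf := (τ.isCurveFamily_H hD).isDerivedFrameOn τ.D_eq
  have h := (matHomotopic_kapMat (S := τ.endSet c')
    (τ.continuous_comp_Φ hm.isDerivedFrameOn.smooth_κ₁.continuousOn)
    (τ.continuous_comp_Φ hm.isDerivedFrameOn.smooth_κ₂.continuousOn)
    (τ.continuous_comp_Φ hHf.smooth_κ₁.continuousOn)
    (τ.continuous_comp_Φ hHf.smooth_κ₂.continuousOn) (fun q => hm.kap_pos hD hD' (τ.Φ_mem q.2))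
    (fun q hq => hm.kap_eq (dom_mem q) (lt_of_lt_of_le hc' hq))).mul
    (U := fun q : τ.dom => frameMat (l q.1.1 q.1.2) (deriv (l q.1.1) q.1.2)) (V := fun _ => 1)
    (continuous_frameMat hm.family.smooth.continuous hm.family.smooth.deriv.continuous)
    continuous_const (fun q => det_frameMat_ne_zero (hm.family.cross_ne_zero _ (dom_mem q)))
    (by simp)
  simp only [mul_one] at h
  exact h

theorem continuous_kapMat_H (hD : IsEngel D) : Continuous fun q : τ.dom =>
    kapMat (τ.kap₁ τ.H (τ.Φ q.1)) (τ.kap₂ τ.H (τ.Φ q.1)) := by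
  have hHf := (τ.isCurveFamily_H hD).isDerivedFrameOn τ.D_eq
  refine continuous_kapMat (τ.continuous_comp_Φ hHf.smooth_κ₁.continuousOn)
    (τ.continuous_comp_Φ hHf.smooth_κ₂.continuousOn) fun q h => ?_
  have h1 := (add_eq_zero_iff_of_nonneg (sq_nonneg _) (sq_nonneg _)).1 h
  rcases (hHf.derived_derived_eq_top_iff (τ.Φ_mem q.2)).1 (hD.2.2 _) with h2 | h2
  · exact h2 (pow_eq_zero_iff two_ne_zero |>.1 h1.1)
  · exact h2 (pow_eq_zero_iff two_ne_zero |>.1 h1.2)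

theorem Profile.continuous_η (P : τ.Profile) : Continuous fun q : τ.dom => P.η q.1.1 q.1.2 :=
  P.η_C2.continuousOn.comp_continuous continuous_subtype_val fun q => q.2

theorem Profile.continuous_deriv_η (P : τ.Profile) :
    Continuous fun q : τ.dom => deriv (P.η q.1.1) q.1.2 :=
  P.contMDiffOn_deriv_η.continuousOn.comp_continuous continuous_subtype_val fun q => q.2

/-- The unit tangent of the curves of a family. -/
def unitTangent (h : N → ℝ → R3) (q : N × ℝ) : R3 := ‖deriv (h q.1) q.2‖⁻¹ • deriv (h q.1) q.2

theorem cross_smul_right (u v : R3) (m : ℝ) : cross u (m • v) = m • cross u v := by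
  ext i
  fin_cases i <;> simp [cross] <;> ring

theorem IsModification.matHomotopic_profile (hD : IsEngel D) (hm : τ.IsModification P.c l D')
    (hc' : P.c < c') (hseg : ∀ p, ∀ t ∈ Ioo (-τ.ε) τ.ε, ∀ s ∈ Icc (0 : ℝ) 1,
      cross ((1 - s) • l p t + s • P.η p t)
        ((1 - s) • deriv (l p) t + s • deriv (P.η p) t) ≠ 0) :
    MatHomotopic (τ.endSet c') (fun q => frameMat (l q.1.1 q.1.2) (deriv (l q.1.1) q.1.2))
      fun q => frameMat (P.η q.1.1 q.1.2) (unitTangent P.η q.1) *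
        scaleMat ‖deriv (τ.H q.1.1) q.1.2‖ := by
  have hH := τ.isCurveFamily_H hD
  have hη0 : ∀ q : τ.dom, ‖deriv (P.η q.1.1) q.1.2‖ ≠ 0 := fun q =>
    norm_ne_zero_iff.2 (P.η_immersed _ _ (dom_mem q))
  have h1 := matHomotopic_frameMat (S := τ.endSet c') hm.family.smooth.continuous
    hm.family.smooth.deriv.continuous P.continuous_η P.continuous_deriv_η
    (fun q => hseg _ _ (dom_mem q)) (fun q hq => by
      have hq' : P.c < |q.1.2| := lt_of_lt_of_le hc' hq
      rw [hm.ends _ _ (dom_mem q) hq'.le, hm.deriv_eq _ (dom_mem q) hq',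
        P.η_eq_H _ (dom_mem q) hq'.le, P.deriv_η_eq _ (dom_mem q) hq']
      exact ⟨rfl, rfl⟩)
  -- rescale the velocity of `η` to the length of `H'`, which it has near the ends
  have h2 := matHomotopic_frameMat (S := τ.endSet c') P.continuous_η P.continuous_deriv_η
    P.continuous_η (v' := fun q => ‖deriv (τ.H q.1.1) q.1.2‖ • unitTangent P.η q.1)
    (hH.smooth.deriv.continuous.norm.smul
      ((P.continuous_deriv_η.norm.inv₀ hη0).smul P.continuous_deriv_η))
    (fun q s hs => by
      have hc0 : cross (P.η q.1.1 q.1.2) (deriv (P.η q.1.1) q.1.2) ≠ 0 := by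
        have := hseg q.1.1 q.1.2 (dom_mem q) 1 (by simp)
        simpa using this
      have hpos : 0 < (1 - s) + s * ‖deriv (τ.H q.1.1) q.1.2‖ * ‖deriv (P.η q.1.1) q.1.2‖⁻¹ := by
        rw [mul_assoc]
        have ha : 0 < ‖deriv (τ.H q.1.1) q.1.2‖ * ‖deriv (P.η q.1.1) q.1.2‖⁻¹ :=
          mul_pos (norm_pos_iff.2 (hH.deriv_ne _ _ (dom_mem q)))
            (inv_pos.2 ((norm_nonneg _).lt_of_ne' (hη0 q)))
        rcases eq_or_lt_of_le hs.1 with h | h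
        · rw [← h]
          norm_num
        · exact add_pos_of_nonneg_of_pos (by linarith [hs.2]) (mul_pos h ha)
      rw [← add_smul, sub_add_cancel, one_smul, unitTangent, smul_smul, smul_smul, ← add_smul,
        cross_smul_right]
      exact smul_ne_zero hpos.ne' hc0)
    (fun q hq => by
      have hq' : P.c < |q.1.2| := lt_of_lt_of_le hc' hq
      refine ⟨rfl, ?_⟩
      rw [unitTangent, smul_smul, P.deriv_η_eq _ (dom_mem q) hq', mul_inv_cancel₀, one_smul]
      exact norm_ne_zero_iff.2 (hH.deriv_ne _ _ (dom_mem q)))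
  simp only [frameMat_smul] at h2
  exact h1.trans h2

theorem continuous_geodesicCurvature_zero (hD : IsEngel D) :
    Continuous fun p : N => geodesicCurvature (τ.H p) 0 := by
  have hH := τ.isCurveFamily_H hD
  have hi : Continuous fun p : N => (p, (0 : ℝ)) := continuous_id.prodMk continuous_const
  have hm : ∀ p : N, (p, (0 : ℝ)) ∈ τ.dom := fun p => τ.mk_mem_dom.2 τ.zero_mem_Ioo
  have h2' : ContinuousOn (fun q : N × ℝ => deriv (τ.H q.1) q.2) τ.dom :=
    ContMDiffOn.continuousOn hH.smooth.deriv
  have h1 := hH.smooth.continuousOn_convexity.comp_continuous hi hm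
  have h2 := h2'.comp_continuous hi hm
  unfold geodesicCurvature
  exact h1.div (h2.norm.pow 3) fun p =>
    pow_ne_zero _ (norm_ne_zero_iff.2 (hH.deriv_ne p 0 τ.zero_mem_Ioo))

/-- The inserted circle may be contracted to a great circle and the remaining part of the profile
reparametrised: the frame along the profile is homotopic to the frame along `H`, rotated by the
angle `2πf`. -/
theorem Profile.matHomotopic_rotation (hD : IsEngel D) (P : τ.Profile) (hc' : P.c < c')
    {f : ℝ → ℝ} (hf : Continuous f) (hf0 : ∀ t ≤ -c', f t = 0) (hf1 : ∀ t, c' ≤ t → f t = 1) :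
    MatHomotopic (τ.endSet c') (fun q => frameMat (P.η q.1.1 q.1.2) (unitTangent P.η q.1))
      fun q => frameMat (τ.H q.1.1 q.1.2) (unitTangent τ.H q.1) *
        rotMat (planeRot (Pi.single 1 1) (Pi.single 2 1)) (2 * Real.pi * f q.1.2) := by
  have hH := τ.isCurveFamily_H hD
  have h0 := P.c_pos
  -- deform the parameter `ρ` to `t`, the angle `θ` to `2πf`, and the curvature `k` of the circle to
  -- zero; at the ends `ρ = t` and the angle is `0` or `2π` at all times
  set k : N → ℝ := fun p => geodesicCurvature (τ.H p) 0
  set ρs : unitInterval × τ.dom → N × ℝ := fun z => (z.2.1.1,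
    (1 - (z.1 : ℝ)) * P.ρ' z.2.1.1 z.2.1.2 + z.1 * z.2.1.2)
  set θs : unitInterval × τ.dom → ℝ := fun z =>
    (1 - (z.1 : ℝ)) * P.θ' z.2.1.1 z.2.1.2 + z.1 * (2 * Real.pi * f z.2.1.2)
  have hρ : Continuous fun q : τ.dom => P.ρ' q.1.1 q.1.2 :=
    P.continuousOn_ρ'.comp_continuous continuous_subtype_val fun q => q.2
  have hρ' : Continuous fun z : unitInterval × τ.dom => P.ρ' z.2.1.1 z.2.1.2 :=
    hρ.comp continuous_snd
  have hθ' : Continuous fun z : unitInterval × τ.dom => P.θ' z.2.1.1 z.2.1.2 :=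
    P.continuous_θ'.comp (continuous_subtype_val.comp continuous_snd)
  have hρs : Continuous ρs := by
    simp only [ρs]
    fun_prop
  have hθs : Continuous θs := by
    simp only [θs]
    fun_prop
  have hmem : ∀ z, ρs z ∈ τ.dom := by
    intro z
    have h1 := P.ρ'_mem z.2.1.1 (dom_mem z.2)
    have h2 := dom_mem z.2
    refine τ.mk_mem_dom.2 ?_
    have := (convex_Ioo (-τ.ε) τ.ε) h1 h2 (sub_nonneg.2 z.1.2.2) z.1.2.1 (by ring)
    simpa using this
  have hk : Continuous k := τ.continuous_geodesicCurvature_zero hD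
  have hks : Continuous fun z : unitInterval × τ.dom => (1 - (z.1 : ℝ)) * k z.2.1.1 := by
    have : Continuous fun z : unitInterval × τ.dom => k z.2.1.1 :=
      hk.comp (continuous_fst.comp (continuous_subtype_val.comp continuous_snd))
    fun_prop
  have hHc : Continuous fun z : unitInterval × τ.dom => τ.H (ρs z).1 (ρs z).2 :=
    (ContMDiffOn.continuousOn hH.smooth).comp_continuous hρs hmem
  have hHd : Continuous fun z : unitInterval × τ.dom => deriv (τ.H (ρs z).1) (ρs z).2 :=
    (ContMDiffOn.continuousOn hH.smooth.deriv).comp_continuous hρs hmem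
  have hHd0 : ∀ z, ‖deriv (τ.H (ρs z).1) (ρs z).2‖ ≠ 0 := fun z =>
    norm_ne_zero_iff.2 (hH.deriv_ne _ _ (τ.mk_mem_dom.1 (hmem z)))
  have hut : Continuous fun z => unitTangent τ.H (ρs z) := (hHd.norm.inv₀ hHd0).smul hHd
  have hc1 := continuous_sphereCircle hks hθs
  have hc2 := continuous_circleTangent hks hθs
  refine ⟨fun z => frameMat (τ.H (ρs z).1 (ρs z).2) (unitTangent τ.H (ρs z)) *
    frameMat (sphereCircle ((1 - (z.1 : ℝ)) * k z.2.1.1) (θs z))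
      (circleTangent ((1 - (z.1 : ℝ)) * k z.2.1.1) (θs z)),
    (continuous_frameMat hHc hut).matrix_mul (continuous_frameMat hc1 hc2), fun z => ?_,
    fun q => ?_, fun q => ?_, ?_⟩
  · rw [Matrix.det_mul]
    refine mul_ne_zero (det_frameMat_ne_zero ?_) ?_
    · rw [unitTangent, cross_smul_right]
      exact smul_ne_zero (inv_ne_zero (hHd0 z)) (hH.cross_ne_zero _ (τ.mk_mem_dom.1 (hmem z)))
    · rw [det_frameMat, inner_cross_self, inner_sphereCircle_self, inner_circleTangent_self,
        inner_sphereCircle_circleTangent]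
      norm_num
  · have e1 : ρs (0, q) = (q.1.1, P.ρ' q.1.1 q.1.2) := by simp [ρs]
    have e2 : θs (0, q) = P.θ' q.1.1 q.1.2 := by simp [θs]
    simp only [e1, e2, Icc.coe_zero, sub_zero, one_mul]
    have ht := dom_mem q
    -- along the inserted circle `ρ = 0` and the first factor is the identity; elsewhere the second
    -- factor is the identity
    by_cases hab : q.1.2 ∈ Ioc P.a P.b
    · have hab' : q.1.2 ∈ Icc P.a P.b := ⟨hab.1.le, hab.2⟩
      have h1 : τ.H q.1.1 0 = !₂[1, 0, 0] := τ.H_zero _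
      have h2 : unitTangent τ.H (q.1.1, 0) = !₂[0, 1, 0] := by
        obtain ⟨d0, d2⟩ := τ.deriv_H_zero_eq hD q.1.1
        have d1 := τ.deriv_H_zero q.1.1
        have hv : deriv (τ.H q.1.1) 0 = deriv (τ.H q.1.1) 0 1 • (!₂[0, 1, 0] : R3) := by
          ext i
          fin_cases i <;> simp [d0, d2]
        have hn1 : ‖(!₂[0, 1, 0] : R3)‖ = 1 := norm_eq_one_of_inner_self (by
          rw [inner_eq_three]; simp)
        have hn : ‖deriv (τ.H q.1.1) 0‖ = deriv (τ.H q.1.1) 0 1 := by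
          conv_lhs => rw [hv]
          rw [norm_smul, hn1, mul_one, Real.norm_of_nonneg d1.le]
        simp only [unitTangent]
        rw [hn]
        conv_lhs => rw [hv]
        rw [smul_smul]
        simp [d1.ne']
      rw [P.ρ'_middle _ hab', h1, h2, frameMat_standard, one_mul, unitTangent,
        P.normalize_deriv_η_middle _ hab, P.η_middle _ _ hab', P.θ'_middle _ hab']
    · have hθ0 : P.θ' q.1.1 q.1.2 = 0 ∨ P.θ' q.1.1 q.1.2 = 2 * Real.pi := by
        rcases le_or_gt q.1.2 P.a with h | h
        · exact Or.inl (P.θ'_left _ h)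
        · exact Or.inr (P.θ'_right _ (not_le.1 fun h' => hab ⟨h, h'⟩).le)
      have hη : P.η q.1.1 q.1.2 = τ.H q.1.1 (P.ρ' q.1.1 q.1.2) := by
        rcases le_or_gt q.1.2 P.a with h | h
        · rw [P.ρ'_left _ h, P.η_outer _ _ (Or.inl ⟨ht.1, h⟩)]
        · have h' := (not_le.1 fun h' => hab ⟨h, h'⟩).le
          rw [P.ρ'_right _ h', P.η_outer _ _ (Or.inr ⟨h', ht.2⟩)]
      have h1 : frameMat (sphereCircle (k q.1.1) (P.θ' q.1.1 q.1.2))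
          (circleTangent (k q.1.1) (P.θ' q.1.1 q.1.2)) = 1 := by
        rcases hθ0 with h | h
        · rw [h, sphereCircle_angle_zero, circleTangent_angle_zero, frameMat_standard]
        · rw [h, sphereCircle_angle_two_pi, circleTangent_angle_two_pi, frameMat_standard]
      rw [h1, mul_one, hη]
      simp only [unitTangent]
      rw [P.normalize_deriv_η_outer hD _ ht hab]
  · have e1 : ρs (1, q) = q.1 := by simp [ρs]
    have e2 : θs (1, q) = 2 * Real.pi * f q.1.2 := by simp [θs]
    simp only [e1, e2, Icc.coe_one, sub_self, zero_mul, frameMat_sphereCircle_zero]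
  · intro s q hq
    have hq' : P.c < |q.1.2| := lt_of_lt_of_le hc' hq
    have ht := dom_mem q
    have e1 : ρs (s, q) = q.1 := by
      simp only [ρs, P.ρ'_ends _ ht hq'.le]
      ext
      · rfl
      · simp only
        ring
    have hθ0 : θs (s, q) = 0 ∨ θs (s, q) = 2 * Real.pi := by
      simp only [θs, P.θ'_ends _ hq'.le]
      rcases le_abs.1 (show c' ≤ |q.1.2| from hq) with h | h
      · right
        rw [if_pos (by linarith), hf1 _ h]
        ring
      · left
        rw [if_neg (by linarith), hf0 _ (by linarith)]
        ring
    have h1 : frameMat (sphereCircle ((1 - (s : ℝ)) * k q.1.1) (θs (s, q)))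
        (circleTangent ((1 - (s : ℝ)) * k q.1.1) (θs (s, q))) = 1 := by
      rcases hθ0 with h | h
      · rw [h, sphereCircle_angle_zero, circleTangent_angle_zero, frameMat_standard]
      · rw [h, sphereCircle_angle_two_pi, circleTangent_angle_two_pi, frameMat_standard]
    simp only [h1, mul_one, e1]
    rw [P.η_eq_H _ ht hq'.le, unitTangent, unitTangent, P.deriv_η_eq _ ht hq']

/-- The frames of the tube which are adapted to `D` and `D'` differ, up to homotopy, by one full
turn of the plane spanned by the kernel direction and its normal. -/
theorem IsModification.matHomotopic_adaptedMat (hD : IsEngel D) (hm : τ.IsModification P.c l D')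
    (hD' : IsEngel D') (hc' : P.c < c') (hseg : ∀ p, ∀ t ∈ Ioo (-τ.ε) τ.ε, ∀ s ∈ Icc (0 : ℝ) 1,
      cross ((1 - s) • l p t + s • P.η p t)
        ((1 - s) • deriv (l p) t + s • deriv (P.η p) t) ≠ 0)
    {f : ℝ → ℝ} (hf : Continuous f) (hf0 : ∀ t ≤ -c', f t = 0) (hf1 : ∀ t, c' ≤ t → f t = 1)
    {γ : τ.dom → Matrix (Fin 4) (Fin 4) ℝ} (hγ : Continuous γ) (hγp : ∀ q, (γ q).PosDef) :
    MatHomotopic (τ.endSet c') (τ.adaptedMat l) fun q =>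
      τ.adaptedMat τ.H q * rotMat (gramRot (γ q)) (2 * Real.pi * f q.1.2) := by
  have hH := τ.isCurveFamily_H hD
  set K : τ.dom → Matrix (Fin 4) (Fin 4) ℝ := fun q =>
    kapMat (τ.kap₁ τ.H (τ.Φ q.1)) (τ.kap₂ τ.H (τ.Φ q.1))
  set m : τ.dom → ℝ := fun q => ‖deriv (τ.H q.1.1) q.1.2‖
  set A : τ.dom → Matrix (Fin 4) (Fin 4) ℝ := fun q =>
    frameMat (τ.H q.1.1 q.1.2) (unitTangent τ.H q.1)
  set θ : τ.dom → ℝ := fun q => 2 * Real.pi * f q.1.2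
  have hθ : Continuous θ := by
    simp only [θ]
    fun_prop
  have hS : ∀ q ∈ τ.endSet c', θ q = 0 ∨ θ q = 2 * Real.pi := by
    intro q hq
    rcases le_abs.1 (show c' ≤ |q.1.2| from hq) with h | h
    · right
      simp only [θ, hf1 _ h, mul_one]
    · left
      simp only [θ, hf0 _ (by linarith : q.1.2 ≤ -c'), mul_zero]
  have hK : Continuous K := continuous_kapMat_H hD
  have hKd : ∀ q, (K q).det ≠ 0 := fun q => by
    rw [det_kapMat (hm.kap_ne_zero hD hD' q).2]
    exact one_ne_zero
  have hm0 : ∀ q, m q ≠ 0 := fun q => norm_ne_zero_iff.2 (hH.deriv_ne _ _ (dom_mem q))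
  have hmc : Continuous m := hH.smooth.deriv.continuous.norm
  have hsK : Continuous fun q => scaleMat (m q) * K q := (continuous_scaleMat hmc).matrix_mul hK
  have hsKd : ∀ q, (scaleMat (m q) * K q).det ≠ 0 := fun q => by
    rw [Matrix.det_mul, det_scaleMat]
    exact mul_ne_zero (mul_ne_zero (hm0 q) (hm0 q)) (hKd q)
  have hA : Continuous A := continuous_frameMat hH.smooth.continuous
    ((hmc.inv₀ hm0).smul hH.smooth.deriv.continuous)
  have hAd : ∀ q, (A q).det ≠ 0 := fun q => det_frameMat_ne_zero (by
    rw [unitTangent, cross_smul_right]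
    exact smul_ne_zero (inv_ne_zero (hm0 q)) (hH.cross_ne_zero _ (dom_mem q)))
  have hE : ∀ q, τ.adaptedMat τ.H q = A q * (scaleMat (m q) * K q) := by
    intro q
    rw [← mul_assoc, ← frameMat_smul, unitTangent, smul_smul, mul_inv_cancel₀ (hm0 q), one_smul]
    rfl
  have h1 := hm.matHomotopic_kap hD hD' hc'
  have h2 := (hm.matHomotopic_profile hD hc' hseg).mul_right hK hKd
  have h3 := (P.matHomotopic_rotation hD hc' hf hf0 hf1).mul_right hsK hsKd
  -- rotate the plane `⟨e₁, e₂⟩` of the rotation to `⟨e₂, e₃⟩`, then to `⟨e₀, e₃⟩`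
  have hcos : ∀ s : ℝ, Real.cos (Real.pi / 2 * s) * Real.cos (Real.pi / 2 * s) +
      Real.sin (Real.pi / 2 * s) * Real.sin (Real.pi / 2 * s) = 1 := fun s => by
    linear_combination Real.sin_sq_add_cos_sq (Real.pi / 2 * s)
  have h4 := matHomotopic_planeRot (S := τ.endSet c') (u := fun s =>
      ![0, Real.cos (Real.pi / 2 * s), 0, -Real.sin (Real.pi / 2 * s)]) (w := Pi.single 2 1)
    (continuous_pi fun i => by fin_cases i <;> simp <;> fun_prop)
    (fun s => by simpa [dotProduct, Fin.sum_univ_four] using hcos s) (by simp) (by simp) hθ hS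
  have h5 := matHomotopic_planeRot (S := τ.endSet c') (u := fun s =>
      ![Real.sin (Real.pi / 2 * s), 0, Real.cos (Real.pi / 2 * s), 0]) (w := Pi.single 3 1)
    (continuous_pi fun i => by fin_cases i <;> simp <;> fun_prop)
    (fun s => by
      have := hcos s
      simp [dotProduct, Fin.sum_univ_four]
      linarith) (by simp) (by simp) hθ hS
  have h6 := matHomotopic_gramRot (S := τ.endSet c') hγ hγp hθ hS
  have e0 : (![0, Real.cos (Real.pi / 2 * 0), 0, -Real.sin (Real.pi / 2 * 0)] : Fin 4 → ℝ) =
      Pi.single 1 1 := by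
    funext i; fin_cases i <;> simp
  have e1 : planeRot (![0, Real.cos (Real.pi / 2 * 1), 0, -Real.sin (Real.pi / 2 * 1)])
      (Pi.single 2 1) = planeRot (Pi.single 2 1) (Pi.single 3 1) := by
    rw [← planeRot_neg (Pi.single 2 1)]
    congr 1
    funext i; fin_cases i <;> simp
  have e2 : (![Real.sin (Real.pi / 2 * 0), 0, Real.cos (Real.pi / 2 * 0), 0] : Fin 4 → ℝ) =
      Pi.single 2 1 := by
    funext i; fin_cases i <;> simp
  have e3 : planeRot (![Real.sin (Real.pi / 2 * 1), 0, Real.cos (Real.pi / 2 * 1), 0])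
      (Pi.single 3 1) = gramRot 1 := by
    rw [gramRot_one]
    congr 1
    funext i; fin_cases i <;> simp
  rw [e0, e1] at h4
  rw [e2, e3] at h5
  have h4' := h4.mul hA hsK hAd hsKd
  have hEc : Continuous fun q => τ.adaptedMat τ.H q := by
    simp only [hE]
    exact hA.matrix_mul hsK
  have hEd : ∀ q, (τ.adaptedMat τ.H q).det ≠ 0 := fun q => by
    rw [hE, Matrix.det_mul]
    exact mul_ne_zero (hAd q) (hsKd q)
  have h5' := ((h5.trans h6).mul (V := fun _ => 1) hEc continuous_const hEd (by simp))
  simp only [mul_one] at h5'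
  -- the rotation of `⟨e₂, e₃⟩` commutes with the matrices `scaleMat` and `kapMat`
  have hcomm : ∀ q, A q * rotMat (planeRot (Pi.single 2 1) (Pi.single 3 1)) (θ q) *
      (scaleMat (m q) * K q) =
        τ.adaptedMat τ.H q * rotMat (planeRot (Pi.single 2 1) (Pi.single 3 1)) (θ q) := by
    intro q
    rw [hE, mul_assoc, mul_assoc, rotMat_conj (scaleMat_mul_kapMat_comm _ _ _)]
  simp only [hcomm] at h4'
  refine h1.trans (h2.trans ?_)
  have h3' : MatHomotopic (τ.endSet c') (fun q => frameMat (P.η q.1.1 q.1.2) (unitTangent P.η q.1) *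
      scaleMat (m q) * K q) fun q => A q *
        rotMat (planeRot (Pi.single 1 1) (Pi.single 2 1)) (θ q) * (scaleMat (m q) * K q) := by
    simpa only [Matrix.mul_assoc] using h3
  exact h3'.trans (h4'.trans h5')

end Chain

end Tube

/-! ### Smoothing of matrix valued functions -/

section SmoothMatrix

universe u

variable {M : Type u} [TopologicalSpace M] [ChartedSpace R4 M] [IsManifold (𝓡 4) ∞ M]

/-- The matrix valued function `A` is smooth on `O`. -/
def SmoothMatOn (A : M → Matrix (Fin 4) (Fin 4) ℝ) (O : Set M) : Prop :=
  ∀ i j, ContMDiffOn (𝓡 4) 𝓘(ℝ) ∞ (fun x => A x i j) O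

variable {A B : M → Matrix (Fin 4) (Fin 4) ℝ} {O : Set M}

theorem SmoothMatOn.pi (hA : SmoothMatOn A O) :
    ContMDiffOn (𝓡 4) 𝓘(ℝ, Fin 4 → Fin 4 → ℝ) ∞ (fun x i j => A x i j) O :=
  contMDiffOn_pi_space.2 fun i => contMDiffOn_pi_space.2 fun j => hA i j

theorem SmoothMatOn.mul (hA : SmoothMatOn A O) (hB : SmoothMatOn B O) :
    SmoothMatOn (fun x => A x * B x) O := by
  intro i j
  simp only [Matrix.mul_apply]
  exact contMDiffOn_finsetSum fun k _ => (hA i k).mul (hB k j)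

theorem smoothMatOn_const (C : Matrix (Fin 4) (Fin 4) ℝ) : SmoothMatOn (fun _ : M => C) O :=
  fun _ _ => contMDiffOn_const

theorem SmoothMatOn.add (hA : SmoothMatOn A O) (hB : SmoothMatOn B O) :
    SmoothMatOn (fun x => A x + B x) O := fun i j => (hA i j).add (hB i j)

theorem SmoothMatOn.smul {f : M → ℝ} (hf : ContMDiffOn (𝓡 4) 𝓘(ℝ) ∞ f O) (hA : SmoothMatOn A O) :
    SmoothMatOn (fun x => f x • A x) O := fun i j => hf.mul (hA i j)

theorem SmoothMatOn.inv (hA : SmoothMatOn A O) (hd : ∀ x ∈ O, (A x).det ≠ 0) :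
    SmoothMatOn (fun x => (A x)⁻¹) O := fun i j x hx =>
  ContMDiffAt.comp_contMDiffWithinAt (g := fun B : Fin 4 → Fin 4 → ℝ => (Matrix.of B)⁻¹ i j) x
    (contDiffAt_matrix_inv (A x) (hd x hx) i j).contMDiffAt (hA.pi x hx)

theorem SmoothMatOn.gramRot (hA : SmoothMatOn A O) (hd : ∀ x ∈ O, (A x).PosDef) :
    SmoothMatOn (fun x => gramRot (A x)) O := fun i j x hx =>
  ContMDiffAt.comp_contMDiffWithinAt (g := fun B : Fin 4 → Fin 4 → ℝ => Engel.gramRot (Matrix.of B) i j) x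
    (contDiffAt_gramRot (A x) (hd x hx) i j).contMDiffAt (hA.pi x hx)

theorem SmoothMatOn.rotMat {θ : M → ℝ} (hA : SmoothMatOn A O)
    (hθ : ContMDiffOn (𝓡 4) 𝓘(ℝ) ∞ θ O) : SmoothMatOn (fun x => rotMat (A x) (θ x)) O := by
  have hs : ContMDiffOn (𝓡 4) 𝓘(ℝ) ∞ (fun x => Real.sin (θ x)) O :=
    Real.contDiff_sin.contMDiff.comp_contMDiffOn hθ
  have hc : ContMDiffOn (𝓡 4) 𝓘(ℝ) ∞ (fun x => 1 - Real.cos (θ x)) O :=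
    contMDiffOn_const.sub (Real.contDiff_cos.contMDiff.comp_contMDiffOn hθ)
  exact ((smoothMatOn_const 1).add (.smul hs hA)).add (.smul hc (hA.mul hA))

theorem SmoothMatOn.continuousOn (hA : SmoothMatOn A O) : ContinuousOn A O := hA.pi.continuousOn

theorem isClosed_singular : IsClosed {A : Fin 4 → Fin 4 → ℝ | (Matrix.of A).det = 0} :=
  isClosed_eq (Continuous.matrix_det continuous_id) continuous_const

/-- A homotopy of invertible matrix valued functions, from the constant `1` to a smooth function,
which is constant outside a closed set `K` may be replaced by a smooth one which is constant outside
a given neighbourhood `U` of `K`. -/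
theorem exists_smooth_matHomotopy [T2Space M] [SecondCountableTopology M] {K U : Set M}
    (hK : IsClosed K) (hU : IsOpen U) (hKU : K ⊆ U) {w : ℝ × M → Matrix (Fin 4) (Fin 4) ℝ}
    (hw : Continuous w) (hd : ∀ z, (w z).det ≠ 0) (h0 : ∀ s ≤ 0, ∀ x, w (s, x) = 1)
    {w₁ : M → Matrix (Fin 4) (Fin 4) ℝ} (hw₁ : SmoothMatOn w₁ univ)
    (h1 : ∀ s, 1 ≤ s → ∀ x, w (s, x) = w₁ x) (hwK : ∀ s, ∀ x ∉ K, w (s, x) = 1) :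
    ∃ G : ℝ → M → Matrix (Fin 4) (Fin 4) ℝ, (∀ s, SmoothMatOn (G s) univ) ∧
      Continuous (fun z : ℝ × M => G z.1 z.2) ∧ (∀ s x, (G s x).det ≠ 0) ∧ (∀ x, G 0 x = 1) ∧
      (∀ x, G 1 x = w₁ x) ∧ ∀ s, ∀ x ∉ U, G s x = 1 := by
  have : LocallyCompactSpace M := ChartedSpace.locallyCompactSpace R4 M
  set Sg : Set (Fin 4 → Fin 4 → ℝ) := {A | (Matrix.of A).det = 0}
  set W : ℝ × M → (Fin 4 → Fin 4 → ℝ) := w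
  have hW : Continuous W := hw
  have hW₁ : ContMDiff (𝓡 4) 𝓘(ℝ, Fin 4 → Fin 4 → ℝ) ∞ (fun x i j => w₁ x i j) :=
    contMDiffOn_univ.1 hw₁.pi
  set W₁ : M → (Fin 4 → Fin 4 → ℝ) := w₁
  set Id : Fin 4 → Fin 4 → ℝ := (1 : Matrix (Fin 4) (Fin 4) ℝ)
  have hne : Sg.Nonempty := ⟨0, by simp [Sg]⟩
  have hr : ∀ z, 0 < Metric.infDist (W z) Sg := fun z =>
    (isClosed_singular.notMem_iff_infDist_pos hne).1 (hd z)
  have hrc : Continuous fun z => Metric.infDist (W z) Sg := (Metric.continuous_infDist_pt _).comp hW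
  -- the allowed values at `z` form a convex set `t z`: an open ball around `w z` of invertible matrices,
  -- intersected with the boundary conditions; sections of `t` exist locally, and a partition of unity
  -- glues them
  set t : ℝ × M → Set (Fin 4 → Fin 4 → ℝ) := fun z => Metric.ball (W z) (Metric.infDist (W z) Sg) ∩
    {A | (z.1 ≤ 0 → A = Id) ∧ (1 ≤ z.1 → A = W₁ z.2) ∧ (z.2 ∉ U → A = Id)} with ht
  have hself : ∀ z, W z ∈ Metric.ball (W z) (Metric.infDist (W z) Sg) := fun z =>
    Metric.mem_ball_self (hr z)
  have himp : ∀ (p : Prop) (B : Fin 4 → Fin 4 → ℝ), Convex ℝ {A | p → A = B} := by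
    intro p B
    by_cases hp : p
    · simp [hp]
    · simp [hp, convex_univ]
  have hconv : ∀ z, Convex ℝ (t z) := fun z => (convex_ball _ _).inter
    ((himp _ _).inter ((himp _ _).inter (himp _ _)))
  obtain ⟨g, hg⟩ := exists_contMDiffMap_forall_mem_convex_of_local (n := ⊤)
    (𝓘(ℝ, ℝ).prod (𝓡 4)) hconv fun z₀ => by
      by_cases hx : z₀.2 ∈ K
      · have hnear : ∀ C : ℝ × M → (Fin 4 → Fin 4 → ℝ), Continuous C → C z₀ = W z₀ →
            ∀ᶠ z in 𝓝 z₀, C z ∈ Metric.ball (W z) (Metric.infDist (W z) Sg) ∧ z.2 ∈ U := by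
          intro C hC hC0
          refine Filter.Eventually.and ?_ (continuous_snd.continuousAt (hU.mem_nhds (hKU hx)))
          refine (isOpen_lt (hC.dist hW) hrc).mem_nhds ?_
          rw [mem_ofPred_eq, hC0]
          exact hself z₀
        rcases le_or_gt z₀.1 0 with hs | hs
        · refine ⟨_, Filter.inter_mem (hnear (fun _ => Id) continuous_const (h0 z₀.1 hs z₀.2).symm)
            ((isOpen_lt continuous_fst continuous_const).mem_nhds (hs.trans_lt one_pos)), fun _ => Id,
            contMDiffOn_const, ?_⟩
          rintro z ⟨⟨hz, hzU⟩, hz1⟩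
          exact ⟨hz, fun _ => rfl, fun h => absurd hz1 (not_lt.2 h), fun h => absurd hzU h⟩
        rcases le_or_gt 1 z₀.1 with hs' | hs'
        · refine ⟨_, Filter.inter_mem (hnear (fun z => W₁ z.2)
            (hW₁.continuous.comp continuous_snd) (h1 z₀.1 hs' z₀.2).symm)
            ((isOpen_lt continuous_const continuous_fst).mem_nhds hs), fun z => W₁ z.2,
            (hW₁.comp contMDiff_snd).contMDiffOn, ?_⟩
          rintro z ⟨⟨hz, hzU⟩, hz1⟩
          exact ⟨hz, fun h => absurd hz1 (not_lt.2 h), fun _ => rfl, fun h => absurd hzU h⟩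
        · refine ⟨_, Filter.inter_mem (hnear (fun _ => W z₀) continuous_const rfl)
            (Filter.inter_mem ((isOpen_lt continuous_const continuous_fst).mem_nhds hs)
              ((isOpen_lt continuous_fst continuous_const).mem_nhds hs')), fun _ => W z₀,
            contMDiffOn_const, ?_⟩
          rintro z ⟨⟨hz, hzU⟩, hz1, hz2⟩
          exact ⟨hz, fun h => absurd hz1 (not_lt.2 h), fun h => absurd hz2 (not_lt.2 h),
            fun h => absurd hzU h⟩
      · refine ⟨_, (hK.isOpen_compl.preimage continuous_snd).mem_nhds hx, fun _ => Id,
          contMDiffOn_const, fun z hz => ⟨?_, fun _ => rfl, fun h => ?_, fun _ => rfl⟩⟩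
        · have : W z = Id := hwK z.1 z.2 hz
          rw [← this]
          exact hself z
        · exact (hwK z.1 z.2 hz).symm.trans (h1 z.1 h z.2)
  refine ⟨fun s x => g (s, x), fun s i j => ?_, g.contMDiff.continuous, fun s x h => ?_,
    fun x => (hg (0, x)).2.1 le_rfl, fun x => (hg (1, x)).2.2.1 le_rfl,
    fun s x hx => (hg (s, x)).2.2.2 hx⟩
  · have h1 : ContMDiff (𝓡 4) 𝓘(ℝ, Fin 4 → Fin 4 → ℝ) ∞ fun x => g (s, x) :=
      g.contMDiff.comp (contMDiff_const.prodMk contMDiff_id)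
    exact (contMDiff_pi_space.1 (contMDiff_pi_space.1 h1 i) j).contMDiffOn
  · have h2 : dist (W (s, x)) (g (s, x)) < Metric.infDist (W (s, x)) Sg := by
      rw [dist_comm]
      exact (hg (s, x)).1
    exact Metric.notMem_of_dist_lt_infDist h2 h

end SmoothMatrix

/-! ### Automorphisms of the tangent bundle supported in the tube -/

theorem sum_one_smul {T : Type*} [AddCommGroup T] [Module ℝ T] (e : Fin 4 → T) (j : Fin 4) :
    ∑ i, (1 : Matrix (Fin 4) (Fin 4) ℝ) i j • e i = e j := by
  rw [Finset.sum_eq_single j]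
  · rw [Matrix.one_apply_eq, one_smul]
  · intro i _ hi
    rw [Matrix.one_apply_ne hi, zero_smul]
  · simp

namespace Tube

universe u

variable {M : Type u} [TopologicalSpace M] [T2Space M] [ChartedSpace R4 M] [IsManifold (𝓡 4) ∞ M]
  {EN : Type*} [NormedAddCommGroup EN] [NormedSpace ℝ EN] [FiniteDimensional ℝ EN]
  {HN : Type*} [TopologicalSpace HN]
  {D : Π x : M, Submodule ℝ (TangentSpace (𝓡 4) x)} {J : ModelWithCorners ℝ EN HN} [J.Boundaryless]
  {N : Type*} [TopologicalSpace N] [CompactSpace N] [ChartedSpace HN N] [IsManifold J ∞ N]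
  [Nonempty N] {τ : Tube D J N}

/-- The matrix `adaptedMat` as a function on the image of the tube. -/
def tubeMat (τ : Tube D J N) (h : N → ℝ → R3) (x : M) : Matrix (Fin 4) (Fin 4) ℝ :=
  frameMat (h (τ.inv x).1 (τ.inv x).2) (deriv (h (τ.inv x).1) (τ.inv x).2) *
    kapMat (τ.kap₁ h x) (τ.kap₂ h x)

theorem tubeMat_Φ (h : N → ℝ → R3) (q : τ.dom) : τ.tubeMat h (τ.Φ q.1) = τ.adaptedMat h q := by
  rw [tubeMat, τ.inv_Φ q.2]
  rfl

section TubeMat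

variable {h : N → ℝ → R3} {D' : Π x : M, Submodule ℝ (TangentSpace (𝓡 4) x)}

theorem smoothMatOn_tubeMat (hh : τ.IsCurveFamily h) (hf : IsDerivedFrameOn D' τ.image (τ.field 0)
      (τ.push h) (τ.push fun p => deriv (h p)) (τ.push (normal h)) (τ.kap₁ h) (τ.kap₂ h))
    (hκ : ∀ x ∈ τ.image, τ.kap₁ h x ^ 2 + τ.kap₂ h x ^ 2 ≠ 0) :
    SmoothMatOn (τ.tubeMat h) τ.image := by
  have h1 := hf.smooth_κ₁
  have h2 := hf.smooth_κ₂
  have h3 := hh.smooth.comp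
  have h4 := hh.smooth.deriv.comp
  have h5 := hh.smooth_normal.comp
  have hc : ∀ c : ℝ, ContMDiffOn (𝓡 4) 𝓘(ℝ) ∞ (fun _ : M => c) τ.image :=
    fun c => contMDiffOn_const
  have hn := ((h1.mul h1).add (h2.mul h2)).inv₀ fun x hx => by simpa [sq] using hκ x hx
  refine SmoothMatOn.mul (fun i j => ?_) fun i j => ?_
  · fin_cases i <;> fin_cases j
    exacts [hc 1, hc 0, hc 0, hc 0, hc 0, h3 0, h4 0, h5 0, hc 0, h3 1, h4 1, h5 1, hc 0, h3 2, h4 2,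
      h5 2]
  · have ha : ContMDiffOn (𝓡 4) 𝓘(ℝ) ∞
        (fun x => τ.kap₁ h x / (τ.kap₁ h x ^ 2 + τ.kap₂ h x ^ 2)) τ.image :=
      (h1.mul hn).congr fun x _ => by simp [sq, div_eq_mul_inv]
    have hb : ContMDiffOn (𝓡 4) 𝓘(ℝ) ∞
        (fun x => τ.kap₂ h x / (τ.kap₁ h x ^ 2 + τ.kap₂ h x ^ 2)) τ.image :=
      (h2.mul hn).congr fun x _ => by simp [sq, div_eq_mul_inv]
    fin_cases i <;> fin_cases j
    exacts [h2, ha, hc 0, hc 0, h1.neg, hb, hc 0, hc 0, hc 0, hc 0, hc 1, hc 0, hc 0, hc 0, hc 0,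
      hc 1]

/-- The columns of `tubeMat` are the coordinates of a bracket frame. -/
theorem isBracketFrame_tubeMat (hf : IsDerivedFrameOn D' τ.image (τ.field 0)
      (τ.push h) (τ.push fun p => deriv (h p)) (τ.push (normal h)) (τ.kap₁ h) (τ.kap₂ h))
    {x : M} (hx : x ∈ τ.image) (hκ : τ.kap₁ h x ^ 2 + τ.kap₂ h x ^ 2 ≠ 0) :
    IsBracketFrame D' x fun j => ∑ i, τ.tubeMat h x i j • τ.field i x := by
  have h1 := hf.isBracketFrame hx hκ
  refine Eq.mp (congrArg _ (funext fun j => ?_)) h1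
  have key : ∀ (e : Fin 4 → TangentSpace (𝓡 4) x) (A : Matrix (Fin 4) (Fin 4) ℝ) (a b : R3)
      (k l : ℝ), A = frameMat a b * kapMat k l →
      (![l • e 0 - k • (a 0 • e 1 + a 1 • e 2 + a 2 • e 3),
        (k ^ 2 + l ^ 2)⁻¹ • (k • e 0 + l • (a 0 • e 1 + a 1 • e 2 + a 2 • e 3)),
        b 0 • e 1 + b 1 • e 2 + b 2 • e 3,
        cross a b 0 • e 1 + cross a b 1 • e 2 + cross a b 2 • e 3] :
          Fin 4 → TangentSpace (𝓡 4) x) j = ∑ i, A i j • e i := by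
    intro e A a b k l hA
    rw [hA]
    simp only [Matrix.mul_apply, Fin.sum_univ_four, frameMat, kapMat]
    fin_cases j
    · change l • e 0 - k • (a 0 • e 1 + a 1 • e 2 + a 2 • e 3) = _
      simp
      module
    · change (k ^ 2 + l ^ 2)⁻¹ • (k • e 0 + l • (a 0 • e 1 + a 1 • e 2 + a 2 • e 3)) = _
      simp [div_eq_mul_inv]
      module
    · change b 0 • e 1 + b 1 • e 2 + b 2 • e 3 = _
      simp
    · change cross a b 0 • e 1 + cross a b 1 • e 2 + cross a b 2 • e 3 = _
      simp
  exact key (fun i => τ.field i x) _ _ _ _ _ rfl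

end TubeMat

section TubeGauge

/-- The endomorphism of `TM` with matrix `A` in the frame of the tube, extended by the identity. -/
def tubeEnd (τ : Tube D J N) (A : M → Matrix (Fin 4) (Fin 4) ℝ) (x : M) :
    TangentSpace (𝓡 4) x →ₗ[ℝ] TangentSpace (𝓡 4) x :=
  open Classical in if x ∈ τ.image then
    ∑ i, ∑ j, A x i j • (τ.frameCoord j x).smulRight (τ.field i x) else LinearMap.id

variable {A B : M → Matrix (Fin 4) (Fin 4) ℝ}

theorem tubeEnd_field {x : M} (hx : x ∈ τ.image) (j : Fin 4) :
    τ.tubeEnd A x (τ.field j x) = ∑ i, A x i j • τ.field i x := by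
  rw [tubeEnd, if_pos hx, LinearMap.sum_apply]
  refine Finset.sum_congr rfl fun i _ => ?_
  rw [LinearMap.sum_apply, Finset.sum_eq_single j]
  · rw [LinearMap.smul_apply, LinearMap.smulRight_apply, τ.frameCoord_field hx, if_pos rfl, one_smul]
  · intro k _ hk
    rw [LinearMap.smul_apply, LinearMap.smulRight_apply, τ.frameCoord_field hx, if_neg hk, zero_smul,
      smul_zero]
  · simp

theorem tubeEnd_sum {x : M} (hx : x ∈ τ.image) (C : Matrix (Fin 4) (Fin 4) ℝ) (j : Fin 4) :
    τ.tubeEnd A x (∑ i, C i j • τ.field i x) = ∑ i, (A x * C) i j • τ.field i x := by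
  simp only [map_sum, map_smul, tubeEnd_field hx, Finset.smul_sum, Matrix.mul_apply, Finset.sum_smul,
    smul_smul]
  rw [Finset.sum_comm]
  simp only [mul_comm]

theorem tubeEnd_eq_id {x : M} (h : x ∈ τ.image → A x = 1) : τ.tubeEnd A x = LinearMap.id := by
  by_cases hx : x ∈ τ.image
  · refine LinearMap.ext fun v => ?_
    have hA : ∀ j, τ.tubeEnd A x (τ.field j x) = τ.field j x := by
      intro j
      rw [tubeEnd_field hx, h hx, sum_one_smul]
    conv_lhs => rw [τ.eq_sum_frameCoord hx v]
    conv_rhs => rw [τ.eq_sum_frameCoord hx v]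
    simp only [map_add, map_smul, hA, LinearMap.id_apply]
  · rw [tubeEnd, if_neg hx]

/-- A homotopy, constant near the ends of the tube, between two matrix valued functions `A`, `B` on
the tube gives rise to a path of automorphisms of `TM` which ends with the automorphism `B A⁻¹`. -/
theorem exists_gaugePath_of_matHomotopic [SecondCountableTopology M] (hD : IsEngel D) {c' : ℝ}
    (hc' : c' < τ.ε) (hA : SmoothMatOn A τ.image)
    (hB : SmoothMatOn B τ.image) (hAd : ∀ x ∈ τ.image, (A x).det ≠ 0)
    (h : MatHomotopic (τ.endSet c') (fun q => A (τ.Φ q.1)) fun q => B (τ.Φ q.1)) :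
    ∃ Q : unitInterval → Π x : M, TangentSpace (𝓡 4) x →ₗ[ℝ] TangentSpace (𝓡 4) x,
      IsGaugePath Q ∧ (∀ x, Q 0 x = LinearMap.id) ∧ (∀ s, ∀ x ∉ τ.image, Q s x = LinearMap.id) ∧
      ∀ x ∈ τ.image, ∀ j,
        Q 1 x (∑ i, A x i j • τ.field i x) = ∑ i, B x i j • τ.field i x := by
  classical
  obtain ⟨F, hF, hFd, hF0, hF1, hFS⟩ := h
  have hmemS : ∀ (x) (hx : x ∈ τ.image), x ∉ τ.core c' →
      (⟨τ.inv x, τ.inv_mem hx⟩ : τ.dom) ∈ τ.endSet c' := by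
    intro x hx hxc
    rw [← τ.Φ_inv hx, τ.Φ_mem_core_iff hc' (τ.inv_snd_mem hx)] at hxc
    exact (not_le.1 hxc).le
  set w : ℝ × M → Matrix (Fin 4) (Fin 4) ℝ := fun z =>
    if hz : z.2 ∈ τ.image then
      F (projIcc 0 1 zero_le_one z.1, ⟨τ.inv z.2, τ.inv_mem hz⟩) * (A z.2)⁻¹ else 1 with hwdef
  set w₁ : M → Matrix (Fin 4) (Fin 4) ℝ := fun x =>
    if x ∈ τ.image then B x * (A x)⁻¹ else 1 with hw₁def
  have hFA : ∀ x (hx : x ∈ τ.image), F (0, ⟨τ.inv x, τ.inv_mem hx⟩) = A x := fun x hx => by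
    rw [hF0]
    dsimp only
    rw [τ.Φ_inv hx]
  have hFB : ∀ x (hx : x ∈ τ.image), F (1, ⟨τ.inv x, τ.inv_mem hx⟩) = B x := fun x hx => by
    rw [hF1]
    dsimp only
    rw [τ.Φ_inv hx]
  have hAA : ∀ x ∈ τ.image, A x * (A x)⁻¹ = 1 := fun x hx =>
    Matrix.mul_nonsing_inv _ (hAd x hx).isUnit
  have hwK : ∀ s, ∀ x ∉ τ.core c', w (s, x) = 1 := by
    intro s x hx
    by_cases hxi : x ∈ τ.image
    · simp only [hwdef, dif_pos hxi]
      rw [hFS _ _ (hmemS x hxi hx), ← hFS 0 _ (hmemS x hxi hx), hFA x hxi, hAA x hxi]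
    · simp only [hwdef, dif_neg hxi]
  have h0 : ∀ s ≤ 0, ∀ x, w (s, x) = 1 := by
    intro s hs x
    by_cases hxi : x ∈ τ.image
    · simp only [hwdef, dif_pos hxi, projIcc_of_le_left zero_le_one hs]
      exact (congrArg (· * (A x)⁻¹) (hFA x hxi)).trans (hAA x hxi)
    · simp only [hwdef, dif_neg hxi]
  have h1 : ∀ s, 1 ≤ s → ∀ x, w (s, x) = w₁ x := by
    intro s hs x
    by_cases hxi : x ∈ τ.image
    · simp only [hwdef, hw₁def, dif_pos hxi, if_pos hxi, projIcc_of_right_le zero_le_one hs]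
      exact congrArg (· * (A x)⁻¹) (hFB x hxi)
    · simp only [hwdef, hw₁def, dif_neg hxi, if_neg hxi]
  have hKc : IsClosed (τ.core c') := (τ.isCompact_core hc').isClosed
  have hw₁ : SmoothMatOn w₁ univ := by
    intro i j x _
    refine ContMDiffAt.contMDiffWithinAt ?_
    by_cases hx : x ∈ τ.core c'
    · have hxi := τ.core_subset_image hc' hx
      refine ContMDiffAt.congr_of_eventuallyEq
        (((hB.mul (hA.inv hAd)) i j).contMDiffAt (τ.isOpen_image.mem_nhds hxi)) ?_
      filter_upwards [τ.isOpen_image.mem_nhds hxi] with y hy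
      simp only [hw₁def, if_pos hy]
    · refine ContMDiffAt.congr_of_eventuallyEq
        (contMDiffAt_const (c := (1 : Matrix (Fin 4) (Fin 4) ℝ) i j)) ?_
      filter_upwards [hKc.isOpen_compl.mem_nhds hx] with y hy
      rw [← h1 1 le_rfl, hwK 1 y hy]
  have hwc : Continuous w := by
    have hAc : ContinuousOn (fun x => (A x)⁻¹) τ.image := (hA.inv hAd).continuousOn
    have hon : ContinuousOn w (univ ×ˢ τ.image) := by
      rw [continuousOn_iff_continuous_domRestrict]
      have hi : Continuous fun z : (univ ×ˢ τ.image : Set (ℝ × M)) =>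
          (projIcc (0 : ℝ) 1 zero_le_one z.1.1, (⟨τ.inv z.1.2, τ.inv_mem z.2.2⟩ : τ.dom)) :=
        (continuous_projIcc.comp (continuous_fst.comp continuous_subtype_val)).prodMk
          ((τ.contMDiffOn_inv.continuousOn.comp_continuous
            (continuous_snd.comp continuous_subtype_val) fun z => z.2.2).subtype_mk _)
      have := (hF.comp hi).matrix_mul (hAc.comp_continuous
        (continuous_snd.comp continuous_subtype_val) fun z : (univ ×ˢ τ.image : Set (ℝ × M)) => z.2.2)
      refine this.congr fun z => ?_
      simp only [domRestrict_apply, hwdef, dif_pos z.2.2]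
      rfl
    refine continuous_iff_continuousAt.2 fun z => ?_
    by_cases hx : z.2 ∈ τ.core c'
    · exact hon.continuousAt ((isOpen_univ.prod τ.isOpen_image).mem_nhds
        ⟨mem_univ _, τ.core_subset_image hc' hx⟩)
    · refine (continuousAt_const (y := (1 : Matrix (Fin 4) (Fin 4) ℝ))).congr ?_
      filter_upwards [(hKc.isOpen_compl.preimage continuous_snd).mem_nhds hx] with y hy
      exact (hwK y.1 y.2 hy).symm
  have hwd : ∀ z, (w z).det ≠ 0 := by
    intro z
    by_cases hz : z.2 ∈ τ.image
    · simp only [hwdef, dif_pos hz, Matrix.det_mul]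
      refine mul_ne_zero (hFd _) ?_
      have := congrArg Matrix.det (hAA _ hz)
      rw [Matrix.det_mul, Matrix.det_one] at this
      exact right_ne_zero_of_mul_eq_one this
    · simp only [hwdef, dif_neg hz, Matrix.det_one]
      exact one_ne_zero
  -- the support of the smooth homotopy lies in a slightly larger compact part of the tube
  obtain ⟨c, hcc', hcε⟩ := exists_between hc'
  have hsub : (univ : Set N) ×ˢ Ioo (-c) c ⊆ τ.dom :=
    (prod_mono Subset.rfl Ioo_subset_Icc_self).trans (τ.prod_Icc_subset_dom hcε)
  have hKU : τ.core c' ⊆ τ.Φ '' (univ ×ˢ Ioo (-c) c) := by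
    refine image_mono (prod_mono Subset.rfl fun t ht => ⟨by linarith [ht.1], by linarith [ht.2]⟩)
  obtain ⟨G, hGs, hGc, hGd, hG0, hG1, hGU⟩ := exists_smooth_matHomotopy hKc
    (τ.isOpen_image_Φ hsub (isOpen_univ.prod isOpen_Ioo)) hKU hwc hwd h0 hw₁ h1 hwK
  have hGcore : ∀ s, ∀ x ∉ τ.core c, G s x = 1 := fun s x hx =>
    hGU s x fun hx' => hx (image_mono (prod_mono Subset.rfl Ioo_subset_Icc_self) hx')
  refine ⟨fun s x => τ.tubeEnd (G s) x, isGaugePath_of_local fun x₀ => ?_,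
    fun x => tubeEnd_eq_id fun _ => hG0 x, fun s x hx => tubeEnd_eq_id fun h => absurd h hx,
    fun x hx j => ?_⟩
  · by_cases hx₀ : x₀ ∈ τ.core c
    · have hxi := τ.core_subset_image hcε hx₀
      exact ⟨τ.image, τ.isOpen_image, hxi, τ.field, fun s => G s, τ.smooth_field, τ.indep_field hxi,
        fun s i j => (hGs s i j).mono (subset_univ _),
        fun i j => (((hGc.comp (continuous_subtype_val.prodMap continuous_id)).matrix_elem i
          j).continuousOn), fun s x _ => hGd s x, fun s x hx j => tubeEnd_field hx j⟩
    · obtain ⟨O, e, hO, hx, he, hb⟩ := hD.exists_bracketFrame x₀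
      refine ⟨O ∩ (τ.core c)ᶜ, hO.inter (τ.isCompact_core hcε).isClosed.isOpen_compl, ⟨hx, hx₀⟩, e,
        fun _ _ => 1, fun i => (he i).mono inter_subset_left, (hb x₀ hx).indep,
        fun s i j => contMDiffOn_const, fun i j => continuousOn_const, fun s x _ => by simp,
        fun s x hx j => ?_⟩
      rw [tubeEnd_eq_id fun _ => hGcore s x hx.2, LinearMap.id_apply]
      exact (sum_one_smul (fun i => e i x) j).symm
  · rw [tubeEnd_sum hx]
    simp only [Icc.coe_one, hG1, hw₁def, if_pos hx, mul_assoc]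
    rw [Matrix.nonsing_inv_mul _ (hAd x hx).isUnit, mul_one]

end TubeGauge

end Tube

/-! ### Gram matrices and rotations adapted to an Engel structure -/

section Gram

universe u

variable {M : Type u} [TopologicalSpace M] [ChartedSpace R4 M] [IsManifold (𝓡 4) ∞ M]

/-- The Gram matrices of frames with respect to some Riemannian metric on `M`. -/
structure IsGram (Γ : Π x : M, (Fin 4 → TangentSpace (𝓡 4) x) → Matrix (Fin 4) (Fin 4) ℝ) :
    Prop where
  smooth : ∀ (e : Fin 4 → Π x : M, TangentSpace (𝓡 4) x) (O : Set M), IsOpen O →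
    (∀ i, SmoothFieldOn (e i) O) → SmoothMatOn (fun x => Γ x fun i => e i x) O
  posDef : ∀ x e, LinearIndependent ℝ e → (Γ x e).PosDef
  change : ∀ x e (P : Matrix (Fin 4) (Fin 4) ℝ),
    Γ x (fun j => ∑ i, P i j • e i) = P.transpose * Γ x e * P

variable (M) in
/-- Every manifold carries a Riemannian metric, which is obtained from the scalar products of
coordinates by means of a partition of unity. -/
theorem exists_isGram [T2Space M] [SecondCountableTopology M] :
    ∃ Γ : Π x : M, (Fin 4 → TangentSpace (𝓡 4) x) → Matrix (Fin 4) (Fin 4) ℝ, IsGram Γ := by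
  have : LocallyCompactSpace M := ChartedSpace.locallyCompactSpace R4 M
  obtain ⟨f, hf⟩ := SmoothPartitionOfUnity.exists_isSubordinate (𝓡 4) (s := (univ : Set M))
    isClosed_univ coordDom isOpen_coordDom fun x _ => mem_iUnion.2 ⟨x, mem_coordDom x⟩
  -- the metric, as a sum of pulled back scalar products
  set g : Π x : M, TangentSpace (𝓡 4) x →ₗ[ℝ] TangentSpace (𝓡 4) x →ₗ[ℝ] ℝ := fun x =>
    ∑ k ∈ f.finsupport x, f k x • (innerₗ R4).compl₁₂ (coord k x) (coord k x) with hg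
  have hgv : ∀ x v w, g x v w = ∑ k ∈ f.finsupport x, f k x • inner ℝ (coord k x v) (coord k x w) := by
    intro x v w
    simp only [hg, LinearMap.sum_apply, LinearMap.smul_apply, LinearMap.compl₁₂_apply, innerₗ_apply_apply]
  have hsymm : ∀ x v w, g x v w = g x w v := fun x v w => by
    simp only [hgv, real_inner_comm]
  have hpos : ∀ x v, v ≠ 0 → 0 < g x v v := by
    intro x v hv
    rw [hgv]
    have h0 : ∀ k ∈ f.finsupport x, 0 < f k x • inner ℝ (coord k x v) (coord k x v) := by
      intro k hk
      have hk' : f k x ≠ 0 := f.mem_finsupport x |>.1 hk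
      have hx : x ∈ coordDom k := hf k (subset_tsupport _ hk')
      refine smul_pos ((f.nonneg k x).lt_of_ne' hk') (real_inner_self_pos.2 fun h => hv ?_)
      exact coord_injective hx (h.trans (map_zero _).symm)
    refine Finset.sum_pos h0 ?_
    by_contra hne
    have h1 := f.sum_finsupport x (mem_univ x)
    rw [Finset.not_nonempty_iff_eq_empty.1 hne, Finset.sum_empty] at h1
    exact zero_ne_one h1
  refine ⟨fun x e => Matrix.of fun i j => g x (e i) (e j), fun e O hO he i j x₀ hx₀ => ?_,
    fun x e he => ?_, fun x e P => ?_⟩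
  · refine ContMDiffAt.contMDiffWithinAt ?_
    have h1 : ContMDiffAt (𝓡 4) 𝓘(ℝ) ∞ (fun x => ∑ᶠ k, f k x •
        (inner ℝ (coord k x (e i x)) (coord k x (e j x)) : ℝ)) x₀ := by
      refine f.contMDiffAt_finsum fun k hk => ?_
      have hO' : IsOpen (O ∩ coordDom k) := hO.inter (isOpen_coordDom k)
      have hc : ∀ i, ContMDiffAt (𝓡 4) 𝓘(ℝ, R4) ∞ (fun x => coord k x (e i x)) x₀ := fun i =>
        ((smoothFieldOn_iff_coord hO' inter_subset_right (e i)).1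
          ((he i).mono inter_subset_left)).contMDiffAt (hO'.mem_nhds ⟨hx₀, hf k hk⟩)
      have hin : ContDiff ℝ ∞ fun p : R4 × R4 => inner ℝ p.1 p.2 := contDiff_fst.inner ℝ contDiff_snd
      exact ContMDiffAt.comp (g := fun p : R4 × R4 => inner ℝ p.1 p.2) x₀
        hin.contDiffAt.contMDiffAt ((hc i).prodMk_space (hc j))
    refine h1.congr_of_eventuallyEq (Filter.Eventually.of_forall fun x => ?_)
    exact (hgv x _ _).trans (f.sum_finsupport_smul_eq_finsum x
      fun k x => (inner ℝ (coord k x (e i x)) (coord k x (e j x)) : ℝ))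
  · refine Matrix.PosDef.of_dotProduct_mulVec_pos ?_ fun c hc => ?_
    · ext i j
      simp [hsymm x (e i) (e j)]
    · have hv : ∑ i, c i • e i ≠ 0 := fun h =>
        hc (funext fun i => Fintype.linearIndependent_iff.1 he c h i)
      refine (hpos x _ hv).trans_eq ?_
      simp only [map_sum, map_smul, LinearMap.sum_apply, LinearMap.smul_apply, dotProduct,
        Matrix.mulVec, Pi.star_apply, star_trivial, Matrix.of_apply, smul_eq_mul, Finset.mul_sum]
      refine Finset.sum_congr rfl fun i _ => Finset.sum_congr rfl fun j _ => ?_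
      rw [hsymm x (e j) (e i)]
      ring
  · ext i j
    simp only [Matrix.of_apply, map_sum, map_smul, LinearMap.sum_apply, LinearMap.smul_apply,
      Matrix.mul_apply, Matrix.transpose_apply, smul_eq_mul, Finset.sum_mul, Finset.mul_sum]
    refine Finset.sum_congr rfl fun k _ => Finset.sum_congr rfl fun l _ => ?_
    ring

end Gram

section Rotation

universe u

variable {M : Type u} [TopologicalSpace M] [ChartedSpace R4 M] [IsManifold (𝓡 4) ∞ M]
  {D : Π x : M, Submodule ℝ (TangentSpace (𝓡 4) x)}

theorem TriRel.exists_matrix {T : Type*} [AddCommGroup T] [Module ℝ T] {e e' : Fin 4 → T}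
    (h : TriRel e e') : ∃ P : Matrix (Fin 4) (Fin 4) ℝ, P.det ≠ 0 ∧ (∃ a d : ℝ, 0 < a * d ∧
      (∀ i, P i 0 = if i = 0 then a else 0) ∧ ∀ j, P 3 j = if j = 3 then d else 0) ∧
      e' = fun j => ∑ i, P i j • e i := by
  obtain ⟨a, b, ha, hb, u₀, v₀, v₁, w₀, w₁, w₂, h0, h1, h2, h3⟩ := h
  refine ⟨!![a, u₀, v₀, w₀; 0, b, v₁, w₁; 0, 0, a * b, w₂; 0, 0, 0, a * b ^ 2], ?_,
    ⟨a, a * b ^ 2, ?_, fun i => ?_, fun j => ?_⟩, funext fun j => ?_⟩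
  · rw [Matrix.det_of_isUpperTriangular]
    · simp [Fin.prod_univ_succ, ha, hb]
    · intro i j hij
      fin_cases i <;> fin_cases j <;> first | rfl | exact absurd hij (by decide)
  · rw [show a * (a * b ^ 2) = (a * b) ^ 2 by ring]
    exact sq_pos_of_ne_zero (mul_ne_zero ha hb)
  · fin_cases i <;> rfl
  · fin_cases j <;> rfl
  · rw [Fin.sum_univ_four]
    fin_cases j
    · refine h0.trans ?_
      simp
    · refine h1.trans ?_
      simp [add_comm]
    · refine h2.trans ?_
      simp
      abel
    · refine h3.trans ?_
      simp
      abel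

/-- The rotations by the angles `2πsf` in the plane spanned by the kernel line field and the normal
of the even contact structure form a path of automorphisms of `TM`. The choice of a bracket frame
orients this plane, and the orientation does not depend on the choice. -/
theorem exists_rotationPath (hD : IsEngel D)
    {Γ : Π x : M, (Fin 4 → TangentSpace (𝓡 4) x) → Matrix (Fin 4) (Fin 4) ℝ} (hΓ : IsGram Γ)
    {f : M → ℝ} (hf : ContMDiff (𝓡 4) 𝓘(ℝ) ∞ f) :
    ∃ R : unitInterval → Π x : M, TangentSpace (𝓡 4) x →ₗ[ℝ] TangentSpace (𝓡 4) x,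
      IsGaugePath R ∧ (∀ x, R 0 x = LinearMap.id) ∧ (∀ s x, f x = 0 → R s x = LinearMap.id) ∧
      ∀ s x e, IsBracketFrame D x e → ∀ j,
        R s x (e j) = ∑ i, rotMat (gramRot (Γ x e)) (2 * Real.pi * (s * f x)) i j • e i := by
  have hex : ∀ x, ∃ e, IsBracketFrame D x e := fun x => by
    obtain ⟨O, e, -, hx, -, h⟩ := hD.exists_bracketFrame x
    exact ⟨_, h x hx⟩
  choose e he using hex
  set A : unitInterval → M → Matrix (Fin 4) (Fin 4) ℝ := fun s x =>
    rotMat (gramRot (Γ x (e x))) (2 * Real.pi * (s * f x)) with hA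
  set R : unitInterval → Π x : M, TangentSpace (𝓡 4) x →ₗ[ℝ] TangentSpace (𝓡 4) x := fun s x =>
    Matrix.toLin (frameBasis (he x).indep) (frameBasis (he x).indep) (A s x) with hR
  have hb : ∀ x i, frameBasis (he x).indep i = e x i := fun x i => Module.Basis.mk_apply _ _ i
  have hRe : ∀ s x j, R s x (e x j) = ∑ i, A s x i j • e x i := by
    intro s x j
    have := Matrix.toLin_self (frameBasis (he x).indep) (frameBasis (he x).indep) (A s x) j
    simpa only [hb] using this
  have hR1 : ∀ s x, A s x = 1 → R s x = LinearMap.id := fun s x h => by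
    simp only [hR, h, Matrix.toLin_one]
  -- the rotation is given by the same formula in every bracket frame; this makes it smooth
  have key : ∀ s x e', IsBracketFrame D x e' → ∀ j,
      R s x (e' j) = ∑ i, rotMat (gramRot (Γ x e')) (2 * Real.pi * (s * f x)) i j • e' i := by
    intro s x e' he' j
    obtain ⟨P, hP, ⟨a, d, had, h0, h3⟩, rfl⟩ := ((he x).triRel hD.1 hD.2.1 he').exists_matrix
    have h1 := gramRot_conj (hΓ.posDef x _ (he x).indep) hP had h0 h3
    have h2 := rotMat_conj h1 (2 * Real.pi * (s * f x))
    rw [hΓ.change]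
    have h4 := fun i => congrFun (congrFun h2 i) j
    simp only [Matrix.mul_apply] at h4
    simp only [map_sum, map_smul, hRe, Finset.smul_sum, smul_smul]
    rw [Finset.sum_comm]
    conv_rhs => rw [Finset.sum_comm]
    refine Finset.sum_congr rfl fun i _ => ?_
    rw [← Finset.sum_smul, ← Finset.sum_smul]
    congr 1
    have h5 := h4 i
    rw [show (∑ k, P k j * A s x i k) = ∑ k, A s x i k * P k j from
      Finset.sum_congr rfl fun k _ => mul_comm _ _, ← h5]
    exact Finset.sum_congr rfl fun k _ => mul_comm _ _
  refine ⟨R, isGaugePath_of_local fun x₀ => ?_, fun x => hR1 0 x ?_, fun s x hx => hR1 s x ?_, key⟩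
  · obtain ⟨O, e', hO, hx, hs, hb'⟩ := hD.exists_bracketFrame x₀
    have hpd : ∀ x ∈ O, (Γ x fun i => e' i x).PosDef := fun x hx => hΓ.posDef x _ (hb' x hx).indep
    have hg : SmoothMatOn (fun x => gramRot (Γ x fun i => e' i x)) O :=
      (hΓ.smooth e' O hO hs).gramRot hpd
    refine ⟨O, hO, hx, e', fun s x =>
      rotMat (gramRot (Γ x fun i => e' i x)) (2 * Real.pi * (s * f x)), hs, (hb' x₀ hx).indep,
      fun s => hg.rotMat (contMDiffOn_const.mul (contMDiffOn_const.mul hf.contMDiffOn)), fun i j => ?_,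
      fun s x hx => det_rotMat_ne_zero (gramRot_cube (hpd x hx)) _,
      fun s x hx j => key s x _ (hb' x hx) j⟩
    have hgc : ContinuousOn (fun q : unitInterval × M => gramRot (Γ q.2 fun i => e' i q.2))
        (univ ×ˢ O) := hg.continuousOn.comp continuousOn_snd fun q hq => hq.2
    have hfc : ContinuousOn (fun q : unitInterval × M => 2 * Real.pi * (q.1 * f q.2)) (univ ×ˢ O) := by
      have := hf.continuous
      fun_prop
    have h1 := ((continuousOn_const (c := (1 : Matrix (Fin 4) (Fin 4) ℝ))).add
      ((Real.continuous_sin.comp_continuousOn hfc).smul hgc)).add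
      (((continuousOn_const (c := (1 : ℝ))).sub (Real.continuous_cos.comp_continuousOn hfc)).smul (hgc.mul hgc))
    exact (continuous_apply_apply i j).comp_continuousOn h1
  · simp only [hA, Icc.coe_zero, zero_mul, mul_zero, rotMat_zero]
  · simp only [hA, hx, mul_zero, rotMat_zero]

end Rotation

/-! ### Lifting of circle valued functions -/

section Lifting

theorem eqOn_zero_of_circleExp {Z : Type*} [TopologicalSpace Z] {S : Set Z} (hS : IsPreconnected S)
    {g : Z → ℝ} (hg : Continuous g) (h : ∀ z ∈ S, Circle.exp (g z) = 1) {z₀ : Z} (hz₀ : z₀ ∈ S)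
    (h0 : g z₀ = 0) {z : Z} (hz : z ∈ S) : g z = 0 :=
  Circle.isCoveringMap_exp.eqOn_of_comp_eqOn hS hg.continuousOn (g₂ := fun _ => 0) continuousOn_const
    (fun z hz => by simp [h z hz]) hz₀ h0 hz

theorem isPreconnected_norm_ge {E : Type*} [NormedAddCommGroup E] [NormedSpace ℝ E]
    (hE : 1 < Module.rank ℝ E) (r : ℝ) : IsPreconnected {z : E | r ≤ ‖z‖} := by
  have h1 := ((isConnected_sphere hE (0 : E) zero_le_one).isPreconnected.prod
    (isPreconnected_Ici (a := r))).image (fun p : E × ℝ => p.2 • p.1) (by fun_prop)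
  obtain ⟨u₀, hu₀⟩ := (isConnected_sphere hE (0 : E) zero_le_one).nonempty
  convert h1 using 1
  ext z
  constructor
  · intro hz
    rcases eq_or_ne z 0 with rfl | h0
    · exact ⟨(u₀, 0), ⟨hu₀, by simpa using hz⟩, by simp⟩
    · refine ⟨(‖z‖⁻¹ • z, ‖z‖), ⟨?_, hz⟩, ?_⟩
      · simp [norm_smul, norm_ne_zero_iff.2 h0]
      · simp [smul_smul, norm_ne_zero_iff.2 h0]
  · rintro ⟨⟨u, t⟩, ⟨hu, ht⟩, rfl⟩
    have hu' : ‖u‖ = 1 := by simpa using hu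
    have ht' : r ≤ t := ht
    rw [mem_ofPred_eq, norm_smul, hu', mul_one]
    exact ht'.trans (le_abs_self t)

/-- A circle valued function on `A × E` which is trivial outside a tube around `A × {0}` lifts to a
function which vanishes outside the tube, since the complement of a ball in `E` is connected. -/
theorem exists_lift_prod {A E : Type*} [TopologicalSpace A] [NormedAddCommGroup E]
    [NormedSpace ℝ E] (hE : 1 < Module.rank ℝ E) {r : ℝ} {q : A × E → Circle}
    (hq : Continuous q) (h : ∀ a z, r ≤ ‖z‖ → q (a, z) = 1) :
    ∃ F : A × E → ℝ, Continuous F ∧ (∀ p, Circle.exp (F p) = q p) ∧ ∀ a z, r ≤ ‖z‖ → F (a, z) = 0 := by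
  have : Nontrivial E := (rank_pos_iff_nontrivial (R := ℝ)).1 (zero_lt_one.trans hE)
  obtain ⟨z₀, hz₀⟩ := NormedSpace.exists_lt_norm ℝ E r
  -- contract the second factor to the point `z₀` outside the tube
  set H : C(unitInterval × (A × E), Circle) :=
    ⟨fun p => q (p.2.1, z₀ + (p.1 : ℝ) • (p.2.2 - z₀)), by fun_prop⟩ with hH
  have hH0 : ∀ p : A × E, H (0, p) = Circle.exp ((0 : C(A × E, ℝ)) p) := fun p => by
    simp [hH, h p.1 z₀ hz₀.le]
  set L := Circle.isCoveringMap_exp.liftHomotopy H 0 hH0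
  have hL : ∀ p, Circle.exp (L p) = H p :=
    congrFun (Circle.isCoveringMap_exp.liftHomotopy_lifts H 0 hH0)
  have hL0 : ∀ p, L (0, p) = 0 := Circle.isCoveringMap_exp.liftHomotopy_zero H 0 hH0
  have hLz₀ : ∀ a, L (1, (a, z₀)) = 0 := fun a =>
    eqOn_zero_of_circleExp (g := fun s : unitInterval => L (s, (a, z₀))) isPreconnected_univ
      (by fun_prop) (fun s _ => by rw [hL]; simp [hH, h a z₀ hz₀.le]) (mem_univ 0) (hL0 _)
      (mem_univ 1)
  refine ⟨fun p => L (1, p), by fun_prop, fun p => by rw [hL]; simp [hH], fun a z hz => ?_⟩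
  exact eqOn_zero_of_circleExp (g := fun z => L (1, (a, z))) (isPreconnected_norm_ge hE r)
    (by fun_prop) (fun z hz => by rw [hL]; simp [hH, h a z hz]) hz₀.le (hLz₀ a) hz

/-- Circle valued functions with compact support in the open set `V` lift to real valued functions
which vanish outside `V`. -/
def HasLifting {M : Type*} [TopologicalSpace M] (V : Set M) : Prop :=
  ∀ q : M → Circle, Continuous q → ∀ K ⊆ V, IsCompact K → (∀ x ∉ K, q x = 1) →
    ∃ F : M → ℝ, Continuous F ∧ (∀ x, Circle.exp (F x) = q x) ∧ ∀ x ∉ V, F x = 0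

theorem hasLifting_of_prod {M A E : Type*} [TopologicalSpace M] [T2Space M] [TopologicalSpace A]
    [CompactSpace A] [NormedAddCommGroup E] [NormedSpace ℝ E] [FiniteDimensional ℝ E]
    (hE : 1 < Module.rank ℝ E) {r : ℝ} (hr : 0 < r) {ψ : A × E → M} {g : M → A × E}
    (hψ : ContinuousOn ψ (univ ×ˢ Metric.ball 0 r)) (hgψ : ∀ p ∈ univ ×ˢ Metric.ball 0 r, g (ψ p) = p)
    (hg : ContinuousOn g (ψ '' (univ ×ˢ Metric.ball 0 r)))
    (hV : IsOpen (ψ '' (univ ×ˢ Metric.ball 0 r))) :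
    HasLifting (ψ '' (univ ×ˢ Metric.ball 0 r)) := by
  classical
  have : ProperSpace E := FiniteDimensional.proper ℝ E
  intro q hq K hKV hK hqK
  set V := ψ '' (univ ×ˢ Metric.ball 0 r) with hVdef
  have hgV : ∀ x ∈ V, ψ (g x) = x ∧ ‖(g x).2‖ < r := by
    rintro _ ⟨p, hp, rfl⟩
    rw [hgψ p hp]
    exact ⟨rfl, by simpa using hp.2⟩
  obtain ⟨r', hr', hKr⟩ : ∃ r' < r, ∀ x ∈ K, ‖(g x).2‖ ≤ r' := by
    rcases K.eq_empty_or_nonempty with rfl | hne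
    · exact ⟨0, hr, by simp⟩
    · obtain ⟨x, hx, hmax⟩ := hK.exists_isMaxOn hne ((continuous_snd.comp_continuousOn
        (hg.mono hKV)).norm)
      exact ⟨_, (hgV x (hKV hx)).2, fun y hy => hmax hy⟩
  obtain ⟨r₁, hr₁, hr₁r⟩ := exists_between hr'
  set Q : A × E → Circle := fun p => if ‖p.2‖ < r then q (ψ p) else 1 with hQ
  have hQ1 : ∀ a z, r' < ‖z‖ → Q (a, z) = 1 := by
    intro a z hz
    by_cases hzr : ‖z‖ < r
    · simp only [hQ, if_pos hzr]
      refine hqK _ fun hK' => ?_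
      have := hKr _ hK'
      rw [hgψ (a, z) ⟨mem_univ _, by simpa using hzr⟩] at this
      exact absurd hz (not_lt.2 this)
    · simp only [hQ, if_neg hzr]
  have hopen : IsOpen ((univ : Set A) ×ˢ Metric.ball (0 : E) r) := isOpen_univ.prod Metric.isOpen_ball
  have hQc : Continuous Q := by
    refine continuous_iff_continuousAt.2 fun p => ?_
    rcases lt_or_ge ‖p.2‖ r with hp | hp
    · have hmem : (univ : Set A) ×ˢ Metric.ball (0 : E) r ∈ 𝓝 p :=
        hopen.mem_nhds ⟨mem_univ _, by simpa using hp⟩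
      refine (hq.continuousAt.comp (hψ.continuousAt hmem)).congr ?_
      filter_upwards [hmem] with y hy
      have hy' : ‖y.2‖ < r := by simpa using hy.2
      simp only [hQ, if_pos hy', Function.comp_apply]
    · refine (continuousAt_const (y := (1 : Circle))).congr ?_
      filter_upwards [(isOpen_lt continuous_const continuous_snd.norm).mem_nhds
        (show r' < ‖p.2‖ from hr'.trans_le hp)] with y hy
      exact (hQ1 y.1 y.2 hy).symm
  obtain ⟨F, hF, hFQ, hF0⟩ := exists_lift_prod hE hQc
    fun a z hz => hQ1 a z (hr₁.trans_le hz)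
  have hC : IsCompact (ψ '' (univ ×ˢ Metric.closedBall 0 r₁)) :=
    (isCompact_univ.prod (isCompact_closedBall _ _)).image_of_continuousOn
      (hψ.mono (prod_mono Subset.rfl (Metric.closedBall_subset_ball hr₁r)))
  have hCV : ψ '' (univ ×ˢ Metric.closedBall 0 r₁) ⊆ V :=
    image_mono (prod_mono Subset.rfl (Metric.closedBall_subset_ball hr₁r))
  set f : M → ℝ := fun x => if x ∈ V then F (g x) else 0 with hf
  have hf0 : ∀ x ∉ ψ '' (univ ×ˢ Metric.closedBall 0 r₁), f x = 0 := by
    intro x hx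
    by_cases hxV : x ∈ V
    · simp only [hf, if_pos hxV]
      refine hF0 (g x).1 (g x).2 (not_lt.1 fun h => hx ⟨g x, ⟨mem_univ _, ?_⟩, (hgV x hxV).1⟩)
      simpa using h.le
    · simp only [hf, if_neg hxV]
  refine ⟨f, continuous_iff_continuousAt.2 fun x => ?_, fun x => ?_, fun x hx => by
    simp only [hf, if_neg hx]⟩
  · by_cases hx : x ∈ ψ '' (univ ×ˢ Metric.closedBall 0 r₁)
    · have hmem := hV.mem_nhds (hCV hx)
      refine (hF.continuousAt.comp (hg.continuousAt hmem)).congr ?_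
      filter_upwards [hmem] with y hy
      simp only [hf, if_pos hy, Function.comp_apply]
    · refine (continuousAt_const (y := (0 : ℝ))).congr ?_
      filter_upwards [hC.isClosed.isOpen_compl.mem_nhds hx] with y hy
      exact (hf0 y hy).symm
  · by_cases hx : x ∈ V
    · simp only [hf, if_pos hx, hFQ, hQ, if_pos (hgV x hx).2, (hgV x hx).1]
    · simp only [hf, if_neg hx, Circle.exp_zero]
      exact (hqK x fun h => hx (hKV h)).symm

end Lifting

namespace Tube

universe u

variable {M : Type u} [TopologicalSpace M] [T2Space M] [ChartedSpace R4 M] [IsManifold (𝓡 4) ∞ M]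
  {EN : Type*} [NormedAddCommGroup EN] [NormedSpace ℝ EN] [FiniteDimensional ℝ EN]
  {HN : Type*} [TopologicalSpace HN]
  {D : Π x : M, Submodule ℝ (TangentSpace (𝓡 4) x)} {J : ModelWithCorners ℝ EN HN} [J.Boundaryless]
  {N : Type*} [TopologicalSpace N] [CompactSpace N] [ChartedSpace HN N] [IsManifold J ∞ N]
  [Nonempty N] {τ : Tube D J N}

theorem contMDiffAt_of_circleExp_eq {F G : M → ℝ} (hF : Continuous F) {O : Set M} (hO : IsOpen O)
    (hG : ContMDiffOn (𝓡 4) 𝓘(ℝ) ∞ G O)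
    (h : ∀ x ∈ O, Circle.exp (2 * Real.pi * F x) = Circle.exp (2 * Real.pi * G x)) {x₀ : M}
    (hx₀ : x₀ ∈ O) : ContMDiffAt (𝓡 4) 𝓘(ℝ) ∞ F x₀ := by
  have hpi := Real.pi_pos
  have hint : ∀ x ∈ O, ∃ n : ℤ, F x = G x + n := by
    intro x hx
    obtain ⟨n, hn⟩ := Circle.exp_eq_exp.1 (h x hx)
    exact ⟨n, mul_left_cancel₀ (show 2 * Real.pi ≠ 0 by positivity) (by linear_combination hn)⟩
  -- the difference of the two functions is integer valued, hence locally constant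
  have hc : ContinuousAt (fun x => F x - G x) x₀ :=
    hF.continuousAt.sub (hG.continuousOn.continuousAt (hO.mem_nhds hx₀))
  have hev : ∀ᶠ x in 𝓝 x₀, F x = G x + (F x₀ - G x₀) := by
    filter_upwards [hO.mem_nhds hx₀, Metric.continuousAt_iff'.1 hc 1 one_pos] with x hx hd
    obtain ⟨n, hn⟩ := hint x hx
    obtain ⟨m, hm⟩ := hint x₀ hx₀
    have h1 : F x - G x = n := by linarith
    have h2 : F x₀ - G x₀ = m := by linarith
    rw [h1, h2, Real.dist_eq] at hd
    have h3 : n = m := by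
      have : |n - m| < 1 := by exact_mod_cast hd
      exact sub_eq_zero.1 (Int.abs_lt_one_iff.1 this)
    rw [h2, ← h3, hn]
  exact ((hG.contMDiffAt (hO.mem_nhds hx₀)).add contMDiffAt_const).congr_of_eventuallyEq hev

/-- The angle of rotation, which is a function of `t` near the tube, extends to a smooth function on
`M` which is integer valued outside of the tube. -/
theorem exists_angle {c' : ℝ} (hc' : c' < τ.ε) {f : ℝ → ℝ} (hf : ContDiff ℝ ∞ f)
    (hf0 : ∀ t ≤ -c', f t = 0) (hf1 : ∀ t, c' ≤ t → f t = 1) {V : Set M} (hV : HasLifting V)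
    (hτV : τ.image ⊆ V) : ∃ F : M → ℝ, ContMDiff (𝓡 4) 𝓘(ℝ) ∞ F ∧ (∀ x ∉ V, F x = 0) ∧
      (∀ x ∈ τ.image, ∃ n : ℤ, F x = f (τ.inv x).2 + n) ∧ ∀ x ∉ τ.image, ∃ n : ℤ, F x = n := by
  classical
  have hpi := Real.two_pi_pos
  set q : M → Circle := fun x =>
    if x ∈ τ.image then Circle.exp (2 * Real.pi * f (τ.inv x).2) else 1 with hq
  have hKc : IsClosed (τ.core c') := (τ.isCompact_core hc').isClosed
  have hfs : ContMDiffOn (𝓡 4) 𝓘(ℝ) ∞ (fun x => f (τ.inv x).2) τ.image :=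
    hf.contMDiff.comp_contMDiffOn (contMDiff_snd.comp_contMDiffOn τ.contMDiffOn_inv)
  have hq1 : ∀ x ∉ τ.core c', q x = 1 := by
    intro x hx
    by_cases hxi : x ∈ τ.image
    · rw [← τ.Φ_inv hxi, τ.Φ_mem_core_iff hc' (τ.inv_snd_mem hxi), not_le] at hx
      simp only [hq, if_pos hxi]
      rcases lt_abs.1 hx with h | h
      · rw [hf1 _ h.le, mul_one, Circle.exp_two_pi]
      · rw [hf0 _ (by linarith), mul_zero, Circle.exp_zero]
    · simp only [hq, if_neg hxi]
  have hqc : Continuous q := by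
    refine continuous_iff_continuousAt.2 fun x => ?_
    by_cases hx : x ∈ τ.core c'
    · have hmem := τ.isOpen_image.mem_nhds (τ.core_subset_image hc' hx)
      have h1 : ContinuousAt (fun x => Circle.exp (2 * Real.pi * f (τ.inv x).2)) x :=
        Circle.exp.continuous.continuousAt.comp
          (continuousAt_const.mul (hfs.continuousOn.continuousAt hmem))
      refine h1.congr ?_
      filter_upwards [hmem] with y hy
      simp only [hq, if_pos hy]
    · refine (continuousAt_const (y := (1 : Circle))).congr ?_
      filter_upwards [hKc.isOpen_compl.mem_nhds hx] with y hy
      exact (hq1 y hy).symm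
  obtain ⟨G, hG, hGq, hGV⟩ := hV q hqc _ ((τ.core_subset_image hc').trans hτV)
    (τ.isCompact_core hc') hq1
  have hexp : ∀ x, Circle.exp (2 * Real.pi * (G x / (2 * Real.pi))) = q x := fun x => by
    rw [mul_div_cancel₀ _ hpi.ne', hGq]
  have hFc : Continuous fun x => G x / (2 * Real.pi) := hG.div_const _
  have hin : ∀ x ∈ τ.image, Circle.exp (2 * Real.pi * (G x / (2 * Real.pi))) =
      Circle.exp (2 * Real.pi * f (τ.inv x).2) := fun x hx => by
    rw [hexp]
    simp only [hq, if_pos hx]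
  have hout : ∀ x ∉ τ.core c', Circle.exp (2 * Real.pi * (G x / (2 * Real.pi))) =
      Circle.exp (2 * Real.pi * 0) := fun x hx => by
    rw [hexp, hq1 x hx, mul_zero, Circle.exp_zero]
  have hint : ∀ {a b : ℝ}, Circle.exp (2 * Real.pi * a) = Circle.exp (2 * Real.pi * b) →
      ∃ n : ℤ, a = b + n := by
    intro a b h
    obtain ⟨n, hn⟩ := Circle.exp_eq_exp.1 h
    exact ⟨n, mul_left_cancel₀ hpi.ne' (by linear_combination hn)⟩
  refine ⟨fun x => G x / (2 * Real.pi), fun x => ?_, fun x hx => by simp only [hGV x hx, zero_div],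
    fun x hx => hint (hin x hx), fun x hx => ?_⟩
  · by_cases hx : x ∈ τ.core c'
    · exact contMDiffAt_of_circleExp_eq hFc τ.isOpen_image hfs hin (τ.core_subset_image hc' hx)
    · exact contMDiffAt_of_circleExp_eq hFc hKc.isOpen_compl contMDiffOn_const hout hx
  · obtain ⟨n, hn⟩ := hint (hout x fun h => hx (τ.core_subset_image hc' h))
    exact ⟨n, hn.trans (zero_add _)⟩

end Tube

/-! ### Comparison of the two Engel structures -/

theorem rotMat_add_int_mul_two_pi (J : Matrix (Fin 4) (Fin 4) ℝ) (θ : ℝ) (n : ℤ) :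
    rotMat J (θ + n * (2 * Real.pi)) = rotMat J θ := by
  rw [rotMat, rotMat, Real.sin_add_int_mul_two_pi, Real.cos_add_int_mul_two_pi]

theorem isGaugePath_id {M : Type*} [TopologicalSpace M] [ChartedSpace R4 M]
    [IsManifold (𝓡 4) ∞ M] : IsGaugePath (M := M) fun _ _ => LinearMap.id where
  injective _ _ := Function.injective_id
  smooth _ _ _ _ h := h
  continuous _ _ h := h

/-- The properties of the open set `V` which enter the comparison of Engel structures
relative to its complement. -/
structure IsStandardDomain {M : Type*} [TopologicalSpace M] (V : Set M) : Prop where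
  lifting : HasLifting V
  preconnected : IsPreconnected V
  boundary : (closure V ∩ Vᶜ).Nonempty
  regular : Vᶜ ⊆ closure (interior Vᶜ)

namespace Tube

universe u

variable {M : Type u} [TopologicalSpace M] [T2Space M] [SecondCountableTopology M]
  [ChartedSpace R4 M] [IsManifold (𝓡 4) ∞ M]
  {EN : Type*} [NormedAddCommGroup EN] [NormedSpace ℝ EN] [FiniteDimensional ℝ EN]
  {HN : Type*} [TopologicalSpace HN]
  {D : Π x : M, Submodule ℝ (TangentSpace (𝓡 4) x)} {J : ModelWithCorners ℝ EN HN} [J.Boundaryless]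
  {N : Type*} [TopologicalSpace N] [CompactSpace N] [ChartedSpace HN N] [IsManifold J ∞ N]

section

variable [Nonempty N] {τ : Tube D J N}

/-- The two Engel structures are related by a path of automorphisms of `TM`: a rotation by `2πs`
times an extension of the angle function on the tube to all of `V`, followed by a deformation which
is supported in the tube. -/
theorem IsModification.exists_gaugePath {P : τ.Profile} {l : N → ℝ → R3}
    {D' : Π x : M, Submodule ℝ (TangentSpace (𝓡 4) x)} (hD : IsEngel D)
    (hm : τ.IsModification P.c l D') (hD' : IsEngel D')
    (hseg : ∀ p, ∀ t ∈ Ioo (-τ.ε) τ.ε, ∀ s ∈ Icc (0 : ℝ) 1,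
      cross ((1 - s) • l p t + s • P.η p t)
        ((1 - s) • deriv (l p) t + s • deriv (P.η p) t) ≠ 0)
    {V : Set M} (hV : HasLifting V) (hτV : τ.image ⊆ V) :
    ∃ L : unitInterval → Π x : M, TangentSpace (𝓡 4) x →ₗ[ℝ] TangentSpace (𝓡 4) x,
      IsGaugePath L ∧ (∀ x, L 0 x = LinearMap.id) ∧ (∀ s, ∀ x ∉ V, L s x = LinearMap.id) ∧
      ∀ x e, IsBracketFrame D x e → IsBracketFrame D' x fun i => L 1 x (e i) := by
  obtain ⟨c', hcc', hc'⟩ := exists_between P.c_lt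
  have hc0 := P.c_pos
  have hc'0 : 0 < 2 * c' := by linarith
  set f : ℝ → ℝ := fun t => Real.smoothTransition ((t + c') / (2 * c'))
  have hf : ContDiff ℝ ∞ f :=
    Real.smoothTransition.contDiff.comp ((contDiff_id.add contDiff_const).div_const _)
  have hf0 : ∀ t ≤ -c', f t = 0 := fun t ht =>
    Real.smoothTransition.zero_of_nonpos (div_nonpos_of_nonpos_of_nonneg (by linarith) hc'0.le)
  have hf1 : ∀ t, c' ≤ t → f t = 1 := fun t ht =>
    Real.smoothTransition.one_of_one_le ((one_le_div hc'0).2 (by linarith))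
  -- `F` extends the angle function modulo integers, so that the rotation by `2πF` is the rotation by
  -- `2πf` in the tube and the identity elsewhere
  obtain ⟨Γ, hΓ⟩ := exists_isGram M
  obtain ⟨F, hF, hFV, hFi, hFo⟩ := exists_angle hc' hf hf0 hf1 hV hτV
  obtain ⟨R, hR, hR0, hRF, hRe⟩ := exists_rotationPath hD hΓ hF
  have hH := τ.isCurveFamily_H hD
  have hHf := hH.isDerivedFrameOn τ.D_eq
  have hκ : ∀ x ∈ τ.image, τ.kap₁ l x ^ 2 + τ.kap₂ l x ^ 2 ≠ 0 ∧
      τ.kap₁ τ.H x ^ 2 + τ.kap₂ τ.H x ^ 2 ≠ 0 := by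
    rintro _ ⟨q, hq, rfl⟩
    exact hm.kap_ne_zero hD hD' ⟨q, hq⟩
  have hsH := smoothMatOn_tubeMat hH hHf fun x hx => (hκ x hx).2
  have hsl := smoothMatOn_tubeMat hm.family hm.isDerivedFrameOn fun x hx => (hκ x hx).1
  have hbH := fun x hx => isBracketFrame_tubeMat (h := τ.H) hHf hx (hκ x hx).2
  have hbl := fun x hx => isBracketFrame_tubeMat (h := l) hm.isDerivedFrameOn hx (hκ x hx).1
  -- the Gram matrices of the frame adapted to `D`
  set γ : M → Matrix (Fin 4) (Fin 4) ℝ := fun x =>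
    Γ x fun j => ∑ i, τ.tubeMat τ.H x i j • τ.field i x
  have hγp : ∀ x ∈ τ.image, (γ x).PosDef := fun x hx => hΓ.posDef x _ (hbH x hx).indep
  have hγ : SmoothMatOn γ τ.image :=
    hΓ.smooth (fun j x => ∑ i, τ.tubeMat τ.H x i j • τ.field i x) _ τ.isOpen_image fun j =>
      SmoothFieldOn.sum _ fun i _ => SmoothFieldOn.smul (hsH i j) (τ.smooth_field i)
  have hfs : ContMDiffOn (𝓡 4) 𝓘(ℝ) ∞ (fun x => 2 * Real.pi * f (τ.inv x).2) τ.image :=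
    contMDiffOn_const.mul
      (hf.contMDiff.comp_contMDiffOn (contMDiff_snd.comp_contMDiffOn τ.contMDiffOn_inv))
  set A : M → Matrix (Fin 4) (Fin 4) ℝ := fun x =>
    τ.tubeMat τ.H x * rotMat (gramRot (γ x)) (2 * Real.pi * f (τ.inv x).2) with hAdef
  have hA : SmoothMatOn A τ.image := hsH.mul ((hγ.gramRot hγp).rotMat hfs)
  have hAd : ∀ x ∈ τ.image, (A x).det ≠ 0 := fun x hx => by
    rw [hAdef, Matrix.det_mul]
    refine mul_ne_zero ?_ (det_rotMat_ne_zero (gramRot_cube (hγp x hx)) _)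
    rw [tubeMat, Matrix.det_mul, det_kapMat (hκ x hx).2, mul_one]
    exact det_frameMat_ne_zero (hH.cross_ne_zero _ (τ.inv_snd_mem hx))
  have hhom := (hm.matHomotopic_adaptedMat hD hD' hcc' hseg hf.continuous hf0 hf1
    (γ := fun q => γ (τ.Φ q.1)) (hγ.continuousOn.comp_continuous
      (τ.smooth_Φ.continuousOn.comp_continuous continuous_subtype_val fun q => q.2)
      fun q => τ.Φ_mem q.2) fun q => hγp _ (τ.Φ_mem q.2)).symm
  have hhom' : MatHomotopic (τ.endSet c') (fun q => A (τ.Φ q.1)) fun q => τ.tubeMat l (τ.Φ q.1) := by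
    simp only [hAdef, tubeMat_Φ]
    refine Eq.mp (congrArg₂ (MatHomotopic (τ.endSet c')) (funext fun q => ?_) rfl) hhom
    rw [τ.inv_Φ q.2]
  obtain ⟨Q, hQ, hQ0, hQo, hQe⟩ := exists_gaugePath_of_matHomotopic hD hc' hA hsl hAd hhom'
  refine ⟨fun s x => Q s x ∘ₗ R s x, hQ.comp hR, fun x => ?_, fun s x hx => ?_, fun x e he => ?_⟩
  · simp only [hQ0, hR0, LinearMap.id_comp]
  · simp only [hQo s x fun h => hx (hτV h), hRF s x (hFV x hx), LinearMap.id_comp]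
  · by_cases hx : x ∈ τ.image
    · have h1 : ∀ j, R 1 x (∑ i, τ.tubeMat τ.H x i j • τ.field i x) =
          ∑ i, A x i j • τ.field i x := by
        intro j
        obtain ⟨n, hn⟩ := hFi x hx
        have h2 : (2 * Real.pi * (((1 : unitInterval) : ℝ) * F x)) =
            2 * Real.pi * f (τ.inv x).2 + n * (2 * Real.pi) := by
          rw [hn, Icc.coe_one]
          ring
        have h3 := hRe 1 x _ (hbH x hx) j
        rw [h2, rotMat_add_int_mul_two_pi] at h3
        refine h3.trans ?_
        simp only [hAdef, Matrix.mul_apply, Finset.smul_sum, Finset.sum_smul, smul_smul]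
        rw [Finset.sum_comm]
        simp only [mul_comm, γ]
      have h2 : IsBracketFrame D' x fun j =>
          Q 1 x (R 1 x (∑ i, τ.tubeMat τ.H x i j • τ.field i x)) := by
        simp only [h1, hQe x hx]
        exact hbl x hx
      -- any bracket frame of `D` differs from the one of the tube by a triangular matrix
      exact h2.of_triRel (((hbH x hx).triRel hD.1 hD.2.1 he).map (Q 1 x ∘ₗ R 1 x))
    · have h1 : ∀ j, Q 1 x (R 1 x (e j)) = e j := by
        intro j
        obtain ⟨n, hn⟩ := hFo x hx
        have h2 : (2 * Real.pi * (((1 : unitInterval) : ℝ) * F x)) = 0 + n * (2 * Real.pi) := by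
          rw [hn, Icc.coe_one]
          ring
        rw [hQo 1 x hx, LinearMap.id_apply, hRe 1 x e he j, h2, rotMat_add_int_mul_two_pi,
          rotMat_zero, sum_one_smul]
      simp only [LinearMap.comp_apply, h1]
      exact he.congr (τ.isCompact_core P.c_lt).isClosed.isOpen_compl
        (fun y hy => (hm.eq_of_notMem_core hy).symm) fun h => hx (τ.core_subset_image P.c_lt h)

end

theorem forEveryTorsion_isEngel_and_same (hD : IsEngel D) (τ : Tube D J N) :
    τ.ForEveryTorsion fun D' => (τ.IsRegular → IsEngel D') ∧
      (IsEngel D' → ∀ V, IsStandardDomain V → τ.image ⊆ V →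
        SameEngelFramingRel V D D' ∧ SameFormalTypeRel V D D') := by
  intro P
  rcases isEmpty_or_nonempty N with hN | hN
  -- an empty hypersurface changes nothing
  · refine ⟨1, one_pos, fun l D' _ hD' => ?_⟩
    have h : D' = D := funext fun x => hD'.1 x fun ⟨q, _⟩ => hN.elim q.1
    rw [h]
    exact ⟨fun _ => hD, fun _ V hV _ => ⟨sameEngelFramingRel_of_gaugePath hD hD hV.preconnected
      hV.boundary hV.regular isGaugePath_id (fun _ => rfl) (fun _ _ _ => rfl) fun _ _ h => h,
      sameFormalTypeRel_of_gaugePath hD isGaugePath_id (fun _ => rfl) (fun _ _ _ => rfl)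
        fun _ _ h => h⟩⟩
  · obtain ⟨δ, hδ, hseg⟩ := Profile.exists_delta hD P
    refine ⟨δ, hδ, fun l D' hl hD' => ?_⟩
    have hm := hl.isModification hD' (hseg l hl)
    refine ⟨hm.isEngel hD, fun hE V hV hτV => ?_⟩
    obtain ⟨L, hL, h0, hLV, h1⟩ := hm.exists_gaugePath hD hE (hseg l hl) hV.lifting hτV
    exact ⟨sameEngelFramingRel_of_gaugePath hD hE hV.preconnected hV.boundary hV.regular hL h0 hLV h1,
      sameFormalTypeRel_of_gaugePath hD hL h0 hLV h1⟩

end Tube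

/-! ### Tubular domains -/

section Domains

/-- The image of `A × ball 0 r` under an embedding of `A × ball 0 R`, where `r < R`. -/
theorem isStandardDomain_of_prod {M A E : Type*} [TopologicalSpace M] [T2Space M]
    [TopologicalSpace A] [CompactSpace A] [ConnectedSpace A] [NormedAddCommGroup E] [NormedSpace ℝ E]
    [FiniteDimensional ℝ E] (hE : 1 < Module.rank ℝ E) {r R : ℝ} (hr : 0 < r) (hrR : r < R)
    {ψ : A × E → M} {g : M → A × E} (hψ : ContinuousOn ψ (univ ×ˢ Metric.ball 0 R))
    (hgψ : ∀ p ∈ univ ×ˢ Metric.ball 0 R, g (ψ p) = p)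
    (hg : ContinuousOn g (ψ '' (univ ×ˢ Metric.ball 0 R)))
    (ho : ∀ U ⊆ univ ×ˢ Metric.ball 0 R, IsOpen U → IsOpen (ψ '' U)) :
    IsStandardDomain (ψ '' (univ ×ˢ Metric.ball 0 r)) := by
  have : ProperSpace E := FiniteDimensional.proper ℝ E
  have : Nontrivial E := (rank_pos_iff_nontrivial (R := ℝ)).1 (zero_lt_one.trans hE)
  have hsub : (univ : Set A) ×ˢ Metric.ball (0 : E) r ⊆ univ ×ˢ Metric.ball 0 R :=
    prod_mono Subset.rfl (Metric.ball_subset_ball hrR.le)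
  have hsubc : (univ : Set A) ×ˢ Metric.closedBall (0 : E) r ⊆ univ ×ˢ Metric.ball 0 R :=
    prod_mono Subset.rfl (Metric.closedBall_subset_ball hrR)
  have hopen : IsOpen ((univ : Set A) ×ˢ Metric.ball (0 : E) R) := isOpen_univ.prod Metric.isOpen_ball
  have hinj : InjOn ψ (univ ×ˢ Metric.ball 0 R) := fun p hp q hq h => by
    rw [← hgψ p hp, h, hgψ q hq]
  refine ⟨hasLifting_of_prod hE hr (hψ.mono hsub) (fun p hp => hgψ p (hsub hp))
    (hg.mono (image_mono hsub)) (ho _ hsub (isOpen_univ.prod Metric.isOpen_ball)),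
    (isPreconnected_univ.prod (convex_ball _ _).isPreconnected).image _ (hψ.mono hsub), ?_, ?_⟩
  · obtain ⟨z, hz⟩ := NormedSpace.sphere_nonempty (x := (0 : E)) (r := r) |>.2 hr.le
    set p : A × E := (Classical.arbitrary A, z)
    have hp : p ∈ (univ : Set A) ×ˢ Metric.ball (0 : E) R :=
      hsubc ⟨mem_univ _, Metric.sphere_subset_closedBall hz⟩
    refine ⟨ψ p, ?_, ?_⟩
    · refine ContinuousWithinAt.mem_closure_image ((hψ p hp).mono hsub) ?_
      rw [closure_prod_eq, closure_ball _ hr.ne', closure_univ]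
      exact ⟨mem_univ _, Metric.sphere_subset_closedBall hz⟩
    · rintro ⟨q, hq, hqp⟩
      have := hinj (hsub hq) hp hqp
      rw [this] at hq
      have h1 : ‖z‖ < r := by simpa using hq.2
      have h2 : ‖z‖ = r := by simpa using hz
      exact h1.ne h2
  · have hC : IsCompact (ψ '' (univ ×ˢ Metric.closedBall 0 r)) :=
      (isCompact_univ.prod (isCompact_closedBall _ _)).image_of_continuousOn (hψ.mono hsubc)
    have hint : (ψ '' (univ ×ˢ Metric.closedBall 0 r))ᶜ ⊆
        interior (ψ '' (univ ×ˢ Metric.ball 0 r))ᶜ :=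
      interior_maximal (compl_subset_compl.2
        (image_mono (prod_mono Subset.rfl Metric.ball_subset_closedBall))) hC.isClosed.isOpen_compl
    intro x hx
    by_cases hxC : x ∈ ψ '' (univ ×ˢ Metric.closedBall 0 r)
    · obtain ⟨p, hp, rfl⟩ := hxC
      -- points of the boundary are limits of points outside the closed ball
      have hp2 : p.2 ∉ Metric.ball (0 : E) r := fun h => hx ⟨p, ⟨mem_univ _, h⟩, rfl⟩
      have hcl : p ∈ closure ((univ ×ˢ Metric.ball (0 : E) R) ∩
          (univ ×ˢ (Metric.closedBall (0 : E) r)ᶜ)) := by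
        refine hopen.inter_closure ⟨hsubc hp, ?_⟩
        rw [closure_prod_eq, closure_compl, interior_closedBall _ hr.ne', closure_univ]
        exact ⟨mem_univ _, hp2⟩
      have h1 := ContinuousWithinAt.mem_closure_image ((hψ p (hsubc hp)).mono inter_subset_left) hcl
      refine closure_mono (Subset.trans ?_ hint) h1
      rintro _ ⟨q, ⟨hq, hq'⟩, rfl⟩ ⟨q', hq'', he⟩
      have := hinj (hsubc hq'') hq he
      rw [this] at hq''
      exact hq'.2 hq''.2
    · exact subset_closure (hint hxC)

universe u

variable {M : Type u} [TopologicalSpace M] [T2Space M] [ChartedSpace R4 M] [IsManifold (𝓡 4) ∞ M]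

theorem IsThinNeighbourhood.isStandardDomain {D : Π x : M, Submodule ℝ (TangentSpace (𝓡 4) x)}
    {ψ : Torus × ℂ → M} {R : ℝ} (h : IsThinNeighbourhood D ψ R) {r : ℝ} (hr : 0 < r) (hrR : r < R) :
    IsStandardDomain (ψ '' (univ ×ˢ Metric.ball 0 r)) := by
  obtain ⟨g, hg, hgs, ho⟩ := exists_smooth_inverse (isOpen_univ.prod Metric.isOpen_ball) h.smooth
    h.injOn fun p hp => h.bijective p.1 p.2 hp.2
  exact isStandardDomain_of_prod (by rw [Complex.rank_real_complex]; exact Cardinal.one_lt_two) hr hrR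
    h.smooth.continuousOn hg hgs.continuousOn ho

theorem IsEmbeddedBall.isStandardDomain {β : R4 → M} {R : ℝ} (h : IsEmbeddedBall β R) {r : ℝ}
    (hr : 0 < r) (hrR : r < R) : IsStandardDomain (β '' Metric.ball 0 r) := by
  obtain ⟨g, hg, hgs, ho⟩ := exists_smooth_inverse Metric.isOpen_ball h.smooth h.injOn h.bijective
  have himg : ∀ U : Set (Unit × R4), (β ∘ Prod.snd) '' U = β '' (Prod.snd '' U) := fun U =>
    image_comp _ _ _
  have hball : ∀ r : ℝ, Prod.snd '' ((univ : Set Unit) ×ˢ Metric.ball (0 : R4) r) = Metric.ball 0 r :=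
    fun r => by rw [snd_image_prod univ_nonempty]
  have h1 := isStandardDomain_of_prod (A := Unit) (ψ := β ∘ Prod.snd) (g := fun x => ((), g x))
    (R := R) (by rw [← Module.finrank_eq_rank, finrank_euclideanSpace_fin]; norm_num) hr hrR
    (h.smooth.continuousOn.comp continuousOn_snd fun p hp => hp.2)
    (fun p hp => Prod.ext rfl (hg p.2 hp.2)) ?_ ?_
  · rwa [himg, hball] at h1
  · rw [himg, hball]
    exact continuousOn_const.prodMk hgs.continuousOn
  · intro U hU hUo
    rw [himg]
    exact ho _ (by rintro _ ⟨p, hp, rfl⟩; exact (hU hp).2) (isOpenMap_snd U hUo)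

end Domains

end Engel

end

open Set Metric Engel
open scoped Manifold ContDiff

theorem mainTheorem8 {M : Type*} [TopologicalSpace M] [T2Space M]
    [SecondCountableTopology M] [ChartedSpace R4 M] [IsManifold (𝓡 4) ∞ M]
    (D : Π x : M, Submodule ℝ (TangentSpace (𝓡 4) x)) (hD : IsEngel D) :
    -- Engel-Lutz twists along a transverse torus
    (∀ (ψ : Torus × ℂ → M) (R : ℝ), IsThinNeighbourhood D ψ R →
      ∀ τ : Tube D (torusModel.prod (𝓡 1)) (Torus × Circle),
        (∀ (s : Torus) (z : Circle), τ.Φ ((s, z), 0) = ψ (s, (z : ℂ))) →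
        τ.ForEveryTorsion fun D' =>
          (τ.IsRegular → IsEngel D') ∧
          (IsEngel D' → ∀ r, 1 < r → r < R → τ.image ⊆ ψ '' (univ ×ˢ ball 0 r) →
            SameEngelFramingRel (ψ '' (univ ×ˢ ball 0 r)) D D' ∧
            SameFormalTypeRel (ψ '' (univ ×ˢ ball 0 r)) D D')) ∧
    -- Engel torsion along a closed transverse hypersurface in a ball
    (∀ (β : R4 → M) (R : ℝ), IsEmbeddedBall β R →
      ∀ (N : Type*) [TopologicalSpace N] [CompactSpace N]
        [ChartedSpace (EuclideanSpace ℝ (Fin 3)) N] [IsManifold (𝓡 3) ∞ N] (τ : Tube D (𝓡 3) N),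
        τ.image ⊆ β '' ball 0 1 →
        τ.ForEveryTorsion fun D' =>
          (τ.IsRegular → IsEngel D') ∧
          (IsEngel D' →
            SameEngelFramingRel (β '' ball 0 1) D D' ∧
            SameFormalTypeRel (β '' ball 0 1) D D')) := by
  refine ⟨fun ψ R hψ τ _ P => ?_, fun β R hβ N _ _ _ _ τ hτ P => ?_⟩
  · obtain ⟨δ, hδ, h⟩ := τ.forEveryTorsion_isEngel_and_same hD P
    refine ⟨δ, hδ, fun l D' hl hD' => ⟨(h l D' hl hD').1, fun hE r hr hrR hτ => ?_⟩⟩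
    exact (h l D' hl hD').2 hE _ (hψ.isStandardDomain (zero_lt_one.trans hr) hrR) hτ
  · obtain ⟨δ, hδ, h⟩ := τ.forEveryTorsion_isEngel_and_same hD P
    refine ⟨δ, hδ, fun l D' hl hD' => ⟨(h l D' hl hD').1, fun hE => ?_⟩⟩
    exact (h l D' hl hD').2 hE _ (hβ.isStandardDomain one_pos hβ.one_lt) hτ
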